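/- Fix a smooth function $\phi_0:\mathbb R\to\mathbb R$ supported on $[-5/2,-1/2]\cup[1/2,5/2]$ with $\phi_0=1$ on $[-2,-1]\cup[1,2]$. For $k\in\mathbb Z$ let $P_k$ be the Littlewood–Paley projection in the second variable, $$P_kf(x,y)=\int_{\mathbb R}f(x,y-t)\,K_k(t)\,dt,\qquad K_k(t)=\int_{\mathbb R}\phi_0(2^{-k}\eta)\,e^{2\pi i t\eta}\,d\eta .$$ For a measurable function $u:\mathbb R\to\mathbb R$ define, for functions on $\mathbb R^2$, $$\mathcal M^uf(x,y)=\sup_{j\in\mathbb Z}\frac1{2^j}\left|\int_{-2^j}^{2^j}f(x-t,\,y-u(x)t^2)\,dt\right|,\qquad \mathcal H^uf(x,y)=\mathrm{p.v.}\!\int_{\mathbb R}f(x-t,\,y-u(x)t^2)\,\frac{dt}{t}=\lim_{\varepsilon\to0^+}\int_{|t|>\varepsilon}f(x-t,\,y-u(x)t^2)\,\frac{dt}{t}.$$ **Theorem.** There is an absolute constant $p_0\in(1,2)$ (independent also of $\phi_0$) such that for every $p\in(p_0,\infty)$ there is a constant $C_p>0$, depending only on $p$ (and on the fixed bump $\phi_0$),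 such that for every measurable $u:\mathbb R\to\mathbb R$, every $k\in\mathbb Z$ and every complex-valued $f\in L^p(\mathbb R^2)$, the functions $P_kf$, $\mathcal M^u(P_kf)$ and $\mathcal H^u(P_kf)$ are well defined and measurable (the integrals defining $P_kf$, the averages in $\mathcal M^u(P_kf)$ and the truncated integrals in $\mathcal H^u(P_kf)$ converge absolutely, and the limit defining $\mathcal H^u(P_kf)$ exists, at almost every point), and $$\|\mathcal M^u(P_kf)\|_{L^p(\mathbb R^2)}\le C_p\|f\|_{L^p(\mathbb R^2)},\qquad \|\mathcal H^u(P_kf)\|_{L^p(\mathbb R^2)}\le C_p\|f\|_{L^p(\mathbb R^2)} .$$ -/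

import Mathlib

open MeasureTheory Filter Topology
open scoped ENNReal NNReal ContDiff FourierTransform

noncomputable section

/-- A smooth bump function `φ₀ : ℝ → ℝ` supported on `[-5/2, -1/2] ∪ [1/2, 5/2]` and equal to `1` on
`[-2, -1] ∪ [1, 2]`. -/
structure IsLPBump (φ₀ : ℝ → ℝ) : Prop where
  smooth : ContDiff ℝ ∞ φ₀
  support_subset : Function.support φ₀ ⊆ Set.Icc (-5 / 2) (-1 / 2) ∪ Set.Icc (1 / 2) (5 / 2)
  eq_one : ∀ t ∈ Set.Icc (-2 : ℝ) (-1) ∪ Set.Icc 1 2, φ₀ t = 1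

/-- The kernel of the `k`-th Littlewood-Paley projection: the inverse Fourier transform
`t ↦ ∫ φ₀(2^{-k} η) e^{2π i t η} dη` of the dilated bump. It equals `2^k φ₀ˇ(2^k t)`, so its
`L¹` norm does not depend on `k`. -/
def lpKernel (φ₀ : ℝ → ℝ) (k : ℤ) : ℝ → ℂ :=
  𝓕⁻ (fun η : ℝ => ((φ₀ (η / (2 : ℝ) ^ k) : ℝ) : ℂ))

/-- The Littlewood-Paley projection `P_k` in the second variable. -/
def lpProj (φ₀ : ℝ → ℝ) (k : ℤ) (f : ℝ × ℝ → ℂ) (z : ℝ × ℝ) : ℂ :=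
  ∫ t : ℝ, f (z.1, z.2 - t) * lpKernel φ₀ k t

/-- The restriction of `f` to the parabola with parameter `u(x)` through `z = (x, y)`:
`t ↦ f(x - t, y - u(x) t²)`. -/
def alongParabola (u : ℝ → ℝ) (f : ℝ × ℝ → ℂ) (z : ℝ × ℝ) (t : ℝ) : ℂ :=
  f (z.1 - t, z.2 - u z.1 * t ^ 2)

/-- The maximal operator
`M^u f(x, y) = sup_{j ∈ ℤ} 2^{-j} |∫_{-2^j}^{2^j} f(x - t, y - u(x) t²) dt|`,
with values in `[0, ∞]`. -/
def parabolaMaximal (u : ℝ → ℝ) (f : ℝ × ℝ → ℂ) (z : ℝ × ℝ) : ℝ≥0∞ :=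
  ⨆ j : ℤ, ENNReal.ofReal
    (1 / (2 : ℝ) ^ j * ‖∫ t in (-(2 : ℝ) ^ j)..((2 : ℝ) ^ j), alongParabola u f z t‖)

/-- The truncated integral `∫_{|t| > ε} f(x - t, y - u(x) t²) dt / t`. -/
def parabolaHilbertTrunc (u : ℝ → ℝ) (f : ℝ × ℝ → ℂ) (z : ℝ × ℝ) (ε : ℝ) : ℂ :=
  ∫ t in {t : ℝ | ε < |t|}, alongParabola u f z t / (t : ℂ)

/-- The Hilbert transform `H^u f(x, y) = p.v. ∫ f(x - t, y - u(x) t²) dt / t`, the limit of the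
truncated integrals as `ε → 0⁺` (wherever it exists). -/
def parabolaHilbert (u : ℝ → ℝ) (f : ℝ × ℝ → ℂ) (z : ℝ × ℝ) : ℂ :=
  limUnder (𝓝[>] (0 : ℝ)) (parabolaHilbertTrunc u f z)

end

/-! The function `P_k f` oscillates in `y` at frequency about `2^k`, so it is essentially constant
at vertical scale `2^{-k}`. Along the parabola the vertical displacement is `u(x) t²`. For each `x`
with `u(x) ≠ 0` let `s(x)` be the largest power of two with `s(x)² 2^k |u(x)| ≤ 1` (see `scaleExp`);
this radius splits the parabola into a flat part `|t| ≤ s(x)` and dyadic shells `|t| ~ 2^l s(x)`, `l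
≥ 1`, where the curvature is felt.

On the flat part the parabola may be replaced by the horizontal line through `(x, y)`. Averages are
then bounded by the iterated maximal function `hlMax₁ (hlMax₂ |f|)`. For the singular integral, the
replacement error is at most `2^k |u(x)| t²` times a maximal function, and this absorbs the
singularity of `1/t`; what remains is the truncated Hilbert transform in the first variable. Its
maximal inequality and its almost everywhere convergence are `exists_maximal_truncIntegral` and
`ae_exists_tendsto_truncIntegral`. They rest on M. Riesz' complex-analytic argument for even
exponents (the powers `F^{2n}` of a Cauchy transform have integral zero on horizontal lines), on
interpolation and duality, and on Cotlar's inequality.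

On the `l`-th shell, `u` depends on `x` only, so the Fourier transform in `y` turns the operator,
for each frequency `η`, into a one-dimensional integral with phase `-2π η v(x) τ²`, where `v(x) =
u(x) r(x)²` and `2^k |v(x)| ~ 4^l`. Although `r` and `v` are merely measurable, the kernel of `TT*`
is dominated by averages centred at either variable, by van der Corput's estimate for quadratic
phases; this gives an `L²` gain (`exists_lintegral_chirp_sq_le`, `exists_lintegral_scaleOp_sq_le`).
The squared `L²` norm decays like `2^{-l}`, while a crude `L^{3/2}` bound grows exponentially in
`l`. Interpolation gives a weak type bound with constant `2^{-3l/10}` at the exponent `39/20`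
(`IsLPBump.exists_measure_lt_scaleOp_le`), and interpolation with `L^∞` spreads this decay to every
`p > 39/20`. Summation over `l` is `IsLPBump.exists_lintegral_curvedPart_le`.

The two regions are assembled pointwise in `IsLPBump.exists_parabolaMaximal_le` and
`IsLPBump.exists_tendsto_parabolaHilbertTrunc`. Hence `p₀ = 39/20`. -/

noncomputable section

/-! ### Layer cake formula and real interpolation. -/

section Interpolation

lemma lintegral_Ioo_rpow {a s : ℝ} (ha : 0 ≤ a) (hs : -1 < s) :
    ∫⁻ t in Set.Ioo 0 a, ENNReal.ofReal (t ^ s) = ENNReal.ofReal (a ^ (s + 1) / (s + 1)) := by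
  have h1 : IntegrableOn (fun t : ℝ => t ^ s) (Set.Ioo 0 a) := by
    have := (intervalIntegral.intervalIntegrable_rpow' (a := 0) (b := a) hs).1
    exact this.mono_set Set.Ioo_subset_Ioc_self
  rw [← ofReal_integral_eq_lintegral_ofReal h1]
  · rw [← integral_Ioc_eq_integral_Ioo, ← intervalIntegral.integral_of_le ha,
      integral_rpow (Or.inl hs), Real.zero_rpow (by linarith), sub_zero]
  · filter_upwards [ae_restrict_mem measurableSet_Ioo] with t ht
    exact Real.rpow_nonneg ht.1.le _

lemma lintegral_Ioi_rpow {a s : ℝ} (ha : 0 < a) (hs : s < -1) :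
    ∫⁻ t in Set.Ioi a, ENNReal.ofReal (t ^ s) = ENNReal.ofReal (-a ^ (s + 1) / (s + 1)) := by
  rw [← ofReal_integral_eq_lintegral_ofReal (integrableOn_Ioi_rpow_of_lt hs ha)]
  · rw [integral_Ioi_rpow_of_lt hs ha]
  · filter_upwards [ae_restrict_mem measurableSet_Ioi] with t ht
    exact Real.rpow_nonneg (ha.le.trans (le_of_lt ht)) _

lemma rpow_eq_lintegral_Ioi {p : ℝ} (hp : 0 < p) (a : ℝ≥0∞) :
    a ^ p = ENNReal.ofReal p *
      ∫⁻ t in Set.Ioi (0 : ℝ), {t : ℝ | ENNReal.ofReal t < a}.indicator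
        (fun t => ENNReal.ofReal (t ^ (p - 1))) t := by
  have hm : MeasurableSet {t : ℝ | ENNReal.ofReal t < a} :=
    measurableSet_lt ENNReal.measurable_ofReal measurable_const
  rw [setLIntegral_indicator hm]
  rcases eq_or_ne a ⊤ with rfl | ha
  · have : {t : ℝ | ENNReal.ofReal t < ⊤} ∩ Set.Ioi 0 = Set.Ioi 0 := by
      ext; simp
    rw [this, ENNReal.top_rpow_of_pos hp]
    symm
    rw [ENNReal.mul_eq_top]
    left
    refine ⟨by simpa using hp, ?_⟩
    rw [eq_top_iff]
    refine ENNReal.le_of_forall_nnreal_lt fun r _ => ?_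
    -- The endpoint `(r p)^{1/p}` makes the integral exactly `r`, so the integral over the half-line
    -- exceeds every finite `r`.
    have h2 : ∫⁻ t in Set.Ioo (0 : ℝ) (((r : ℝ) * p) ^ (1 / p)), ENNReal.ofReal (t ^ (p - 1)) = r := by
      rw [lintegral_Ioo_rpow (by positivity) (by linarith), sub_add_cancel, ← Real.rpow_mul (by positivity),
        one_div, inv_mul_cancel₀ hp.ne', Real.rpow_one, mul_div_assoc, div_self hp.ne', mul_one]
      simp
    rw [← h2]
    exact lintegral_mono_set Set.Ioo_subset_Ioi_self
  · have : {t : ℝ | ENNReal.ofReal t < a} ∩ Set.Ioi 0 = Set.Ioo 0 a.toReal := by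
      ext t
      simp only [Set.mem_inter_iff, Set.mem_ofPred_eq, Set.mem_Ioi, Set.mem_Ioo]
      constructor
      · rintro ⟨h1, h2⟩
        exact ⟨h2, (ENNReal.ofReal_lt_iff_lt_toReal h2.le ha).1 h1⟩
      · rintro ⟨h1, h2⟩
        exact ⟨(ENNReal.ofReal_lt_iff_lt_toReal h1.le ha).2 h2, h1⟩
    rw [this, lintegral_Ioo_rpow ENNReal.toReal_nonneg (by linarith), sub_add_cancel,
      ← ENNReal.ofReal_mul hp.le, mul_div_cancel₀ _ hp.ne', ENNReal.toReal_rpow, ENNReal.ofReal_toReal]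
    exact ENNReal.rpow_ne_top_of_nonneg hp.le ha

lemma lintegral_rpow_eq_layercake {α : Type*} [MeasurableSpace α] {μ : Measure α} [SFinite μ]
    {G : α → ℝ≥0∞} (hG : Measurable G) {p : ℝ} (hp : 0 < p) :
    ∫⁻ x, G x ^ p ∂μ = ENNReal.ofReal p *
      ∫⁻ t in Set.Ioi (0 : ℝ), ENNReal.ofReal (t ^ (p - 1)) * μ {x | ENNReal.ofReal t < G x} := by
  simp_rw [fun x => rpow_eq_lintegral_Ioi hp (G x)]
  have hS : MeasurableSet {q : α × ℝ | ENNReal.ofReal q.2 < G q.1} :=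
    measurableSet_lt (ENNReal.measurable_ofReal.comp measurable_snd) (hG.comp measurable_fst)
  have hmeas : Measurable (fun q : α × ℝ => {t : ℝ | ENNReal.ofReal t < G q.1}.indicator
      (fun t => ENNReal.ofReal (t ^ (p - 1))) q.2) := by
    have : (fun q : α × ℝ => {t : ℝ | ENNReal.ofReal t < G q.1}.indicator
      (fun t => ENNReal.ofReal (t ^ (p - 1))) q.2) =
      {q : α × ℝ | ENNReal.ofReal q.2 < G q.1}.indicator
        (fun q => ENNReal.ofReal (q.2 ^ (p - 1))) := by
      ext q; simp [Set.indicator]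
    rw [this]
    exact Measurable.indicator (by fun_prop) hS
  rw [lintegral_const_mul _ hmeas.lintegral_prod_right', lintegral_lintegral_swap hmeas.aemeasurable]
  congr 1
  refine lintegral_congr fun t => ?_
  have : (fun x => {t : ℝ | ENNReal.ofReal t < G x}.indicator
      (fun t => ENNReal.ofReal (t ^ (p - 1))) t) =
      {x | ENNReal.ofReal t < G x}.indicator fun _ => ENNReal.ofReal (t ^ (p - 1)) := by
    ext x; simp [Set.indicator]
  rw [this, lintegral_indicator_const (measurableSet_lt measurable_const hG)]

/-- Real interpolation from a bound of the distribution function of `G` in terms of `g`. -/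
lemma exists_lintegral_rpow_le_of_distribution {p₀ p p₁ c : ℝ} (h0 : 0 < p₀) (h0p : p₀ < p) (hp1 : p < p₁)
    (hc : 0 < c) : ∃ C : ℝ≥0, ∀ {α β : Type} [MeasurableSpace α] [MeasurableSpace β]
    {μ : Measure α} {ν : Measure β} [SFinite μ] [SFinite ν] {G : α → ℝ≥0∞} {g : β → ℝ≥0∞}
    (_ : Measurable G) (_ : Measurable g) {A₀ A₁ : ℝ≥0∞}
    (_ : ∀ t : ℝ, 0 < t → μ {x | ENNReal.ofReal t < G x} ≤
      A₀ * ENNReal.ofReal (t ^ (-p₀)) * ∫⁻ y in {y | ENNReal.ofReal (c * t) < g y}, g y ^ p₀ ∂ν +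
      A₁ * ENNReal.ofReal (t ^ (-p₁)) * ∫⁻ y in {y | g y ≤ ENNReal.ofReal (c * t)}, g y ^ p₁ ∂ν),
    ∫⁻ x, G x ^ p ∂μ ≤ C * (A₀ + A₁) * ∫⁻ y, g y ^ p ∂ν := by
  have hp : 0 < p := h0.trans h0p
  -- For `b = g y` the two parts of the hypothesis meet at `t = b / c`. The number `D₀ b^p` is the
  -- integral of `t^{p-1-p₀} b^{p₀}` over `(0, b/c)`, finite since `p₀ < p`, and `D₁ b^p` is that of
  -- `t^{p-1-p₁} b^{p₁}` over `(b/c, ∞)`, finite since `p < p₁`.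
  set D₀ : ℝ := c ^ (p₀ - p) / (p - p₀) with hD₀
  set D₁ : ℝ := c ^ (p₁ - p) / (p₁ - p) with hD₁
  have hD₀pos : 0 < D₀ := div_pos (Real.rpow_pos_of_pos hc _) (by linarith)
  have hD₁pos : 0 < D₁ := div_pos (Real.rpow_pos_of_pos hc _) (by linarith)
  -- pointwise computations
  have key0 : ∀ b : ℝ≥0∞, ∫⁻ t in Set.Ioi (0 : ℝ), {t : ℝ | ENNReal.ofReal (c * t) < b}.indicator
      (fun t => ENNReal.ofReal (t ^ (p - 1 - p₀)) * b ^ p₀) t ≤ ENNReal.ofReal D₀ * b ^ p := by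
    intro b
    rcases eq_or_ne b ⊤ with rfl | hb
    · rw [ENNReal.top_rpow_of_pos hp, ENNReal.mul_top (by simpa using hD₀pos)]
      exact le_top
    · have hm : MeasurableSet {t : ℝ | ENNReal.ofReal (c * t) < b} :=
        measurableSet_lt (by fun_prop) measurable_const
      have : {t : ℝ | ENNReal.ofReal (c * t) < b} ∩ Set.Ioi 0 = Set.Ioo 0 (b.toReal / c) := by
        ext t
        simp only [Set.mem_inter_iff, Set.mem_ofPred_eq, Set.mem_Ioi, Set.mem_Ioo]
        constructor
        · rintro ⟨h1, h2⟩
          refine ⟨h2, ?_⟩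
          rw [lt_div_iff₀' hc]
          exact (ENNReal.ofReal_lt_iff_lt_toReal (by positivity) hb).1 h1
        · rintro ⟨h1, h2⟩
          rw [lt_div_iff₀' hc] at h2
          exact ⟨(ENNReal.ofReal_lt_iff_lt_toReal (by positivity) hb).2 h2, h1⟩
      rw [setLIntegral_indicator hm, this, lintegral_mul_const _ (by fun_prop),
        lintegral_Ioo_rpow (by positivity) (by linarith)]
      lift b to ℝ≥0 using hb
      rw [← ENNReal.coe_rpow_of_nonneg _ h0.le, ← ENNReal.coe_rpow_of_nonneg _ hp.le,
        ← ENNReal.ofReal_coe_nnreal (p := b ^ p₀), ← ENNReal.ofReal_coe_nnreal (p := b ^ p),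
        ← ENNReal.ofReal_mul (by
          apply div_nonneg (by positivity); linarith), ← ENNReal.ofReal_mul hD₀pos.le]
      apply ENNReal.ofReal_le_ofReal
      rw [ENNReal.coe_toReal, NNReal.coe_rpow, NNReal.coe_rpow]
      rcases eq_or_lt_of_le b.2 with hb0 | hb0
      · have : (b : ℝ) = 0 := hb0.symm
        rw [this, Real.zero_rpow h0.ne', Real.zero_rpow hp.ne']; simp
      · have hb' : (0 : ℝ) < b := hb0
        have e1 : p - 1 - p₀ + 1 = p - p₀ := by ring
        rw [e1, Real.div_rpow hb'.le hc.le, hD₀, show p₀ - p = -(p - p₀) by ring, Real.rpow_neg hc.le]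
        have e2 : (b : ℝ) ^ p = (b : ℝ) ^ (p - p₀) * (b : ℝ) ^ p₀ := by
          rw [← Real.rpow_add hb']; ring_nf
        rw [e2]
        apply le_of_eq
        field_simp
  have key1 : ∀ b : ℝ≥0∞, ∫⁻ t in Set.Ioi (0 : ℝ), {t : ℝ | b ≤ ENNReal.ofReal (c * t)}.indicator
      (fun t => ENNReal.ofReal (t ^ (p - 1 - p₁)) * b ^ p₁) t ≤ ENNReal.ofReal D₁ * b ^ p := by
    intro b
    rcases eq_or_ne b ⊤ with rfl | hb
    · rw [ENNReal.top_rpow_of_pos hp, ENNReal.mul_top (by simpa using hD₁pos)]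
      exact le_top
    · lift b to ℝ≥0 using hb
      rcases eq_or_lt_of_le b.2 with hb0 | hb0
      · have : b = 0 := NNReal.eq hb0.symm
        rw [this]
        simp [ENNReal.zero_rpow_of_pos (h0.trans (h0p.trans hp1))]
      have hb' : (0 : ℝ) < b := hb0
      have hm : MeasurableSet {t : ℝ | (b : ℝ≥0∞) ≤ ENNReal.ofReal (c * t)} :=
        measurableSet_le measurable_const (by fun_prop)
      have : {t : ℝ | (b : ℝ≥0∞) ≤ ENNReal.ofReal (c * t)} ∩ Set.Ioi 0 ⊆ Set.Ici (b / c) := by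
        rintro t ⟨h1, h2⟩
        have h2' : 0 < t := h2
        have h3 : (b : ℝ) ≤ c * t := by
          have h1' : (b : ℝ≥0∞) ≤ ENNReal.ofReal (c * t) := h1
          rw [← ENNReal.ofReal_coe_nnreal] at h1'
          exact (ENNReal.ofReal_le_ofReal_iff (by positivity)).1 h1'
        rw [Set.mem_Ici, div_le_iff₀' hc]
        exact h3
      rw [setLIntegral_indicator hm]
      refine (lintegral_mono_set this).trans ?_
      rw [setLIntegral_congr Ioi_ae_eq_Ici.symm, lintegral_mul_const _ (by fun_prop),
        lintegral_Ioi_rpow (by positivity) (by linarith)]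
      rw [← ENNReal.coe_rpow_of_nonneg _ (by linarith), ← ENNReal.coe_rpow_of_nonneg _ hp.le,
        ← ENNReal.ofReal_coe_nnreal, ← ENNReal.ofReal_coe_nnreal, ← ENNReal.ofReal_mul (by
          rw [neg_div, ← div_neg]
          apply div_nonneg (by positivity); linarith), ← ENNReal.ofReal_mul hD₁pos.le]
      apply ENNReal.ofReal_le_ofReal
      rw [NNReal.coe_rpow, NNReal.coe_rpow]
      have e1 : p - 1 - p₁ + 1 = -(p₁ - p) := by ring
      rw [e1, Real.rpow_neg (by positivity), Real.div_rpow hb'.le hc.le, hD₁]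
      have e2 : (b : ℝ) ^ p₁ = (b : ℝ) ^ (p₁ - p) * (b : ℝ) ^ p := by
        rw [← Real.rpow_add hb']; ring_nf
      rw [e2]
      apply le_of_eq
      have : (b : ℝ) ^ (p₁ - p) ≠ 0 := (Real.rpow_pos_of_pos hb' _).ne'
      have : p₁ - p ≠ 0 := by linarith
      field_simp
  refine ⟨Real.toNNReal p * (Real.toNNReal D₀ + Real.toNNReal D₁), ?_⟩
  intro α β _ _ μ ν _ _ G g hG hg A₀ A₁ h
  rw [lintegral_rpow_eq_layercake hG hp]
  have hS0 : MeasurableSet {q : ℝ × β | ENNReal.ofReal (c * q.1) < g q.2} :=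
    measurableSet_lt (by fun_prop) (hg.comp measurable_snd)
  have hS1 : MeasurableSet {q : ℝ × β | g q.2 ≤ ENNReal.ofReal (c * q.1)} :=
    measurableSet_le (hg.comp measurable_snd) (by fun_prop)
  have hm0 : Measurable (fun q : ℝ × β => {q : ℝ × β | ENNReal.ofReal (c * q.1) < g q.2}.indicator
      (fun q => ENNReal.ofReal (q.1 ^ (p - 1 - p₀)) * g q.2 ^ p₀) q) :=
    Measurable.indicator (by fun_prop) hS0
  have hm1 : Measurable (fun q : ℝ × β => {q : ℝ × β | g q.2 ≤ ENNReal.ofReal (c * q.1)}.indicator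
      (fun q => ENNReal.ofReal (q.1 ^ (p - 1 - p₁)) * g q.2 ^ p₁) q) :=
    Measurable.indicator (by fun_prop) hS1
  have step : ∀ t ∈ Set.Ioi (0 : ℝ), ENNReal.ofReal (t ^ (p - 1)) * μ {x | ENNReal.ofReal t < G x} ≤
      A₀ * (∫⁻ y, {q : ℝ × β | ENNReal.ofReal (c * q.1) < g q.2}.indicator
      (fun q => ENNReal.ofReal (q.1 ^ (p - 1 - p₀)) * g q.2 ^ p₀) (t, y) ∂ν) +
      A₁ * (∫⁻ y, {q : ℝ × β | g q.2 ≤ ENNReal.ofReal (c * q.1)}.indicator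
      (fun q => ENNReal.ofReal (q.1 ^ (p - 1 - p₁)) * g q.2 ^ p₁) (t, y) ∂ν) := by
    intro t ht
    have ht' : 0 < t := ht
    refine (mul_le_mul_right (h t ht) _).trans (le_of_eq ?_)
    have e0 : ∀ r : ℝ, ENNReal.ofReal (t ^ (p - 1 - r)) =
        ENNReal.ofReal (t ^ (p - 1)) * ENNReal.ofReal (t ^ (-r)) := by
      intro r
      rw [← ENNReal.ofReal_mul (by positivity), ← Real.rpow_add ht', ← sub_eq_add_neg]
    have i0 : (∫⁻ y, {q : ℝ × β | ENNReal.ofReal (c * q.1) < g q.2}.indicator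
      (fun q => ENNReal.ofReal (q.1 ^ (p - 1 - p₀)) * g q.2 ^ p₀) (t, y) ∂ν) =
       ENNReal.ofReal (t ^ (p - 1 - p₀)) * ∫⁻ y in {y | ENNReal.ofReal (c * t) < g y}, g y ^ p₀ ∂ν := by
      rw [← lintegral_const_mul _ (by fun_prop), ← lintegral_indicator (measurableSet_lt measurable_const hg)]
      rfl
    have i1 : (∫⁻ y, {q : ℝ × β | g q.2 ≤ ENNReal.ofReal (c * q.1)}.indicator
      (fun q => ENNReal.ofReal (q.1 ^ (p - 1 - p₁)) * g q.2 ^ p₁) (t, y) ∂ν) =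
       ENNReal.ofReal (t ^ (p - 1 - p₁)) * ∫⁻ y in {y | g y ≤ ENNReal.ofReal (c * t)}, g y ^ p₁ ∂ν := by
      rw [← lintegral_const_mul _ (by fun_prop), ← lintegral_indicator (measurableSet_le hg measurable_const)]
      rfl
    rw [i0, i1, e0, e0]
    ring
  have hL : ∀ (A : ℝ≥0∞) (f : ℝ × β → ℝ≥0∞) (D : ℝ) (_ : Measurable f)
      (_ : ∀ y, ∫⁻ t in Set.Ioi (0 : ℝ), f (t, y) ≤ ENNReal.ofReal D * g y ^ p),
      ∫⁻ t in Set.Ioi (0 : ℝ), A * ∫⁻ y, f (t, y) ∂ν ≤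
        A * (ENNReal.ofReal D * ∫⁻ y, g y ^ p ∂ν) := by
    intro A f D hf hD
    rw [lintegral_const_mul _ hf.lintegral_prod_right',
      lintegral_lintegral_swap (f := fun t y => f (t, y)) hf.aemeasurable]
    refine mul_le_mul_right ?_ _
    rw [← lintegral_const_mul _ (by fun_prop)]
    exact lintegral_mono hD
  calc _ ≤ ENNReal.ofReal p * ∫⁻ t in Set.Ioi (0 : ℝ), (A₀ * (∫⁻ y, {q : ℝ × β | ENNReal.ofReal (c * q.1) < g q.2}.indicator
      (fun q => ENNReal.ofReal (q.1 ^ (p - 1 - p₀)) * g q.2 ^ p₀) (t, y) ∂ν) +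
      A₁ * (∫⁻ y, {q : ℝ × β | g q.2 ≤ ENNReal.ofReal (c * q.1)}.indicator
      (fun q => ENNReal.ofReal (q.1 ^ (p - 1 - p₁)) * g q.2 ^ p₁) (t, y) ∂ν)) :=
        mul_le_mul_right (setLIntegral_mono' measurableSet_Ioi step) _
    _ ≤ ENNReal.ofReal p * (A₀ * (ENNReal.ofReal D₀ * ∫⁻ y, g y ^ p ∂ν) +
        A₁ * (ENNReal.ofReal D₁ * ∫⁻ y, g y ^ p ∂ν)) := by
      refine mul_le_mul_right ?_ _
      rw [lintegral_add_left (hm0.lintegral_prod_right'.const_mul _)]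
      exact add_le_add (hL _ _ _ hm0 fun y => key0 _) (hL _ _ _ hm1 fun y => key1 _)
    _ ≤ _ := by
      push_cast
      change _ ≤ ENNReal.ofReal p * (ENNReal.ofReal D₀ + ENNReal.ofReal D₁) * _ * _
      -- The product form of the constant exceeds the sum `A₀ D₀ + A₁ D₁` by the cross terms, which
      -- are discarded.
      have : ENNReal.ofReal p * (ENNReal.ofReal D₀ + ENNReal.ofReal D₁) * (A₀ + A₁) * (∫⁻ y, g y ^ p ∂ν) =
        ENNReal.ofReal p * (A₀ * (ENNReal.ofReal D₀ * ∫⁻ y, g y ^ p ∂ν) +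
        A₁ * (ENNReal.ofReal D₁ * ∫⁻ y, g y ^ p ∂ν)) + ENNReal.ofReal p * (A₁ * (ENNReal.ofReal D₀ * ∫⁻ y, g y ^ p ∂ν) +
        A₀ * (ENNReal.ofReal D₁ * ∫⁻ y, g y ^ p ∂ν)) := by ring
      rw [this]
      exact le_self_add

end Interpolation

end

noncomputable section

/-! ### Hardy-Littlewood and iterated maximal functions. -/

section MaximalFunction

/-- The centered Hardy-Littlewood maximal function on the line over intervals of dyadic length. -/
def hlMax (g : ℝ → ℝ≥0∞) (x : ℝ) : ℝ≥0∞ :=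
  ⨆ j : ℤ, ENNReal.ofReal ((2 : ℝ) ^ (-j)) * ∫⁻ t in Set.Icc (-(2 : ℝ) ^ j) (2 ^ j), g (x - t)

lemma lintegral_Icc_le_hlMax (g : ℝ → ℝ≥0∞) (x : ℝ) (j : ℤ) :
    ENNReal.ofReal ((2 : ℝ) ^ (-j)) * ∫⁻ t in Set.Icc (-(2 : ℝ) ^ j) (2 ^ j), g (x - t) ≤ hlMax g x :=
  le_iSup (fun j : ℤ => ENNReal.ofReal ((2 : ℝ) ^ (-j)) *
    ∫⁻ t in Set.Icc (-(2 : ℝ) ^ j) (2 ^ j), g (x - t)) j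

lemma lintegral_Icc_le_mul_hlMax (g : ℝ → ℝ≥0∞) (x : ℝ) (j : ℤ) :
    ∫⁻ t in Set.Icc (-(2 : ℝ) ^ j) (2 ^ j), g (x - t) ≤ ENNReal.ofReal ((2 : ℝ) ^ j) * hlMax g x := by
  refine le_trans ?_ (mul_le_mul_right (lintegral_Icc_le_hlMax g x j) _)
  rw [← mul_assoc, ← ENNReal.ofReal_mul (by positivity), ← zpow_add₀ two_ne_zero]
  simp

lemma hlMax_mono {g h : ℝ → ℝ≥0∞} (hgh : ∀ x, g x ≤ h x) (x : ℝ) : hlMax g x ≤ hlMax h x :=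
  iSup_mono fun _ => mul_le_mul_right (lintegral_mono fun _ => hgh _) _

lemma measurable_hlMax_param {β : Type*} [MeasurableSpace β] {g : β × ℝ → ℝ≥0∞} (hg : Measurable g) :
    Measurable (fun q : β × ℝ => hlMax (fun s => g (q.1, s)) q.2) := by
  refine Measurable.iSup fun j => Measurable.const_mul ?_ _
  have : Measurable (fun q : (β × ℝ) × ℝ => g (q.1.1, q.1.2 - q.2)) := by fun_prop
  exact this.lintegral_prod_right'

lemma measurable_hlMax {g : ℝ → ℝ≥0∞} (hg : Measurable g) : Measurable (hlMax g) :=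
  (measurable_hlMax_param (β := Unit) (g := fun q => g q.2) (by fun_prop)).comp
    (measurable_const.prodMk measurable_id : Measurable fun x : ℝ => ((), x))

lemma setLIntegral_Icc_sub (g : ℝ → ℝ≥0∞) (x r : ℝ) :
    ∫⁻ t in Set.Icc (-r) r, g (x - t) = ∫⁻ y in Metric.closedBall x r, g y := by
  have h := (Measure.measurePreserving_sub_left (volume : Measure ℝ) x).setLIntegral_comp_preimage_emb
    (Homeomorph.subLeft x).measurableEmbedding g (Metric.closedBall x r)
  rw [← h]
  congr 2
  ext t
  simp [Real.closedBall_eq_Icc, and_comm]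

/-- The weak type `(1, 1)` inequality. -/
lemma measure_lt_hlMax_le (g : ℝ → ℝ≥0∞) {t : ℝ} (ht : 0 < t) :
    volume {x | ENNReal.ofReal t < hlMax g x} ≤ 10 * ENNReal.ofReal (t⁻¹) * ∫⁻ y, g y := by
  rcases eq_or_ne (∫⁻ y, g y) ⊤ with h | hfin
  · rw [h, ENNReal.mul_top]
    · exact le_top
    · simp [ht]
  set T : Set (ℝ × ℤ) := {q | ENNReal.ofReal (t * 2 ^ q.2) <
    ∫⁻ y in Metric.closedBall q.1 ((2 : ℝ) ^ q.2), g y} with hT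
  have hmem : ∀ x, ENNReal.ofReal t < hlMax g x → ∃ j : ℤ, (x, j) ∈ T := by
    intro x hx
    obtain ⟨j, hj⟩ := lt_iSup_iff.1 hx
    refine ⟨j, ?_⟩
    have h2 : (0 : ℝ) < 2 ^ j := by positivity
    rw [setLIntegral_Icc_sub] at hj
    change ENNReal.ofReal (t * 2 ^ j) < ∫⁻ y in Metric.closedBall x ((2 : ℝ) ^ j), g y
    rw [ENNReal.ofReal_mul ht.le]
    have h3 := ENNReal.mul_lt_mul_left (a := ENNReal.ofReal ((2 : ℝ) ^ j)) (by simpa using h2) ENNReal.ofReal_ne_top hj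
    rw [mul_right_comm, ← ENNReal.ofReal_mul (p := (2 : ℝ) ^ (-j)) (by positivity),
      ← zpow_add₀ two_ne_zero, neg_add_cancel,
      zpow_zero, ENNReal.ofReal_one, one_mul] at h3
    exact h3
  -- Vitali's lemma requires bounded radii: each admissible interval satisfies `t 2^j ≤ ∫ g`, which
  -- is finite.
  obtain ⟨u, huT, hdisj, hcov⟩ := Vitali.exists_disjoint_subfamily_covering_enlargement_closedBall T
    (fun q => q.1) (fun q => (2 : ℝ) ^ q.2) ((∫⁻ y, g y).toReal / t) (by
      intro q hq
      rw [le_div_iff₀' ht]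
      have h1 : ENNReal.ofReal (t * 2 ^ q.2) ≤ ∫⁻ y, g y :=
        (le_of_lt hq).trans (setLIntegral_le_lintegral _ _)
      exact (ENNReal.ofReal_le_iff_le_toReal hfin).1 h1) 5 (by norm_num)
  have hcount : u.Countable := by
    refine hdisj.countable_of_nonempty_interior fun q _ => ?_
    refine ⟨q.1, Metric.ball_subset_interior_closedBall (Metric.mem_ball_self (by positivity))⟩
  have hsub : {x | ENNReal.ofReal t < hlMax g x} ⊆
      ⋃ q ∈ u, Metric.closedBall q.1 (5 * (2 : ℝ) ^ q.2) := by
    intro x hx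
    obtain ⟨j, hj⟩ := hmem x hx
    obtain ⟨b, hb, hsub⟩ := hcov _ hj
    exact Set.mem_biUnion hb (hsub (Metric.mem_closedBall_self (by positivity)))
  calc _ ≤ volume (⋃ q ∈ u, Metric.closedBall q.1 (5 * (2 : ℝ) ^ q.2)) := measure_mono hsub
    _ ≤ ∑' q : u, volume (Metric.closedBall q.1.1 (5 * (2 : ℝ) ^ q.1.2)) :=
        measure_biUnion_le _ hcount _
    _ ≤ ∑' q : u, 10 * ENNReal.ofReal (t⁻¹) * ∫⁻ y in Metric.closedBall q.1.1 ((2 : ℝ) ^ q.1.2), g y := by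
        refine ENNReal.tsum_le_tsum fun q => ?_
        have hq : ENNReal.ofReal (t * 2 ^ q.1.2) ≤ _ := le_of_lt (show ENNReal.ofReal (t * 2 ^ q.1.2) < _ from huT q.2)
        -- The factor `10` is the fivefold Vitali enlargement times the length `2 · 2^j` of an
        -- interval of radius `2^j`.
        refine le_trans (le_of_eq ?_) (mul_le_mul_right hq _)
        rw [Real.volume_closedBall, show (10 : ℝ≥0∞) = ENNReal.ofReal 10 by simp,
          ← ENNReal.ofReal_mul (by norm_num), ← ENNReal.ofReal_mul (by positivity)]
        congr 1
        field_simp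
        norm_num
    _ = 10 * ENNReal.ofReal (t⁻¹) * ∫⁻ y in ⋃ q ∈ u, Metric.closedBall q.1 ((2 : ℝ) ^ q.2), g y := by
        rw [ENNReal.tsum_mul_left, lintegral_biUnion hcount (fun _ _ => Metric.isClosed_closedBall.measurableSet) hdisj]
    _ ≤ _ := mul_le_mul_right (setLIntegral_le_lintegral _ _) _

/-- The factor `2` comes from the normalization by `2^j` of an integral over an interval of length
`2 · 2^j`. -/
lemma hlMax_le_of_le {g : ℝ → ℝ≥0∞} {b : ℝ≥0∞} (hg : ∀ x, g x ≤ b) (x : ℝ) : hlMax g x ≤ 2 * b := by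
  refine iSup_le fun j => ?_
  calc _ ≤ ENNReal.ofReal ((2 : ℝ) ^ (-j)) * ∫⁻ t in Set.Icc (-(2 : ℝ) ^ j) (2 ^ j), b :=
        mul_le_mul_right (lintegral_mono fun _ => hg _) _
    _ = 2 * b := by
        rw [setLIntegral_const, Real.volume_Icc, mul_left_comm, ← ENNReal.ofReal_mul (by positivity),
          mul_sub, mul_neg, ← zpow_add₀ two_ne_zero, mul_comm]
        norm_num

lemma hlMax_add_le {g h : ℝ → ℝ≥0∞} (hg : Measurable g) (x : ℝ) :
    hlMax (fun y => g y + h y) x ≤ hlMax g x + hlMax h x := by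
  refine iSup_le fun j => ?_
  rw [lintegral_add_left (by fun_prop), mul_add]
  exact add_le_add (lintegral_Icc_le_hlMax g x j) (lintegral_Icc_le_hlMax h x j)

/-- Interpolation between weak type `(1, 1)` and the trivial `L^∞` bound. The part of `g` below
`t/4` has maximal function at most `t/2`, so only the large part contributes to the level set; hence
`A₁ = 0` and the upper exponent `p + 1` is arbitrary. -/
lemma exists_lintegral_hlMax_rpow_le {p : ℝ} (hp : 1 < p) :
    ∃ C : ℝ≥0, ∀ g : ℝ → ℝ≥0∞, Measurable g → ∫⁻ x, hlMax g x ^ p ≤ C * ∫⁻ x, g x ^ p := by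
  obtain ⟨C, hC⟩ := exists_lintegral_rpow_le_of_distribution one_pos hp (lt_add_one p)
    (show (0 : ℝ) < 1 / 4 by norm_num)
  refine ⟨C * 20, fun g hg => ?_⟩
  refine (hC (μ := volume) (ν := volume) (measurable_hlMax hg) hg (A₀ := 20) (A₁ := 0) ?_).trans (by simp)
  intro t ht
  set s : Set ℝ := {y | ENNReal.ofReal (1 / 4 * t) < g y} with hs
  have hsm : MeasurableSet s := measurableSet_lt measurable_const hg
  have hsub : {x | ENNReal.ofReal t < hlMax g x} ⊆ {x | ENNReal.ofReal (t / 2) < hlMax (s.indicator g) x} := by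
    intro x hx
    have h1 : hlMax g x ≤ hlMax (s.indicator g) x + ENNReal.ofReal (t / 2) := by
      calc hlMax g x ≤ hlMax (fun y => s.indicator g y + ENNReal.ofReal (1 / 4 * t)) x := by
            refine hlMax_mono (fun y => ?_) x
            by_cases hy : y ∈ s
            · rw [Set.indicator_of_mem hy]; exact le_self_add
            · rw [Set.indicator_of_notMem hy, zero_add]; exact not_lt.1 hy
        _ ≤ _ := hlMax_add_le (hg.indicator hsm) x
        _ ≤ _ := by
            refine add_le_add le_rfl ((hlMax_le_of_le (fun _ => le_rfl) x).trans (le_of_eq ?_))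
            rw [show (2 : ℝ≥0∞) = ENNReal.ofReal 2 by simp, ← ENNReal.ofReal_mul (by norm_num)]
            congr 1; ring
    have h2 : ENNReal.ofReal t = ENNReal.ofReal (t / 2) + ENNReal.ofReal (t / 2) := by
      rw [← ENNReal.ofReal_add (by positivity) (by positivity)]; congr 1; ring
    have h3 := lt_of_lt_of_le hx h1
    rw [h2] at h3
    exact lt_of_add_lt_add_right h3
  refine (measure_mono hsub).trans ((measure_lt_hlMax_le (s.indicator g) (by positivity)).trans ?_)
  rw [zero_mul, zero_mul, add_zero, lintegral_indicator hsm]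
  simp only [ENNReal.rpow_one, Real.rpow_neg ht.le, Real.rpow_one]
  refine le_of_eq ?_
  congr 1
  rw [show (10 : ℝ≥0∞) = ENNReal.ofReal 10 by simp, show (20 : ℝ≥0∞) = ENNReal.ofReal 20 by simp,
    ← ENNReal.ofReal_mul (by norm_num), ← ENNReal.ofReal_mul (by norm_num)]
  congr 1
  field_simp
  norm_num

/-- A kernel on the line whose convolutions are controlled by the maximal function. -/
def hlKernel (s t : ℝ) : ℝ := |t|⁻¹ * min √(|t| / s) √(s / |t|)

/-- With `s ~ 2^m`, the kernel on the shell `|t| ~ 2^i` is at most a constant times `2^{-i}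
2^{-|i-m|/2}`. Each shell thus contributes a geometric weight times an average over an interval of
radius `2^i`, and the sum of the weights does not depend on `s`. -/
lemma exists_lintegral_hlKernel_mul_le : ∃ C : ℝ≥0, ∀ (s : ℝ), 0 < s → ∀ (g : ℝ → ℝ≥0∞),
    Measurable g → ∀ x : ℝ,
    ∫⁻ t, ENNReal.ofReal (hlKernel s t) * g (x - t) ≤ C * hlMax g x := by
  set q : ℝ := √(1 / 2) with hq
  have hq0 : 0 < q := by positivity
  have hq1 : q < 1 := by
    rw [hq, Real.sqrt_lt' one_pos]; norm_num
  have hsum : Summable fun i : ℤ => q ^ i.natAbs := by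
    apply Summable.of_nat_of_neg <;> simpa using summable_geometric_of_lt_one hq0.le hq1
  set S : ℝ≥0∞ := ∑' i : ℤ, ENNReal.ofReal (4 * q ^ i.natAbs) with hS
  have hSfin : S ≠ ⊤ := (hsum.mul_left 4).tsum_ofReal_ne_top
  refine ⟨S.toNNReal, fun s hs g hg x => ?_⟩
  rw [ENNReal.coe_toNNReal hSfin]
  obtain ⟨m, hm1, hm2⟩ := exists_mem_Ico_zpow hs one_lt_two
  set sh : ℤ → Set ℝ := fun i => {t | (2 : ℝ) ^ (i - 1) < |t| ∧ |t| ≤ 2 ^ i} with hsh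
  have hcov : ∀ t : ℝ, t ≠ 0 → t ∈ ⋃ i, sh i := by
    intro t ht
    obtain ⟨i, hi1, hi2⟩ := exists_mem_Ioc_zpow (abs_pos.2 ht) one_lt_two
    exact Set.mem_iUnion.2 ⟨i + 1, by simpa [hsh] using And.intro hi1 hi2⟩
  have hker : ∀ i, ∀ t ∈ sh i, hlKernel s t ≤ 2 ^ (-i) * (4 * q ^ (i - m).natAbs) := by
    rintro i t ⟨h1, h2⟩
    have ht : 0 < |t| := lt_trans (by positivity) h1
    have e1 : |t|⁻¹ ≤ 2 * 2 ^ (-i) := by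
      rw [inv_le_comm₀ ht (by positivity)]
      refine le_trans (le_of_eq ?_) h1.le
      rw [mul_inv, zpow_sub₀ two_ne_zero, zpow_neg, inv_inv]
      norm_num; ring
    have hpow : ∀ n : ℤ, √((2 : ℝ) ^ (2 * n)) = 2 ^ n := by
      intro n
      rw [mul_comm, zpow_mul]; norm_cast; rw [Real.sqrt_sq (by positivity)]
    have e2 : min √(|t| / s) √(s / |t|) ≤ 2 * q ^ (i - m).natAbs := by
      have hqp : ∀ n : ℕ, q ^ n = √((2 : ℝ) ^ (-(n : ℤ))) := by
        intro n
        symm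
        rw [Real.sqrt_eq_iff_mul_self_eq (by positivity) (by positivity), hq, ← pow_two, ← pow_mul,
          mul_comm, pow_mul, Real.sq_sqrt (by norm_num)]
        simp
      have h22 : ∀ a : ℝ, 0 ≤ a → 2 * √a = √(4 * a) := by
        intro a ha
        rw [Real.sqrt_mul (by norm_num), show (4 : ℝ) = 2 ^ 2 by norm_num, Real.sqrt_sq (by norm_num)]
      rw [hqp, h22 _ (by positivity)]
      rcases le_total i m with him | him
      · refine (min_le_left _ _).trans (Real.sqrt_le_sqrt ?_)
        rw [show (-((i - m).natAbs : ℤ)) = i - m by omega, zpow_sub₀ two_ne_zero]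
        calc |t| / s ≤ 2 ^ i / 2 ^ m := by gcongr
          _ ≤ 4 * (2 ^ i / 2 ^ m) := by
            have : (0 : ℝ) ≤ 2 ^ i / 2 ^ m := by positivity
            linarith
      · refine (min_le_right _ _).trans (Real.sqrt_le_sqrt ?_)
        rw [show (-((i - m).natAbs : ℤ)) = m - i by omega, zpow_sub₀ two_ne_zero]
        calc s / |t| ≤ 2 ^ (m + 1) / 2 ^ (i - 1) := by gcongr
          _ = 4 * (2 ^ m / 2 ^ i) := by
            rw [zpow_add₀ two_ne_zero, zpow_sub₀ two_ne_zero]; field_simp; norm_num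
    calc hlKernel s t ≤ (2 * 2 ^ (-i)) * (2 * q ^ (i - m).natAbs) := by
          unfold hlKernel; gcongr
      _ = _ := by ring
  have hmeas : ∀ i, MeasurableSet (sh i) := fun i =>
    (measurableSet_lt measurable_const measurable_abs).inter (measurableSet_le measurable_abs measurable_const)
  calc ∫⁻ t, ENNReal.ofReal (hlKernel s t) * g (x - t)
      = ∫⁻ t in ⋃ i, sh i, ENNReal.ofReal (hlKernel s t) * g (x - t) := by
        rw [← setLIntegral_univ]
        refine setLIntegral_congr ?_
        have : ∀ᵐ t : ℝ, t ≠ 0 := by simp [ae_iff]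
        filter_upwards [this] with t ht
        exact propext ⟨fun _ => hcov t ht, fun _ => trivial⟩
    _ ≤ ∑' i, ∫⁻ t in sh i, ENNReal.ofReal (hlKernel s t) * g (x - t) := lintegral_iUnion_le _ _
    _ ≤ ∑' i : ℤ, ENNReal.ofReal (4 * q ^ (i - m).natAbs) * hlMax g x := by
        refine ENNReal.tsum_le_tsum fun i => ?_
        calc _ ≤ ∫⁻ t in sh i, ENNReal.ofReal (2 ^ (-i) * (4 * q ^ (i - m).natAbs)) * g (x - t) := by
              refine setLIntegral_mono' (hmeas i) fun t ht => ?_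
              gcongr
              exact hker i t ht
          _ ≤ ∫⁻ t in Set.Icc (-(2 : ℝ) ^ i) (2 ^ i), ENNReal.ofReal (2 ^ (-i) * (4 * q ^ (i - m).natAbs)) * g (x - t) := by
              refine lintegral_mono_set fun t ht => abs_le.1 ht.2
          _ = ENNReal.ofReal (4 * q ^ (i - m).natAbs) * (ENNReal.ofReal (2 ^ (-i)) * ∫⁻ t in Set.Icc (-(2 : ℝ) ^ i) (2 ^ i), g (x - t)) := by
              rw [lintegral_const_mul' _ _ ENNReal.ofReal_ne_top, mul_comm ((2 : ℝ) ^ (-i)), ENNReal.ofReal_mul (by positivity), mul_assoc]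
          _ ≤ _ := mul_le_mul_right (lintegral_Icc_le_hlMax g x i) _
    _ = S * hlMax g x := by
        rw [ENNReal.tsum_mul_right, hS, ← (Equiv.subRight m).tsum_eq (fun i : ℤ => ENNReal.ofReal (4 * q ^ i.natAbs))]
        rfl

/-- The Poisson kernel decays faster than `hlKernel` both for `|t|` much smaller and much larger
than `s`, so Poisson averages inherit the bound by the maximal function. -/
lemma cauchy_le_hlKernel {s t : ℝ} (hs : 0 < s) (ht : t ≠ 0) : s / (s ^ 2 + t ^ 2) ≤ hlKernel s t := by
  unfold hlKernel
  have ht' := abs_pos.2 ht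
  have key : ∀ a b : ℝ, 0 < a → 0 < b → a * b / (a ^ 2 + b ^ 2) ≤ √(a / b) := by
    intro a b ha hb
    rcases le_total a b with h | h
    · calc a * b / (a ^ 2 + b ^ 2) ≤ a / b := by
            rw [div_le_div_iff₀ (by positivity) hb]; nlinarith [pow_pos ha 3, mul_pos ha (mul_pos hb hb)]
        _ ≤ √(a / b) := by
            apply Real.le_sqrt_of_sq_le
            have h1 : a / b ≤ 1 := by rw [div_le_one hb]; exact h
            have h0 : 0 ≤ a / b := by positivity
            nlinarith
    · calc a * b / (a ^ 2 + b ^ 2) ≤ 1 := by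
            rw [div_le_one (by positivity)]; nlinarith [sq_nonneg (a - b), mul_pos ha hb]
        _ ≤ √(a / b) := by
            apply Real.le_sqrt_of_sq_le
            rw [one_pow, le_div_iff₀ hb]; linarith
  have h1 := key |t| s ht' hs
  have h2 := key s |t| hs ht'
  have e : s / (s ^ 2 + t ^ 2) = |t|⁻¹ * (|t| * s / (|t| ^ 2 + s ^ 2)) := by
    rw [sq_abs, add_comm (t ^ 2)]; field_simp
  rw [e]
  refine mul_le_mul_of_nonneg_left (le_min h1 ?_) (by positivity)
  rwa [mul_comm, add_comm] at h2

lemma exists_lintegral_cauchy_mul_le : ∃ C : ℝ≥0, ∀ (s : ℝ), 0 < s → ∀ (g : ℝ → ℝ≥0∞),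
    Measurable g → ∀ x : ℝ,
    ∫⁻ t, ENNReal.ofReal (s / (s ^ 2 + t ^ 2)) * g (x - t) ≤ C * hlMax g x := by
  obtain ⟨C, hC⟩ := exists_lintegral_hlKernel_mul_le
  refine ⟨C, fun s hs g hg x => le_trans (lintegral_mono_ae ?_) (hC s hs g hg x)⟩
  have : ∀ᵐ t : ℝ, t ≠ 0 := by simp [ae_iff]
  filter_upwards [this] with t ht
  gcongr
  exact cauchy_le_hlKernel hs ht

/-- The maximal function in the first variable. -/
def hlMax₁ (g : ℝ × ℝ → ℝ≥0∞) (z : ℝ × ℝ) : ℝ≥0∞ := hlMax (fun s => g (s, z.2)) z.1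

/-- The maximal function in the second variable. -/
def hlMax₂ (g : ℝ × ℝ → ℝ≥0∞) (z : ℝ × ℝ) : ℝ≥0∞ := hlMax (fun s => g (z.1, s)) z.2

@[fun_prop]
lemma measurable_hlMax₂ {g : ℝ × ℝ → ℝ≥0∞} (hg : Measurable g) : Measurable (hlMax₂ g) :=
  measurable_hlMax_param hg

@[fun_prop]
lemma measurable_hlMax₁ {g : ℝ × ℝ → ℝ≥0∞} (hg : Measurable g) : Measurable (hlMax₁ g) :=
  (measurable_hlMax_param (g := fun q : ℝ × ℝ => g (q.2, q.1)) (by fun_prop)).comp measurable_swap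

/-- A bound for an operator acting on the second variable, from a bound on the fibers. -/
lemma lintegral_prod_le_of_fibers {G g : ℝ × ℝ → ℝ≥0∞} (hG : Measurable G) (hg : Measurable g) {C : ℝ≥0}
    (h : ∀ x, ∫⁻ y, G (x, y) ≤ C * ∫⁻ y, g (x, y)) : ∫⁻ z, G z ≤ C * ∫⁻ z, g z := by
  rw [Measure.volume_eq_prod, lintegral_prod _ hG.aemeasurable, lintegral_prod _ hg.aemeasurable,
    ← lintegral_const_mul' _ _ ENNReal.coe_ne_top]
  exact lintegral_mono h

lemma lintegral_prod_le_of_fibers_symm {G g : ℝ × ℝ → ℝ≥0∞} (hG : Measurable G) (hg : Measurable g) {C : ℝ≥0}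
    (h : ∀ y, ∫⁻ x, G (x, y) ≤ C * ∫⁻ x, g (x, y)) : ∫⁻ z, G z ≤ C * ∫⁻ z, g z := by
  rw [Measure.volume_eq_prod, lintegral_prod_symm _ hG.aemeasurable, lintegral_prod_symm _ hg.aemeasurable,
    ← lintegral_const_mul' _ _ ENNReal.coe_ne_top]
  exact lintegral_mono h

lemma exists_lintegral_hlMax₁_rpow_le {p : ℝ} (hp : 1 < p) : ∃ C : ℝ≥0, ∀ g : ℝ × ℝ → ℝ≥0∞,
    Measurable g → ∫⁻ z, hlMax₁ g z ^ p ≤ C * ∫⁻ z, g z ^ p := by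
  obtain ⟨C, hC⟩ := exists_lintegral_hlMax_rpow_le hp
  exact ⟨C, fun g hg => lintegral_prod_le_of_fibers_symm (by fun_prop) (by fun_prop) fun y =>
    hC (fun s => g (s, y)) (by fun_prop)⟩

lemma exists_lintegral_hlMax₂_rpow_le {p : ℝ} (hp : 1 < p) : ∃ C : ℝ≥0, ∀ g : ℝ × ℝ → ℝ≥0∞,
    Measurable g → ∫⁻ z, hlMax₂ g z ^ p ≤ C * ∫⁻ z, g z ^ p := by
  obtain ⟨C, hC⟩ := exists_lintegral_hlMax_rpow_le hp
  exact ⟨C, fun g hg => lintegral_prod_le_of_fibers (by fun_prop) (by fun_prop) fun x =>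
    hC (fun s => g (x, s)) (by fun_prop)⟩

lemma exists_lintegral_strongMax_rpow_le {p : ℝ} (hp : 1 < p) : ∃ C : ℝ≥0, ∀ g : ℝ × ℝ → ℝ≥0∞,
    Measurable g → ∫⁻ z, hlMax₁ (hlMax₂ g) z ^ p ≤ C * ∫⁻ z, g z ^ p := by
  obtain ⟨C, hC⟩ := exists_lintegral_hlMax₁_rpow_le hp
  obtain ⟨D, hD⟩ := exists_lintegral_hlMax₂_rpow_le hp
  refine ⟨C * D, fun g hg => (hC _ (by fun_prop)).trans ?_⟩
  rw [ENNReal.coe_mul, mul_assoc]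
  gcongr
  exact hD g hg

end MaximalFunction

end

noncomputable section

/-! ### Van der Corput estimates for quadratic phases. -/

section Oscillatory

lemma hasDerivAt_cexp_quadratic (α β τ : ℝ) :
    HasDerivAt (fun τ : ℝ => Complex.exp (Complex.I * ((α * τ ^ 2 + β * τ : ℝ) : ℂ)))
      (Complex.exp (Complex.I * ((α * τ ^ 2 + β * τ : ℝ) : ℂ)) * (Complex.I * ((2 * α * τ + β : ℝ) : ℂ))) τ := by
  have h : HasDerivAt (fun τ : ℝ => α * τ ^ 2 + β * τ) (2 * α * τ + β) τ := by
    have := ((hasDerivAt_pow 2 τ).const_mul α).add ((hasDerivAt_id τ).const_mul β)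
    refine this.congr_deriv ?_
    simp; ring
  exact (h.ofReal_comp.const_mul Complex.I).cexp

lemma norm_cexp_I_mul_ofReal (a : ℝ) : ‖Complex.exp (Complex.I * (a : ℂ))‖ = 1 := by
  rw [mul_comm]; exact Complex.norm_exp_ofReal_mul_I a

lemma continuous_cexp_quadratic (α β : ℝ) :
    Continuous (fun τ : ℝ => Complex.exp (Complex.I * ((α * τ ^ 2 + β * τ : ℝ) : ℂ))) := by fun_prop

lemma norm_integral_cexp_quadratic_le_abs_sub (α β a b : ℝ) :
    ‖∫ τ in a..b, Complex.exp (Complex.I * ((α * τ ^ 2 + β * τ : ℝ) : ℂ))‖ ≤ |b - a| := by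
  refine (intervalIntegral.norm_integral_le_of_norm_le_const (C := 1)
    (fun τ _ => (norm_cexp_I_mul_ofReal (α * τ ^ 2 + β * τ)).le)).trans ?_
  rw [one_mul]

/-- First derivative test for quadratic phases. -/
lemma norm_integral_cexp_quadratic_le_of_deriv {α β a b m : ℝ} (hm : 0 < m)
    (h : ∀ τ ∈ Set.uIcc a b, m ≤ |2 * α * τ + β|) :
    ‖∫ τ in a..b, Complex.exp (Complex.I * ((α * τ ^ 2 + β * τ : ℝ) : ℂ))‖ ≤ 4 / m := by
  set e : ℝ → ℂ := fun τ => Complex.exp (Complex.I * ((α * τ ^ 2 + β * τ : ℝ) : ℂ)) with he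
  set d : ℝ → ℝ := fun τ => 2 * α * τ + β with hd
  have hne : ∀ τ ∈ Set.uIcc a b, d τ ≠ 0 := fun τ hτ h0 => by
    have := h τ hτ
    rw [show 2 * α * τ + β = 0 from h0, abs_zero] at this
    linarith
  -- Integration by parts: the derivative of `e / d` is `i e` plus an error with the derivative of
  -- `1/d`. The boundary terms cost `2/m` and the error another `2/m`.
  have hdd : ∀ τ, HasDerivAt d (2 * α) τ := fun τ => by
    exact (((hasDerivAt_id τ).const_mul (2 * α)).add_const β).congr_deriv (mul_one _)
  have hinv : ∀ τ ∈ Set.uIcc a b, HasDerivAt (fun τ => (d τ)⁻¹) (-(2 * α) / d τ ^ 2) τ :=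
    fun τ hτ => (hdd τ).inv (hne τ hτ)
  have hF : ∀ τ ∈ Set.uIcc a b, HasDerivAt (fun τ => e τ * (((d τ)⁻¹ : ℝ) : ℂ))
      (e τ * (Complex.I * ((d τ : ℝ) : ℂ)) * (((d τ)⁻¹ : ℝ) : ℂ) + e τ * ((-(2 * α) / d τ ^ 2 : ℝ) : ℂ)) τ :=
    fun τ hτ => (hasDerivAt_cexp_quadratic α β τ).mul (hinv τ hτ).ofReal_comp
  have hF' : ∀ τ ∈ Set.uIcc a b, HasDerivAt (fun τ => e τ * (((d τ)⁻¹ : ℝ) : ℂ))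
      (e τ * Complex.I + e τ * ((-(2 * α) / d τ ^ 2 : ℝ) : ℂ)) τ := by
    intro τ hτ
    convert hF τ hτ using 2
    rw [mul_assoc, mul_assoc, ← Complex.ofReal_mul, mul_inv_cancel₀ (hne τ hτ)]
    simp
  have hdc : Continuous d := by fun_prop
  have hgc : ContinuousOn (fun τ => -(2 * α) / d τ ^ 2) (Set.uIcc a b) :=
    continuousOn_const.div (by fun_prop) fun τ hτ => pow_ne_zero _ (hne τ hτ)
  have hec : Continuous e := continuous_cexp_quadratic α β
  have hg : ContinuousOn (fun τ => e τ * ((-(2 * α) / d τ ^ 2 : ℝ) : ℂ)) (Set.uIcc a b) :=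
    hec.continuousOn.mul (Complex.continuous_ofReal.comp_continuousOn hgc)
  have hint : IntervalIntegrable (fun τ => e τ * Complex.I) volume a b :=
    (hec.mul continuous_const).intervalIntegrable _ _
  have hint2 := hg.intervalIntegrable (μ := volume)
  have hFTC := intervalIntegral.integral_eq_sub_of_hasDerivAt hF' (hint.add hint2)
  rw [intervalIntegral.integral_add hint hint2, intervalIntegral.integral_mul_const] at hFTC
  have hb : ∀ τ ∈ Set.uIcc a b, ‖e τ * (((d τ)⁻¹ : ℝ) : ℂ)‖ ≤ 1 / m := by
    intro τ hτ
    rw [norm_mul, he, norm_cexp_I_mul_ofReal, one_mul, Complex.norm_real, norm_inv, ← one_div]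
    exact one_div_le_one_div_of_le hm (h τ hτ)
  have hI2 : ‖∫ τ in a..b, e τ * ((-(2 * α) / d τ ^ 2 : ℝ) : ℂ)‖ ≤ 2 / m := by
    refine (intervalIntegral.norm_integral_le_abs_integral_norm).trans ?_
    -- Since `d` is affine, the derivative of `1/d` has constant sign, so the integral of its
    -- absolute value telescopes to the difference of the endpoint values of `1/d`.
    have h1 : ∀ τ, ‖e τ * ((-(2 * α) / d τ ^ 2 : ℝ) : ℂ)‖ = (SignType.sign (-α) : ℝ) * (-(2 * α) / d τ ^ 2) := by
      intro τ
      rw [norm_mul, he, norm_cexp_I_mul_ofReal, one_mul, Complex.norm_real, Real.norm_eq_abs, abs_div, abs_neg,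
        abs_mul, abs_two, abs_of_nonneg (sq_nonneg (d τ))]
      have : |α| = (SignType.sign (-α) : ℝ) * (-α) := by rw [sign_mul_self, abs_neg]
      rw [this]; ring
    simp_rw [h1]
    rw [intervalIntegral.integral_const_mul, abs_mul,
      intervalIntegral.integral_eq_sub_of_hasDerivAt hinv hgc.intervalIntegrable]
    have hs : |(SignType.sign (-α) : ℝ)| ≤ 1 := by
      rcases lt_trichotomy (-α) 0 with h | h | h
      · simp [sign_neg h]
      · simp [h]
      · simp [sign_pos h]
    have hbd : ∀ τ ∈ Set.uIcc a b, |(d τ)⁻¹| ≤ 1 / m := by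
      intro τ hτ
      rw [abs_inv, ← one_div]
      exact one_div_le_one_div_of_le hm (h τ hτ)
    have h3 := abs_sub (d b)⁻¹ (d a)⁻¹
    have h4 := hbd b Set.right_mem_uIcc
    have h5 := hbd a Set.left_mem_uIcc
    calc _ ≤ 1 * |(d b)⁻¹ - (d a)⁻¹| := mul_le_mul_of_nonneg_right hs (abs_nonneg _)
      _ ≤ 1 / m + 1 / m := by linarith
      _ = 2 / m := by ring
  have hfin : ‖(∫ τ in a..b, e τ) * Complex.I‖ ≤ 4 / m := by
    have : (∫ τ in a..b, e τ) * Complex.I = e b * (((d b)⁻¹ : ℝ) : ℂ) - e a * (((d a)⁻¹ : ℝ) : ℂ)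
      - ∫ τ in a..b, e τ * ((-(2 * α) / d τ ^ 2 : ℝ) : ℂ) := by rw [← hFTC]; ring
    rw [this]
    calc _ ≤ 1 / m + 1 / m + 2 / m :=
        (norm_sub_le _ _).trans (add_le_add ((norm_sub_le _ _).trans
          (add_le_add (hb b Set.right_mem_uIcc) (hb a Set.left_mem_uIcc))) hI2)
      _ = 4 / m := by ring
  rwa [norm_mul, Complex.norm_I, mul_one] at hfin

/-- The phase has derivative `2α(τ - c)` with `c = -β/(2α)`. Within distance `δ = |α|^{-1/2}` of `c`
the length of the interval is used, beyond it the first derivative test with lower bound `2|α|δ`;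
the contributions are `δ` and `2δ`. -/
lemma norm_integral_cexp_quadratic_from_critical {α β q : ℝ} (hα : α ≠ 0) :
    ‖∫ τ in (-β / (2 * α))..q, Complex.exp (Complex.I * ((α * τ ^ 2 + β * τ : ℝ) : ℂ))‖ ≤ 3 / √|α| := by
  set c := -β / (2 * α) with hc
  set δ := 1 / √|α| with hδ
  have hα' := abs_pos.2 hα
  have hδ0 : 0 < δ := by positivity
  have hsq : √|α| * √|α| = |α| := Real.mul_self_sqrt hα'.le
  have hd : ∀ τ, 2 * α * τ + β = 2 * α * (τ - c) := by intro τ; rw [hc]; field_simp; ring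
  have htriv := norm_integral_cexp_quadratic_le_abs_sub α β
  have hbig : ∀ s : ℝ, |s - c| = δ → (∀ τ ∈ Set.uIcc s q, δ ≤ |τ - c|) →
      ‖∫ τ in c..q, Complex.exp (Complex.I * ((α * τ ^ 2 + β * τ : ℝ) : ℂ))‖ ≤ 3 / √|α| := by
    intro s hs hsq'
    rw [← intervalIntegral.integral_add_adjacent_intervals
      ((continuous_cexp_quadratic α β).intervalIntegrable c s)
      ((continuous_cexp_quadratic α β).intervalIntegrable s q)]
    have h2 := norm_integral_cexp_quadratic_le_of_deriv (α := α) (β := β) (a := s) (b := q)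
      (m := 2 * |α| * δ) (by positivity) (by
        intro τ hτ
        rw [hd, abs_mul, abs_mul, abs_two]
        exact mul_le_mul_of_nonneg_left (hsq' τ hτ) (by positivity))
    have e : 4 / (2 * |α| * δ) = 2 / √|α| := by
      rw [hδ, ← hsq]; field_simp; norm_num
    rw [e] at h2
    refine (norm_add_le _ _).trans ((add_le_add ((htriv c s).trans hs.le) h2).trans (le_of_eq ?_))
    rw [hδ]; ring
  by_cases hq : |q - c| ≤ δ
  · refine (htriv c q).trans (hq.trans ?_)
    rw [hδ]; gcongr; norm_num
  · push Not at hq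
    rcases le_total c q with h | h
    · rw [abs_of_nonneg (by linarith)] at hq
      refine hbig (c + δ) (by rw [add_sub_cancel_left, abs_of_pos hδ0]) fun τ hτ => ?_
      rw [Set.uIcc_of_le (by linarith)] at hτ
      exact le_trans (by linarith [hτ.1]) (le_abs_self _)
    · rw [abs_of_nonpos (by linarith)] at hq
      refine hbig (c - δ) (by rw [sub_sub_cancel_left, abs_neg, abs_of_pos hδ0]) fun τ hτ => ?_
      rw [Set.uIcc_of_ge (by linarith)] at hτ
      exact le_trans (by linarith [hτ.2]) (neg_le_abs _)

/-- Van der Corput estimate for quadratic phases on the unit interval. -/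
lemma norm_integral_cexp_quadratic_mul_sqrt_le {α β a b : ℝ} (ha : a ∈ Set.Icc (0 : ℝ) 1)
    (hb : b ∈ Set.Icc (0 : ℝ) 1) :
    ‖∫ τ in a..b, Complex.exp (Complex.I * ((α * τ ^ 2 + β * τ : ℝ) : ℂ))‖ * √(|α| + |β|) ≤ 20 := by
  set N := |α| + |β| with hN
  have hN0 : 0 ≤ N := by positivity
  have htriv : ‖∫ τ in a..b, Complex.exp (Complex.I * ((α * τ ^ 2 + β * τ : ℝ) : ℂ))‖ ≤ 1 := by
    refine (norm_integral_cexp_quadratic_le_abs_sub α β a b).trans ?_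
    rw [abs_le]; constructor <;> linarith [ha.1, ha.2, hb.1, hb.2]
  rcases le_total N 1 with hN1 | hN1
  · have : √N ≤ 1 := by rw [Real.sqrt_le_one]; exact hN1
    nlinarith [Real.sqrt_nonneg N, norm_nonneg (∫ τ in a..b, Complex.exp (Complex.I * ((α * τ ^ 2 + β * τ : ℝ) : ℂ)))]
  have hsN : √N * √N = N := Real.mul_self_sqrt hN0
  have hsN1 : 1 ≤ √N := by rw [Real.one_le_sqrt]; exact hN1
  -- If `β` dominates, the phase derivative on `[0, 1]` is at least `|β| - 2|α| ≥ 0.4 N` and there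
  -- is no stationary point. Otherwise `|α| ≥ N/5`, and the integral is a difference of two
  -- integrals started at the critical point, wherever that point lies.
  by_cases hcase : 4 * |α| ≤ |β|
  · have hβ : 0.8 * N ≤ |β| := by rw [hN]; linarith
    have h1 := norm_integral_cexp_quadratic_le_of_deriv (α := α) (β := β) (a := a) (b := b)
      (m := 0.4 * N) (by positivity) (by
        intro τ hτ
        have hτ' : τ ∈ Set.Icc (0 : ℝ) 1 := Set.uIcc_subset_Icc ha hb hτ
        have h2 : |2 * α * τ| ≤ 2 * |α| := by
          rw [abs_mul, abs_mul, abs_two, abs_of_nonneg hτ'.1]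
          nlinarith [abs_nonneg α, hτ'.2]
        have h3 := abs_sub_abs_le_abs_sub β (-(2 * α * τ))
        rw [abs_neg, sub_neg_eq_add, add_comm β] at h3
        linarith)
    calc _ ≤ 4 / (0.4 * N) * √N := by gcongr
      _ = 10 / √N := by rw [← hsN]; field_simp; norm_num; ring
      _ ≤ 20 := by
        rw [div_le_iff₀ (by positivity)]; linarith
  · push Not at hcase
    have hα : N / 5 ≤ |α| := by rw [hN]; linarith
    have hα0 : α ≠ 0 := by
      intro h; rw [h, abs_zero] at hα; linarith
    have h1 := norm_integral_cexp_quadratic_from_critical (α := α) (β := β) (q := a) hα0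
    have h2 := norm_integral_cexp_quadratic_from_critical (α := α) (β := β) (q := b) hα0
    have hint : ∀ x y, IntervalIntegrable (fun τ : ℝ => Complex.exp (Complex.I * ((α * τ ^ 2 + β * τ : ℝ) : ℂ))) volume x y :=
      fun x y => (continuous_cexp_quadratic α β).intervalIntegrable x y
    rw [← intervalIntegral.integral_interval_sub_left (hint (-β / (2 * α)) b) (hint (-β / (2 * α)) a)]
    have hs : √N ≤ 3 * √|α| := by
      rw [show (3 : ℝ) = √9 by rw [show (9 : ℝ) = 3 ^ 2 by norm_num, Real.sqrt_sq (by norm_num)],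
        ← Real.sqrt_mul (by norm_num)]
      exact Real.sqrt_le_sqrt (by linarith)
    have hsα : 0 < √|α| := Real.sqrt_pos.2 (abs_pos.2 hα0)
    calc _ ≤ (3 / √|α| + 3 / √|α|) * (3 * √|α|) := by
          gcongr
          exact (norm_sub_le _ _).trans (add_le_add h2 h1)
      _ = 18 := by field_simp; norm_num
      _ ≤ 20 := by norm_num

/-- Integration by parts against the primitive of the oscillating factor, which is uniformly
controlled by the previous estimate. The boundary term and the integral containing `A'` cost `20 V`
each, the latter because `b - a ≤ 1`. -/
lemma norm_integral_amplitude_mul_cexp_le {α β a b V : ℝ} {A A' : ℝ → ℝ} (ha : 0 ≤ a) (hab : a ≤ b) (hb : b ≤ 1)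
    (hA : ∀ τ ∈ Set.Icc a b, HasDerivAt A (A' τ) τ) (hA'c : ContinuousOn A' (Set.Icc a b))
    (hAV : ∀ τ ∈ Set.Icc a b, |A τ| ≤ V) (hA'V : ∀ τ ∈ Set.Icc a b, |A' τ| ≤ V) :
    ‖∫ τ in a..b, (A τ : ℂ) * Complex.exp (Complex.I * ((α * τ ^ 2 + β * τ : ℝ) : ℂ))‖ * √(|α| + |β|) ≤ 40 * V := by
  set e : ℝ → ℂ := fun τ => Complex.exp (Complex.I * ((α * τ ^ 2 + β * τ : ℝ) : ℂ)) with he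
  have hec : Continuous e := continuous_cexp_quadratic α β
  set P : ℝ → ℂ := fun τ => ∫ s in a..τ, e s with hP
  have hPd : ∀ τ, HasDerivAt P (e τ) τ := fun τ =>
    intervalIntegral.integral_hasDerivAt_right (hec.intervalIntegrable _ _)
      (hec.stronglyMeasurableAtFilter _ _) hec.continuousAt
  have hPb : ∀ τ ∈ Set.Icc a b, ‖P τ‖ * √(|α| + |β|) ≤ 20 := fun τ hτ =>
    norm_integral_cexp_quadratic_mul_sqrt_le ⟨ha, hab.trans hb⟩ ⟨ha.trans hτ.1, hτ.2.trans hb⟩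
  have hI : Set.uIcc a b = Set.Icc a b := Set.uIcc_of_le hab
  have hV : 0 ≤ V := (abs_nonneg _).trans (hAV a ⟨le_rfl, hab⟩)
  have hibp := intervalIntegral.integral_mul_deriv_eq_deriv_mul (a := a) (b := b) (u := fun τ => (A τ : ℂ)) (v := P)
    (u' := fun τ => (A' τ : ℂ)) (v' := e) (fun τ hτ => (hA τ (hI ▸ hτ)).ofReal_comp) (fun τ _ => hPd τ)
    ((Complex.continuous_ofReal.comp_continuousOn (hI ▸ hA'c)).intervalIntegrable) (hec.intervalIntegrable _ _)
  have hPa : P a = 0 := by simp [hP]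
  rw [hibp, hPa, mul_zero, sub_zero]
  have hb' : b ∈ Set.Icc a b := ⟨hab, le_rfl⟩
  set S := √(|α| + |β|) with hS
  have hS0 : 0 ≤ S := Real.sqrt_nonneg _
  have h1 : ‖(A b : ℂ) * P b‖ * S ≤ V * 20 := by
    rw [norm_mul, mul_assoc, Complex.norm_real]
    exact mul_le_mul (hAV b hb') (hPb b hb') (by positivity) hV
  have h2 : ‖∫ τ in a..b, (A' τ : ℂ) * P τ‖ * S ≤ V * 20 := by
    rw [← abs_of_nonneg hS0, ← Real.norm_eq_abs, ← Complex.norm_real, ← norm_mul, ← intervalIntegral.integral_mul_const]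
    refine (intervalIntegral.norm_integral_le_of_norm_le_const (C := V * 20) ?_).trans ?_
    · intro τ hτ
      rw [Set.uIoc_of_le hab] at hτ
      have hτ' : τ ∈ Set.Icc a b := ⟨hτ.1.le, hτ.2⟩
      rw [norm_mul, norm_mul, Complex.norm_real, Complex.norm_real, mul_assoc, Real.norm_eq_abs S, abs_of_nonneg hS0]
      exact mul_le_mul (hA'V τ hτ') (hPb τ hτ') (by positivity) hV
    · have : |b - a| ≤ 1 := by rw [abs_of_nonneg (by linarith)]; linarith
      nlinarith
  calc _ ≤ (‖(A b : ℂ) * P b‖ + ‖∫ τ in a..b, (A' τ : ℂ) * P τ‖) * S := by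
        gcongr; exact norm_sub_le _ _
    _ ≤ 40 * V := by rw [add_mul]; linarith

end Oscillatory

end

noncomputable section

/-! ### The `TT*` method with maximal function control. -/

section TTStar

open scoped ComplexConjugate

lemma lintegral_mul_sq_le {α : Type*} [MeasurableSpace α] {μ : Measure α} {f g : α → ℝ≥0∞}
    (hf : AEMeasurable f μ) (hg : AEMeasurable g μ) :
    (∫⁻ x, f x * g x ∂μ) ^ 2 ≤ (∫⁻ x, f x ^ 2 ∂μ) * ∫⁻ x, g x ^ 2 ∂μ := by
  have h := ENNReal.lintegral_mul_le_Lp_mul_Lq μ Real.HolderConjugate.two_two hf hg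
  have e : ∀ a : ℝ≥0∞, (a ^ (1 / 2 : ℝ)) ^ 2 = a := fun a => by
    rw [← ENNReal.rpow_natCast, ← ENNReal.rpow_mul]; norm_num
  calc _ ≤ _ := pow_le_pow_left' h 2
    _ = _ := by
      rw [mul_pow, e, e]
      simp only [ENNReal.rpow_two]

lemma integrable_of_bounded_of_support {α : Type*} [MeasurableSpace α] {μ : Measure α} {f : α → ℂ}
    (hf : Measurable f) {s : Set α} (hs : μ s ≠ ⊤) {B : ℝ} (hB : ∀ x, ‖f x‖ ≤ B)
    (hsupp : ∀ x, f x ≠ 0 → x ∈ s) : Integrable f μ := by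
  have h1 : IntegrableOn f s μ :=
    Measure.integrableOn_of_bounded hs hf.aestronglyMeasurable (Eventually.of_forall hB)
  rw [← integrableOn_iff_integrable_of_support_subset (s := s)]
  · exact h1
  · intro x hx; exact hsupp x hx

lemma norm_sq_enorm_eq {α : Type*} [MeasurableSpace α] {μ : Measure α} {f : α → ℂ}
    (hf : Integrable (fun x => f x * conj (f x)) μ) :
    ∫⁻ x, ‖f x‖ₑ ^ 2 ∂μ = ‖∫ x, f x * conj (f x) ∂μ‖ₑ := by
  have h1 : ∀ x, f x * conj (f x) = ((‖f x‖ ^ 2 : ℝ) : ℂ) := fun x => by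
    rw [Complex.mul_conj, Complex.normSq_eq_norm_sq]
  simp_rw [h1] at hf ⊢
  rw [show ∫ x, ((‖f x‖ ^ 2 : ℝ) : ℂ) ∂μ = ((∫ x, ‖f x‖ ^ 2 ∂μ : ℝ) : ℂ) from integral_ofReal]
  have h2 : Integrable (fun x => ‖f x‖ ^ 2) μ := by
    exact (hf.re).congr (Eventually.of_forall fun x => Complex.ofReal_re _)
  rw [← ofReal_norm, Complex.norm_real, Real.norm_of_nonneg (integral_nonneg fun _ => by positivity),
    ofReal_integral_eq_lintegral_ofReal h2 (Eventually.of_forall fun _ => by positivity)]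
  refine lintegral_congr fun x => ?_
  rw [ENNReal.ofReal_pow (norm_nonneg _), ofReal_norm]

set_option maxHeartbeats 800000 in
/-- The `TT*` method for kernels whose `TT*` kernel is dominated by the maximal function. -/
lemma exists_lintegral_kernel_sq_le : ∃ C : ℝ≥0, ∀ {k : ℝ × ℝ → ℂ} (_ : Measurable k) {B L : ℝ}
    (_ : ∀ q, ‖k q‖ ≤ B) (_ : ∀ q, k q ≠ 0 → q ∈ Set.Icc (-L) L ×ˢ Set.Icc (-L) L)
    {s : ℝ → ℝ} (_ : Measurable s) (_ : ∀ x, 0 < s x) {D : ℝ} (_ : 0 ≤ D)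
    (_ : ∀ x x', x ≠ x' → ‖∫ z, k (x, z) * conj (k (x', z))‖ ≤
      D * (hlKernel (s x) (x - x') + hlKernel (s x') (x' - x)))
    {g : ℝ → ℂ} (_ : Measurable g) {B' : ℝ} (_ : ∀ x, ‖g x‖ ≤ B'),
    ∫⁻ x, ‖∫ z, k (x, z) * g z‖ₑ ^ 2 ≤ C * ENNReal.ofReal D * ∫⁻ z, ‖g z‖ₑ ^ 2 := by
  obtain ⟨C₁, hC₁⟩ := exists_lintegral_hlKernel_mul_le
  obtain ⟨C₂, hC₂⟩ := exists_lintegral_hlMax_rpow_le one_lt_two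
  refine ⟨2 * C₁ * (1 + C₂), ?_⟩
  intro k hk B L hB hL s hsm hs D hD hK g hg B' hB'
  have hB0 : 0 ≤ B := (norm_nonneg _).trans (hB (0, 0))
  have hB'0 : 0 ≤ B' := (norm_nonneg _).trans (hB' 0)
  set I : Set ℝ := Set.Icc (-L) L with hI
  have hIfin : volume I ≠ ⊤ := by simp [hI]
  have hIIfin : volume (I ×ˢ I) ≠ ⊤ := by
    rw [Measure.volume_eq_prod, Measure.prod_prod]; exact ENNReal.mul_ne_top hIfin hIfin
  set h : ℝ → ℂ := fun x => ∫ z, k (x, z) * g z with hh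
  have hkg : Measurable (fun q : ℝ × ℝ => k q * g q.2) := by fun_prop
  have hhm : Measurable h := hkg.stronglyMeasurable.integral_prod_right'.measurable
  have hbd : ∀ {f : ℝ → ℂ} {A : ℝ}, (∀ z, ‖f z‖ ≤ A) → (∀ z, f z ≠ 0 → z ∈ I) →
      ‖∫ z, f z‖ ≤ A * (volume I).toReal := by
    intro f A hA hf
    rw [← setIntegral_eq_integral_of_forall_compl_eq_zero (s := I) (fun x hx => by
      by_contra h0; exact hx (hf x h0))]
    exact norm_setIntegral_le_of_norm_le_const hIfin.lt_top (fun x _ => hA x)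
  have hhb : ∀ x, ‖h x‖ ≤ B * B' * (volume I).toReal := by
    intro x
    refine hbd (fun z => ?_) (fun z hz => (hL _ (left_ne_zero_of_mul hz)).2)
    rw [norm_mul]
    exact mul_le_mul (hB _) (hB' _) (norm_nonneg _) hB0
  have hhs : ∀ x, h x ≠ 0 → x ∈ I := by
    intro x hx
    by_contra hxI
    apply hx
    simp only [hh]
    rw [← integral_zero ℝ ℂ]
    congr 1 with z
    have : k (x, z) = 0 := by
      by_contra h0; exact hxI (hL _ h0).1
    rw [this, zero_mul]
  set A := B * B' * (volume I).toReal with hA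
  have hA0 : 0 ≤ A := (norm_nonneg _).trans (hhb 0)
  -- Up to complex conjugation, `S` is the adjoint operator applied to `h = T g`. The argument
  -- bounds `‖h‖²` by `‖g‖ ‖S‖`, and `‖S‖²` by the `TT*` form evaluated at `h`.
  set S : ℝ → ℂ := fun z => ∫ x, conj (h x) * k (x, z) with hS
  have hSm : Measurable S := by
    have : Measurable (fun q : ℝ × ℝ => conj (h q.1) * k q) := by fun_prop
    exact this.stronglyMeasurable.integral_prod_left'.measurable
  have hSb : ∀ z, ‖S z‖ ≤ A * B * (volume I).toReal := by
    intro z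
    refine hbd (fun x => ?_) (fun x hx => (hL _ (right_ne_zero_of_mul hx)).1)
    rw [norm_mul, RCLike.norm_conj]
    exact mul_le_mul (hhb _) (hB _) (norm_nonneg _) hA0
  have hSs : ∀ z, S z ≠ 0 → z ∈ I := by
    intro z hz
    by_contra hzI
    apply hz
    simp only [hS]
    rw [← integral_zero ℝ ℂ]
    congr 1 with x
    have : k (x, z) = 0 := by
      by_contra h0; exact hzI (hL _ h0).2
    rw [this, mul_zero]
  -- first duality step
  have step1 : ∫⁻ x, ‖h x‖ₑ ^ 2 ≤ ∫⁻ z, ‖g z‖ₑ * ‖S z‖ₑ := by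
    have hint : Integrable (fun x => h x * conj (h x)) := by
      refine integrable_of_bounded_of_support (by fun_prop) hIfin (B := A * A) (fun x => ?_)
        (fun x hx => hhs x (left_ne_zero_of_mul hx))
      rw [norm_mul, RCLike.norm_conj]
      exact mul_le_mul (hhb x) (hhb x) (norm_nonneg _) hA0
    rw [norm_sq_enorm_eq hint]
    have hint2 : Integrable (fun q : ℝ × ℝ => conj (h q.1) * (k q * g q.2)) (volume.prod volume) := by
      refine integrable_of_bounded_of_support (by fun_prop) (s := I ×ˢ I) hIIfin (B := A * (B * B'))
        (fun q => ?_) (fun q hq => hL q (left_ne_zero_of_mul (right_ne_zero_of_mul hq)))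
      rw [norm_mul, norm_mul, RCLike.norm_conj]
      exact mul_le_mul (hhb _) (mul_le_mul (hB _) (hB' _) (norm_nonneg _) hB0) (by positivity) hA0
    have e : ∫ x, h x * conj (h x) = ∫ z, g z * S z := by
      calc ∫ x, h x * conj (h x) = ∫ x, ∫ z, conj (h x) * (k (x, z) * g z) := by
            congr 1 with x
            rw [integral_const_mul, mul_comm]
        _ = ∫ z, ∫ x, conj (h x) * (k (x, z) * g z) := integral_integral_swap hint2
        _ = ∫ z, g z * S z := by
            congr 1 with z
            rw [hS, ← integral_const_mul]
            congr 1 with x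
            ring
    rw [e]
    refine (enorm_integral_le_lintegral_enorm _).trans (le_of_eq ?_)
    simp_rw [enorm_mul]
  -- second step
  have step2 : ∫⁻ z, ‖S z‖ₑ ^ 2 ≤ ∫⁻ x, ∫⁻ x', ‖h x‖ₑ * ‖h x'‖ₑ * ‖∫ z, k (x, z) * conj (k (x', z))‖ₑ := by
    have hint : Integrable (fun z => S z * conj (S z)) := by
      refine integrable_of_bounded_of_support (by fun_prop) hIfin
        (B := (A * B * (volume I).toReal) * (A * B * (volume I).toReal)) (fun x => ?_)
        (fun x hx => hSs x (left_ne_zero_of_mul hx))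
      rw [norm_mul, RCLike.norm_conj]
      exact mul_le_mul (hSb x) (hSb x) (norm_nonneg _) (by positivity)
    rw [norm_sq_enorm_eq hint]
    set F : ℝ → ℝ × ℝ → ℂ := fun z q => (conj (h q.1) * k (q.1, z)) * (h q.2 * conj (k (q.2, z))) with hF
    have hint2 : Integrable (Function.uncurry F) (volume.prod (volume.prod volume)) := by
      refine integrable_of_bounded_of_support (s := I ×ˢ (I ×ˢ I)) ?_ ?_ (B := (A * B) * (A * B))
        (fun q => ?_) (fun q hq => ?_)
      · simp only [hF, Function.uncurry_def]; fun_prop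
      · rw [Measure.prod_prod]; exact ENNReal.mul_ne_top hIfin hIIfin
      · simp only [hF, Function.uncurry_def]
        rw [norm_mul, norm_mul, norm_mul, RCLike.norm_conj, RCLike.norm_conj]
        exact mul_le_mul (mul_le_mul (hhb _) (hB _) (norm_nonneg _) hA0)
          (mul_le_mul (hhb _) (hB _) (norm_nonneg _) hA0) (by positivity) (by positivity)
      · simp only [hF, Function.uncurry_def] at hq
        have h1 := hL _ (right_ne_zero_of_mul (left_ne_zero_of_mul hq))
        have h2 := hhs _ (left_ne_zero_of_mul (right_ne_zero_of_mul hq))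
        exact ⟨h1.2, h1.1, h2⟩
    have e : ∫ z, S z * conj (S z) = ∫ q : ℝ × ℝ, conj (h q.1) * h q.2 * ∫ z, k (q.1, z) * conj (k (q.2, z)) := by
      calc ∫ z, S z * conj (S z) = ∫ z, ∫ q, F z q := by
            congr 1 with z
            rw [Measure.volume_eq_prod]
            simp only [hF, hS]
            rw [integral_prod_mul (fun x => conj (h x) * k (x, z)) (fun x => h x * conj (k (x, z))), ← integral_conj]
            simp
        _ = ∫ q, ∫ z, F z q := integral_integral_swap hint2
        _ = _ := by
            congr 1 with q
            rw [← integral_const_mul]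
            congr 1 with z
            simp only [hF]; ring
    rw [e]
    refine (enorm_integral_le_lintegral_enorm _).trans ?_
    rw [Measure.volume_eq_prod]
    refine (lintegral_prod_le _).trans (le_of_eq ?_)
    simp_rw [enorm_mul]
    simp
  -- The kernel bound has one term with the scale of `x` and one with the scale of `x'`. After
  -- exchanging the variables both give the same quantity, in which the inner integral is dominated
  -- by the maximal function of `h`.
  have step3 : ∫⁻ x, ∫⁻ x', ‖h x‖ₑ * ‖h x'‖ₑ * ‖∫ z, k (x, z) * conj (k (x', z))‖ₑ ≤
      ENNReal.ofReal D * (2 * (C₁ * ∫⁻ x, ‖h x‖ₑ * hlMax (fun y => ‖h y‖ₑ) x)) := by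
    set f : ℝ → ℝ → ℝ≥0∞ := fun x x' => ‖h x‖ₑ * (ENNReal.ofReal (hlKernel (s x) (x - x')) * ‖h x'‖ₑ) with hf
    have hkm : Measurable (fun q : ℝ × ℝ => hlKernel (s q.1) (q.1 - q.2)) := by
      unfold hlKernel; fun_prop
    have hfm : Measurable (Function.uncurry f) := by
      simp only [hf, Function.uncurry_def]; fun_prop
    have hA1 : ∫⁻ x, ∫⁻ x', f x x' ≤ C₁ * ∫⁻ x, ‖h x‖ₑ * hlMax (fun y => ‖h y‖ₑ) x := by
      rw [← lintegral_const_mul' _ _ ENNReal.coe_ne_top]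
      refine lintegral_mono fun x => ?_
      simp only [hf]
      rw [lintegral_const_mul' _ _ enorm_ne_top, mul_left_comm]
      refine mul_le_mul_right ?_ _
      refine le_trans (le_of_eq ?_) (hC₁ (s x) (hs x) (fun y => ‖h y‖ₑ) (by fun_prop) x)
      rw [← lintegral_sub_left_eq_self _ x]
      simp
    have hswap : ∫⁻ x, ∫⁻ x', f x' x = ∫⁻ x, ∫⁻ x', f x x' :=
      (lintegral_lintegral_swap hfm.aemeasurable).symm
    calc _ ≤ ∫⁻ x, ∫⁻ x', ENNReal.ofReal D * (f x x' + f x' x) := by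
          refine lintegral_mono fun x => lintegral_mono_ae ?_
          have : ∀ᵐ x' : ℝ, x' ≠ x := by simp [ae_iff]
          filter_upwards [this] with x' hx'
          have h1 : ‖∫ z, k (x, z) * conj (k (x', z))‖ₑ ≤ ENNReal.ofReal D *
              (ENNReal.ofReal (hlKernel (s x) (x - x')) + ENNReal.ofReal (hlKernel (s x') (x' - x))) := by
            have hnn : ∀ t w : ℝ, 0 ≤ hlKernel t w := fun t w => by unfold hlKernel; positivity
            rw [← ENNReal.ofReal_add (hnn _ _) (hnn _ _), ← ENNReal.ofReal_mul hD, ← ofReal_norm]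
            exact ENNReal.ofReal_le_ofReal (hK x x' hx'.symm)
          refine (mul_le_mul_right h1 _).trans (le_of_eq ?_)
          simp only [hf]; ring
      _ = ENNReal.ofReal D * ((∫⁻ x, ∫⁻ x', f x x') + ∫⁻ x, ∫⁻ x', f x' x) := by
          simp_rw [lintegral_const_mul' _ _ ENNReal.ofReal_ne_top]
          congr 1
          rw [← lintegral_add_left (f := fun x => ∫⁻ x', f x x') hfm.lintegral_prod_right']
          refine lintegral_congr fun x => ?_
          exact lintegral_add_left (hfm.of_uncurry_left (x := x)) _
      _ ≤ _ := by
          rw [hswap, ← two_mul]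
          gcongr
  set H := ∫⁻ x, ‖h x‖ₑ ^ 2 with hH
  have step4 : ∫⁻ x, ‖h x‖ₑ * hlMax (fun y => ‖h y‖ₑ) x ≤ (1 + C₂) * H := by
    have hMm : Measurable (hlMax fun y => ‖h y‖ₑ) := measurable_hlMax (by fun_prop)
    calc _ ≤ ∫⁻ x, (‖h x‖ₑ ^ 2 + hlMax (fun y => ‖h y‖ₑ) x ^ 2) := by
          refine lintegral_mono fun x => ?_
          have : ∀ a b : ℝ≥0∞, a * b ≤ a ^ 2 + b ^ 2 := by
            intro a b
            rcases le_total a b with hab | hab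
            · exact (mul_le_mul_left hab b).trans (by rw [← pow_two]; exact le_add_self)
            · exact (mul_le_mul_right hab a).trans (by rw [← pow_two]; exact le_self_add)
          exact this _ _
      _ = H + ∫⁻ x, hlMax (fun y => ‖h y‖ₑ) x ^ 2 := lintegral_add_left (by fun_prop) _
      _ ≤ H + C₂ * H := by
          gcongr
          have := hC₂ (fun y => ‖h y‖ₑ) (by fun_prop)
          simpa only [ENNReal.rpow_two] using this
      _ = _ := by ring
  -- Finiteness permits the cancellation of one factor `H` at the end; this is where boundedness and
  -- compact support of the kernel matter, and the resulting constant depends on neither.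
  have hHfin : H ≠ ⊤ := by
    have hint : Integrable (fun x => h x * conj (h x)) := by
      refine integrable_of_bounded_of_support (by fun_prop) hIfin (B := A * A) (fun x => ?_)
        (fun x hx => hhs x (left_ne_zero_of_mul hx))
      rw [norm_mul, RCLike.norm_conj]
      exact mul_le_mul (hhb x) (hhb x) (norm_nonneg _) hA0
    rw [hH, norm_sq_enorm_eq hint]
    exact enorm_ne_top
  have hfinal : H * H ≤ ((2 * C₁ * (1 + C₂) : ℝ≥0) * ENNReal.ofReal D * ∫⁻ z, ‖g z‖ₑ ^ 2) * H := by
    calc H * H = H ^ 2 := (pow_two H).symm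
      _ ≤ (∫⁻ z, ‖g z‖ₑ * ‖S z‖ₑ) ^ 2 := pow_le_pow_left' step1 2
      _ ≤ (∫⁻ z, ‖g z‖ₑ ^ 2) * ∫⁻ z, ‖S z‖ₑ ^ 2 := lintegral_mul_sq_le (by fun_prop) (by fun_prop)
      _ ≤ (∫⁻ z, ‖g z‖ₑ ^ 2) * (ENNReal.ofReal D * (2 * (C₁ * ((1 + C₂) * H)))) := by
          gcongr
          exact step2.trans (step3.trans (by gcongr))
      _ = _ := by push_cast; ring
  rcases eq_or_ne H 0 with h0 | h0
  · rw [h0]; exact zero_le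
  · exact (ENNReal.mul_le_mul_iff_left h0 hHfin).1 hfinal

end TTStar

end

noncomputable section

/-! ### One-dimensional oscillatory integrals with measurable scale and frequency. -/

section Chirp

open scoped ComplexConjugate

/-- A `C¹` weight on `[1/2, 1]` with explicit bounds. -/
structure IsAmplitude (ρ ρ' : ℝ → ℝ) : Prop where
  measurable : Measurable ρ
  hasDerivAt : ∀ τ ∈ Set.Icc (1 / 2 : ℝ) 1, HasDerivAt ρ (ρ' τ) τ
  continuousOn : ContinuousOn ρ' (Set.Icc (1 / 2 : ℝ) 1)
  abs_le : ∀ τ ∈ Set.Icc (1 / 2 : ℝ) 1, |ρ τ| ≤ 2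
  abs_deriv_le : ∀ τ ∈ Set.Icc (1 / 2 : ℝ) 1, |ρ' τ| ≤ 4

lemma isAmplitude_one : IsAmplitude (fun _ => 1) (fun _ => 0) where
  measurable := measurable_const
  hasDerivAt _ _ := hasDerivAt_const _ _
  continuousOn := continuousOn_const
  abs_le _ _ := by norm_num
  abs_deriv_le _ _ := by norm_num

lemma isAmplitude_inv : IsAmplitude (fun τ => τ⁻¹) (fun τ => -(τ ^ 2)⁻¹) where
  measurable := measurable_inv
  hasDerivAt τ hτ := hasDerivAt_inv (by linarith [hτ.1] : (0 : ℝ) < τ).ne'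
  continuousOn := by
    refine ContinuousOn.neg (ContinuousOn.inv₀ (by fun_prop) fun τ hτ => ?_)
    have : (0 : ℝ) < τ := by linarith [hτ.1]
    positivity
  abs_le τ hτ := by
    have : (0 : ℝ) < τ := by linarith [hτ.1]
    rw [abs_of_pos (by positivity), inv_le_comm₀ this two_pos]; linarith [hτ.1]
  abs_deriv_le τ hτ := by
    have : (0 : ℝ) < τ := by linarith [hτ.1]
    rw [abs_neg, abs_of_pos (by positivity), inv_le_comm₀ (by positivity) (by norm_num)]
    nlinarith [hτ.1]

/-- The kernel of a single-scale quadratic oscillatory integral. -/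
def chirp (ρ : ℝ → ℝ) (r l w : ℝ) : ℂ :=
  (Set.Ioc (1 / 2 : ℝ) 1).indicator
    (fun τ => ((ρ τ / |r| : ℝ) : ℂ) * Complex.exp (Complex.I * ((l * τ ^ 2 : ℝ) : ℂ))) (w / r)

lemma conj_cexp_I_mul_ofReal (a : ℝ) :
    conj (Complex.exp (Complex.I * (a : ℂ))) = Complex.exp (Complex.I * ((-a : ℝ) : ℂ)) := by
  rw [← Complex.exp_conj]; simp

/-- With `z = x - rτ`, the second chirp is evaluated at `θ + κτ`, where `κ = r/r' ∈ (0, 1]` and `θ =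
(x' - x)/r'`. The product has a quadratic phase with coefficients `α = l - l'κ²` and `β = -2l'κθ`.
These cannot both be small: if `|α| < Λ/2` then `|l'|κ² ≥ Λ/2`, whence `|β| ≥ Λ|θ|`. Van der Corput
gives decay `(Λ|θ|)^{-1/2}`, and `|r'|⁻¹|θ|^{-1/2}` is the value of `hlKernel` because `|θ| ≤ 1` on
the support. Only the frequency attached to the smaller scale needs a lower bound. -/
lemma norm_integral_chirp_mul_conj_le {ρ ρ' : ℝ → ℝ} (hρ : IsAmplitude ρ ρ') {r r' l l' Λ x x' : ℝ}
    (hrr : 0 < r * r') (hle : |r| ≤ |r'|) (hΛ : 0 < Λ) (hl : Λ ≤ |l|) (hx : x ≠ x') :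
    ‖∫ z, chirp ρ r l (x - z) * conj (chirp ρ r' l' (x' - z))‖ ≤
      1000 / √Λ * hlKernel |r'| (x' - x) := by
  have hr : r ≠ 0 := left_ne_zero_of_mul hrr.ne'
  have hr' : r' ≠ 0 := right_ne_zero_of_mul hrr.ne'
  have har : 0 < |r| := abs_pos.2 hr
  have har' : 0 < |r'| := abs_pos.2 hr'
  set κ := r / r' with hκ
  have hκ0 : 0 < κ := by
    rw [hκ, ← mul_div_mul_right _ _ hr']
    exact div_pos hrr (mul_self_pos.2 hr')
  have hκ1 : κ ≤ 1 := by
    rw [← abs_of_pos hκ0, hκ, abs_div, div_le_one har']; exact hle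
  set θ := (x' - x) / r' with hθ
  set α := l - l' * κ ^ 2 with hα
  set β := -(2 * l' * κ * θ) with hβ
  -- The interval `(a, b]` is the set of `τ` for which both `τ` and `θ + κτ` lie in `(1/2, 1]`.
  set a := max (1 / 2) ((1 / 2 - θ) / κ) with ha
  set b := min 1 ((1 - θ) / κ) with hb
  have hRHS : 0 ≤ 1000 / √Λ * hlKernel |r'| (x' - x) := by unfold hlKernel; positivity
  have hmem : ∀ τ, τ ∈ Set.Ioc a b ↔ τ ∈ Set.Ioc (1 / 2 : ℝ) 1 ∧ θ + κ * τ ∈ Set.Ioc (1 / 2 : ℝ) 1 := by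
    intro τ
    simp only [Set.mem_Ioc, ha, hb, max_lt_iff, le_min_iff, div_lt_iff₀ hκ0, le_div_iff₀ hκ0]
    constructor
    · rintro ⟨⟨h1, h2⟩, h3, h4⟩; exact ⟨⟨h1, h3⟩, by linarith, by linarith⟩
    · rintro ⟨⟨h1, h2⟩, h3, h4⟩; exact ⟨⟨h1, by linarith⟩, h2, by linarith⟩
  set c₀ : ℂ := (((|r| * |r'|)⁻¹ : ℝ) : ℂ) * Complex.exp (Complex.I * ((-(l' * θ ^ 2) : ℝ) : ℂ)) with hc₀
  set A : ℝ → ℝ := fun τ => ρ τ * ρ (θ + κ * τ) with hA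
  have hfun : ∀ τ, chirp ρ r l (x - (x - r * τ)) * conj (chirp ρ r' l' (x' - (x - r * τ))) =
      (Set.Ioc a b).indicator (fun τ => c₀ * ((A τ : ℂ) * Complex.exp (Complex.I * ((α * τ ^ 2 + β * τ : ℝ) : ℂ)))) τ := by
    intro τ
    have e1 : (x - (x - r * τ)) / r = τ := by field_simp; ring
    have e2 : (x' - (x - r * τ)) / r' = θ + κ * τ := by rw [hθ, hκ]; field_simp; ring
    unfold chirp
    rw [e1, e2]
    by_cases h : τ ∈ Set.Ioc a b
    · have h' := (hmem τ).1 h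
      rw [Set.indicator_of_mem h, Set.indicator_of_mem h'.1, Set.indicator_of_mem h'.2, map_mul,
        conj_cexp_I_mul_ofReal, Complex.conj_ofReal, hc₀, hA]
      have e3 : Complex.exp (Complex.I * ((l * τ ^ 2 : ℝ) : ℂ)) *
          Complex.exp (Complex.I * ((-(l' * (θ + κ * τ) ^ 2) : ℝ) : ℂ)) =
          Complex.exp (Complex.I * ((-(l' * θ ^ 2) : ℝ) : ℂ)) *
          Complex.exp (Complex.I * ((α * τ ^ 2 + β * τ : ℝ) : ℂ)) := by
        rw [← Complex.exp_add, ← Complex.exp_add, ← mul_add, ← mul_add, ← Complex.ofReal_add, ← Complex.ofReal_add]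
        congr 3
        rw [hα, hβ]; ring
      calc _ = ((ρ τ / |r| : ℝ) : ℂ) * ((ρ (θ + κ * τ) / |r'| : ℝ) : ℂ) *
            (Complex.exp (Complex.I * ((l * τ ^ 2 : ℝ) : ℂ)) *
              Complex.exp (Complex.I * ((-(l' * (θ + κ * τ) ^ 2) : ℝ) : ℂ))) := by ring
        _ = _ := by
          rw [e3]; push_cast; field_simp
    · rw [Set.indicator_of_notMem h]
      by_cases h1 : τ ∈ Set.Ioc (1 / 2 : ℝ) 1
      · have h2 : θ + κ * τ ∉ Set.Ioc (1 / 2 : ℝ) 1 := fun h2 => h ((hmem τ).2 ⟨h1, h2⟩)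
        rw [Set.indicator_of_notMem h2]; simp
      · rw [Set.indicator_of_notMem h1]; simp
  have hcv : ∫ z, chirp ρ r l (x - z) * conj (chirp ρ r' l' (x' - z)) =
      |r| • ∫ τ in Set.Ioc a b, c₀ * ((A τ : ℂ) * Complex.exp (Complex.I * ((α * τ ^ 2 + β * τ : ℝ) : ℂ))) := by
    rw [← integral_sub_left_eq_self _ _ x, ← integral_indicator measurableSet_Ioc]
    simp_rw [← hfun]
    have := Measure.integral_comp_mul_left
      (fun w => chirp ρ r l (x - (x - w)) * conj (chirp ρ r' l' (x' - (x - w)))) r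
    rw [this, smul_smul, abs_inv, mul_inv_cancel₀ har.ne', one_smul]
  rw [hcv]
  rcases le_or_gt b a with hba | hab
  · rw [Set.Ioc_eq_empty (not_lt.2 hba)]; simpa using hRHS
  have hcl : ∀ τ ∈ Set.Icc a b, τ ∈ Set.Icc (1 / 2 : ℝ) 1 ∧ θ + κ * τ ∈ Set.Icc (1 / 2 : ℝ) 1 := by
    intro τ hτ
    simp only [Set.mem_Icc, ha, hb, max_le_iff, le_min_iff, div_le_iff₀ hκ0, le_div_iff₀ hκ0] at hτ ⊢
    obtain ⟨⟨h1, h2⟩, h3, h4⟩ := hτ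
    exact ⟨⟨h1, h3⟩, by linarith, by linarith⟩
  have hθ1 : |θ| ≤ 1 := by
    obtain ⟨⟨h1, h2⟩, h3, h4⟩ := hcl b ⟨hab.le, le_rfl⟩
    rw [abs_le]; constructor <;> nlinarith
  have hθ0 : 0 < |θ| := abs_pos.2 (div_ne_zero (sub_ne_zero.2 hx.symm) hr')
  rw [← intervalIntegral.integral_of_le hab.le, intervalIntegral.integral_const_mul]
  set N := |α| + |β| with hN
  have hNlow : Λ * |θ| / 2 ≤ N := by
    by_cases hcase : Λ / 2 ≤ |α|
    · have := abs_nonneg β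
      nlinarith
    · push Not at hcase
      have h1 : Λ / 2 ≤ |l'| * κ ^ 2 := by
        have : |l| ≤ |α| + |l' * κ ^ 2| := by
          have := abs_add_le α (l' * κ ^ 2)
          rwa [hα, sub_add_cancel] at this
        rw [abs_mul, abs_of_nonneg (sq_nonneg κ)] at this
        linarith
      have h2 : |l'| * κ ^ 2 ≤ |l'| * κ := by
        have := abs_nonneg l'
        nlinarith [mul_nonneg this hκ0.le]
      have h3 : |β| = 2 * (|l'| * κ) * |θ| := by
        rw [hβ, abs_neg, abs_mul, abs_mul, abs_mul, abs_two, abs_of_pos hκ0]; ring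
      have := abs_nonneg α
      nlinarith
  -- The derivative of `ρ(τ) ρ(θ + κτ)` is at most `4·2 + 2·4·κ ≤ 16`, which also majorizes the
  -- product itself.
  have hvdc := norm_integral_amplitude_mul_cexp_le (α := α) (β := β) (a := a) (b := b) (V := 16) (A := A)
    (A' := fun τ => ρ' τ * ρ (θ + κ * τ) + ρ τ * (ρ' (θ + κ * τ) * κ))
    (le_trans (by norm_num) (le_max_left _ _)) hab.le (min_le_left _ _) (by
      intro τ hτ
      have h1 : HasDerivAt (fun τ => θ + κ * τ) κ τ := by
        simpa using ((hasDerivAt_id τ).const_mul κ).const_add θ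
      exact (hρ.hasDerivAt τ (hcl τ hτ).1).mul ((hρ.hasDerivAt _ (hcl τ hτ).2).comp τ h1)) (by
      have hc1 : ContinuousOn ρ (Set.Icc (1 / 2 : ℝ) 1) := fun τ hτ =>
        (hρ.hasDerivAt τ hτ).continuousAt.continuousWithinAt
      have hm1 : Set.MapsTo (fun τ : ℝ => τ) (Set.Icc a b) (Set.Icc (1 / 2 : ℝ) 1) := fun τ hτ => (hcl τ hτ).1
      have hm2 : Set.MapsTo (fun τ : ℝ => θ + κ * τ) (Set.Icc a b) (Set.Icc (1 / 2 : ℝ) 1) := fun τ hτ => (hcl τ hτ).2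
      have hcc : ContinuousOn (fun τ : ℝ => θ + κ * τ) (Set.Icc a b) := by fun_prop
      have k1 := hρ.continuousOn.comp continuousOn_id hm1
      have k2 := hc1.comp continuousOn_id hm1
      have k3 := hρ.continuousOn.comp hcc hm2
      have k4 := hc1.comp hcc hm2
      exact (k1.mul k4).add (k2.mul (k3.mul continuousOn_const))) (by
      intro τ hτ
      rw [hA, abs_mul]
      have h1 := hρ.abs_le _ (hcl τ hτ).1
      have h2 := hρ.abs_le _ (hcl τ hτ).2
      nlinarith [abs_nonneg (ρ τ), abs_nonneg (ρ (θ + κ * τ))]) (by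
      intro τ hτ
      have h1 := hρ.abs_le _ (hcl τ hτ).1
      have h2 := hρ.abs_le _ (hcl τ hτ).2
      have h3 := hρ.abs_deriv_le _ (hcl τ hτ).1
      have h4 := hρ.abs_deriv_le _ (hcl τ hτ).2
      have h5 : |ρ' τ * ρ (θ + κ * τ)| ≤ 4 * 2 := by
        rw [abs_mul]; exact mul_le_mul h3 h2 (abs_nonneg _) (by norm_num)
      have h6 : |ρ τ * (ρ' (θ + κ * τ) * κ)| ≤ 2 * (4 * 1) := by
        rw [abs_mul, abs_mul, abs_of_pos hκ0]
        exact mul_le_mul h1 (mul_le_mul h4 hκ1 hκ0.le (by norm_num)) (by positivity) (by norm_num)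
      calc _ ≤ 4 * 2 + 2 * (4 * 1) := (abs_add_le _ _).trans (add_le_add h5 h6)
        _ = 16 := by norm_num)
  set J := ∫ τ in a..b, (A τ : ℂ) * Complex.exp (Complex.I * ((α * τ ^ 2 + β * τ : ℝ) : ℂ)) with hJ
  have hnorm : ‖|r| • (c₀ * J)‖ = |r'|⁻¹ * ‖J‖ := by
    rw [norm_smul, norm_mul, hc₀, norm_mul, norm_cexp_I_mul_ofReal, Complex.norm_real, Real.norm_eq_abs, abs_abs,
      mul_one, norm_inv, Real.norm_of_nonneg (by positivity)]
    field_simp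
  rw [hnorm]
  have hker : hlKernel |r'| (x' - x) = |r'|⁻¹ * (√|θ|)⁻¹ := by
    have e1 : |x' - x| / |r'| = |θ| := by rw [hθ, abs_div]
    have e2 : |r'| / |x' - x| = |θ|⁻¹ := by rw [hθ, abs_div, inv_div]
    have e3 : |x' - x|⁻¹ = |r'|⁻¹ * |θ|⁻¹ := by
      rw [← e1]; have : |x' - x| ≠ 0 := abs_ne_zero.2 (sub_ne_zero.2 hx.symm)
      field_simp
    unfold hlKernel
    rw [e1, e2, e3, min_eq_left (Real.sqrt_le_sqrt (hθ1.trans ((one_le_inv₀ hθ0).2 hθ1)))]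
    have h1 : √|θ| * √|θ| = |θ| := Real.mul_self_sqrt hθ0.le
    have h2 : 0 < √|θ| := Real.sqrt_pos.2 hθ0
    rw [mul_assoc]
    congr 1
    nth_rewrite 1 [← h1]
    field_simp
  rw [hker]
  -- From `Λ|θ| ≤ 2N ≤ (9/4) N`; then `40 · 16 · 3/2 = 960 ≤ 1000`.
  have hsq : √Λ * √|θ| ≤ 3 / 2 * √N := by
    rw [← Real.sqrt_mul hΛ.le, show (3 / 2 : ℝ) = √(9 / 4) by
      rw [show (9 / 4 : ℝ) = (3 / 2) ^ 2 by norm_num, Real.sqrt_sq (by norm_num)], ← Real.sqrt_mul (by norm_num)]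
    have hN0 : 0 ≤ N := by positivity
    exact Real.sqrt_le_sqrt (by linarith)
  have hsΛ : 0 < √Λ := Real.sqrt_pos.2 hΛ
  have hsθ : 0 < √|θ| := Real.sqrt_pos.2 hθ0
  have hJ0 := norm_nonneg J
  have : ‖J‖ ≤ 1000 / √Λ * (√|θ|)⁻¹ := by
    rw [div_mul_eq_mul_div, ← div_eq_mul_inv, div_div, le_div_iff₀ (by positivity), mul_comm (√|θ|)]
    nlinarith
  calc |r'|⁻¹ * ‖J‖ ≤ |r'|⁻¹ * (1000 / √Λ * (√|θ|)⁻¹) := by gcongr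
    _ = _ := by ring

lemma norm_chirp_le {ρ ρ' : ℝ → ℝ} (hρ : IsAmplitude ρ ρ') (r l w : ℝ) : ‖chirp ρ r l w‖ ≤ 2 / |r| := by
  unfold chirp
  by_cases h : w / r ∈ Set.Ioc (1 / 2 : ℝ) 1
  · rw [Set.indicator_of_mem h, norm_mul, norm_cexp_I_mul_ofReal, mul_one, Complex.norm_real, Real.norm_eq_abs,
      abs_div, abs_abs]
    gcongr
    exact hρ.abs_le _ ⟨h.1.le, h.2⟩
  · rw [Set.indicator_of_notMem h, norm_zero]; positivity

lemma abs_le_of_chirp_ne_zero {ρ : ℝ → ℝ} {r l w : ℝ} (h : chirp ρ r l w ≠ 0) : |w| ≤ |r| := by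
  have h1 : w / r ∈ Set.Ioc (1 / 2 : ℝ) 1 := by
    by_contra h1; exact h (Set.indicator_of_notMem h1 _)
  have hr : r ≠ 0 := by rintro rfl; simp at h1; linarith
  have h2 : |w / r| ≤ 1 := by rw [abs_le]; constructor <;> linarith [h1.1, h1.2]
  rwa [abs_div, div_le_one (abs_pos.2 hr)] at h2

lemma measurable_chirp {ρ : ℝ → ℝ} (hρ : Measurable ρ) {α : Type*} [MeasurableSpace α] {r l w : α → ℝ} (hr : Measurable r)
    (hl : Measurable l) (hw : Measurable w) : Measurable fun a => chirp ρ (r a) (l a) (w a) := by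
  have h1 : MeasurableSet {a | w a / r a ∈ Set.Ioc (1 / 2 : ℝ) 1} := (hw.div hr) measurableSet_Ioc
  have h2 : (fun a => chirp ρ (r a) (l a) (w a)) = {a | w a / r a ∈ Set.Ioc (1 / 2 : ℝ) 1}.indicator
      (fun a => ((ρ (w a / r a) / |r a| : ℝ) : ℂ) * Complex.exp (Complex.I * ((l a * (w a / r a) ^ 2 : ℝ) : ℂ))) := by
    ext a; simp [chirp, Set.indicator]
  rw [h2]
  refine Measurable.indicator ?_ h1
  fun_prop

lemma integral_chirp_mul {ρ : ℝ → ℝ} {r l x : ℝ} (hr : r ≠ 0) (g : ℝ → ℂ) :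
    ∫ z, chirp ρ r l (x - z) * g z =
      ∫ τ in Set.Ioc (1 / 2 : ℝ) 1, (ρ τ : ℂ) * Complex.exp (Complex.I * ((l * τ ^ 2 : ℝ) : ℂ)) * g (x - r * τ) := by
  have har : 0 < |r| := abs_pos.2 hr
  rw [← integral_sub_left_eq_self _ _ x, ← integral_indicator measurableSet_Ioc]
  have := Measure.integral_comp_mul_left (fun w => chirp ρ r l (x - (x - w)) * g (x - w)) r
  have h2 : ∫ w, chirp ρ r l (x - (x - w)) * g (x - w) = |r| • ∫ τ, chirp ρ r l (x - (x - r * τ)) * g (x - r * τ) := by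
    rw [this, smul_smul, abs_inv, mul_inv_cancel₀ har.ne', one_smul]
  rw [h2, ← integral_smul]
  congr 1 with τ
  have e1 : (x - (x - r * τ)) / r = τ := by field_simp; ring
  unfold chirp
  rw [e1]
  by_cases h : τ ∈ Set.Ioc (1 / 2 : ℝ) 1
  · rw [Set.indicator_of_mem h, Set.indicator_of_mem h, Complex.real_smul]
    have : ((|r| : ℝ) : ℂ) ≠ 0 := by exact_mod_cast har.ne'
    push_cast
    field_simp
  · rw [Set.indicator_of_notMem h, Set.indicator_of_notMem h]; simp

/-- The `L²` bound for single-scale oscillatory integrals with measurable scales and frequencies. -/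
lemma exists_lintegral_chirp_sq_le : ∃ C : ℝ≥0, ∀ {ρ ρ' : ℝ → ℝ} (_ : IsAmplitude ρ ρ') {r l : ℝ → ℝ}
    (_ : Measurable r) (_ : Measurable l) {E : Set ℝ} (_ : MeasurableSet E)
    (_ : ∀ x ∈ E, ∀ x' ∈ E, 0 < r x * r x') {Λ : ℝ} (_ : 0 < Λ) (_ : ∀ x ∈ E, Λ ≤ |l x|)
    {g : ℝ → ℂ} (_ : Measurable g) {B : ℝ} (_ : ∀ x, ‖g x‖ ≤ B),
    ∫⁻ x in E, ‖∫ τ in Set.Ioc (1 / 2 : ℝ) 1, (ρ τ : ℂ) * Complex.exp (Complex.I * ((l x * τ ^ 2 : ℝ) : ℂ)) *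
      g (x - r x * τ)‖ₑ ^ 2 ≤ C * ENNReal.ofReal (1 / √Λ) * ∫⁻ z, ‖g z‖ₑ ^ 2 := by
  obtain ⟨C, hC⟩ := exists_lintegral_kernel_sq_le
  refine ⟨C * 1000, ?_⟩
  intro ρ ρ' hρ r l hr hl E hE hrr Λ hΛ hlΛ g hg B hB
  have hr0 : ∀ x ∈ E, r x ≠ 0 := fun x hx => left_ne_zero_of_mul (hrr x hx x hx).ne'
  -- The `TT*` lemma needs a bounded kernel of bounded support. Restricting `x` to sets where `|x|`
  -- and `|r x|` are bounded and `|r x|` is bounded below achieves this with a uniform constant, and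
  -- monotone convergence removes the restriction.
  set En : ℕ → Set ℝ := fun n => E ∩ {x | |x| ≤ n} ∩ ({x | |r x| ≤ n} ∩ {x | 1 ≤ n * |r x|}) with hEn
  have hEnm : ∀ n, MeasurableSet (En n) := fun n =>
    (hE.inter (measurableSet_le measurable_abs measurable_const)).inter
      ((measurableSet_le (by fun_prop) measurable_const).inter (measurableSet_le measurable_const (by fun_prop)))
  have hmono : Monotone En := by
    intro n m hnm x hx
    have hnm' : (n : ℝ) ≤ m := by exact_mod_cast hnm
    have h1 : |x| ≤ n := hx.1.2
    have h2 : |r x| ≤ n := hx.2.1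
    have h3 : 1 ≤ n * |r x| := hx.2.2
    exact ⟨⟨hx.1.1, h1.trans hnm'⟩, h2.trans hnm', h3.trans (by gcongr)⟩
  have hunion : E = ⋃ n, En n := by
    ext x
    constructor
    · intro hx
      obtain ⟨n, hn⟩ := exists_nat_ge (max (max |x| |r x|) (1 / |r x|))
      refine Set.mem_iUnion.2 ⟨n, ⟨hx, ?_⟩, ?_, ?_⟩
      · exact ((le_max_left _ _).trans (le_max_left _ _)).trans hn
      · exact ((le_max_right _ _).trans (le_max_left _ _)).trans hn
      · have := (le_max_right _ _).trans hn
        rwa [div_le_iff₀ (abs_pos.2 (hr0 x hx))] at this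
    · intro hx
      obtain ⟨n, hn⟩ := Set.mem_iUnion.1 hx
      exact hn.1.1
  set G : ℝ → ℝ≥0∞ := fun x => ‖∫ τ in Set.Ioc (1 / 2 : ℝ) 1, (ρ τ : ℂ) *
    Complex.exp (Complex.I * ((l x * τ ^ 2 : ℝ) : ℂ)) * g (x - r x * τ)‖ₑ ^ 2 with hG
  have key : ∀ n, ∫⁻ x in En n, G x ≤ ↑(C * 1000) * ENNReal.ofReal (1 / √Λ) * ∫⁻ z, ‖g z‖ₑ ^ 2 := by
    intro n
    set k : ℝ × ℝ → ℂ := fun q => (En n).indicator (fun x => chirp ρ (r x) (l x) (x - q.2)) q.1 with hk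
    have hkm : Measurable k := by
      have : k = {q : ℝ × ℝ | q.1 ∈ En n}.indicator (fun q => chirp ρ (r q.1) (l q.1) (q.1 - q.2)) := by
        ext q; simp [hk, Set.indicator]
      rw [this]
      exact (measurable_chirp hρ.measurable (by fun_prop) (by fun_prop) (by fun_prop)).indicator
        (measurable_fst (hEnm n))
    have hkB : ∀ q, ‖k q‖ ≤ 2 * n := by
      intro q
      by_cases h : q.1 ∈ En n
      · simp only [hk]
        rw [Set.indicator_of_mem h]
        refine (norm_chirp_le hρ _ _ _).trans ?_
        rw [div_le_iff₀ (abs_pos.2 (hr0 _ h.1.1))]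
        have : 1 ≤ n * |r q.1| := h.2.2
        nlinarith
      · simp only [hk]
        rw [Set.indicator_of_notMem h, norm_zero]; positivity
    have hkS : ∀ q, k q ≠ 0 → q ∈ Set.Icc (-(2 * n : ℝ)) (2 * n) ×ˢ Set.Icc (-(2 * n : ℝ)) (2 * n) := by
      intro q hq
      have h : q.1 ∈ En n := by
        by_contra h; exact hq (Set.indicator_of_notMem h _)
      simp only [hk] at hq
      rw [Set.indicator_of_mem h] at hq
      have h1 := abs_le.1 (abs_le_of_chirp_ne_zero hq)
      have h2 := abs_le.1 (show |q.1| ≤ n from h.1.2)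
      have h3 : |r q.1| ≤ n := h.2.1
      refine ⟨⟨by linarith [h2.1], by linarith [h2.2]⟩, ⟨by linarith [h2.1, h1.2], by linarith [h2.2, h1.1]⟩⟩
    -- The value `1` at `r = 0` only keeps the scale function positive everywhere; such points lie
    -- outside `En n`.
    have hKer : ∀ x x', x ≠ x' → ‖∫ z, k (x, z) * conj (k (x', z))‖ ≤
        1000 / √Λ * (hlKernel (if r x = 0 then 1 else |r x|) (x - x') +
          hlKernel (if r x' = 0 then 1 else |r x'|) (x' - x)) := by
      intro x x' hxx
      have hnn : ∀ t w : ℝ, 0 ≤ hlKernel t w := fun t w => by unfold hlKernel; positivity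
      have hpos : 0 ≤ 1000 / √Λ := by positivity
      by_cases h : x ∈ En n ∧ x' ∈ En n
      · obtain ⟨h1, h2⟩ := h
        simp only [hk, Set.indicator_of_mem h1, Set.indicator_of_mem h2, if_neg (hr0 _ h1.1.1), if_neg (hr0 _ h2.1.1)]
        -- The kernel estimate requires the smaller scale first; the other order follows by complex
        -- conjugation, and this is why both terms appear on the right.
        rcases le_total |r x| |r x'| with hle | hle
        · refine (norm_integral_chirp_mul_conj_le hρ (hrr _ h1.1.1 _ h2.1.1) hle hΛ (hlΛ _ h1.1.1) hxx).trans ?_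
          exact mul_le_mul_of_nonneg_left (le_add_of_nonneg_left (hnn _ _)) hpos
        · have h3 := norm_integral_chirp_mul_conj_le hρ (hrr _ h2.1.1 _ h1.1.1) hle hΛ (l' := l x) (hlΛ _ h2.1.1) hxx.symm
          rw [← RCLike.norm_conj, ← integral_conj] at h3
          simp only [map_mul, Complex.conj_conj] at h3
          simp_rw [mul_comm (conj _) (chirp ρ (r x) _ _)] at h3
          refine h3.trans (mul_le_mul_of_nonneg_left (le_add_of_nonneg_right (hnn _ _)) hpos)
      · have : ∀ z, k (x, z) * conj (k (x', z)) = 0 := by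
          intro z
          rcases not_and_or.1 h with h | h
          · simp [hk, Set.indicator_of_notMem h]
          · simp [hk, Set.indicator_of_notMem h]
        simp_rw [this]
        rw [integral_zero, norm_zero]
        exact mul_nonneg hpos (add_nonneg (hnn _ _) (hnn _ _))
    have hfin := hC hkm hkB hkS (s := fun x => if r x = 0 then 1 else |r x|)
      (Measurable.ite (hr (measurableSet_singleton 0)) measurable_const (by fun_prop))
      (fun x => by
        by_cases h : r x = 0
        · simp [h]
        · simp [h]) (D := 1000 / √Λ) (by positivity) hKer hg hB
    calc ∫⁻ x in En n, G x = ∫⁻ x, ‖∫ z, k (x, z) * g z‖ₑ ^ 2 := by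
          rw [← lintegral_indicator (hEnm n)]
          refine lintegral_congr fun x => ?_
          by_cases h : x ∈ En n
          · simp only [hk, Set.indicator_of_mem h, hG]
            rw [integral_chirp_mul (hr0 _ h.1.1)]
          · simp [hk, Set.indicator_of_notMem h]
      _ ≤ _ := hfin
      _ = _ := by
          rw [show 1000 / √Λ = 1000 * (1 / √Λ) by ring, ENNReal.ofReal_mul (by norm_num)]
          push_cast
          rw [show ENNReal.ofReal 1000 = 1000 by simp]
          ring
  rw [hunion, setLIntegral_iUnion_of_directed _ (hmono.directed_le)]
  exact iSup_le key

end Chirp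

end

noncomputable section

/-! ### Cauchy transforms and vanishing integrals of their powers. -/

section CauchyTransform

/-- Bounded measurable functions with bounded support. -/
structure IsNice {α : Type*} [MeasurableSpace α] [Norm α] (f : α → ℂ) : Prop where
  measurable : Measurable f
  bounded : ∃ B : ℝ, ∀ x, ‖f x‖ ≤ B
  support : ∃ L : ℝ, ∀ x, f x ≠ 0 → ‖x‖ ≤ L

lemma IsNice.integrable {f : ℝ → ℂ} (hf : IsNice f) : Integrable f := by
  obtain ⟨B, hB⟩ := hf.bounded
  obtain ⟨L, hL⟩ := hf.support
  refine integrable_of_bounded_of_support hf.measurable (s := Set.Icc (-L) L) (by simp) hB fun x hx => ?_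
  exact abs_le.1 (hL x hx)

lemma IsNice.indicator {α : Type*} [MeasurableSpace α] [Norm α] {f : α → ℂ} (hf : IsNice f) {s : Set α}
    (hs : MeasurableSet s) : IsNice (s.indicator f) where
  measurable := hf.measurable.indicator hs
  bounded := by
    obtain ⟨B, hB⟩ := hf.bounded
    exact ⟨B, fun x => (norm_indicator_le_norm_self _ _).trans (hB x)⟩
  support := by
    obtain ⟨L, hL⟩ := hf.support
    refine ⟨L, fun x hx => hL x fun h0 => hx ?_⟩
    by_cases h : x ∈ s <;> simp [h, h0]

/-- The Cauchy transform of `f`. -/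
def cauchyTransform (f : ℝ → ℂ) (z : ℂ) : ℂ := ∫ y, f y / (z - y)

lemma sub_ofReal_ne_zero {z : ℂ} (hz : 0 < z.im) (y : ℝ) : z - y ≠ 0 := by
  intro h
  have : (z - y).im = 0 := by rw [h]; rfl
  simp at this
  linarith

lemma im_le_norm_sub_ofReal (z : ℂ) (y : ℝ) : z.im ≤ ‖z - y‖ := by
  have := Complex.abs_im_le_norm (z - y)
  simp at this
  exact (le_abs_self _).trans this

lemma differentiableAt_cauchyTransform {f : ℝ → ℂ} (hf : IsNice f) {z : ℂ} (hz : 0 < z.im) :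
    DifferentiableAt ℂ (cauchyTransform f) z := by
  have hball : ∀ w ∈ Metric.ball z (z.im / 2), z.im / 2 ≤ w.im := by
    intro w hw
    have h1 := (Complex.abs_im_le_norm (w - z)).trans_lt (by rwa [mem_ball_iff_norm] at hw)
    rw [Complex.sub_im, abs_lt] at h1
    linarith [h1.1]
  have hfm := hf.measurable
  have h := hasDerivAt_integral_of_dominated_loc_of_deriv_le (μ := volume) (𝕜 := ℂ)
    (F := fun w y => f y / (w - y)) (F' := fun w y => -f y / (w - y) ^ 2)
    (x₀ := z) (s := Metric.ball z (z.im / 2)) (bound := fun y => ‖f y‖ * (4 / z.im ^ 2))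
    (Metric.ball_mem_nhds z (by positivity))
    (Eventually.of_forall fun w => by
      apply Measurable.aestronglyMeasurable; fun_prop)
    (by
      refine Integrable.mono (hf.integrable.norm.mul_const (1 / z.im)) ?_ (Eventually.of_forall fun y => ?_)
      · apply Measurable.aestronglyMeasurable; fun_prop
      · rw [norm_div, norm_mul, norm_norm, div_eq_mul_one_div, Real.norm_of_nonneg (by positivity : 0 ≤ 1 / z.im)]
        gcongr
        exact im_le_norm_sub_ofReal z y)
    (by apply Measurable.aestronglyMeasurable; fun_prop)
    (Eventually.of_forall fun y w hw => by
      rw [norm_div, norm_neg, norm_pow, div_eq_mul_one_div]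
      have h1 := hball w hw
      have h2 := im_le_norm_sub_ofReal w y
      have : 4 / z.im ^ 2 = 1 / (z.im / 2) ^ 2 := by field_simp; norm_num
      rw [this]
      gcongr
      linarith)
    (hf.integrable.norm.mul_const _)
    (Eventually.of_forall fun y w hw => by
      have hw0 : w - y ≠ 0 := sub_ofReal_ne_zero (lt_of_lt_of_le (by positivity) (hball w hw)) y
      have h1 : HasDerivAt (fun w : ℂ => w - y) 1 w := (hasDerivAt_id w).sub_const _
      have h2 := (h1.inv hw0).const_mul (f y)
      simp only [div_eq_mul_inv]
      refine h2.congr_deriv ?_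
      field_simp)
  exact h.2.differentiableAt

/-- For `y` in the bounded support of `f` and `Im z ≥ s`, the distance `|z - y|` is comparable to
`√(1 + |z|²)`, with a constant depending on `s` and the support. -/
lemma exists_norm_cauchyTransform_le {f : ℝ → ℂ} (hf : IsNice f) {s : ℝ} (hs : 0 < s) :
    ∃ A : ℝ, 0 ≤ A ∧ ∀ z : ℂ, s ≤ z.im → ‖cauchyTransform f z‖ ≤ A / √(1 + z.re ^ 2 + z.im ^ 2) := by
  obtain ⟨M, hM⟩ := hf.support
  set K := √(2 + (1 + 2 * M ^ 2) / s ^ 2) with hK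
  refine ⟨(∫ y, ‖f y‖) * K, by positivity, fun z hz => ?_⟩
  have hpt : ∀ y, ‖f y / (z - y)‖ ≤ ‖f y‖ * (K / √(1 + z.re ^ 2 + z.im ^ 2)) := by
    intro y
    by_cases h0 : f y = 0
    · simp [h0]
    have hy : y ^ 2 ≤ M ^ 2 := by
      have := hM y h0
      rw [Real.norm_eq_abs] at this
      exact sq_le_sq' (by linarith [neg_abs_le y]) ((le_abs_self y).trans this)
    rw [norm_div, div_eq_mul_one_div]
    refine mul_le_mul_of_nonneg_left ?_ (norm_nonneg _)
    have him : 0 < z.im := lt_of_lt_of_le hs hz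
    have hpos : 0 < ‖z - y‖ := lt_of_lt_of_le him (im_le_norm_sub_ofReal z y)
    rw [div_le_div_iff₀ hpos (by positivity), one_mul, hK]
    have hnorm : ‖z - y‖ = √((z.re - y) ^ 2 + z.im ^ 2) := by
      rw [Complex.norm_eq_sqrt_sq_add_sq]; simp
    rw [hnorm, ← Real.sqrt_mul (by positivity)]
    apply Real.sqrt_le_sqrt
    have h1 : 1 + 2 * M ^ 2 ≤ (1 + 2 * M ^ 2) / s ^ 2 * ((z.re - y) ^ 2 + z.im ^ 2) := by
      rw [div_mul_eq_mul_div, le_div_iff₀ (by positivity)]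
      have : s ^ 2 ≤ (z.re - y) ^ 2 + z.im ^ 2 := by nlinarith [sq_nonneg (z.re - y)]
      gcongr
    nlinarith [sq_nonneg (z.re - 2 * y), sq_nonneg z.im, h1]
  refine (norm_integral_le_of_norm_le (hf.integrable.norm.mul_const _) (Eventually.of_forall hpt)).trans (le_of_eq ?_)
  rw [integral_mul_const]; ring

lemma continuous_cauchyTransform_line {f : ℝ → ℂ} (hf : IsNice f) {s : ℝ} (hs : 0 < s) :
    Continuous fun x : ℝ => cauchyTransform f (x + s * Complex.I) := by
  rw [continuous_iff_continuousAt]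
  intro x
  have h := (differentiableAt_cauchyTransform hf (z := x + s * Complex.I) (by simpa using hs)).continuousAt
  exact ContinuousAt.comp (f := fun x : ℝ => (x : ℂ) + s * Complex.I) h (by fun_prop)

lemma integrable_cauchyTransform_pow {f : ℝ → ℂ} (hf : IsNice f) {s : ℝ} (hs : 0 < s) {m : ℕ} (hm : 2 ≤ m) :
    Integrable fun x : ℝ => cauchyTransform f (x + s * Complex.I) ^ m := by
  obtain ⟨A, hA0, hA⟩ := exists_norm_cauchyTransform_le hf hs
  refine (integrable_inv_one_add_sq.const_mul (A ^ m)).mono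
    ((continuous_cauchyTransform_line hf hs).pow m).aestronglyMeasurable (Eventually.of_forall fun x => ?_)
  have h1 := hA (x + s * Complex.I) (by simp)
  simp only [Complex.add_re, Complex.ofReal_re, Complex.mul_re, Complex.I_re, mul_zero, Complex.ofReal_im,
    Complex.I_im, mul_one, sub_self, add_zero, Complex.add_im, Complex.mul_im, zero_add] at h1
  have h2 : ‖cauchyTransform f (x + s * Complex.I)‖ ≤ A / √(1 + x ^ 2) := by
    refine h1.trans ?_
    have : √(1 + x ^ 2) ≤ √(1 + x ^ 2 + s ^ 2) := Real.sqrt_le_sqrt (by nlinarith)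
    gcongr
  rw [norm_pow, norm_mul, norm_pow, Real.norm_of_nonneg hA0, Real.norm_of_nonneg (by positivity)]
  calc _ ≤ (A / √(1 + x ^ 2)) ^ m := by gcongr
    _ = A ^ m * ((√(1 + x ^ 2))⁻¹) ^ m := by rw [div_eq_mul_inv, mul_pow]
    _ ≤ A ^ m * ((√(1 + x ^ 2))⁻¹) ^ 2 := by
        have : (√(1 + x ^ 2))⁻¹ ≤ 1 := by
          apply inv_le_one_of_one_le₀
          rw [Real.one_le_sqrt]; nlinarith [sq_nonneg x]
        gcongr ?_ * ?_
        exact pow_le_pow_of_le_one (by positivity) this hm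
    _ = _ := by rw [inv_pow, Real.sq_sqrt (by positivity)]

/-- The `m`-th power is holomorphic in the upper half-plane and `O(|z|^{-2})`. Cauchy's theorem on a
rectangle of width `2X` and height `X` above the line moves the integral to the other three sides,
of total length `4X`, where the integrand is `O(X^{-2})`. -/
lemma integral_cauchyTransform_pow_eq_zero {f : ℝ → ℂ} (hf : IsNice f) {s : ℝ} (hs : 0 < s) {m : ℕ} (hm : 2 ≤ m) :
    ∫ x : ℝ, cauchyTransform f (x + s * Complex.I) ^ m = 0 := by
  obtain ⟨A, hA0, hA⟩ := exists_norm_cauchyTransform_le hf hs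
  have hlim := intervalIntegral_tendsto_integral (integrable_cauchyTransform_pow hf hs hm)
    tendsto_neg_atTop_atBot (tendsto_id (α := ℝ))
  refine tendsto_nhds_unique hlim ?_
  have hbound : ∀ X : ℝ, 1 ≤ X → ‖∫ x in (-X)..X, cauchyTransform f (x + s * Complex.I) ^ m‖ ≤ 4 * A ^ m / X := by
    intro X hX
    have hX0 : 0 < X := by linarith
    have hptw : ∀ z : ℂ, s ≤ z.im → X ≤ |z.re| ∨ X ≤ |z.im| → ‖cauchyTransform f z ^ m‖ ≤ A ^ m / X ^ 2 := by
      intro z hz hor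
      have h1 : X ≤ √(1 + z.re ^ 2 + z.im ^ 2) := by
        apply Real.le_sqrt_of_sq_le
        rcases hor with h | h
        · rw [← sq_abs z.re]; nlinarith [sq_nonneg z.im]
        · rw [← sq_abs z.im]; nlinarith [sq_nonneg z.re]
      rw [norm_pow]
      calc _ ≤ (A / X) ^ m := by
            gcongr
            exact (hA z hz).trans (by gcongr)
        _ = A ^ m / X ^ m := div_pow _ _ _
        _ ≤ A ^ m / X ^ 2 := by gcongr
    have hrect := Complex.integral_boundary_rect_eq_zero_of_differentiableOn (fun z => cauchyTransform f z ^ m)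
      (⟨-X, s⟩ : ℂ) (⟨X, s + X⟩ : ℂ) (by
        intro z hz
        have him : z.im ∈ Set.uIcc s (s + X) := hz.2
        rw [Set.uIcc_of_le (by linarith)] at him
        exact ((differentiableAt_cauchyTransform hf (by linarith [him.1])).pow m).differentiableWithinAt)
    simp only at hrect
    have hT : ‖∫ x in (-X)..X, cauchyTransform f (x + (s + X : ℝ) * Complex.I) ^ m‖ ≤ A ^ m / X ^ 2 * |X - -X| := by
      refine intervalIntegral.norm_integral_le_of_norm_le_const fun x _ => hptw _ ?_ (Or.inr ?_)
      · simp; linarith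
      · simp; rw [abs_of_pos (by linarith)]
        linarith
    have hS : ∀ σ : ℝ, |σ| = X → ‖∫ y in s..(s + X), cauchyTransform f (σ + y * Complex.I) ^ m‖ ≤ A ^ m / X ^ 2 * |s + X - s| := by
      intro σ hσ
      refine intervalIntegral.norm_integral_le_of_norm_le_const fun y hy => hptw _ ?_ (Or.inl ?_)
      · rw [Set.uIoc_of_le (by linarith)] at hy; simpa using hy.1.le
      · simp [hσ]
    have hS1 := hS X (abs_of_pos hX0)
    have hS2 := hS (-X) (by rw [abs_neg, abs_of_pos hX0])
    have e : ∫ x in (-X)..X, cauchyTransform f (x + s * Complex.I) ^ m =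
        (∫ x in (-X)..X, cauchyTransform f (x + (s + X : ℝ) * Complex.I) ^ m)
        - Complex.I • (∫ y in s..(s + X), cauchyTransform f ((X : ℝ) + y * Complex.I) ^ m)
        + Complex.I • (∫ y in s..(s + X), cauchyTransform f ((-X : ℝ) + y * Complex.I) ^ m) := by
      linear_combination hrect
    rw [e]
    refine (norm_add_le _ _).trans ((add_le_add (norm_sub_le _ _) le_rfl).trans ?_)
    rw [norm_smul, norm_smul, Complex.norm_I, one_mul, one_mul]
    rw [show |X - -X| = 2 * X by rw [abs_of_pos] <;> linarith] at hT
    rw [show |s + X - s| = X by rw [add_sub_cancel_left, abs_of_pos hX0]] at hS1 hS2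
    have : A ^ m / X ^ 2 * (2 * X) + A ^ m / X ^ 2 * X + A ^ m / X ^ 2 * X = 4 * A ^ m / X := by
      field_simp; norm_num
    linarith
  rw [tendsto_zero_iff_norm_tendsto_zero]
  refine squeeze_zero' (Eventually.of_forall fun _ => norm_nonneg _) (eventually_ge_atTop 1 |>.mono fun X hX => hbound X hX) ?_
  exact tendsto_const_nhds.div_atTop tendsto_id

lemma norm_pow_sub_pow_le_mul {w v : ℂ} {R : ℝ} (hw : ‖w‖ ≤ R) (hv : ‖v‖ ≤ R) (m : ℕ) :
    ‖w ^ m - v ^ m‖ * R ≤ m * ‖w - v‖ * R ^ m := by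
  have hR : 0 ≤ R := (norm_nonneg w).trans hw
  induction m with
  | zero => simp
  | succ m ih =>
    have e : w ^ (m + 1) - v ^ (m + 1) = (w ^ m - v ^ m) * w + v ^ m * (w - v) := by ring
    have h1 : ‖v ^ m * (w - v)‖ ≤ R ^ m * ‖w - v‖ := by
      rw [norm_mul, norm_pow]; gcongr
    have h2 : ‖(w ^ m - v ^ m) * w‖ ≤ ‖w ^ m - v ^ m‖ * R := by
      rw [norm_mul]; gcongr
    have h3 : ‖w ^ (m + 1) - v ^ (m + 1)‖ ≤ ‖w ^ m - v ^ m‖ * R + R ^ m * ‖w - v‖ := by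
      rw [e]; exact (norm_add_le _ _).trans (add_le_add h2 h1)
    calc _ ≤ (m * ‖w - v‖ * R ^ m + R ^ m * ‖w - v‖) * R := by gcongr; exact h3.trans (by linarith)
      _ = _ := by push_cast; ring

/-- The pointwise inequality behind M. Riesz' theorem on conjugate functions. -/
lemma exists_pow_le_re_pow (n : ℕ) (hn : 1 ≤ n) : ∃ C : ℝ, 0 ≤ C ∧ ∀ a b : ℝ,
    a ^ (2 * n) ≤ C * b ^ (2 * n) + 2 * (((a : ℂ) - Complex.I * b) ^ (2 * n)).re := by
  -- The threshold between two regimes. If `|a| ≥ K|b|`, then `(a - ib)^{2n}` differs from `a^{2n}`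
  -- by at most `a^{2n}/2`, so its real part controls `a^{2n}`. If `|a| ≤ K|b|`, every term is a
  -- multiple of `b^{2n}`.
  set K : ℝ := 4 * n * 2 ^ (2 * n) with hK
  have hn' : (1 : ℝ) ≤ n := by exact_mod_cast hn
  have hK1 : 1 ≤ K := by
    rw [hK]
    have : (1 : ℝ) ≤ 2 ^ (2 * n) := one_le_pow₀ (by norm_num)
    nlinarith
  refine ⟨K ^ (2 * n) + 2 * (K + 1) ^ (2 * n), by positivity, fun a b => ?_⟩
  have heven : Even (2 * n) := even_two_mul n
  set w : ℂ := (a : ℂ) - Complex.I * b with hw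
  have hwn : ‖w‖ ≤ |a| + |b| := by
    rw [hw]; refine (norm_sub_le _ _).trans ?_
    simp
  have hre : |(w ^ (2 * n)).re| ≤ ‖w‖ ^ (2 * n) := (Complex.abs_re_le_norm _).trans (by rw [norm_pow])
  rw [← heven.pow_abs a, ← heven.pow_abs b]
  rcases le_total (K * |b|) |a| with h | h
  · rcases eq_or_lt_of_le (abs_nonneg a) with ha | ha
    · have hb : |b| = 0 := by
        rw [← ha] at h
        have := abs_nonneg b
        nlinarith
      have ha' : a = 0 := abs_eq_zero.1 ha.symm
      have hb' : b = 0 := abs_eq_zero.1 hb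
      simp [hw, ha', hb', show n ≠ 0 by omega]
    have hba : |b| ≤ |a| := by nlinarith [abs_nonneg b]
    have h1 := norm_pow_sub_pow_le_mul (w := w) (v := (a : ℂ)) (R := 2 * |a|) (by linarith) (by
      simp only [Complex.norm_real, Real.norm_eq_abs]; linarith) (2 * n)
    have hwa : ‖w - a‖ = |b| := by rw [hw]; simp
    rw [hwa, mul_pow] at h1
    have h2 : ‖w ^ (2 * n) - (a : ℂ) ^ (2 * n)‖ ≤ |a| ^ (2 * n) / 2 := by
      have h3 : ((2 * n : ℕ) : ℝ) * |b| * (2 ^ (2 * n) * |a| ^ (2 * n)) ≤ |a| / 2 * |a| ^ (2 * n) := by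
        have : ((2 * n : ℕ) : ℝ) * |b| * (2 ^ (2 * n) * |a| ^ (2 * n)) = (K * |b|) / 2 * |a| ^ (2 * n) := by
          rw [hK]; push_cast; ring
        rw [this]; gcongr
      have h4 := h1.trans h3
      have h5 : ‖w ^ (2 * n) - (a : ℂ) ^ (2 * n)‖ * (2 * |a|) ≤ (|a| ^ (2 * n) / 4) * (2 * |a|) := by
        refine h4.trans (le_of_eq ?_); ring
      have h6 := le_of_mul_le_mul_right h5 (by positivity)
      have : 0 ≤ |a| ^ (2 * n) := by positivity
      linarith
    have h3 : |a| ^ (2 * n) - (w ^ (2 * n)).re ≤ |a| ^ (2 * n) / 2 := by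
      have h4 := (Complex.abs_re_le_norm (w ^ (2 * n) - (a : ℂ) ^ (2 * n))).trans h2
      rw [Complex.sub_re, ← Complex.ofReal_pow, Complex.ofReal_re, ← heven.pow_abs a] at h4
      linarith [neg_abs_le ((w ^ (2 * n)).re - |a| ^ (2 * n))]
    have : 0 ≤ (K ^ (2 * n) + 2 * (K + 1) ^ (2 * n)) * |b| ^ (2 * n) := by positivity
    linarith
  · have h1 : |a| ^ (2 * n) ≤ K ^ (2 * n) * |b| ^ (2 * n) := by
      rw [← mul_pow]; gcongr
    have h2 : ‖w‖ ^ (2 * n) ≤ (K + 1) ^ (2 * n) * |b| ^ (2 * n) := by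
      rw [← mul_pow]; gcongr; linarith
    have h3 := neg_abs_le (w ^ (2 * n)).re
    nlinarith

end CauchyTransform

end

noncomputable section

/-! ### Conjugate Poisson integrals at even exponents. -/

section ConjugatePoisson

open scoped ComplexConjugate

/-- The unnormalized conjugate Poisson integral of `f` at height `s`. -/
def conjPoisson (s : ℝ) (f : ℝ → ℂ) (x : ℝ) : ℂ :=
  ∫ y, f y * (((x - y) / (s ^ 2 + (x - y) ^ 2) : ℝ) : ℂ)

lemma abs_conjKernel_le {s : ℝ} (hs : 0 < s) (t : ℝ) : |t / (s ^ 2 + t ^ 2)| ≤ 1 / s := by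
  rw [abs_div, abs_of_pos (by positivity : 0 < s ^ 2 + t ^ 2), div_le_div_iff₀ (by positivity) hs]
  have := sq_nonneg (|t| - s)
  rw [sub_sq, sq_abs] at this
  nlinarith [abs_nonneg t]

lemma IsNice.integrable_mul_conjKernel {f : ℝ → ℂ} (hf : IsNice f) {s : ℝ} (hs : 0 < s) (x : ℝ) :
    Integrable fun y => f y * (((x - y) / (s ^ 2 + (x - y) ^ 2) : ℝ) : ℂ) := by
  have hfm := hf.measurable
  refine (hf.integrable.norm.mul_const (1 / s)).mono ?_ (Eventually.of_forall fun y => ?_)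
  · apply Measurable.aestronglyMeasurable; fun_prop
  · rw [norm_mul, norm_mul, norm_norm, Complex.norm_real, Real.norm_of_nonneg (by positivity : 0 ≤ 1 / s)]
    gcongr
    exact abs_conjKernel_le hs _

lemma IsNice.exists_norm_conjPoisson_le {f : ℝ → ℂ} (hf : IsNice f) {s : ℝ} (hs : 0 < s) :
    ∃ B, ∀ x, ‖conjPoisson s f x‖ ≤ B := by
  refine ⟨∫ y, ‖f y‖ * (1 / s), fun x => norm_integral_le_of_norm_le (hf.integrable.norm.mul_const _)
    (Eventually.of_forall fun y => ?_)⟩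
  rw [norm_mul, Complex.norm_real]
  gcongr
  exact abs_conjKernel_le hs _

lemma measurable_conjPoisson_param {β : Type*} [MeasurableSpace β] {f : β × ℝ → ℂ} (hf : Measurable f) (s : ℝ) :
    Measurable fun q : β × ℝ => conjPoisson s (fun y => f (q.1, y)) q.2 := by
  have : Measurable (fun p : (β × ℝ) × ℝ => f (p.1.1, p.2) *
    (((p.1.2 - p.2) / (s ^ 2 + (p.1.2 - p.2) ^ 2) : ℝ) : ℂ)) := by fun_prop
  exact this.stronglyMeasurable.integral_prod_right'.measurable

lemma measurable_conjPoisson {f : ℝ → ℂ} (hf : Measurable f) (s : ℝ) : Measurable (conjPoisson s f) :=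
  (measurable_conjPoisson_param (β := Unit) (f := fun q => f q.2) (by fun_prop) s).comp
    (measurable_const.prodMk measurable_id : Measurable fun x : ℝ => ((), x))

lemma conjPoisson_add {f g : ℝ → ℂ} (hf : IsNice f) (hg : IsNice g) {s : ℝ} (hs : 0 < s) (x : ℝ) :
    conjPoisson s (fun y => f y + g y) x = conjPoisson s f x + conjPoisson s g x := by
  unfold conjPoisson
  rw [← integral_add (hf.integrable_mul_conjKernel hs x) (hg.integrable_mul_conjKernel hs x)]
  simp_rw [add_mul]

lemma conjPoisson_const_mul (c : ℂ) (f : ℝ → ℂ) (s x : ℝ) :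
    conjPoisson s (fun y => c * f y) x = c * conjPoisson s f x := by
  unfold conjPoisson
  rw [← integral_const_mul]
  simp_rw [mul_assoc]

/-- For real `φ` the real and imaginary parts on a horizontal line are the conjugate Poisson
integral and minus the Poisson integral, both unnormalized. -/
lemma cauchyTransform_ofReal {φ : ℝ → ℝ} (hφ : IsNice fun x => (φ x : ℂ)) {s : ℝ} (hs : 0 < s) (x : ℝ) :
    cauchyTransform (fun x => (φ x : ℂ)) (x + s * Complex.I) =
      ((∫ y, φ y * ((x - y) / (s ^ 2 + (x - y) ^ 2)) : ℝ) : ℂ) -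
        Complex.I * ((∫ y, φ y * (s / (s ^ 2 + (x - y) ^ 2)) : ℝ) : ℂ) := by
  have h1 : Integrable fun y => φ y * ((x - y) / (s ^ 2 + (x - y) ^ 2)) := by
    have := (hφ.integrable_mul_conjKernel hs x).re
    exact this.congr (Eventually.of_forall fun y => by
      show (((φ y : ℂ) * (((x - y) / (s ^ 2 + (x - y) ^ 2) : ℝ) : ℂ)) : ℂ).re = _
      rw [← Complex.ofReal_mul, Complex.ofReal_re])
  have hφm : Measurable φ := by
    have := Complex.measurable_re.comp hφ.measurable
    exact this
  have h2 : Integrable fun y => φ y * (s / (s ^ 2 + (x - y) ^ 2)) := by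
    refine (hφ.integrable.norm.mul_const (1 / s)).mono ?_ (Eventually.of_forall fun y => ?_)
    · apply Measurable.aestronglyMeasurable; fun_prop
    · rw [norm_mul, norm_mul, norm_norm, Complex.norm_real, Real.norm_of_nonneg (by positivity : 0 ≤ 1 / s)]
      gcongr
      rw [Real.norm_of_nonneg (by positivity), div_le_div_iff₀ (by positivity) hs]
      nlinarith [sq_nonneg (x - y)]
  rw [show ((∫ y, φ y * ((x - y) / (s ^ 2 + (x - y) ^ 2)) : ℝ) : ℂ) =
      ∫ y, ((φ y * ((x - y) / (s ^ 2 + (x - y) ^ 2)) : ℝ) : ℂ) from integral_ofReal.symm,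
    show ((∫ y, φ y * (s / (s ^ 2 + (x - y) ^ 2)) : ℝ) : ℂ) =
      ∫ y, ((φ y * (s / (s ^ 2 + (x - y) ^ 2)) : ℝ) : ℂ) from integral_ofReal.symm,
    ← integral_const_mul, ← integral_sub h1.ofReal (h2.ofReal.const_mul _)]
  unfold cauchyTransform
  congr 1 with y
  have hne : (x : ℂ) + s * Complex.I - y ≠ 0 := sub_ofReal_ne_zero (by simpa using hs) y
  have hne2 : ((s ^ 2 + (x - y) ^ 2 : ℝ) : ℂ) ≠ 0 := by
    have : s ^ 2 + (x - y) ^ 2 ≠ 0 := by positivity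
    exact_mod_cast this
  rw [div_eq_iff hne]
  push_cast at hne2 ⊢
  field_simp
  linear_combination ((φ y : ℂ) * s ^ 2) * Complex.I_sq

/-- M. Riesz' argument: integrating the pointwise inequality for `F = a - ib` removes the term `Re
F^{2n}`, whose integral vanishes. What remains is the Poisson integral `b`, bounded by the maximal
function. -/
lemma exists_lintegral_conjPoisson_ofReal_even_le (n : ℕ) (hn : 1 ≤ n) : ∃ C : ℝ≥0, ∀ {φ : ℝ → ℝ}
    (_ : IsNice fun x => (φ x : ℂ)) {s : ℝ} (_ : 0 < s),
    ∫⁻ x, ‖conjPoisson s (fun x => (φ x : ℂ)) x‖ₑ ^ ((2 * n : ℕ) : ℝ) ≤ C * ∫⁻ x, ‖φ x‖ₑ ^ ((2 * n : ℕ) : ℝ) := by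
  obtain ⟨C₀, hC₀, hineq⟩ := exists_pow_le_re_pow n hn
  obtain ⟨C₁, hC₁⟩ := exists_lintegral_cauchy_mul_le
  have h2n : 1 < ((2 * n : ℕ) : ℝ) := by exact_mod_cast (by omega : 1 < 2 * n)
  obtain ⟨C₂, hC₂⟩ := exists_lintegral_hlMax_rpow_le h2n
  refine ⟨C₀.toNNReal * (C₁ ^ (2 * n) * C₂), fun {φ} hφ {s} hs => ?_⟩
  have hφm : Measurable φ := by
    have := Complex.measurable_re.comp hφ.measurable
    exact this
  set a : ℝ → ℝ := fun x => ∫ y, φ y * ((x - y) / (s ^ 2 + (x - y) ^ 2)) with ha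
  set b : ℝ → ℝ := fun x => ∫ y, φ y * (s / (s ^ 2 + (x - y) ^ 2)) with hb
  set F : ℝ → ℂ := fun x => cauchyTransform (fun x => (φ x : ℂ)) (x + s * Complex.I) with hF
  have hFab : ∀ x, F x = (a x : ℂ) - Complex.I * (b x : ℂ) := fun x => cauchyTransform_ofReal hφ hs x
  have hQ : ∀ x, conjPoisson s (fun x => (φ x : ℂ)) x = (a x : ℂ) := by
    intro x
    unfold conjPoisson
    simp_rw [← Complex.ofReal_mul]
    exact integral_ofReal
  have hFint : Integrable fun x => F x ^ (2 * n) := integrable_cauchyTransform_pow hφ hs (by omega)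
  have hF0 : ∫ x, F x ^ (2 * n) = 0 := integral_cauchyTransform_pow_eq_zero hφ hs (by omega)
  have hFc : Continuous F := continuous_cauchyTransform_line hφ hs
  have hare : ∀ x, a x = (F x).re := fun x => by rw [hFab]; simp
  have hbim : ∀ x, b x = -(F x).im := fun x => by rw [hFab]; simp
  have hac : Continuous a := by
    rw [funext hare]; exact Complex.continuous_re.comp hFc
  have hbc : Continuous b := by
    rw [funext hbim]; exact (Complex.continuous_im.comp hFc).neg
  -- Integrability of `a^{2n}` and `b^{2n}` follows from that of `F^{2n}` and is needed before the
  -- pointwise inequality can be integrated term by term.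
  have hai : Integrable fun x => a x ^ (2 * n) := by
    refine hFint.mono (hac.pow _).aestronglyMeasurable (Eventually.of_forall fun x => ?_)
    rw [norm_pow, norm_pow]
    gcongr
    rw [hare, Real.norm_eq_abs]; exact Complex.abs_re_le_norm _
  have hbi : Integrable fun x => b x ^ (2 * n) := by
    refine hFint.mono (hbc.pow _).aestronglyMeasurable (Eventually.of_forall fun x => ?_)
    rw [norm_pow, norm_pow]
    gcongr
    rw [hbim, Real.norm_eq_abs, abs_neg]; exact Complex.abs_im_le_norm _
  have hre : ∫ x, (F x ^ (2 * n)).re = 0 := by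
    have : ∫ x, (F x ^ (2 * n)).re = (∫ x, F x ^ (2 * n)).re := integral_re hFint
    rw [this, hF0]; rfl
  have hmain : ∫ x, a x ^ (2 * n) ≤ C₀ * ∫ x, b x ^ (2 * n) := by
    have h1 : ∫ x, a x ^ (2 * n) ≤ ∫ x, (C₀ * b x ^ (2 * n) + 2 * (F x ^ (2 * n)).re) := by
      refine integral_mono hai ((hbi.const_mul _).add (hFint.re.const_mul _)) fun x => ?_
      have := hineq (a x) (b x)
      rw [← hFab] at this
      exact this
    have hI : Integrable fun x => (F x ^ (2 * n)).re := hFint.re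
    rwa [integral_add (hbi.const_mul _) (hI.const_mul _), integral_const_mul, integral_const_mul, hre, mul_zero,
      add_zero] at h1
  have heven : Even (2 * n) := even_two_mul n
  have conv : ∀ g : ℝ → ℝ, Integrable (fun x => g x ^ (2 * n)) →
      ∫⁻ x, ‖g x‖ₑ ^ ((2 * n : ℕ) : ℝ) = ENNReal.ofReal (∫ x, g x ^ (2 * n)) := by
    intro g hg
    rw [ofReal_integral_eq_lintegral_ofReal hg (Eventually.of_forall fun x => heven.pow_nonneg _)]
    refine lintegral_congr fun x => ?_
    rw [ENNReal.rpow_natCast, ← ofReal_norm, ← ENNReal.ofReal_pow (norm_nonneg _), Real.norm_eq_abs, heven.pow_abs]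
  have hbM : ∀ x, ‖b x‖ₑ ≤ C₁ * hlMax (fun y => ‖φ y‖ₑ) x := by
    intro x
    refine le_trans ?_ (hC₁ s hs (fun y => ‖φ y‖ₑ) (by fun_prop) x)
    simp only [hb]
    refine (enorm_integral_le_lintegral_enorm _).trans (le_of_eq ?_)
    rw [← lintegral_sub_left_eq_self _ x]
    refine lintegral_congr fun y => ?_
    rw [enorm_mul, mul_comm, sub_sub_cancel, ← ofReal_norm (s / (s ^ 2 + y ^ 2)), Real.norm_of_nonneg (by positivity)]
  calc _ = ∫⁻ x, ‖a x‖ₑ ^ ((2 * n : ℕ) : ℝ) := by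
        refine lintegral_congr fun x => ?_
        rw [hQ, ← ofReal_norm, Complex.norm_real, ofReal_norm]
    _ = ENNReal.ofReal (∫ x, a x ^ (2 * n)) := conv a hai
    _ ≤ ENNReal.ofReal (C₀ * ∫ x, b x ^ (2 * n)) := ENNReal.ofReal_le_ofReal hmain
    _ = ENNReal.ofReal C₀ * ∫⁻ x, ‖b x‖ₑ ^ ((2 * n : ℕ) : ℝ) := by rw [ENNReal.ofReal_mul hC₀, conv b hbi]
    _ ≤ ENNReal.ofReal C₀ * ∫⁻ x, C₁ ^ (2 * n) * hlMax (fun y => ‖φ y‖ₑ) x ^ ((2 * n : ℕ) : ℝ) := by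
        gcongr with x
        rw [ENNReal.rpow_natCast, ENNReal.rpow_natCast, ← mul_pow]
        exact pow_le_pow_left' (hbM x) _
    _ ≤ ENNReal.ofReal C₀ * (C₁ ^ (2 * n) * (C₂ * ∫⁻ x, ‖φ x‖ₑ ^ ((2 * n : ℕ) : ℝ))) := by
        rw [lintegral_const_mul' _ _ (by finiteness)]
        gcongr
        exact hC₂ _ (by fun_prop)
    _ = _ := by push_cast; rw [ENNReal.ofReal]; ring

lemma enorm_add_rpow_le {p : ℝ} (hp : 1 ≤ p) (a b : ℂ) : ‖a + b‖ₑ ^ p ≤ 2 ^ (p - 1) * (‖a‖ₑ ^ p + ‖b‖ₑ ^ p) :=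
  (ENNReal.rpow_le_rpow (enorm_add_le a b) (by linarith)).trans (ENNReal.rpow_add_le_mul_rpow_add_rpow _ _ hp)

lemma exists_lintegral_conjPoisson_even_le (n : ℕ) (hn : 1 ≤ n) : ∃ C : ℝ≥0, ∀ {f : ℝ → ℂ}
    (_ : IsNice f) {s : ℝ} (_ : 0 < s),
    ∫⁻ x, ‖conjPoisson s f x‖ₑ ^ ((2 * n : ℕ) : ℝ) ≤ C * ∫⁻ x, ‖f x‖ₑ ^ ((2 * n : ℕ) : ℝ) := by
  obtain ⟨C, hC⟩ := exists_lintegral_conjPoisson_ofReal_even_le n hn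
  have h2n : 1 < ((2 * n : ℕ) : ℝ) := by exact_mod_cast (by omega : 1 < 2 * n)
  set p := ((2 * n : ℕ) : ℝ) with hp
  have hfin : (2 : ℝ≥0∞) ^ (p - 1) ≠ ⊤ := ENNReal.rpow_ne_top_of_nonneg (by linarith) (by norm_num)
  refine ⟨((2 : ℝ≥0∞) ^ (p - 1)).toNNReal * (2 * C), fun {f} hf {s} hs => ?_⟩
  have hfm := hf.measurable
  have hu : IsNice fun x => ((f x).re : ℂ) := by
    refine ⟨by fun_prop, ?_, ?_⟩
    · obtain ⟨B, hB⟩ := hf.bounded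
      refine ⟨B, fun x => ?_⟩
      rw [Complex.norm_real]
      exact (Complex.abs_re_le_norm _).trans (hB x)
    · obtain ⟨L, hL⟩ := hf.support
      refine ⟨L, fun x hx => hL x fun h0 => hx (by simp [h0])⟩
  have hv : IsNice fun x => ((f x).im : ℂ) := by
    refine ⟨by fun_prop, ?_, ?_⟩
    · obtain ⟨B, hB⟩ := hf.bounded
      refine ⟨B, fun x => ?_⟩
      rw [Complex.norm_real]
      exact (Complex.abs_im_le_norm _).trans (hB x)
    · obtain ⟨L, hL⟩ := hf.support
      refine ⟨L, fun x hx => hL x fun h0 => hx (by simp [h0])⟩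
  have hiv : IsNice fun x => Complex.I * ((f x).im : ℂ) := by
    refine ⟨by fun_prop, ?_, ?_⟩
    · obtain ⟨B, hB⟩ := hv.bounded
      exact ⟨B, fun x => by rw [norm_mul, Complex.norm_I, one_mul]; exact hB x⟩
    · obtain ⟨L, hL⟩ := hv.support
      exact ⟨L, fun x hx => hL x (right_ne_zero_of_mul hx)⟩
  have hdec : ∀ x, conjPoisson s f x = conjPoisson s (fun x => ((f x).re : ℂ)) x +
      Complex.I * conjPoisson s (fun x => ((f x).im : ℂ)) x := by
    intro x
    rw [← conjPoisson_const_mul, ← conjPoisson_add hu hiv hs]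
    congr 1 with y
    conv_lhs => rw [← Complex.re_add_im (f y)]
    rw [mul_comm Complex.I]
  have hpos : 0 ≤ p := by linarith
  have hre : ∀ x, ‖(f x).re‖ₑ ≤ ‖f x‖ₑ := fun x => by
    rw [enorm_le_iff_norm_le]; exact Complex.abs_re_le_norm _
  have him : ∀ x, ‖(f x).im‖ₑ ≤ ‖f x‖ₑ := fun x => by
    rw [enorm_le_iff_norm_le]; exact Complex.abs_im_le_norm _
  calc _ ≤ ∫⁻ x, 2 ^ (p - 1) * (‖conjPoisson s (fun x => ((f x).re : ℂ)) x‖ₑ ^ p +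
        ‖conjPoisson s (fun x => ((f x).im : ℂ)) x‖ₑ ^ p) := by
        refine lintegral_mono fun x => ?_
        rw [hdec]
        refine (enorm_add_rpow_le h2n.le _ _).trans (le_of_eq ?_)
        rw [enorm_mul, ← ofReal_norm Complex.I, Complex.norm_I, ENNReal.ofReal_one, one_mul]
    _ ≤ 2 ^ (p - 1) * (C * (∫⁻ x, ‖f x‖ₑ ^ p) + C * ∫⁻ x, ‖f x‖ₑ ^ p) := by
        rw [lintegral_const_mul' _ _ hfin]
        have := measurable_conjPoisson hu.measurable s
        rw [lintegral_add_left (by fun_prop)]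
        gcongr
        · refine (hC hu hs).trans ?_
          gcongr with x
          exact hre x
        · refine (hC hv hs).trans ?_
          gcongr with x
          exact him x
    _ = _ := by
        push_cast
        rw [ENNReal.coe_toNNReal hfin]; ring

end ConjugatePoisson

end

noncomputable section

/-! ### Conjugate Poisson integrals at all exponents `p > 1`. -/

section ConjugatePoissonLp

open scoped ComplexConjugate

lemma measure_lt_le_rpow_mul_lintegral {α : Type*} [MeasurableSpace α] {μ : Measure α} {G : α → ℝ≥0∞}
    (hG : Measurable G) {t q : ℝ} (ht : 0 < t) (hq : 0 < q) :
    μ {x | ENNReal.ofReal t < G x} ≤ ENNReal.ofReal (t ^ (-q)) * ∫⁻ x, G x ^ q ∂μ := by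
  have h1 := mul_meas_ge_le_lintegral₀ (μ := μ) (f := fun x => G x ^ q) (by fun_prop) (ENNReal.ofReal (t ^ q))
  have h2 : μ {x | ENNReal.ofReal t < G x} ≤ μ {x | ENNReal.ofReal (t ^ q) ≤ G x ^ q} := by
    refine measure_mono fun x hx => ?_
    have hx' : ENNReal.ofReal t < G x := hx
    show ENNReal.ofReal (t ^ q) ≤ G x ^ q
    rw [← ENNReal.ofReal_rpow_of_pos ht]
    exact ENNReal.rpow_le_rpow hx'.le hq.le
  have h3 : ENNReal.ofReal (t ^ (-q)) * ENNReal.ofReal (t ^ q) = 1 := by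
    rw [← ENNReal.ofReal_mul (by positivity), ← Real.rpow_add ht]; simp
  calc _ ≤ 1 * μ {x | ENNReal.ofReal (t ^ q) ≤ G x ^ q} := by rwa [one_mul]
    _ = ENNReal.ofReal (t ^ (-q)) * (ENNReal.ofReal (t ^ q) * μ {x | ENNReal.ofReal (t ^ q) ≤ G x ^ q}) := by
      rw [← h3, mul_assoc]
    _ ≤ _ := mul_le_mul_right h1 _

/-- The distribution function of a sum, from strong type bounds of the summands. -/
lemma measure_lt_le_add_of_le_add {α : Type*} [MeasurableSpace α] {μ : Measure α} {G G₀ G₁ : α → ℝ≥0∞}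
    (hG₀ : Measurable G₀) (hG₁ : Measurable G₁) (h : ∀ x, G x ≤ G₀ x + G₁ x) {t q₀ q₁ : ℝ} (ht : 0 < t)
    (hq₀ : 0 < q₀) (hq₁ : 0 < q₁) :
    μ {x | ENNReal.ofReal t < G x} ≤
      ENNReal.ofReal (2 ^ q₀) * ENNReal.ofReal (t ^ (-q₀)) * (∫⁻ x, G₀ x ^ q₀ ∂μ) +
      ENNReal.ofReal (2 ^ q₁) * ENNReal.ofReal (t ^ (-q₁)) * ∫⁻ x, G₁ x ^ q₁ ∂μ := by
  have hsub : {x | ENNReal.ofReal t < G x} ⊆ {x | ENNReal.ofReal (t / 2) < G₀ x} ∪ {x | ENNReal.ofReal (t / 2) < G₁ x} := by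
    intro x hx
    by_contra hcon
    simp only [Set.mem_union, Set.mem_ofPred_eq, not_or, not_lt] at hcon hx
    have h1 := hx.trans_le ((h x).trans (add_le_add hcon.1 hcon.2))
    rw [← ENNReal.ofReal_add (by positivity) (by positivity), add_halves] at h1
    exact lt_irrefl _ h1
  have e : ∀ q : ℝ, ENNReal.ofReal ((t / 2) ^ (-q)) = ENNReal.ofReal (2 ^ q) * ENNReal.ofReal (t ^ (-q)) := by
    intro q
    rw [← ENNReal.ofReal_mul (by positivity), Real.div_rpow ht.le (by norm_num), Real.rpow_neg (by norm_num : (0 : ℝ) ≤ 2)]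
    congr 1; field_simp
  rw [← e, ← e]
  exact (measure_mono hsub).trans ((measure_union_le _ _).trans (add_le_add
    (measure_lt_le_rpow_mul_lintegral hG₀ (by positivity) hq₀) (measure_lt_le_rpow_mul_lintegral hG₁ (by positivity) hq₁)))

lemma lintegral_enorm_indicator_rpow {α : Type*} [MeasurableSpace α] {μ : Measure α} (f : α → ℂ) {s : Set α}
    (hs : MeasurableSet s) {q : ℝ} (hq : 0 < q) :
    ∫⁻ x, ‖s.indicator f x‖ₑ ^ q ∂μ = ∫⁻ x in s, ‖f x‖ₑ ^ q ∂μ := by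
  rw [← lintegral_indicator hs]
  refine lintegral_congr fun x => ?_
  by_cases hx : x ∈ s
  · simp [hx]
  · simp [hx, ENNReal.zero_rpow_of_pos hq]

/-- Interpolation between the exponents `2` and `2n > p`, splitting `f` at height `t`. -/
lemma exists_lintegral_conjPoisson_le_of_two_lt {p : ℝ} (hp : 2 < p) : ∃ C : ℝ≥0, ∀ {f : ℝ → ℂ}
    (_ : IsNice f) {s : ℝ} (_ : 0 < s),
    ∫⁻ x, ‖conjPoisson s f x‖ₑ ^ p ≤ C * ∫⁻ x, ‖f x‖ₑ ^ p := by
  obtain ⟨n, hn⟩ := exists_nat_gt p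
  have hn2 : 2 < n := by exact_mod_cast hp.trans hn
  have hp1 : p < ((2 * n : ℕ) : ℝ) := by push_cast; linarith
  obtain ⟨C₀, hC₀⟩ := exists_lintegral_conjPoisson_even_le 1 le_rfl
  obtain ⟨C₁, hC₁⟩ := exists_lintegral_conjPoisson_even_le n (by omega)
  have h21 : ((2 * 1 : ℕ) : ℝ) = 2 := by norm_num
  rw [h21] at hC₀
  set q := ((2 * n : ℕ) : ℝ) with hq
  obtain ⟨C, hC⟩ := exists_lintegral_rpow_le_of_distribution two_pos hp hp1 one_pos
  refine ⟨C * (Real.toNNReal (2 ^ (2 : ℝ)) * C₀ + Real.toNNReal (2 ^ q) * C₁), fun {f} hf {s} hs => ?_⟩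
  have hfm := hf.measurable
  refine (hC (μ := volume) (ν := volume) (G := fun x => ‖conjPoisson s f x‖ₑ) (g := fun x => ‖f x‖ₑ)
    (measurable_conjPoisson hfm s).enorm hfm.enorm (A₀ := ENNReal.ofReal (2 ^ (2 : ℝ)) * C₀)
    (A₁ := ENNReal.ofReal (2 ^ q) * C₁) fun t ht => ?_).trans (le_of_eq ?_)
  · rw [one_mul]
    set S : Set ℝ := {y | ENNReal.ofReal t < ‖f y‖ₑ} with hS
    have hSm : MeasurableSet S := measurableSet_lt measurable_const hfm.enorm
    have hSc : {y | ‖f y‖ₑ ≤ ENNReal.ofReal t} = Sᶜ := by ext y; simp [hS]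
    rw [hSc]
    have hf1 := hf.indicator hSm
    have hf2 := hf.indicator hSm.compl
    have hsum : ∀ x, ‖conjPoisson s f x‖ₑ ≤ ‖conjPoisson s (S.indicator f) x‖ₑ + ‖conjPoisson s (Sᶜ.indicator f) x‖ₑ := by
      intro x
      refine le_trans (le_of_eq ?_) (enorm_add_le _ _)
      rw [← conjPoisson_add hf1 hf2 hs]
      congr 2 with y
      exact (congrFun (Set.indicator_self_add_compl S f) y).symm
    refine (measure_lt_le_add_of_le_add (measurable_conjPoisson hf1.measurable s).enorm
      (measurable_conjPoisson hf2.measurable s).enorm hsum ht (q₀ := 2) (q₁ := q) two_pos (by linarith)).trans ?_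
    have h1 := hC₀ hf1 hs
    have h2 := hC₁ hf2 hs
    rw [lintegral_enorm_indicator_rpow f hSm two_pos] at h1
    rw [lintegral_enorm_indicator_rpow f hSm.compl (by linarith)] at h2
    refine (add_le_add (mul_le_mul_right h1 _) (mul_le_mul_right h2 _)).trans (le_of_eq ?_)
    ring
  · push_cast
    rfl

/-- `M. Riesz`: uniform `L^p` bounds for the conjugate Poisson integrals. -/
lemma exists_lintegral_conjPoisson_le {p : ℝ} (hp : 1 < p) : ∃ C : ℝ≥0, ∀ {f : ℝ → ℂ}
    (_ : IsNice f) {s : ℝ} (_ : 0 < s),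
    ∫⁻ x, ‖conjPoisson s f x‖ₑ ^ p ≤ C * ∫⁻ x, ‖f x‖ₑ ^ p := by
  rcases lt_trichotomy p 2 with h2 | rfl | h2
  rotate_left
  · have := exists_lintegral_conjPoisson_even_le 1 le_rfl
    simpa using this
  · exact exists_lintegral_conjPoisson_le_of_two_lt h2
  have hp0 : 0 < p := by linarith
  -- For `p < 2` the conjugate exponent exceeds `2`, and the operator is antisymmetric because its
  -- kernel is odd; the bound follows by duality.
  set q := p / (p - 1) with hq
  have hq2 : 2 < q := by rw [hq, lt_div_iff₀ (by linarith)]; linarith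
  have hconj : p.HolderConjugate q := by
    rw [Real.holderConjugate_iff]; refine ⟨hp, ?_⟩
    rw [hq]; field_simp; ring
  obtain ⟨C, hC⟩ := exists_lintegral_conjPoisson_le_of_two_lt hq2
  have hCfin : ((C : ℝ≥0∞) ^ (1 / q)) ^ p ≠ ⊤ :=
    ENNReal.rpow_ne_top_of_nonneg hp0.le (ENNReal.rpow_ne_top_of_nonneg (by positivity) ENNReal.coe_ne_top)
  refine ⟨(((C : ℝ≥0∞) ^ (1 / q)) ^ p).toNNReal, fun {f} hf {s} hs => ?_⟩
  rw [ENNReal.coe_toNNReal hCfin]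
  have hfm := hf.measurable
  obtain ⟨B, hB⟩ := hf.exists_norm_conjPoisson_le hs
  have hB0 : 0 ≤ B := (norm_nonneg _).trans (hB 0)
  set h : ℝ → ℂ := conjPoisson s f with hh
  have hhm : Measurable h := measurable_conjPoisson hfm s
  -- local bound
  have key : ∀ N : ℕ, ∫⁻ x in Set.Icc (-N : ℝ) N, ‖h x‖ₑ ^ p ≤ ((C : ℝ≥0∞) ^ (1 / q)) ^ p * ∫⁻ x, ‖f x‖ₑ ^ p := by
    intro N
    set J : Set ℝ := Set.Icc (-N : ℝ) N with hJ
    -- The extremal dual function, localized to `J`: `g h = |h|^p` and `|g|^q = |h|^p` on `J`. The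
    -- localization makes `X` finite, so that a power of it can be cancelled below.
    set g : ℝ → ℂ := J.indicator fun x => conj (h x) * ((‖h x‖ ^ (p - 2) : ℝ) : ℂ) with hg
    have hgn : ∀ x ∈ J, ‖g x‖ = ‖h x‖ ^ (p - 1) := by
      intro x hx
      rw [hg, Set.indicator_of_mem hx, norm_mul, RCLike.norm_conj, Complex.norm_real,
        Real.norm_of_nonneg (by positivity)]
      rcases eq_or_ne ‖h x‖ 0 with h0 | h0
      · rw [h0, zero_mul, Real.zero_rpow (by linarith)]
      · rw [← Real.rpow_one_add' (norm_nonneg _) (by linarith)]; ring_nf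
    have hgnice : IsNice g := by
      refine ⟨Measurable.indicator (by fun_prop) measurableSet_Icc, ⟨B ^ (p - 1), fun x => ?_⟩, ⟨N, fun x hx => ?_⟩⟩
      · by_cases hx : x ∈ J
        · rw [hgn x hx]; exact Real.rpow_le_rpow (norm_nonneg _) (hB x) (by linarith)
        · rw [hg, Set.indicator_of_notMem hx, norm_zero]; positivity
      · by_contra hcon
        refine hx (Set.indicator_of_notMem (fun hxJ => hcon ?_) _)
        exact abs_le.2 hxJ
    have hgm := hgnice.measurable
    have hgh : ∀ x, g x * h x = (((J.indicator (fun x => ‖h x‖ ^ p) x : ℝ)) : ℂ) := by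
      intro x
      by_cases hx : x ∈ J
      · rw [hg, Set.indicator_of_mem hx, Set.indicator_of_mem hx, mul_right_comm, mul_comm (conj _), Complex.mul_conj,
          Complex.normSq_eq_norm_sq, ← Complex.ofReal_mul]
        congr 1
        rcases eq_or_ne ‖h x‖ 0 with h0 | h0
        · rw [h0, Real.zero_rpow hp0.ne']; simp
        · have : 0 < ‖h x‖ := lt_of_le_of_ne (norm_nonneg _) h0.symm
          rw [← Real.rpow_natCast, ← Real.rpow_add this]; congr 1; push_cast; ring
      · rw [hg, Set.indicator_of_notMem hx, Set.indicator_of_notMem hx]; simp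
    set X := ∫⁻ x in J, ‖h x‖ₑ ^ p with hX
    have hXfin : X ≠ ⊤ := by
      have : X ≤ ∫⁻ x in J, ENNReal.ofReal (B ^ p) := by
        refine lintegral_mono fun x => ?_
        rw [← ofReal_norm, ENNReal.ofReal_rpow_of_nonneg (norm_nonneg _) hp0.le]
        exact ENNReal.ofReal_le_ofReal (Real.rpow_le_rpow (norm_nonneg _) (hB x) hp0.le)
      refine ne_top_of_le_ne_top ?_ this
      rw [setLIntegral_const]
      exact ENNReal.mul_ne_top ENNReal.ofReal_ne_top (by simp [hJ])
    have hXeq : X = ‖∫ x, g x * h x‖ₑ := by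
      have hi : Integrable (J.indicator fun x => ‖h x‖ ^ p) := by
        rw [integrable_indicator_iff measurableSet_Icc]
        refine Measure.integrableOn_of_bounded (M := B ^ p) (by simp) (by apply Measurable.aestronglyMeasurable; fun_prop)
          (Eventually.of_forall fun x => ?_)
        rw [Real.norm_of_nonneg (by positivity)]
        exact Real.rpow_le_rpow (norm_nonneg _) (hB x) hp0.le
      have hnn : ∀ x, 0 ≤ J.indicator (fun x => ‖h x‖ ^ p) x := fun x =>
        Set.indicator_nonneg (fun _ _ => by positivity) x
      simp_rw [hgh]
      rw [show ∫ x, ((J.indicator (fun x => ‖h x‖ ^ p) x : ℝ) : ℂ) = ((∫ x, J.indicator (fun x => ‖h x‖ ^ p) x : ℝ) : ℂ)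
        from integral_ofReal, ← ofReal_norm, Complex.norm_real, Real.norm_of_nonneg (integral_nonneg hnn),
        ofReal_integral_eq_lintegral_ofReal hi (Eventually.of_forall hnn), hX, ← lintegral_indicator measurableSet_Icc]
      refine lintegral_congr fun x => ?_
      by_cases hx : x ∈ J
      · rw [Set.indicator_of_mem hx, Set.indicator_of_mem hx, ← ofReal_norm,
          ENNReal.ofReal_rpow_of_nonneg (norm_nonneg _) hp0.le]
      · rw [Set.indicator_of_notMem hx, Set.indicator_of_notMem hx, ENNReal.ofReal_zero]
    have hdual : ∫ x, g x * h x = -∫ y, f y * conjPoisson s g y := by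
      have hprod : Integrable (fun z : ℝ × ℝ => g z.1 * f z.2) (volume.prod volume) :=
        hgnice.integrable.mul_prod hf.integrable
      have hint : Integrable (Function.uncurry fun x y => g x * (f y * (((x - y) / (s ^ 2 + (x - y) ^ 2) : ℝ) : ℂ)))
          (volume.prod volume) := by
        refine (hprod.norm.mul_const (1 / s)).mono ?_ (Eventually.of_forall fun z => ?_)
        · apply Measurable.aestronglyMeasurable
          simp only [Function.uncurry_def]; fun_prop
        · simp only [Function.uncurry_def]
          rw [← mul_assoc, norm_mul, norm_mul _ (1 / s), norm_norm, Complex.norm_real,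
            Real.norm_of_nonneg (by positivity : 0 ≤ 1 / s)]
          gcongr
          exact abs_conjKernel_le hs _
      calc ∫ x, g x * h x = ∫ x, ∫ y, g x * (f y * (((x - y) / (s ^ 2 + (x - y) ^ 2) : ℝ) : ℂ)) := by
            congr 1 with x
            rw [integral_const_mul]; rfl
        _ = ∫ y, ∫ x, g x * (f y * (((x - y) / (s ^ 2 + (x - y) ^ 2) : ℝ) : ℂ)) := integral_integral_swap hint
        _ = _ := by
            rw [← integral_neg]
            congr 1 with y
            unfold conjPoisson
            rw [← integral_const_mul, ← integral_neg]
            congr 1 with x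
            have : (x - y) / (s ^ 2 + (x - y) ^ 2) = -((y - x) / (s ^ 2 + (y - x) ^ 2)) := by
              rw [← neg_sub x y, neg_div, neg_neg, neg_sq]
            rw [this]; push_cast; ring
    have hgq : ∫⁻ x, ‖g x‖ₑ ^ q = X := by
      rw [hX, ← lintegral_indicator measurableSet_Icc]
      refine lintegral_congr fun x => ?_
      by_cases hx : x ∈ J
      · rw [Set.indicator_of_mem hx, ← ofReal_norm, hgn x hx, ← ofReal_norm,
          ENNReal.ofReal_rpow_of_nonneg (by positivity) (by linarith), ENNReal.ofReal_rpow_of_nonneg (by positivity) hp0.le,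
          ← Real.rpow_mul (norm_nonneg _)]
        congr 2
        rw [hq]; field_simp [show p - 1 ≠ 0 by linarith]
      · rw [Set.indicator_of_notMem hx, hg, Set.indicator_of_notMem hx, enorm_zero, ENNReal.zero_rpow_of_pos (by linarith)]
    have hXle : X ≤ (∫⁻ y, ‖f y‖ₑ ^ p) ^ (1 / p) * (C * X) ^ (1 / q) := by
      have hm := measurable_conjPoisson hgm s
      calc X = ‖∫ y, f y * conjPoisson s g y‖ₑ := by rw [hXeq, hdual, enorm_neg]
        _ ≤ ∫⁻ y, ‖f y‖ₑ * ‖conjPoisson s g y‖ₑ := by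
            refine (enorm_integral_le_lintegral_enorm _).trans (le_of_eq ?_)
            simp_rw [enorm_mul]
        _ ≤ _ := ENNReal.lintegral_mul_le_Lp_mul_Lq volume hconj hfm.enorm.aemeasurable hm.enorm.aemeasurable
        _ ≤ _ := by
            rw [← hgq]
            gcongr
            exact hC hgnice hs
    rcases eq_or_ne X 0 with h0 | h0
    · rw [h0]; exact zero_le
    -- Hölder gives `X ≤ ‖f‖_p (C X)^{1/q}`; dividing by `X^{1/q}` leaves `X^{1/p}`.
    have hXp : X ^ (1 / p) ≤ (C : ℝ≥0∞) ^ (1 / q) * (∫⁻ y, ‖f y‖ₑ ^ p) ^ (1 / p) := by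
      have h1 : X ^ (1 / p) * X ^ (1 / q) = X := by
        rw [← ENNReal.rpow_add _ _ h0 hXfin, one_div, one_div, hconj.inv_add_inv_eq_one, ENNReal.rpow_one]
      rw [ENNReal.mul_rpow_of_nonneg _ _ (by positivity)] at hXle
      have h2 : X ^ (1 / p) * X ^ (1 / q) ≤ ((C : ℝ≥0∞) ^ (1 / q) * (∫⁻ y, ‖f y‖ₑ ^ p) ^ (1 / p)) * X ^ (1 / q) := by
        rw [h1]; refine hXle.trans (le_of_eq ?_); ring
      have h3 : X ^ (1 / q) ≠ 0 := by
        simp [ENNReal.rpow_eq_zero_iff, h0, hXfin]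
      have h4 : X ^ (1 / q) ≠ ⊤ := ENNReal.rpow_ne_top_of_nonneg (by positivity) hXfin
      exact (ENNReal.mul_le_mul_iff_left h3 h4).1 h2
    have h5 := ENNReal.rpow_le_rpow hXp hp0.le
    rw [ENNReal.mul_rpow_of_nonneg _ _ hp0.le, ← ENNReal.rpow_mul X, ← ENNReal.rpow_mul (∫⁻ y, ‖f y‖ₑ ^ p),
      one_div_mul_cancel hp0.ne', ENNReal.rpow_one, ENNReal.rpow_one] at h5
    exact h5
  have hmono : Monotone fun N : ℕ => Set.Icc (-N : ℝ) N := by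
    intro a b hab
    have : (a : ℝ) ≤ b := by exact_mod_cast hab
    exact Set.Icc_subset_Icc (by linarith) this
  have huniv : (Set.univ : Set ℝ) = ⋃ N : ℕ, Set.Icc (-N : ℝ) N := by
    symm
    rw [Set.eq_univ_iff_forall]
    intro x
    obtain ⟨N, hN⟩ := exists_nat_ge |x|
    exact Set.mem_iUnion.2 ⟨N, abs_le.1 hN⟩
  rw [← setLIntegral_univ, huniv, setLIntegral_iUnion_of_directed _ hmono.directed_le]
  exact iSup_le key

end ConjugatePoissonLp

end

noncomputable section

/-! ### The Poisson semigroup and Cotlar's inequality. -/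

section Cotlar

lemma integrable_cauchyKernel {s : ℝ} (hs : 0 < s) : Integrable fun t : ℝ => s / (s ^ 2 + t ^ 2) := by
  have h := (integrable_inv_one_add_sq.comp_div hs.ne').const_mul s⁻¹
  refine h.congr (Eventually.of_forall fun t => ?_)
  simp only
  field_simp

/-- In the variable `v = 1/w` the common summand `log w²` cancels and the difference extends
continuously by `0` to `v = 0`; this treats `+∞` and `-∞` at once. -/
lemma tendsto_log_sub_log {σ δ a : ℝ} (hσ : 0 < σ) (hδ : 0 < δ) {l : Filter ℝ} (hl : Tendsto (fun w : ℝ => w⁻¹) l (𝓝 0))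
    (hl0 : ∀ᶠ w in l, w ≠ 0) :
    Tendsto (fun w : ℝ => Real.log (δ ^ 2 + w ^ 2) - Real.log (σ ^ 2 + (w - a) ^ 2)) l (𝓝 0) := by
  have hc : ContinuousAt (fun v : ℝ => Real.log (δ ^ 2 * v ^ 2 + 1) - Real.log (σ ^ 2 * v ^ 2 + (1 - a * v) ^ 2)) 0 := by
    refine ContinuousAt.sub (ContinuousAt.log (by fun_prop) (by simp)) (ContinuousAt.log (by fun_prop) (by simp))
  have h0 := hc.tendsto.comp hl
  simp only [ne_eq, OfNat.ofNat_ne_zero, not_false_eq_true, zero_pow, mul_zero, zero_add, Real.log_one, sub_zero,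
    one_pow, sub_self] at h0
  refine h0.congr' ?_
  filter_upwards [hl0] with w hw
  simp only [Function.comp]
  have hw2 : (w ^ 2) ≠ 0 := pow_ne_zero _ hw
  have e1 : δ ^ 2 + w ^ 2 = (δ ^ 2 * w⁻¹ ^ 2 + 1) * w ^ 2 := by field_simp
  have e2 : σ ^ 2 + (w - a) ^ 2 = (σ ^ 2 * w⁻¹ ^ 2 + (1 - a * w⁻¹) ^ 2) * w ^ 2 := by field_simp
  have p1 : δ ^ 2 * w⁻¹ ^ 2 + 1 ≠ 0 := by positivity
  have p2 : σ ^ 2 * w⁻¹ ^ 2 + (1 - a * w⁻¹) ^ 2 ≠ 0 := by positivity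
  rw [e1, e2, Real.log_mul p1 hw2, Real.log_mul p2 hw2]
  ring

/-- The semigroup identity `P_σ * Q_δ = Q_{σ + δ}` for the Poisson kernels and their conjugates. -/
lemma integral_cauchyKernel_mul_conjKernel {σ δ : ℝ} (hσ : 0 < σ) (hδ : 0 < δ) (hne : σ ≠ δ) (a : ℝ) :
    ∫ w, σ / (σ ^ 2 + (w - a) ^ 2) * (w / (δ ^ 2 + w ^ 2)) = Real.pi * (a / ((σ + δ) ^ 2 + a ^ 2)) := by
  -- Partial fractions: the integrand equals `(A w + B)/(δ² + w²) + (-A (w - a) + E)/(σ² + (w -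
  -- a)²)`. The condition `σ ≠ δ` keeps the denominator `D` nonzero when `a = 0`.
  set D : ℝ := (a ^ 2 + (σ + δ) ^ 2) * (a ^ 2 + (σ - δ) ^ 2) with hD
  have hD0 : D ≠ 0 := by
    have : 0 < (σ - δ) ^ 2 := by
      have := sub_ne_zero.2 hne
      positivity
    positivity
  set A := σ * (σ ^ 2 - δ ^ 2 + a ^ 2) / D with hA
  set B := -2 * a * σ * δ ^ 2 / D with hB
  set E := σ * a * (δ ^ 2 + a ^ 2 + σ ^ 2) / D with hE
  set Φ : ℝ → ℝ := fun w => A / 2 * (Real.log (δ ^ 2 + w ^ 2) - Real.log (σ ^ 2 + (w - a) ^ 2)) +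
    (B / δ * Real.arctan (w / δ) + E / σ * Real.arctan ((w - a) / σ)) with hΦ
  have hderiv : ∀ w, HasDerivAt Φ (σ / (σ ^ 2 + (w - a) ^ 2) * (w / (δ ^ 2 + w ^ 2))) w := by
    intro w
    have p1 : δ ^ 2 + w ^ 2 ≠ 0 := by positivity
    have p2 : σ ^ 2 + (w - a) ^ 2 ≠ 0 := by positivity
    have d1 : HasDerivAt (fun w : ℝ => δ ^ 2 + w ^ 2) (2 * w) w := by
      simpa using (hasDerivAt_pow 2 w).const_add (δ ^ 2)
    have d0 : HasDerivAt (fun w : ℝ => w - a) 1 w := (hasDerivAt_id w).sub_const a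
    have d2 : HasDerivAt (fun w : ℝ => σ ^ 2 + (w - a) ^ 2) (2 * (w - a)) w := by
      simpa using (d0.pow 2).const_add (σ ^ 2)
    have d3 : HasDerivAt (fun w : ℝ => Real.arctan (w / δ)) (1 / (1 + (w / δ) ^ 2) * (1 / δ)) w :=
      ((hasDerivAt_id w).div_const δ).arctan
    have d4 : HasDerivAt (fun w : ℝ => Real.arctan ((w - a) / σ)) (1 / (1 + ((w - a) / σ) ^ 2) * (1 / σ)) w :=
      (d0.div_const σ).arctan
    have h := (((d1.log p1).sub (d2.log p2)).const_mul (A / 2)).add ((d3.const_mul (B / δ)).add (d4.const_mul (E / σ)))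
    refine h.congr_deriv ?_
    have e3 : 1 / (1 + (w / δ) ^ 2) * (1 / δ) = δ / (δ ^ 2 + w ^ 2) := by field_simp
    have e4 : 1 / (1 + ((w - a) / σ) ^ 2) * (1 / σ) = σ / (σ ^ 2 + (w - a) ^ 2) := by field_simp
    rw [e3, e4]
    have e5 : A / 2 * (2 * w / (δ ^ 2 + w ^ 2) - 2 * (w - a) / (σ ^ 2 + (w - a) ^ 2)) +
        (B / δ * (δ / (δ ^ 2 + w ^ 2)) + E / σ * (σ / (σ ^ 2 + (w - a) ^ 2))) =
        (A * w + B) / (δ ^ 2 + w ^ 2) + (-A * (w - a) + E) / (σ ^ 2 + (w - a) ^ 2) := by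
      field_simp; ring
    rw [e5, div_add_div _ _ p1 p2, div_mul_div_comm, div_eq_div_iff (mul_ne_zero p1 p2) (mul_ne_zero p2 p1)]
    have e6 : (A * w + B) * (σ ^ 2 + (w - a) ^ 2) + (δ ^ 2 + w ^ 2) * (-A * (w - a) + E) = σ * w := by
      rw [hA, hB, hE]
      field_simp
      rw [hD]; ring
    rw [e6]; ring
  have hint : Integrable fun w => σ / (σ ^ 2 + (w - a) ^ 2) * (w / (δ ^ 2 + w ^ 2)) := by
    refine (((integrable_cauchyKernel hσ).comp_sub_right a).mul_const (1 / δ)).mono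
      (by apply Measurable.aestronglyMeasurable; fun_prop) (Eventually.of_forall fun w => ?_)
    rw [norm_mul, norm_mul, Real.norm_of_nonneg (by positivity : 0 ≤ 1 / δ)]
    gcongr
    exact abs_conjKernel_le hδ w
  have htop : Tendsto Φ atTop (𝓝 (A / 2 * 0 + (B / δ * (Real.pi / 2) + E / σ * (Real.pi / 2)))) := by
    refine ((tendsto_log_sub_log hσ hδ tendsto_inv_atTop_zero (eventually_ne_atTop 0)).const_mul _).add
      (Tendsto.add (Tendsto.const_mul _ ?_) (Tendsto.const_mul _ ?_))
    · exact (tendsto_nhds_of_tendsto_nhdsWithin Real.tendsto_arctan_atTop).comp (tendsto_id.atTop_div_const hδ)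
    · exact (tendsto_nhds_of_tendsto_nhdsWithin Real.tendsto_arctan_atTop).comp
        ((tendsto_atTop_add_const_right _ (-a) tendsto_id).atTop_div_const hσ)
  have hbot : Tendsto Φ atBot (𝓝 (A / 2 * 0 + (B / δ * (-(Real.pi / 2)) + E / σ * (-(Real.pi / 2))))) := by
    refine ((tendsto_log_sub_log hσ hδ tendsto_inv_atBot_zero (eventually_ne_atBot 0)).const_mul _).add
      (Tendsto.add (Tendsto.const_mul _ ?_) (Tendsto.const_mul _ ?_))
    · exact (tendsto_nhds_of_tendsto_nhdsWithin Real.tendsto_arctan_atBot).comp (tendsto_id.atBot_div_const hδ)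
    · exact (tendsto_nhds_of_tendsto_nhdsWithin Real.tendsto_arctan_atBot).comp
        ((tendsto_atBot_add_const_right _ (-a) tendsto_id).atBot_div_const hσ)
  rw [integral_of_hasDerivAt_of_tendsto hderiv hint hbot htop]
  -- The logarithms vanish at both ends, and each arctangent increases by `π` over the line.
  have e : B / δ + E / σ = a / ((σ + δ) ^ 2 + a ^ 2) := by
    have h1 : (σ + δ) ^ 2 + a ^ 2 ≠ 0 := by positivity
    rw [hB, hE]
    field_simp
    rw [hD]; ring
  rw [← e]; ring

/-- By the semigroup identity, `π` times the conjugate Poisson integral at height `ε` is the Poisson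
average at height `σ = ε - δ` of the one at height `δ`, hence bounded by its maximal function. The
assumption `2δ < ε` gives `σ > δ`, in particular `σ ≠ δ`. -/
lemma exists_enorm_conjPoisson_le_hlMax : ∃ C : ℝ≥0, ∀ {f : ℝ → ℂ} (_ : IsNice f) {ε δ : ℝ} (_ : 0 < δ) (_ : 2 * δ < ε)
    (x : ℝ), ‖conjPoisson ε f x‖ₑ ≤ C * hlMax (fun w => ‖conjPoisson δ f w‖ₑ) x := by
  obtain ⟨C, hC⟩ := exists_lintegral_cauchy_mul_le
  refine ⟨C, fun {f} hf {ε δ} hδ hε x => ?_⟩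
  set σ := ε - δ with hσ
  have hσ0 : 0 < σ := by linarith
  have hσδ : σ ≠ δ := by linarith
  have hfm := hf.measurable
  have hid : Real.pi * conjPoisson ε f x = ∫ w, ((σ / (σ ^ 2 + (x - w) ^ 2) : ℝ) : ℂ) * conjPoisson δ f w := by
    have hP : Integrable fun w => ((σ / (σ ^ 2 + (x - w) ^ 2) : ℝ) : ℂ) :=
      ((integrable_cauchyKernel hσ0).comp_sub_left x).ofReal
    have hint : Integrable (Function.uncurry fun w y => ((σ / (σ ^ 2 + (x - w) ^ 2) : ℝ) : ℂ) *
        (f y * (((w - y) / (δ ^ 2 + (w - y) ^ 2) : ℝ) : ℂ))) (volume.prod volume) := by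
      refine ((hP.mul_prod hf.integrable).norm.mul_const (1 / δ)).mono ?_ (Eventually.of_forall fun z => ?_)
      · apply Measurable.aestronglyMeasurable
        simp only [Function.uncurry_def]; fun_prop
      · simp only [Function.uncurry_def]
        rw [← mul_assoc, norm_mul, norm_mul _ (1 / δ), norm_norm, Complex.norm_real ((z.1 - z.2) / _),
          Real.norm_of_nonneg (by positivity : 0 ≤ 1 / δ)]
        gcongr
        exact abs_conjKernel_le hδ _
    symm
    calc _ = ∫ w, ∫ y, ((σ / (σ ^ 2 + (x - w) ^ 2) : ℝ) : ℂ) *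
        (f y * (((w - y) / (δ ^ 2 + (w - y) ^ 2) : ℝ) : ℂ)) := by
          congr 1 with w
          rw [integral_const_mul]; rfl
      _ = ∫ y, ∫ w, ((σ / (σ ^ 2 + (x - w) ^ 2) : ℝ) : ℂ) *
        (f y * (((w - y) / (δ ^ 2 + (w - y) ^ 2) : ℝ) : ℂ)) := integral_integral_swap hint
      _ = ∫ y, Real.pi * (f y * (((x - y) / (ε ^ 2 + (x - y) ^ 2) : ℝ) : ℂ)) := by
          congr 1 with y
          have h1 : ∫ w, σ / (σ ^ 2 + (x - w) ^ 2) * ((w - y) / (δ ^ 2 + (w - y) ^ 2)) =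
              Real.pi * ((x - y) / (ε ^ 2 + (x - y) ^ 2)) := by
            have := integral_cauchyKernel_mul_conjKernel hσ0 hδ hσδ (x - y)
            rw [show σ + δ = ε by rw [hσ]; ring] at this
            rw [← this, ← integral_sub_right_eq_self
              (fun w => σ / (σ ^ 2 + (w - (x - y)) ^ 2) * (w / (δ ^ 2 + w ^ 2))) y]
            congr 1 with w
            rw [show (w - y - (x - y)) ^ 2 = (x - w) ^ 2 by ring]
          calc _ = ∫ w, f y * ((σ / (σ ^ 2 + (x - w) ^ 2) * ((w - y) / (δ ^ 2 + (w - y) ^ 2)) : ℝ) : ℂ) := by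
                congr 1 with w; push_cast; ring
            _ = f y * ((Real.pi * ((x - y) / (ε ^ 2 + (x - y) ^ 2)) : ℝ) : ℂ) := by
                rw [integral_const_mul, ← h1]
                congr 1
                exact integral_ofReal
            _ = _ := by push_cast; ring
      _ = _ := by rw [integral_const_mul]; rfl
  have hm := measurable_conjPoisson hfm δ
  have h1 : ‖conjPoisson ε f x‖ₑ ≤ ‖Real.pi * conjPoisson ε f x‖ₑ := by
    rw [enorm_mul]
    refine le_mul_of_one_le_left zero_le ?_
    rw [← ofReal_norm, Complex.norm_real, Real.norm_of_nonneg Real.pi_pos.le, ENNReal.one_le_ofReal]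
    linarith [Real.pi_gt_three]
  refine h1.trans ?_
  rw [hid]
  refine le_trans ?_ (hC σ hσ0 (fun w => ‖conjPoisson δ f w‖ₑ) hm.enorm x)
  refine (enorm_integral_le_lintegral_enorm _).trans (le_of_eq ?_)
  rw [← lintegral_sub_left_eq_self _ x]
  refine lintegral_congr fun w => ?_
  rw [enorm_mul, sub_sub_cancel, ← ofReal_norm (((σ / (σ ^ 2 + w ^ 2) : ℝ) : ℂ)), Complex.norm_real,
    Real.norm_of_nonneg (by positivity)]

/-- The truncated integral `∫_{|t| > ε} φ(t) dt / t`. -/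
def truncIntegral (φ : ℝ → ℂ) (ε : ℝ) : ℂ := ∫ t in {t : ℝ | ε < |t|}, φ t / (t : ℂ)

lemma measurableSet_lt_abs (ε : ℝ) : MeasurableSet {t : ℝ | ε < |t|} :=
  measurableSet_lt measurable_const measurable_abs

/-- The truncated kernel `1/t` differs from `t/(ε² + t²)` by at most the Poisson kernel `ε/(ε² +
t²)`: the difference is `ε²/(t(ε² + t²))` for `|t| > ε` and `-t/(ε² + t²)` for `|t| ≤ ε`. -/
lemma exists_enorm_truncIntegral_sub_le : ∃ C : ℝ≥0, ∀ {f : ℝ → ℂ} (_ : IsNice f) {ε : ℝ} (_ : 0 < ε)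
    (x : ℝ), ‖truncIntegral (fun t => f (x - t)) ε - conjPoisson ε f x‖ₑ ≤ C * hlMax (fun w => ‖f w‖ₑ) x := by
  obtain ⟨C, hC⟩ := exists_lintegral_cauchy_mul_le
  refine ⟨C, fun {f} hf {ε} hε x => ?_⟩
  have hfm := hf.measurable
  have hfi : Integrable fun t => f (x - t) := hf.integrable.comp_sub_left x
  have hQ : conjPoisson ε f x = ∫ t, f (x - t) * ((t / (ε ^ 2 + t ^ 2) : ℝ) : ℂ) := by
    unfold conjPoisson
    rw [← integral_sub_left_eq_self _ volume x]
    simp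
  have hi1 : Integrable fun t => f (x - t) * ((t / (ε ^ 2 + t ^ 2) : ℝ) : ℂ) := by
    have := (hf.integrable_mul_conjKernel hε x).comp_sub_left x
    refine this.congr (Eventually.of_forall fun t => ?_)
    simp
  have hi2 : Integrable ({t : ℝ | ε < |t|}.indicator fun t => f (x - t) / (t : ℂ)) := by
    refine (hfi.norm.mul_const (1 / ε)).mono ?_ (Eventually.of_forall fun t => ?_)
    · exact (Measurable.indicator (by fun_prop) (measurableSet_lt_abs ε)).aestronglyMeasurable
    · rw [norm_mul, norm_norm, Real.norm_of_nonneg (by positivity : 0 ≤ 1 / ε)]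
      by_cases ht : ε < |t|
      · rw [Set.indicator_of_mem (show t ∈ {t : ℝ | ε < |t|} from ht), norm_div, Complex.norm_real, div_eq_mul_one_div,
          Real.norm_eq_abs]
        gcongr
      · rw [Set.indicator_of_notMem (show t ∉ {t : ℝ | ε < |t|} from ht), norm_zero]; positivity
  rw [truncIntegral, ← integral_indicator (measurableSet_lt_abs ε), hQ, ← integral_sub hi2 hi1]
  refine (enorm_integral_le_lintegral_enorm _).trans (le_trans (lintegral_mono fun t => ?_)
    (hC ε hε (fun w => ‖f w‖ₑ) hfm.enorm x))
  rw [← ofReal_norm (f (x - t)), ← ENNReal.ofReal_mul (by positivity), ← ofReal_norm]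
  apply ENNReal.ofReal_le_ofReal
  by_cases ht : ε < |t|
  · have ht0 : t ≠ 0 := by rintro rfl; simp at ht; linarith
    rw [Set.indicator_of_mem (show t ∈ {t : ℝ | ε < |t|} from ht)]
    have e : f (x - t) / (t : ℂ) - f (x - t) * ((t / (ε ^ 2 + t ^ 2) : ℝ) : ℂ) =
        f (x - t) * ((ε ^ 2 / (t * (ε ^ 2 + t ^ 2)) : ℝ) : ℂ) := by
      have h1 : (1 : ℝ) / t - t / (ε ^ 2 + t ^ 2) = ε ^ 2 / (t * (ε ^ 2 + t ^ 2)) := by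
        field_simp; ring
      rw [← h1]; push_cast; ring
    rw [e, norm_mul, mul_comm, Complex.norm_real, Real.norm_eq_abs, abs_div, abs_mul,
      abs_of_pos (by positivity : 0 < ε ^ 2 + t ^ 2), abs_of_pos (by positivity : 0 < ε ^ 2)]
    refine mul_le_mul_of_nonneg_right ?_ (norm_nonneg _)
    rw [div_le_div_iff₀ (by positivity) (by positivity)]
    have : 0 < ε ^ 2 + t ^ 2 := by positivity
    nlinarith [mul_pos hε this]
  · rw [Set.indicator_of_notMem (show t ∉ {t : ℝ | ε < |t|} from ht), zero_sub, norm_neg, norm_mul, mul_comm,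
      Complex.norm_real, Real.norm_eq_abs, abs_div, abs_of_pos (by positivity : 0 < ε ^ 2 + t ^ 2)]
    refine mul_le_mul_of_nonneg_right ?_ (norm_nonneg _)
    gcongr
    exact not_lt.1 ht

/-- Cotlar's inequality. -/
lemma exists_enorm_truncIntegral_le : ∃ C : ℝ≥0, ∀ {f : ℝ → ℂ} (_ : IsNice f) {ε : ℝ} (_ : 0 < ε)
    (x : ℝ), ‖truncIntegral (fun t => f (x - t)) ε‖ₑ ≤
      C * (liminf (fun n : ℕ => hlMax (fun w => ‖conjPoisson ((1 / 2) ^ n) f w‖ₑ) x) atTop + hlMax (fun w => ‖f w‖ₑ) x) := by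
  obtain ⟨C₁, hC₁⟩ := exists_enorm_conjPoisson_le_hlMax
  obtain ⟨C₂, hC₂⟩ := exists_enorm_truncIntegral_sub_le
  refine ⟨C₁ + C₂, fun {f} hf {ε} hε x => ?_⟩
  -- Heights `2^{-n}` stand in for the boundary value as the height tends to zero. The comparison
  -- holds for all large `n`, hence for the lower limit, to which Fatou's lemma applies.
  set M := fun n : ℕ => hlMax (fun w => ‖conjPoisson ((1 / 2) ^ n) f w‖ₑ) x with hM
  have h1 : ‖conjPoisson ε f x‖ₑ ≤ C₁ * liminf M atTop := by
    rw [← ENNReal.liminf_const_mul_of_ne_top (by simp)]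
    refine le_liminf_of_le (by isBoundedDefault) ?_
    have : Tendsto (fun n : ℕ => 2 * (1 / 2 : ℝ) ^ n) atTop (𝓝 (2 * 0)) :=
      (tendsto_pow_atTop_nhds_zero_of_lt_one (by norm_num) (by norm_num)).const_mul 2
    rw [mul_zero] at this
    filter_upwards [this.eventually_lt_const hε] with n hn
    exact hC₁ hf (by positivity) hn x
  calc _ = ‖(truncIntegral (fun t => f (x - t)) ε - conjPoisson ε f x) + conjPoisson ε f x‖ₑ := by rw [sub_add_cancel]
    _ ≤ C₂ * hlMax (fun w => ‖f w‖ₑ) x + C₁ * liminf M atTop :=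
        (enorm_add_le _ _).trans (add_le_add (hC₂ hf hε x) h1)
    _ ≤ _ := by
        push_cast
        rw [mul_add, add_comm]
        gcongr
        · exact le_self_add
        · exact le_add_self

end Cotlar

end

noncomputable section

/-! ### Maximal truncations and almost everywhere convergence in the first variable. -/

section PrincipalValue

/-- For fixed `x` the number `u x` is constant, and `(t, y) ↦ (x - t, y - u(x) t²)` preserves area.
So the integral in `y` and `t` equals `∫ g`, and the inner integral is finite for almost every `y`.
-/
lemma ae_lintegral_parabola_lt_top {u : ℝ → ℝ} (hu : Measurable u) {g : ℝ × ℝ → ℝ≥0∞} (hg : Measurable g)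
    (hfin : ∫⁻ z, g z ≠ ⊤) : ∀ᵐ z : ℝ × ℝ, ∫⁻ t, g (z.1 - t, z.2 - u z.1 * t ^ 2) < ⊤ := by
  have hm : Measurable fun z : ℝ × ℝ => ∫⁻ t, g (z.1 - t, z.2 - u z.1 * t ^ 2) :=
    Measurable.lintegral_prod_right' (f := fun q : (ℝ × ℝ) × ℝ => g (q.1.1 - q.2, q.1.2 - u q.1.1 * q.2 ^ 2))
      (by fun_prop)
  refine (Measure.ae_prod_iff_ae_ae (measurableSet_lt hm measurable_const)).2 (Eventually.of_forall fun x => ?_)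
  refine ae_lt_top (hm.comp measurable_prodMk_left) ?_
  have : ∫⁻ y, ∫⁻ t, g (x - t, y - u x * t ^ 2) = ∫⁻ z, g z := by
    rw [lintegral_lintegral_swap (by apply Measurable.aemeasurable; fun_prop),
      Measure.volume_eq_prod, lintegral_prod _ hg.aemeasurable]
    rw [← lintegral_sub_left_eq_self _ x]
    refine lintegral_congr fun t => ?_
    rw [sub_sub_cancel]
    exact lintegral_sub_right_eq_self (μ := volume) (fun y => g (t, y)) (u x * (x - t) ^ 2)
  exact this.trans_ne hfin

lemma memLp_of_lintegral_rpow {α E : Type*} [MeasurableSpace α] [NormedAddCommGroup E] {μ : Measure α} {p : ℝ} (hp : 0 < p)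
    {a : α → E} (ha : AEStronglyMeasurable a μ) (hfin : ∫⁻ t, ‖a t‖ₑ ^ p ∂μ ≠ ⊤) : MemLp a (ENNReal.ofReal p) μ := by
  refine ⟨ha, ?_⟩
  rw [eLpNorm_lt_top_iff_lintegral_rpow_enorm_lt_top (by simpa using hp) ENNReal.ofReal_ne_top,
    ENNReal.toReal_ofReal hp.le]
  exact hfin.lt_top

lemma integrableOn_of_lintegral_rpow {p : ℝ} (hp : 1 ≤ p) {a : ℝ → ℂ} (ha : Measurable a)
    (hfin : ∫⁻ t, ‖a t‖ₑ ^ p ≠ ⊤) {s : Set ℝ} (hs : volume s ≠ ⊤) : IntegrableOn a s := by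
  have : IsFiniteMeasure (volume.restrict s) := ⟨by simpa using hs.lt_top⟩
  have h := (memLp_of_lintegral_rpow (by linarith) ha.aestronglyMeasurable hfin).restrict s
  exact h.integrable (by simpa using hp)

/-- Young's inequality bounds the integrand by `|a|^p/p + |t|^{-q}/q`, and `|t|⁻¹ ≤ (1 + 1/ε)/(1 +
|t|)` for `|t| > ε` makes the second term integrable. -/
lemma integrableOn_div_of_lintegral_rpow {p : ℝ} (hp : 1 < p) {a : ℝ → ℂ} (ha : Measurable a)
    (hfin : ∫⁻ t, ‖a t‖ₑ ^ p ≠ ⊤) {ε : ℝ} (hε : 0 < ε) : IntegrableOn (fun t => a t / (t : ℂ)) {t : ℝ | ε < |t|} := by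
  have hpq := Real.HolderConjugate.conjExponent hp
  set q := p.conjExponent
  have h1 : Integrable fun t => ‖a t‖ ^ p := by
    have := (memLp_of_lintegral_rpow (by linarith) ha.aestronglyMeasurable hfin).integrable_norm_rpow
      (by simp; linarith) ENNReal.ofReal_ne_top
    rwa [ENNReal.toReal_ofReal (by linarith)] at this
  have h2 : Integrable fun t : ℝ => (1 + ‖t‖) ^ (-q) := integrable_one_add_norm (by simpa using hpq.symm.lt)
  have hq0 := hpq.symm.pos
  refine ((h1.div_const p).add ((h2.const_mul ((1 + 1 / ε) ^ q)).div_const q)).integrableOn.mono'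
    (by apply Measurable.aestronglyMeasurable; fun_prop) ?_
  filter_upwards [ae_restrict_mem (measurableSet_lt_abs ε)] with t ht
  have ht : ε < |t| := ht
  have ht0 : 0 < |t| := hε.trans ht
  rw [norm_div, Complex.norm_real, Real.norm_eq_abs, div_eq_mul_inv]
  refine (Real.young_inequality_of_nonneg (norm_nonneg _) (by positivity) hpq).trans ?_
  simp only [Pi.add_apply]
  refine add_le_add le_rfl (div_le_div_of_nonneg_right ?_ hq0.le)
  rw [Real.rpow_neg (by positivity), ← Real.inv_rpow (by positivity), ← Real.mul_rpow (by positivity) (by positivity)]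
  refine Real.rpow_le_rpow (by positivity) ?_ hq0.le
  rw [← div_eq_mul_inv, inv_le_comm₀ ht0 (by positivity), inv_div, div_le_iff₀ (by positivity), Real.norm_eq_abs]
  have : 1 ≤ |t| * (1 / ε) := by rw [mul_one_div, one_le_div hε]; exact ht.le
  linarith

lemma lintegral_liminf_rpow_le {α : Type*} [MeasurableSpace α] {μ : Measure α} {f : ℕ → α → ℝ≥0∞}
    (hf : ∀ n, Measurable (f n)) {p : ℝ} (hp : 0 < p) {B : ℝ≥0∞} (hB : ∀ n, ∫⁻ x, f n x ^ p ∂μ ≤ B) :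
    ∫⁻ x, (liminf (fun n => f n x) atTop) ^ p ∂μ ≤ B := by
  have h : ∀ x, (liminf (fun n => f n x) atTop) ^ p = liminf (fun n => f n x ^ p) atTop := fun x =>
    OrderIso.liminf_apply (ENNReal.orderIsoRpow p hp) (by isBoundedDefault) (by isBoundedDefault)
      (by isBoundedDefault) (by isBoundedDefault)
  simp_rw [h]
  refine (lintegral_liminf_le fun n => (hf n).pow_const p).trans ?_
  exact liminf_le_of_le (by isBoundedDefault) fun b hb => by
    obtain ⟨n, hn⟩ := hb.exists
    exact hn.trans (hB n)

lemma add_rpow_le_two {p : ℝ} (hp : 1 ≤ p) (a b : ℝ≥0∞) : (a + b) ^ p ≤ 2 ^ (p - 1) * (a ^ p + b ^ p) :=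
  ENNReal.rpow_add_le_mul_rpow_add_rpow a b hp

/-- The maximal Hilbert transform in the first variable is bounded on `L^p(ℝ²)`, with a measurable majorant. -/
lemma exists_maximal_truncIntegral {p : ℝ} (hp : 1 < p) : ∃ C : ℝ≥0, ∀ {F : ℝ × ℝ → ℂ} (_ : Measurable F)
    (_ : ∫⁻ z, ‖F z‖ₑ ^ p ≠ ⊤), ∃ W : ℝ × ℝ → ℝ≥0∞, Measurable W ∧
      (∀ᵐ z : ℝ × ℝ, ∀ ε > 0, ‖truncIntegral (fun t => F (z.1 - t, z.2)) ε‖ₑ ≤ W z) ∧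
      ∫⁻ z, W z ^ p ≤ C * ∫⁻ z, ‖F z‖ₑ ^ p := by
  obtain ⟨C₁, hC₁⟩ := exists_enorm_truncIntegral_le
  obtain ⟨C₂, hC₂⟩ := exists_lintegral_conjPoisson_le hp
  obtain ⟨C₃, hC₃⟩ := exists_lintegral_hlMax₁_rpow_le hp
  have hp0 : 0 < p := by linarith
  refine ⟨C₁ ^ p * (2 ^ (p - 1) * (C₃ * C₂ + C₃)), fun {F} hF hfin => ?_⟩
  -- Truncating in the value of `F` and in the first coordinate only makes every horizontal slice
  -- bounded with bounded support, as Cotlar's inequality requires.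
  set S : ℕ → Set (ℝ × ℝ) := fun m => {z | ‖F z‖ ≤ m ∧ |z.1| ≤ m} with hS
  have hSm : ∀ m, MeasurableSet (S m) := fun m =>
    (measurableSet_le hF.norm measurable_const).inter (measurableSet_le measurable_fst.abs measurable_const)
  set G : ℕ → ℝ × ℝ → ℂ := fun m => (S m).indicator F with hG
  have hGm : ∀ m, Measurable (G m) := fun m => hF.indicator (hSm m)
  have hGle : ∀ m z, ‖G m z‖ₑ ≤ ‖F z‖ₑ := fun m z => enorm_indicator_le_enorm_self _ _
  have hnice : ∀ m y, IsNice fun x => G m (x, y) := fun m y =>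
    ⟨(hGm m).comp measurable_prodMk_right, ⟨m, fun x => by
      by_cases h : (x, y) ∈ S m
      · simp only [hG, Set.indicator_of_mem h]; exact h.1
      · simp [hG, Set.indicator_of_notMem h]⟩, ⟨m, fun x hx => (Set.mem_of_indicator_ne_zero hx).2⟩⟩
  set H : ℕ → ℕ → ℝ × ℝ → ℝ≥0∞ := fun m n z => ‖conjPoisson ((1 / 2) ^ n) (fun x => G m (x, z.2)) z.1‖ₑ with hH
  have hHm : ∀ m n, Measurable (H m n) := fun m n =>
    ((measurable_conjPoisson_param (f := fun q => G m q.swap) ((hGm m).comp measurable_swap)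
      ((1 / 2) ^ n)).comp measurable_swap).enorm
  have hMm : ∀ m n, Measurable (hlMax₁ (H m n)) := fun m n => measurable_hlMax₁ (hHm m n)
  have hF' : Measurable fun z => ‖F z‖ₑ := hF.enorm
  -- The inner lower limit is over the Poisson heights, the outer one over the truncations; Fatou's
  -- lemma is applied to each in `hVp`.
  set V : ℝ × ℝ → ℝ≥0∞ := fun z => liminf (fun m => liminf (fun n => hlMax₁ (H m n) z) atTop) atTop with hV
  have hVm' : ∀ m, Measurable fun z => liminf (fun n => hlMax₁ (H m n) z) atTop := fun m => .liminf (hMm m)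
  have hVm : Measurable V := .liminf hVm'
  set B := ∫⁻ z, ‖F z‖ₑ ^ p with hB
  have hVp : ∫⁻ z, V z ^ p ≤ C₃ * (C₂ * B) := by
    refine lintegral_liminf_rpow_le hVm' hp0 fun m => lintegral_liminf_rpow_le (hMm m) hp0 fun n => ?_
    refine (hC₃ _ (hHm m n)).trans (mul_le_mul_right ?_ _)
    refine (lintegral_prod_le_of_fibers_symm ((hHm m n).pow_const p) ((hGm m).enorm.pow_const p) (C := C₂)
      fun y => hC₂ (hnice m y) (by positivity)).trans (mul_le_mul_right ?_ _)
    exact lintegral_mono fun z => ENNReal.rpow_le_rpow (hGle m z) hp0.le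
  refine ⟨fun z => C₁ * (V z + hlMax₁ (fun z => ‖F z‖ₑ) z), (hVm.add (measurable_hlMax₁ hF')).const_mul _, ?_, ?_⟩
  · filter_upwards [ae_lintegral_parabola_lt_top (u := fun _ => 0) measurable_const (hF'.pow_const p) hfin] with z hz ε hε
    simp only [zero_mul, sub_zero] at hz
    have hint := integrableOn_div_of_lintegral_rpow hp (a := fun t => F (z.1 - t, z.2)) (by fun_prop) hz.ne hε
    have hlim : Tendsto (fun m => truncIntegral (fun t => G m (z.1 - t, z.2)) ε) atTop
        (𝓝 (truncIntegral (fun t => F (z.1 - t, z.2)) ε)) := by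
      refine tendsto_integral_of_dominated_convergence _ (fun m => ?_) hint.norm
        (fun m => Eventually.of_forall fun t => ?_) (Eventually.of_forall fun t => ?_)
      · have := hGm m
        apply Measurable.aestronglyMeasurable; fun_prop
      · rw [norm_div, norm_div]
        gcongr
        exact norm_indicator_le_norm_self _ _
      · refine tendsto_const_nhds.congr' ?_
        filter_upwards [eventually_ge_atTop ⌈max ‖F (z.1 - t, z.2)‖ |z.1 - t|⌉₊] with m hm
        have hm' := max_le_iff.1 (Nat.ceil_le.1 hm)
        simp only [hG, Set.indicator_of_mem (show (z.1 - t, z.2) ∈ S m from hm')]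
    have hcont := hlim.enorm
    rw [← hcont.liminf_eq]
    have hb : ∀ m, ‖truncIntegral (fun t => G m (z.1 - t, z.2)) ε‖ₑ ≤
        C₁ * (liminf (fun n => hlMax₁ (H m n) z) atTop + hlMax₁ (fun z => ‖F z‖ₑ) z) := fun m => by
      refine (hC₁ (hnice m z.2) hε z.1).trans (mul_le_mul_right (add_le_add le_rfl ?_) _)
      exact hlMax_mono (fun x => hGle m (x, z.2)) z.1
    refine (liminf_le_liminf (Eventually.of_forall hb)).trans ?_
    rw [ENNReal.liminf_const_mul_of_ne_top (by simp)]
    refine mul_le_mul_right (le_of_eq ?_) _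
    exact liminf_add_const atTop _ _ (by isBoundedDefault) (by isBoundedDefault)
  · simp only [ENNReal.mul_rpow_of_nonneg _ _ hp0.le]
    rw [lintegral_const_mul _ (by have := measurable_hlMax₁ hF'; fun_prop)]
    rw [ENNReal.coe_mul, mul_assoc, ENNReal.coe_rpow_of_nonneg _ hp0.le]
    refine mul_le_mul_right ?_ _
    refine (lintegral_mono fun z => add_rpow_le_two hp.le _ _).trans ?_
    rw [lintegral_const_mul _ (by have := measurable_hlMax₁ hF'; fun_prop), lintegral_add_left (hVm.pow_const p)]
    rw [ENNReal.coe_mul, mul_assoc, ENNReal.coe_rpow_of_nonneg _ (by linarith)]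
    refine mul_le_mul_right ?_ _
    push_cast
    rw [add_mul, mul_assoc]
    exact add_le_add hVp (hC₃ _ hF')

lemma integral_inv_eq_zero_of_symm {s : Set ℝ} (hs : MeasurableSet s) (hsymm : ∀ t, -t ∈ s ↔ t ∈ s) :
    ∫ t in s, (t : ℂ)⁻¹ = 0 := by
  rw [← integral_indicator hs]
  have h := integral_neg_eq_self (s.indicator fun t : ℝ => (t : ℂ)⁻¹) volume
  have h2 : ∀ t, s.indicator (fun t : ℝ => (t : ℂ)⁻¹) (-t) = -s.indicator (fun t : ℝ => (t : ℂ)⁻¹) t := fun t => by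
    by_cases ht : t ∈ s
    · rw [Set.indicator_of_mem ht, Set.indicator_of_mem ((hsymm t).2 ht)]; push_cast; rw [inv_neg]
    · rw [Set.indicator_of_notMem ht, Set.indicator_of_notMem (fun h => ht ((hsymm t).1 h))]; simp
  simp_rw [h2, integral_neg] at h
  exact self_eq_neg.1 h.symm

/-- Absolutely convergent truncated integrals converge. -/
lemma tendsto_setIntegral_truncated {b : ℝ → ℂ} {s : ℝ} (hb : IntegrableOn b {t | |t| ≤ s}) :
    Tendsto (fun ε => ∫ t in {t : ℝ | ε < |t| ∧ |t| ≤ s}, b t) (𝓝[>] 0) (𝓝 (∫ t in {t | |t| ≤ s}, b t)) := by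
  have hms : MeasurableSet {t : ℝ | |t| ≤ s} := measurableSet_le measurable_abs measurable_const
  have e : ∀ ε, ∫ t in {t : ℝ | ε < |t| ∧ |t| ≤ s}, b t = ∫ t in {t | |t| ≤ s}, {t : ℝ | ε < |t|}.indicator b t :=
    fun ε => by
      rw [setIntegral_indicator (measurableSet_lt_abs ε), Set.inter_comm]; rfl
  simp_rw [e]
  refine tendsto_integral_filter_of_dominated_convergence _ (Eventually.of_forall fun ε =>
    hb.aestronglyMeasurable.indicator (measurableSet_lt_abs ε)) (Eventually.of_forall fun ε => Eventually.of_forall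
    fun t => norm_indicator_le_norm_self _ _) hb.norm ?_
  have h0 : ∀ᵐ t : ℝ ∂(volume.restrict {t | |t| ≤ s}), t ≠ 0 := ae_restrict_of_ae (Measure.ae_ne volume 0)
  filter_upwards [h0] with t ht
  refine tendsto_const_nhds.congr' ?_
  have : ∀ᶠ ε in 𝓝[>] (0 : ℝ), ε < |t| := nhdsWithin_le_nhds (eventually_lt_nhds (abs_pos.2 ht))
  filter_upwards [this] with ε hε
  rw [Set.indicator_of_mem (show t ∈ {t : ℝ | ε < |t|} from hε)]

lemma measurableSet_annulus (ε s : ℝ) : MeasurableSet {t : ℝ | ε < |t| ∧ |t| ≤ s} :=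
  (measurableSet_lt_abs ε).inter (measurableSet_le measurable_abs measurable_const)

lemma truncIntegral_eq_add {φ : ℝ → ℂ} {ε s : ℝ} (hεs : ε ≤ s)
    (hφ : IntegrableOn (fun t => φ t / (t : ℂ)) {t : ℝ | ε < |t|}) :
    truncIntegral φ ε = (∫ t in {t : ℝ | ε < |t| ∧ |t| ≤ s}, φ t / (t : ℂ)) + truncIntegral φ s := by
  have e : {t : ℝ | ε < |t|} = {t : ℝ | ε < |t| ∧ |t| ≤ s} ∪ {t : ℝ | s < |t|} := by
    ext t
    constructor
    · intro h
      rcases le_or_gt |t| s with h' | h'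
      · exact Or.inl ⟨h, h'⟩
      · exact Or.inr h'
    · rintro (h | h)
      · exact h.1
      · exact hεs.trans_lt h
  unfold truncIntegral
  conv_lhs => rw [e]
  rw [setIntegral_union _ (measurableSet_lt_abs s)]
  · exact hφ.mono_set fun t ht => ht.1
  · exact hφ.mono_set fun t (ht : s < |t|) => hεs.trans_lt ht
  · exact Set.disjoint_left.2 fun t h h' => absurd h.2 (not_le.2 h')

/-- Since `1/t` has integral zero over symmetric annuli, `φ` may be replaced by `φ - φ(0)` for `|t|
≤ 1`, and the resulting quotient is bounded by the Lipschitz condition at `0`. -/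
lemma exists_tendsto_truncIntegral_of_le {φ : ℝ → ℂ} (hφm : Measurable φ)
    (hφ : ∀ ε > 0, IntegrableOn (fun t => φ t / (t : ℂ)) {t : ℝ | ε < |t|}) {K : ℝ}
    (hK : ∀ t, ‖φ t - φ 0‖ ≤ K * |t|) : ∃ l, Tendsto (truncIntegral φ) (𝓝[>] 0) (𝓝 l) := by
  have hb : IntegrableOn (fun t => (φ t - φ 0) / (t : ℂ)) {t : ℝ | |t| ≤ 1} := by
    have hv : volume {t : ℝ | |t| ≤ 1} ≠ ⊤ := by
      have : {t : ℝ | |t| ≤ 1} = Set.Icc (-1) 1 := by ext t; exact abs_le (a := t)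
      rw [this]; simp
    refine Measure.integrableOn_of_bounded hv (M := |K|) (by apply Measurable.aestronglyMeasurable; fun_prop)
      (Eventually.of_forall fun t => ?_)
    rw [norm_div, Complex.norm_real, Real.norm_eq_abs]
    exact div_le_of_le_mul₀ (abs_nonneg _) (abs_nonneg _) ((hK t).trans (mul_le_mul_of_nonneg_right (le_abs_self K) (abs_nonneg _)))
  refine ⟨_, ((tendsto_setIntegral_truncated hb).add_const (truncIntegral φ 1)).congr' ?_⟩
  have h1 : ∀ᶠ ε in 𝓝[>] (0 : ℝ), ε < 1 := nhdsWithin_le_nhds (eventually_lt_nhds one_pos)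
  filter_upwards [h1, self_mem_nhdsWithin] with ε hε hε0
  have hε0 : 0 < ε := hε0
  rw [truncIntegral_eq_add hε.le (hφ ε hε0)]
  congr 1
  have hA := measurableSet_annulus ε 1
  have hi1 := (hφ ε hε0).mono_set (fun t ht => ht.1 : {t : ℝ | ε < |t| ∧ |t| ≤ 1} ⊆ _)
  have hi2 := hb.mono_set (fun t ht => ht.2 : {t : ℝ | ε < |t| ∧ |t| ≤ 1} ⊆ _)
  rw [← sub_eq_zero, ← integral_sub hi2 hi1]
  have : ∀ t : ℝ, (φ t - φ 0) / (t : ℂ) - φ t / t = -φ 0 * (t : ℂ)⁻¹ := fun t => by ring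
  simp_rw [this]
  rw [integral_const_mul, integral_inv_eq_zero_of_symm hA (fun t => by
    show (ε < |(-t)| ∧ |(-t)| ≤ 1) ↔ (ε < |t| ∧ |t| ≤ 1)
    rw [abs_neg]), mul_zero]

lemma truncIntegral_sub {φ ψ : ℝ → ℂ} {ε : ℝ} (hφ : IntegrableOn (fun t => φ t / (t : ℂ)) {t : ℝ | ε < |t|})
    (hψ : IntegrableOn (fun t => ψ t / (t : ℂ)) {t : ℝ | ε < |t|}) :
    truncIntegral (fun t => φ t - ψ t) ε = truncIntegral φ ε - truncIntegral ψ ε := by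
  unfold truncIntegral
  rw [← integral_sub hφ hψ]
  simp_rw [sub_div]

/-- Density argument: the limit exists everywhere for smooth compactly supported `g n`, and the
truncations of `F - g n` are bounded by a majorant `W n` whose `L^p` norm tends to zero. Hence the
truncations of `F` are Cauchy almost everywhere. -/
lemma ae_exists_tendsto_truncIntegral {p : ℝ} (hp : 1 < p) {F : ℝ × ℝ → ℂ} (hF : Measurable F)
    (hfin : ∫⁻ z, ‖F z‖ₑ ^ p ≠ ⊤) :
    ∀ᵐ z : ℝ × ℝ, ∃ l, Tendsto (truncIntegral (fun t => F (z.1 - t, z.2))) (𝓝[>] 0) (𝓝 l) := by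
  obtain ⟨C, hC⟩ := exists_maximal_truncIntegral hp
  have hp0 : 0 < p := by linarith
  have hL := memLp_of_lintegral_rpow hp0 hF.aestronglyMeasurable hfin
  have happ : ∀ n : ℕ, ∃ g : ℝ × ℝ → ℂ, HasCompactSupport g ∧ ContDiff ℝ ∞ g ∧
      ∫⁻ z, ‖F z - g z‖ₑ ^ p ≤ ENNReal.ofReal ((1 / 2) ^ n) := by
    intro n
    obtain ⟨g, h1, h2, h3⟩ := hL.exist_eLpNorm_sub_le ENNReal.ofReal_ne_top (by simpa using hp.le)
      (ε := ((1 / 2) ^ n) ^ (1 / p)) (by positivity)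
    refine ⟨g, h1, h2, ?_⟩
    rw [eLpNorm_eq_lintegral_rpow_enorm_toReal (by simpa using hp0) ENNReal.ofReal_ne_top,
      ENNReal.toReal_ofReal hp0.le, ← ENNReal.ofReal_rpow_of_nonneg (by positivity) (by positivity),
      ENNReal.rpow_le_rpow_iff (by positivity)] at h3
    exact h3
  choose g hgc hgs hgL using happ
  have hgm : ∀ n, Measurable (g n) := fun n => (hgs n).continuous.measurable
  have hdm : ∀ n, Measurable fun z => F z - g n z := fun n => hF.sub (hgm n)
  have hdfin : ∀ n, ∫⁻ z, ‖F z - g n z‖ₑ ^ p ≠ ⊤ := fun n => ((hgL n).trans_lt ENNReal.ofReal_lt_top).ne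
  choose W hWm hWb hWp using fun n => hC (hdm n) (hdfin n)
  -- The infimum of the majorants suffices: for each tolerance a single good `n` may be chosen
  -- depending on `z`.
  have hW0 : ∀ᵐ z, ⨅ n, W n z = 0 := by
    have hm : Measurable fun z => (⨅ n, W n z) ^ p := (Measurable.iInf hWm).pow_const p
    have h0 : ∫⁻ z, (⨅ n, W n z) ^ p = 0 := by
      refine le_antisymm (ge_of_tendsto' (x := atTop) (f := fun n : ℕ => (C : ℝ≥0∞) * ENNReal.ofReal ((1 / 2) ^ n)) ?_
        fun n => ?_) zero_le
      · have : Tendsto (fun n : ℕ => ENNReal.ofReal ((1 / 2 : ℝ) ^ n)) atTop (𝓝 (ENNReal.ofReal 0)) :=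
          ENNReal.tendsto_ofReal (tendsto_pow_atTop_nhds_zero_of_lt_one (by norm_num) (by norm_num))
        rw [ENNReal.ofReal_zero] at this
        simpa using ENNReal.Tendsto.const_mul this (Or.inr ENNReal.coe_ne_top)
      · refine (lintegral_mono fun z => ENNReal.rpow_le_rpow (iInf_le _ n) hp0.le).trans ((hWp n).trans ?_)
        exact mul_le_mul_right (hgL n) _
    filter_upwards [(lintegral_eq_zero_iff hm).1 h0] with z hz
    exact (ENNReal.rpow_eq_zero_iff_of_pos hp0).1 hz
  have hgi : ∀ n (z : ℝ × ℝ), ∀ ε > 0, IntegrableOn (fun t => g n (z.1 - t, z.2) / (t : ℂ)) {t : ℝ | ε < |t|} := by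
    intro n z ε hε
    refine integrableOn_div_of_lintegral_rpow hp (by have := hgm n; fun_prop) ?_ hε
    have hc : HasCompactSupport fun t => g n (z.1 - t, z.2) := by
      refine HasCompactSupport.of_support_subset_isCompact
        ((hgc n).isCompact.image (f := fun q : ℝ × ℝ => z.1 - q.1) (by fun_prop)) fun t ht => ?_
      exact ⟨(z.1 - t, z.2), subset_tsupport _ ht, by simp⟩
    have hcont : Continuous fun t => g n (z.1 - t, z.2) := (hgs n).continuous.comp (by fun_prop)
    have := (hcont.memLp_of_hasCompactSupport hc (p := ENNReal.ofReal p) (μ := volume)).2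
    rw [eLpNorm_lt_top_iff_lintegral_rpow_enorm_lt_top (by simpa using hp0) ENNReal.ofReal_ne_top,
      ENNReal.toReal_ofReal hp0.le] at this
    exact this.ne
  have hglim : ∀ n (z : ℝ × ℝ), ∃ l, Tendsto (truncIntegral (fun t => g n (z.1 - t, z.2))) (𝓝[>] 0) (𝓝 l) := by
    intro n z
    obtain ⟨K, hK⟩ := (hgs n).lipschitzWith_of_hasCompactSupport (hgc n) (by simp)
    refine exists_tendsto_truncIntegral_of_le (by have := hgm n; fun_prop) (hgi n z) (K := K) fun t => ?_
    have := hK.dist_le_mul (z.1 - t, z.2) (z.1 - 0, z.2)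
    rw [dist_eq_norm] at this
    refine this.trans (le_of_eq ?_)
    simp [Prod.dist_eq]
  filter_upwards [hW0, ae_all_iff.2 hWb, ae_lintegral_parabola_lt_top (u := fun _ => 0) measurable_const
    (hF.enorm.pow_const p) hfin] with z hz0 hzb hzF
  simp only [zero_mul, sub_zero] at hzF
  have hint : ∀ ε > 0, IntegrableOn (fun t => F (z.1 - t, z.2) / (t : ℂ)) {t : ℝ | ε < |t|} := fun ε hε =>
    integrableOn_div_of_lintegral_rpow hp (by fun_prop) hzF.ne hε
  rw [← cauchy_map_iff_exists_tendsto, Metric.cauchy_iff]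
  refine ⟨inferInstance, fun δ hδ => ?_⟩
  obtain ⟨n, hn⟩ := iInf_lt_iff.1 (hz0.trans_lt (ENNReal.ofReal_pos.2 (by positivity : 0 < δ / 4)))
  obtain ⟨l, hl⟩ := hglim n z
  have h1 : ∀ᶠ ε in 𝓝[>] (0 : ℝ), dist (truncIntegral (fun t => F (z.1 - t, z.2)) ε) l < δ / 2 := by
    filter_upwards [Metric.tendsto_nhds.1 hl (δ / 4) (by positivity), self_mem_nhdsWithin] with ε h2 hε
    have hε : 0 < ε := hε
    have h3 := (hzb n ε hε).trans_lt hn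
    rw [truncIntegral_sub (hint ε hε) (hgi n z ε hε), ← ofReal_norm, ENNReal.ofReal_lt_ofReal_iff (by positivity),
      ← dist_eq_norm] at h3
    have := dist_triangle (truncIntegral (fun t => F (z.1 - t, z.2)) ε) (truncIntegral (fun t => g n (z.1 - t, z.2)) ε) l
    linarith
  refine ⟨_, image_mem_map h1, ?_⟩
  rintro _ ⟨a, ha, rfl⟩ _ ⟨b, hb, rfl⟩
  have ha : dist _ _ < _ := ha
  have hb : dist _ _ < _ := hb
  have := dist_triangle_right (truncIntegral (fun t => F (z.1 - t, z.2)) a) (truncIntegral (fun t => F (z.1 - t, z.2)) b) l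
  linarith

end PrincipalValue

end

noncomputable section

/-! ### Plancherel's theorem and the kernel of `P_k`. -/

section LittlewoodPaley

/-- Plancherel's theorem for integrable square-integrable functions. -/
lemma lintegral_enorm_fourier_sq {g : ℝ → ℂ} (h1 : Integrable g) (h2 : MemLp g 2 volume) :
    ∫⁻ η, ‖𝓕 g η‖ₑ ^ 2 = ∫⁻ y, ‖g y‖ₑ ^ 2 := by
  set G : Lp ℂ 2 (volume : Measure ℝ) := h2.toLp g with hG
  have hcont : Continuous (𝓕 g) := VectorFourier.fourierIntegral_continuous Real.continuous_fourierChar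
    (by exact continuous_inner) h1
  -- The `L²` Fourier transform agrees with the Fourier integral since both have the same pairing
  -- with every smooth compactly supported function, by transposition of the transform.
  have hae : ∀ᵐ η, (𝓕 G : Lp ℂ 2 (volume : Measure ℝ)) η = 𝓕 g η := by
    refine ae_eq_of_integral_contDiff_smul_eq ((Lp.memLp (𝓕 G)).locallyIntegrable (by norm_num))
      hcont.locallyIntegrable fun h hh hc => ?_
    have hc' : HasCompactSupport fun x => ((h x : ℝ) : ℂ) := hc.comp_left (g := fun t : ℝ => (t : ℂ)) (by simp)
    set S := hc'.toSchwartzMap (Complex.ofRealCLM.contDiff.comp hh) with hS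
    have e1 : ∫ x, h x • (𝓕 G : Lp ℂ 2 (volume : Measure ℝ)) x =
        Lp.toTemperedDistribution (𝓕 G : Lp ℂ 2 (volume : Measure ℝ)) S := by
      rw [Lp.toTemperedDistribution_apply]; rfl
    rw [e1, ← Lp.fourier_toTemperedDistribution_eq, TemperedDistribution.fourier_apply,
      Lp.toTemperedDistribution_apply]
    have e2 : ∫ x, (𝓕 S) x • (G : ℝ → ℂ) x = ∫ x, 𝓕 (S : ℝ → ℂ) x • g x := by
      refine integral_congr_ae ?_
      filter_upwards [h2.coeFn_toLp] with x hx
      rw [hG, hx, SchwartzMap.fourier_coe]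
    rw [e2]
    have := VectorFourier.integral_fourierIntegral_smul_eq_flip (L := innerₗ ℝ) (μ := volume) (ν := volume)
      Real.continuous_fourierChar (by exact continuous_inner) S.integrable h1
    rw [show (innerₗ ℝ : ℝ →ₗ[ℝ] ℝ →ₗ[ℝ] ℝ).flip = innerₗ ℝ from flip_innerₗ ℝ] at this
    exact this
  have hnorm : eLpNorm (𝓕 G : Lp ℂ 2 (volume : Measure ℝ)) 2 volume = eLpNorm g 2 volume := by
    have h := Lp.norm_fourier_eq G
    rw [Lp.norm_def, Lp.norm_def, ENNReal.toReal_eq_toReal_iff' (Lp.eLpNorm_ne_top _) (Lp.eLpNorm_ne_top _)] at h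
    rw [h]
    exact eLpNorm_congr_ae h2.coeFn_toLp
  rw [eLpNorm_congr_ae hae, eLpNorm_eq_lintegral_rpow_enorm_toReal (by norm_num) (by norm_num),
    eLpNorm_eq_lintegral_rpow_enorm_toReal (by norm_num) (by norm_num)] at hnorm
  have := ENNReal.rpow_left_injective (by norm_num : (1 / (2 : ℝ≥0∞).toReal) ≠ 0) hnorm
  simpa using this

lemma lintegral_enorm_fourierInv_sq {g : ℝ → ℂ} (h1 : Integrable g) (h2 : MemLp g 2 volume) :
    ∫⁻ η, ‖𝓕⁻ g η‖ₑ ^ 2 = ∫⁻ y, ‖g y‖ₑ ^ 2 := by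
  rw [← lintegral_enorm_fourier_sq h1 h2]
  simp_rw [Real.fourierInv_eq_fourier_neg]
  exact lintegral_neg_eq_self (fun η => ‖𝓕 g η‖ₑ ^ 2)

lemma IsLPBump.hasCompactSupport {φ₀ : ℝ → ℝ} (h : IsLPBump φ₀) : HasCompactSupport φ₀ :=
  HasCompactSupport.of_support_subset_isCompact (isCompact_Icc.union isCompact_Icc) h.support_subset

lemma IsLPBump.exists_schwartzMap {φ₀ : ℝ → ℝ} (h : IsLPBump φ₀) : ∃ K : SchwartzMap ℝ ℂ, ⇑K = lpKernel φ₀ 0 := by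
  have hc' : HasCompactSupport fun x => ((φ₀ x : ℝ) : ℂ) := h.hasCompactSupport.comp_left (g := fun t : ℝ => (t : ℂ)) (by simp)
  refine ⟨𝓕⁻ (hc'.toSchwartzMap (Complex.ofRealCLM.contDiff.comp h.smooth)), ?_⟩
  rw [SchwartzMap.fourierInv_coe, lpKernel]
  congr 1
  ext x
  simp only [zpow_zero, div_one]
  rfl

lemma lpKernel_eq (φ₀ : ℝ → ℝ) (k : ℤ) (t : ℝ) :
    lpKernel φ₀ k t = ((2 : ℝ) ^ k : ℝ) * lpKernel φ₀ 0 ((2 : ℝ) ^ k * t) := by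
  have hR : (0 : ℝ) < 2 ^ k := by positivity
  simp only [lpKernel, Real.fourierInv_eq', zpow_zero, div_one]
  have := Measure.integral_comp_div (fun η : ℝ => Complex.exp (↑(2 * Real.pi * inner ℝ η ((2 : ℝ) ^ k * t)) * Complex.I) •
    ((φ₀ η : ℝ) : ℂ)) ((2 : ℝ) ^ k)
  rw [abs_of_pos hR, ← Complex.coe_smul, smul_eq_mul] at this
  rw [← this]
  congr 1 with η
  congr 4
  simp
  field_simp

lemma SchwartzMap.exists_norm_le_div_one_add_sq (K : SchwartzMap ℝ ℂ) : ∃ C : ℝ, 0 ≤ C ∧ ∀ t, ‖K t‖ ≤ C / (1 + t ^ 2) := by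
  obtain ⟨C₀, h₀⟩ := K.decay 0 0
  obtain ⟨C₂, h₂⟩ := K.decay 2 0
  refine ⟨C₀ + C₂, add_nonneg h₀.1.le h₂.1.le, fun t => ?_⟩
  have a := h₀.2 t
  have b := h₂.2 t
  rw [norm_iteratedFDeriv_zero] at a b
  rw [le_div_iff₀ (by positivity)]
  rw [Real.norm_eq_abs, sq_abs] at b
  linarith

/-- Size and smoothness of the Littlewood-Paley kernels. -/
lemma IsLPBump.exists_kernel_bounds {φ₀ : ℝ → ℝ} (h : IsLPBump φ₀) : ∃ C : ℝ≥0,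
    (∀ (k : ℤ) (t : ℝ), ‖lpKernel φ₀ k t‖ ≤ C * ((2 : ℝ) ^ k / (1 + ((2 : ℝ) ^ k * t) ^ 2))) ∧
    ∀ (k : ℤ) (t b : ℝ), (2 : ℝ) ^ k * |b| ≤ 1 → ‖lpKernel φ₀ k (t - b) - lpKernel φ₀ k t‖ ≤
      C * ((2 : ℝ) ^ k * |b|) * ((2 : ℝ) ^ k / (1 + ((2 : ℝ) ^ k * t) ^ 2)) := by
  obtain ⟨K, hK⟩ := h.exists_schwartzMap
  obtain ⟨C, hC0, hC⟩ := SchwartzMap.exists_norm_le_div_one_add_sq K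
  obtain ⟨C', hC0', hC'⟩ := SchwartzMap.exists_norm_le_div_one_add_sq (SchwartzMap.derivCLM ℝ ℂ K)
  refine ⟨⟨C + 3 * C', by positivity⟩, fun k t => ?_, fun k t b hb => ?_⟩
  · rw [lpKernel_eq, ← hK, norm_mul, Complex.norm_real, Real.norm_of_nonneg (by positivity)]
    have := hC ((2 : ℝ) ^ k * t)
    calc _ ≤ (2 : ℝ) ^ k * (C / (1 + ((2 : ℝ) ^ k * t) ^ 2)) := by gcongr
      _ = C * ((2 : ℝ) ^ k / (1 + ((2 : ℝ) ^ k * t) ^ 2)) := by ring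
      _ ≤ _ := by
        refine mul_le_mul_of_nonneg_right ?_ (by positivity)
        show C ≤ C + 3 * C'
        linarith
  · set R : ℝ := (2 : ℝ) ^ k with hR
    have hR0 : 0 < R := by positivity
    have hb' : |R * b| ≤ 1 := by rwa [abs_mul, abs_of_pos hR0]
    -- Mean value inequality. On the segment `|s - R t| ≤ 1`, so `1 + (R t)² ≤ 3 (1 + s²)`, and the
    -- decay of the derivative at `s` transfers to `R t` with a factor `3`.
    have hd : ‖K (R * t - R * b) - K (R * t)‖ ≤ 3 * C' / (1 + (R * t) ^ 2) * ‖(R * t - R * b) - R * t‖ := by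
      refine (convex_segment (R * t) (R * t - R * b)).norm_image_sub_le_of_norm_deriv_le (𝕜 := ℝ) (f := K)
        (fun s _ => K.differentiableAt) (fun s hs => ?_) (left_mem_segment _ _ _) (right_mem_segment _ _ _)
      have h1 := hC' s
      rw [SchwartzMap.derivCLM_apply] at h1
      refine h1.trans ?_
      have hs' : |s - R * t| ≤ 1 := by
        rw [segment_eq_uIcc] at hs
        have := Set.abs_sub_left_of_mem_uIcc hs
        have e : |R * t - R * b - R * t| = |R * b| := by rw [← abs_neg]; congr 1; ring
        linarith
      rw [div_le_div_iff₀ (by positivity) (by positivity)]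
      have : 1 + (R * t) ^ 2 ≤ 3 * (1 + s ^ 2) := by
        have := abs_le.1 hs'
        nlinarith [sq_nonneg (2 * s - R * t)]
      nlinarith
    rw [lpKernel_eq, lpKernel_eq φ₀ k t, ← hK, ← mul_sub, norm_mul, Complex.norm_real, ← hR, Real.norm_of_nonneg hR0.le,
      mul_sub]
    rw [show R * t - R * b - R * t = -(R * b) by ring, norm_neg, Real.norm_eq_abs, abs_mul, abs_of_pos hR0] at hd
    calc _ ≤ R * (3 * C' / (1 + (R * t) ^ 2) * (R * |b|)) := by gcongr
      _ = 3 * C' * (R * |b|) * (R / (1 + (R * t) ^ 2)) := by ring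
      _ ≤ _ := by
        refine mul_le_mul_of_nonneg_right (mul_le_mul_of_nonneg_right ?_ (by positivity)) (by positivity)
        show 3 * C' ≤ C + 3 * C'
        linarith

lemma IsLPBump.continuous_lpKernel {φ₀ : ℝ → ℝ} (h : IsLPBump φ₀) (k : ℤ) : Continuous (lpKernel φ₀ k) := by
  obtain ⟨K, hK⟩ := h.exists_schwartzMap
  have : lpKernel φ₀ k = fun t => (((2 : ℝ) ^ k : ℝ) : ℂ) * K ((2 : ℝ) ^ k * t) := by
    ext t; rw [lpKernel_eq, hK]
  rw [this]
  have := K.continuous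
  fun_prop

lemma IsLPBump.measurable_lpProj {φ₀ : ℝ → ℝ} (h : IsLPBump φ₀) (k : ℤ) {f : ℝ × ℝ → ℂ} (hf : Measurable f) :
    Measurable (lpProj φ₀ k f) := by
  have hK := (h.continuous_lpKernel k).measurable
  have : StronglyMeasurable fun z : ℝ × ℝ => ∫ t, f (z.1, z.2 - t) * lpKernel φ₀ k t :=
    StronglyMeasurable.integral_prod_right (f := fun (z : ℝ × ℝ) (t : ℝ) => f (z.1, z.2 - t) * lpKernel φ₀ k t)
      (Measurable.stronglyMeasurable (by simp only [Function.uncurry_def]; fun_prop))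
  exact this.measurable

lemma div_one_add_sq_eq {R : ℝ} (hR : 0 < R) (t : ℝ) : R / (1 + (R * t) ^ 2) = R⁻¹ / (R⁻¹ ^ 2 + t ^ 2) := by
  field_simp

/-- Integrals against the Littlewood-Paley kernel are controlled by the maximal function. -/
lemma IsLPBump.exists_lintegral_kernel_shift_le {φ₀ : ℝ → ℝ} (h : IsLPBump φ₀) : ∃ C : ℝ≥0, ∀ (k : ℤ) (g : ℝ → ℝ≥0∞),
    Measurable g → ∀ y a, ∫⁻ t, g (y - a - t) * ‖lpKernel φ₀ k t‖ₑ ≤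
      C * ENNReal.ofReal (1 + ((2 : ℝ) ^ k * a) ^ 2) * hlMax g y := by
  obtain ⟨C₁, hC₁, -⟩ := h.exists_kernel_bounds
  obtain ⟨C₂, hC₂⟩ := exists_lintegral_cauchy_mul_le
  refine ⟨C₁ * 2 * C₂, fun k g hg y a => ?_⟩
  set R : ℝ := (2 : ℝ) ^ k with hR
  have hR0 : 0 < R := by positivity
  have hshift : ∫⁻ t, g (y - a - t) * ‖lpKernel φ₀ k t‖ₑ = ∫⁻ t, g (y - t) * ‖lpKernel φ₀ k (t - a)‖ₑ := by
    rw [← lintegral_sub_right_eq_self _ a]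
    simp only [sub_sub, add_sub_cancel]
  rw [hshift]
  have hb : ∀ t, ‖lpKernel φ₀ k (t - a)‖ₑ ≤ ENNReal.ofReal (C₁ * 2 * (1 + (R * a) ^ 2)) *
      ENNReal.ofReal (R⁻¹ / (R⁻¹ ^ 2 + t ^ 2)) := fun t => by
    rw [← ofReal_norm, ← ENNReal.ofReal_mul (by positivity), ← div_one_add_sq_eq hR0]
    refine ENNReal.ofReal_le_ofReal ((hC₁ k (t - a)).trans ?_)
    rw [← hR, mul_assoc (C₁ : ℝ), mul_assoc (C₁ : ℝ)]
    refine mul_le_mul_of_nonneg_left ?_ C₁.2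
    rw [mul_div_assoc', div_le_div_iff₀ (by positivity) (by positivity)]
    -- A shift by `a` costs only the polynomial factor `1 + (2^k a)²`: the decay centred at `a` is
    -- compared with the decay centred at `0`.
    have : 1 + (R * t) ^ 2 ≤ 2 * (1 + (R * a) ^ 2) * (1 + (R * (t - a)) ^ 2) := by
      nlinarith [sq_nonneg (R * a - R * (t - a)), sq_nonneg (R * a * (R * (t - a)))]
    nlinarith
  calc _ ≤ ∫⁻ t, ENNReal.ofReal (C₁ * 2 * (1 + (R * a) ^ 2)) *
      (ENNReal.ofReal (R⁻¹ / (R⁻¹ ^ 2 + t ^ 2)) * g (y - t)) := by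
        refine lintegral_mono fun t => ?_
        rw [mul_comm, ← mul_assoc]
        exact mul_le_mul_left (hb t) _
    _ = ENNReal.ofReal (C₁ * 2 * (1 + (R * a) ^ 2)) *
      ∫⁻ t, (ENNReal.ofReal (R⁻¹ / (R⁻¹ ^ 2 + t ^ 2)) * g (y - t)) :=
        lintegral_const_mul' _ _ ENNReal.ofReal_ne_top
    _ ≤ ENNReal.ofReal (C₁ * 2 * (1 + (R * a) ^ 2)) * (C₂ * hlMax g y) :=
        mul_le_mul_right (hC₂ _ (by positivity) g hg y) _
    _ = _ := by
        rw [ENNReal.ofReal_mul (by positivity), ENNReal.ofReal_mul (by positivity), ENNReal.ofReal_coe_nnreal,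
          ENNReal.ofReal_ofNat]
        push_cast
        ring

lemma IsLPBump.integrable_lpProj {φ₀ : ℝ → ℝ} (h : IsLPBump φ₀) (k : ℤ) {f : ℝ × ℝ → ℂ} (hf : Measurable f)
    {z : ℝ × ℝ} (hz : hlMax₂ (fun w => ‖f w‖ₑ) z ≠ ⊤) (a : ℝ) :
    Integrable fun t => f (z.1, z.2 - a - t) * lpKernel φ₀ k t := by
  obtain ⟨C, hC⟩ := h.exists_lintegral_kernel_shift_le
  have hK := (h.continuous_lpKernel k).measurable
  refine ⟨by apply Measurable.aestronglyMeasurable; fun_prop, ?_⟩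
  have := hC k (fun y => ‖f (z.1, y)‖ₑ) (by fun_prop) z.2 a
  simp_rw [← enorm_mul] at this
  exact this.trans_lt (ENNReal.mul_lt_top (ENNReal.mul_lt_top (by simp) (by simp)) hz.lt_top)

lemma IsLPBump.exists_enorm_lpProj_shift_le {φ₀ : ℝ → ℝ} (h : IsLPBump φ₀) : ∃ C : ℝ≥0, ∀ (k : ℤ) {f : ℝ × ℝ → ℂ},
    Measurable f → ∀ (x y a : ℝ), ‖lpProj φ₀ k f (x, y - a)‖ₑ ≤
      C * ENNReal.ofReal (1 + ((2 : ℝ) ^ k * a) ^ 2) * hlMax₂ (fun w => ‖f w‖ₑ) (x, y) := by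
  obtain ⟨C, hC⟩ := h.exists_lintegral_kernel_shift_le
  refine ⟨C, fun k {f} hf x y a => ?_⟩
  refine (enorm_integral_le_lintegral_enorm _).trans ?_
  simp_rw [enorm_mul]
  exact hC k (fun y => ‖f (x, y)‖ₑ) (by fun_prop) y a

lemma IsLPBump.exists_enorm_lpProj_sub_le {φ₀ : ℝ → ℝ} (h : IsLPBump φ₀) : ∃ C : ℝ≥0, ∀ (k : ℤ) {f : ℝ × ℝ → ℂ},
    Measurable f → ∀ (x y a : ℝ), (2 : ℝ) ^ k * |a| ≤ 1 → ‖lpProj φ₀ k f (x, y - a) - lpProj φ₀ k f (x, y)‖ₑ ≤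
      C * ENNReal.ofReal ((2 : ℝ) ^ k * |a|) * hlMax₂ (fun w => ‖f w‖ₑ) (x, y) := by
  obtain ⟨C₁, -, hC₁⟩ := h.exists_kernel_bounds
  obtain ⟨C₂, hC₂⟩ := exists_lintegral_cauchy_mul_le
  -- The summand `1` makes the constant nonzero, so that the right side is infinite when the maximal
  -- function is infinite and `a ≠ 0`.
  refine ⟨C₁ * C₂ + 1, fun k {f} hf x y a ha => ?_⟩
  set R : ℝ := (2 : ℝ) ^ k with hR
  have hR0 : 0 < R := by positivity
  rcases eq_or_ne a 0 with rfl | ha0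
  · simp
  by_cases htop : hlMax₂ (fun w => ‖f w‖ₑ) (x, y) = ⊤
  · rw [htop, ENNReal.mul_top]
    · exact le_top
    · have : 0 < R * |a| := by positivity
      simp [ha0, hR0]
  have hi1 : Integrable fun t => f (x, y - t) * lpKernel φ₀ k (t - a) := by
    have := (h.integrable_lpProj k hf htop a).comp_sub_right a
    refine this.congr (Eventually.of_forall fun t => ?_)
    simp [sub_sub]
  have hi2 : Integrable fun t => f (x, y - t) * lpKernel φ₀ k t := by
    simpa using h.integrable_lpProj k hf htop 0
  have hs : lpProj φ₀ k f (x, y - a) = ∫ t, f (x, y - t) * lpKernel φ₀ k (t - a) := by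
    unfold lpProj
    rw [← integral_sub_right_eq_self _ a]
    simp [sub_sub]
  rw [hs, lpProj, ← integral_sub hi1 hi2]
  refine (enorm_integral_le_lintegral_enorm _).trans ?_
  calc _ ≤ ∫⁻ t, ENNReal.ofReal (C₁ * (R * |a|)) *
      (ENNReal.ofReal (R⁻¹ / (R⁻¹ ^ 2 + t ^ 2)) * ‖f (x, y - t)‖ₑ) := by
        refine lintegral_mono fun t => ?_
        rw [← mul_sub, enorm_mul, mul_comm, ← mul_assoc]
        refine mul_le_mul_left ?_ _
        rw [← ofReal_norm, ← ENNReal.ofReal_mul (by positivity), ← div_one_add_sq_eq hR0]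
        exact ENNReal.ofReal_le_ofReal (hC₁ k t a ha)
    _ = ENNReal.ofReal (C₁ * (R * |a|)) *
      ∫⁻ t, (ENNReal.ofReal (R⁻¹ / (R⁻¹ ^ 2 + t ^ 2)) * ‖f (x, y - t)‖ₑ) :=
        lintegral_const_mul' _ _ ENNReal.ofReal_ne_top
    _ ≤ ENNReal.ofReal (C₁ * (R * |a|)) * (C₂ * hlMax₂ (fun w => ‖f w‖ₑ) (x, y)) :=
        mul_le_mul_right (hC₂ _ (by positivity) (fun y => ‖f (x, y)‖ₑ) (by fun_prop) y) _
    _ = (C₁ * C₂ : ℝ≥0) * ENNReal.ofReal (R * |a|) * hlMax₂ (fun w => ‖f w‖ₑ) (x, y) := by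
        rw [ENNReal.ofReal_mul (by positivity), ENNReal.ofReal_coe_nnreal]
        push_cast
        ring
    _ ≤ _ := by gcongr; exact le_self_add

end LittlewoodPaley

end

noncomputable section

/-! ### The `L²` bound with oscillatory gain for a single scale. -/

section ScaleOperatorL2

/-- The average of `F` over the piece of the parabola through `z` at a single scale. -/
def scaleOp (ρ r v : ℝ → ℝ) (F : ℝ × ℝ → ℂ) (z : ℝ × ℝ) : ℂ :=
  ∫ τ in Set.Ioc (1 / 2 : ℝ) 1, (ρ τ : ℂ) * F (z.1 - r z.1 * τ, z.2 - v z.1 * τ ^ 2)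

lemma measurable_scaleOp {ρ r v : ℝ → ℝ} (hρ : Measurable ρ) (hr : Measurable r) (hv : Measurable v) {F : ℝ × ℝ → ℂ}
    (hF : Measurable F) : Measurable (scaleOp ρ r v F) := by
  have : StronglyMeasurable fun z : ℝ × ℝ => ∫ τ in Set.Ioc (1 / 2 : ℝ) 1,
      (ρ τ : ℂ) * F (z.1 - r z.1 * τ, z.2 - v z.1 * τ ^ 2) :=
    StronglyMeasurable.integral_prod_right
      (f := fun (z : ℝ × ℝ) (τ : ℝ) => (ρ τ : ℂ) * F (z.1 - r z.1 * τ, z.2 - v z.1 * τ ^ 2))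
      (Measurable.stronglyMeasurable (by simp only [Function.uncurry_def]; fun_prop))
  exact this.measurable

lemma IsNice.slice {f : ℝ × ℝ → ℂ} (hf : IsNice f) (x : ℝ) : IsNice fun y => f (x, y) where
  measurable := hf.measurable.comp measurable_prodMk_left
  bounded := hf.bounded.imp fun _ h y => h (x, y)
  support := hf.support.imp fun _ h y hy => (le_max_right _ _).trans (h (x, y) hy)

lemma IsNice.memLp_two {f : ℝ → ℂ} (hf : IsNice f) : MemLp f 2 volume := by
  rw [memLp_two_iff_integrable_sq_norm hf.measurable.aestronglyMeasurable]
  obtain ⟨B, hB⟩ := hf.bounded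
  refine (hf.integrable.norm.const_mul B).mono' (by have := hf.measurable; apply Measurable.aestronglyMeasurable; fun_prop)
    (Eventually.of_forall fun x => ?_)
  rw [Real.norm_of_nonneg (by positivity), sq]
  exact mul_le_mul_of_nonneg_right (hB x) (norm_nonneg _)

lemma IsNice.mul_of_bounded {α : Type*} [MeasurableSpace α] [Norm α] {f g : α → ℂ} (hf : IsNice f) (hg : Measurable g)
    {B : ℝ} (hB : ∀ x, ‖g x‖ ≤ B) : IsNice fun x => f x * g x where
  measurable := hf.measurable.mul hg
  bounded := by
    obtain ⟨M, hM⟩ := hf.bounded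
    refine ⟨M * B, fun x => ?_⟩
    rw [norm_mul]
    exact mul_le_mul (hM x) (hB x) (norm_nonneg _) ((norm_nonneg _).trans (hM x))
  support := hf.support.imp fun L hL x hx => hL x (left_ne_zero_of_mul hx)

lemma measurable_fourier_slice {f : ℝ × ℝ → ℂ} (hf : Measurable f) :
    Measurable fun q : ℝ × ℝ => 𝓕 (fun s => f (q.1, s)) q.2 := by
  simp only [Real.fourier_eq']
  have : StronglyMeasurable fun q : ℝ × ℝ => ∫ s, Complex.exp (↑(-2 * Real.pi * inner ℝ s q.2) * Complex.I) • f (q.1, s) :=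
    StronglyMeasurable.integral_prod_right
      (f := fun (q : ℝ × ℝ) (s : ℝ) => Complex.exp (↑(-2 * Real.pi * inner ℝ s q.2) * Complex.I) • f (q.1, s))
      (Measurable.stronglyMeasurable (by simp only [Function.uncurry_def]; fun_prop))
  exact this.measurable

lemma IsNice.exists_norm_fourier_slice_le {f : ℝ × ℝ → ℂ} (hf : IsNice f) :
    ∃ B, 0 ≤ B ∧ ∀ x η, ‖𝓕 (fun s => f (x, s)) η‖ ≤ B := by
  obtain ⟨B, hB⟩ := hf.bounded
  obtain ⟨L, hL⟩ := hf.support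
  refine ⟨∫ s, (Set.Icc (-L) L).indicator (fun _ => |B|) s, integral_nonneg fun s =>
    Set.indicator_nonneg (fun _ _ => abs_nonneg B) s, fun x η => ?_⟩
  rw [Real.fourier_eq']
  refine norm_integral_le_of_norm_le ((integrable_indicator_iff measurableSet_Icc).2 (by simp))
    (Eventually.of_forall fun s => ?_)
  rw [norm_smul, Complex.norm_exp_ofReal_mul_I, one_mul]
  by_cases h : f (x, s) = 0
  · rw [h, norm_zero]; exact Set.indicator_nonneg (fun _ _ => abs_nonneg B) s
  · have hs : s ∈ Set.Icc (-L) L := abs_le.1 ((le_max_right _ _).trans (hL (x, s) h))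
    rw [Set.indicator_of_mem hs]
    exact (hB _).trans (le_abs_self B)

lemma IsLPBump.continuous_dilate {φ₀ : ℝ → ℝ} (h : IsLPBump φ₀) (k : ℤ) :
    Continuous fun η : ℝ => ((φ₀ (η / (2 : ℝ) ^ k) : ℝ) : ℂ) := by
  have := h.smooth.continuous
  fun_prop

lemma IsLPBump.isNice_dilate {φ₀ : ℝ → ℝ} (h : IsLPBump φ₀) (k : ℤ) :
    IsNice fun η : ℝ => ((φ₀ (η / (2 : ℝ) ^ k) : ℝ) : ℂ) where
  measurable := (h.continuous_dilate k).measurable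
  bounded := by
    obtain ⟨B, hB⟩ := h.hasCompactSupport.exists_bound_of_continuous h.smooth.continuous
    exact ⟨B, fun η => by rw [Complex.norm_real]; exact hB _⟩
  support := by
    refine ⟨5 / 2 * 2 ^ k, fun η hη => ?_⟩
    have h0 : η / (2 : ℝ) ^ k ∈ Function.support φ₀ := fun h0 => hη (by rw [h0]; simp)
    have hR : (0 : ℝ) < 2 ^ k := by positivity
    rcases h.support_subset h0 with h1 | h1
    · have a := (div_le_iff₀ hR).1 h1.2
      have b := (le_div_iff₀ hR).1 h1.1
      rw [Real.norm_eq_abs, abs_le]; constructor <;> nlinarith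
    · have a := (div_le_iff₀ hR).1 h1.2
      have b := (le_div_iff₀ hR).1 h1.1
      rw [Real.norm_eq_abs, abs_le]; constructor <;> nlinarith

lemma IsLPBump.le_abs_of_ne_zero {φ₀ : ℝ → ℝ} (h : IsLPBump φ₀) {k : ℤ} {η : ℝ} (hη : φ₀ (η / (2 : ℝ) ^ k) ≠ 0) :
    (2 : ℝ) ^ k / 2 ≤ |η| := by
  have hR : (0 : ℝ) < 2 ^ k := by positivity
  rcases h.support_subset hη with h1 | h1
  · have a := (div_le_iff₀ hR).1 h1.2
    linarith [neg_le_abs η]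
  · have b := (le_div_iff₀ hR).1 h1.1
    linarith [le_abs_self η]

/-- Convolution with the kernel becomes multiplication by the bump on the Fourier side of the second
variable; Fubini applies because both `f` on the slice and the bump are integrable. -/
lemma IsLPBump.lpProj_eq_integral {φ₀ : ℝ → ℝ} (h : IsLPBump φ₀) (k : ℤ) {f : ℝ × ℝ → ℂ} (hf : IsNice f) (x y : ℝ) :
    lpProj φ₀ k f (x, y) = ∫ η, ((φ₀ (η / (2 : ℝ) ^ k) : ℝ) : ℂ) *
      (Complex.exp (↑(2 * Real.pi * (η * y)) * Complex.I) * 𝓕 (fun s => f (x, s)) η) := by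
  have hfx := hf.slice x
  have hfm := hfx.measurable
  have hφ := (h.isNice_dilate k)
  have hφm := hφ.measurable
  have hφ₀m : Measurable φ₀ := h.smooth.continuous.measurable
  have hint : Integrable (Function.uncurry fun t η : ℝ => f (x, y - t) *
      (Complex.exp (↑(2 * Real.pi * inner ℝ η t) * Complex.I) • ((φ₀ (η / (2 : ℝ) ^ k) : ℝ) : ℂ))) (volume.prod volume) := by
    refine ((hfx.integrable.comp_sub_left y).mul_prod hφ.integrable).mono ?_ (Eventually.of_forall fun q => ?_)
    · apply Measurable.aestronglyMeasurable
      simp only [Function.uncurry_def]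
      exact (hfm.comp (by fun_prop : Measurable fun p : ℝ × ℝ => y - p.1)).mul
        (Measurable.smul (f := fun p : ℝ × ℝ => Complex.exp (↑(2 * Real.pi * inner ℝ p.2 p.1) * Complex.I))
          (g := fun p : ℝ × ℝ => ((φ₀ (p.2 / (2 : ℝ) ^ k) : ℝ) : ℂ)) (by fun_prop) (by fun_prop))
    · simp only [Function.uncurry_def]
      rw [norm_mul, norm_mul, norm_smul, Complex.norm_exp_ofReal_mul_I, one_mul]
  calc lpProj φ₀ k f (x, y) = ∫ t, ∫ η, f (x, y - t) *
      (Complex.exp (↑(2 * Real.pi * inner ℝ η t) * Complex.I) • ((φ₀ (η / (2 : ℝ) ^ k) : ℝ) : ℂ)) := by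
        unfold lpProj lpKernel
        simp only [Real.fourierInv_eq', integral_const_mul]
    _ = ∫ η, ∫ t, f (x, y - t) *
      (Complex.exp (↑(2 * Real.pi * inner ℝ η t) * Complex.I) • ((φ₀ (η / (2 : ℝ) ^ k) : ℝ) : ℂ)) := integral_integral_swap hint
    _ = _ := by
        congr 1 with η
        rw [Real.fourier_eq', ← integral_const_mul, ← integral_const_mul, ← integral_sub_left_eq_self _ volume y]
        congr 1 with t
        rw [sub_sub_cancel]
        simp only [smul_eq_mul, RCLike.inner_apply, conj_trivial]
        have : Complex.exp (↑(2 * Real.pi * ((y - t) * η)) * Complex.I) =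
            Complex.exp (↑(2 * Real.pi * (η * y)) * Complex.I) * Complex.exp (↑(-2 * Real.pi * (η * t)) * Complex.I) := by
          rw [← Complex.exp_add]; congr 1; push_cast; ring
        rw [this]; ring

lemma IsAmplitude.norm_le {ρ ρ' : ℝ → ℝ} (hρ : IsAmplitude ρ ρ') {τ : ℝ} (hτ : τ ∈ Set.Ioc (1 / 2 : ℝ) 1) :
    ‖(ρ τ : ℂ)‖ ≤ 2 := by
  rw [Complex.norm_real]
  exact hρ.abs_le τ (Set.Ioc_subset_Icc_self hτ)

/-- The chirp integral of the partial Fourier transform of `f`, which describes `scaleOp` on the Fourier side. -/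
def scaleSymbol (ρ r v : ℝ → ℝ) (f : ℝ × ℝ → ℂ) (x η : ℝ) : ℂ :=
  ∫ τ in Set.Ioc (1 / 2 : ℝ) 1, (ρ τ : ℂ) * Complex.exp (Complex.I * ((-2 * Real.pi * η * v x * τ ^ 2 : ℝ) : ℂ)) *
    𝓕 (fun s => f (x - r x * τ, s)) η

lemma measurable_scaleSymbol {ρ r v : ℝ → ℝ} (hρ : Measurable ρ) (hr : Measurable r) (hv : Measurable v) {f : ℝ × ℝ → ℂ}
    (hf : Measurable f) : Measurable fun q : ℝ × ℝ => scaleSymbol ρ r v f q.1 q.2 := by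
  have hF := measurable_fourier_slice hf
  have : StronglyMeasurable fun q : ℝ × ℝ => scaleSymbol ρ r v f q.1 q.2 := by
    refine StronglyMeasurable.integral_prod_right (f := fun (q : ℝ × ℝ) (τ : ℝ) => (ρ τ : ℂ) *
      Complex.exp (Complex.I * ((-2 * Real.pi * q.2 * v q.1 * τ ^ 2 : ℝ) : ℂ)) *
      𝓕 (fun s => f (q.1 - r q.1 * τ, s)) q.2) (Measurable.stronglyMeasurable ?_)
    simp only [Function.uncurry_def]
    refine Measurable.mul (by fun_prop) ?_
    exact hF.comp (f := fun a : (ℝ × ℝ) × ℝ => (a.1.1 - r a.1.1 * a.2, a.1.2)) (by fun_prop)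
  exact this.measurable

/-- The vertical displacement `v(x) τ²` does not depend on `y`, so on the Fourier side it becomes
the modulation `e^{-2πi η v(x) τ²}`. This reduces the planar operator to one-dimensional chirp
integrals, one for each `η`. -/
lemma scaleOp_lpProj_eq_fourierInv {φ₀ : ℝ → ℝ} (h : IsLPBump φ₀) (k : ℤ) {f : ℝ × ℝ → ℂ} (hf : IsNice f) {ρ ρ' r v : ℝ → ℝ}
    (hρ : IsAmplitude ρ ρ') (x y : ℝ) : scaleOp ρ r v (lpProj φ₀ k f) (x, y) =
      𝓕⁻ (fun η => ((φ₀ (η / (2 : ℝ) ^ k) : ℝ) : ℂ) * scaleSymbol ρ r v f x η) y := by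
  obtain ⟨B, hB0, hB⟩ := hf.exists_norm_fourier_slice_le
  have hφ := (h.isNice_dilate k)
  have hφm := hφ.measurable
  have hφ₀m : Measurable φ₀ := h.smooth.continuous.measurable
  have hρm := hρ.measurable
  have hF := measurable_fourier_slice hf.measurable
  have hint : Integrable (Function.uncurry fun τ η : ℝ => (ρ τ : ℂ) * (((φ₀ (η / (2 : ℝ) ^ k) : ℝ) : ℂ) *
      (Complex.exp (((2 * Real.pi * (η * (y - v x * τ ^ 2)) : ℝ) : ℂ) * Complex.I) * 𝓕 (fun s => f (x - r x * τ, s)) η)))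
      ((volume.restrict (Set.Ioc (1 / 2 : ℝ) 1)).prod volume) := by
    have hc : Integrable (fun _ : ℝ => ((2 * B : ℝ) : ℂ)) (volume.restrict (Set.Ioc (1 / 2 : ℝ) 1)) := integrable_const _
    refine (hc.mul_prod hφ.integrable).mono ?_ ?_
    · apply Measurable.aestronglyMeasurable
      simp only [Function.uncurry_def]
      refine Measurable.mul (by fun_prop) (Measurable.mul (by fun_prop) (Measurable.mul (by fun_prop) ?_))
      exact hF.comp (f := fun a : ℝ × ℝ => (x - r x * a.1, a.2)) (by fun_prop)
    · have : ∀ᵐ q : ℝ × ℝ ∂((volume.restrict (Set.Ioc (1 / 2 : ℝ) 1)).prod volume), q.1 ∈ Set.Ioc (1 / 2 : ℝ) 1 :=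
        Measure.quasiMeasurePreserving_fst.ae (ae_restrict_mem measurableSet_Ioc)
      filter_upwards [this] with q hq
      simp only [Function.uncurry_def]
      rw [norm_mul, norm_mul, norm_mul, norm_mul, Complex.norm_exp_ofReal_mul_I, one_mul, Complex.norm_real (2 * B),
        Real.norm_of_nonneg (by positivity)]
      calc _ ≤ 2 * (‖((φ₀ (q.2 / (2 : ℝ) ^ k) : ℝ) : ℂ)‖ * B) := by
            gcongr
            · exact hρ.norm_le hq
            · exact hB _ _
        _ = _ := by ring
  calc _ = ∫ τ in Set.Ioc (1 / 2 : ℝ) 1, ∫ η, (ρ τ : ℂ) * (((φ₀ (η / (2 : ℝ) ^ k) : ℝ) : ℂ) *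
      (Complex.exp (((2 * Real.pi * (η * (y - v x * τ ^ 2)) : ℝ) : ℂ) * Complex.I) * 𝓕 (fun s => f (x - r x * τ, s)) η)) := by
        unfold scaleOp
        simp only [h.lpProj_eq_integral k hf, integral_const_mul]
    _ = ∫ η, ∫ τ in Set.Ioc (1 / 2 : ℝ) 1, (ρ τ : ℂ) * (((φ₀ (η / (2 : ℝ) ^ k) : ℝ) : ℂ) *
      (Complex.exp (((2 * Real.pi * (η * (y - v x * τ ^ 2)) : ℝ) : ℂ) * Complex.I) * 𝓕 (fun s => f (x - r x * τ, s)) η)) :=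
        integral_integral_swap hint
    _ = _ := by
        rw [Real.fourierInv_eq']
        congr 1 with η
        unfold scaleSymbol
        rw [smul_eq_mul, ← integral_const_mul, ← integral_const_mul]
        congr 1 with τ
        simp only [RCLike.inner_apply, conj_trivial]
        have : Complex.exp (((2 * Real.pi * (η * (y - v x * τ ^ 2)) : ℝ) : ℂ) * Complex.I) =
            Complex.exp (((2 * Real.pi * (y * η) : ℝ) : ℂ) * Complex.I) *
              Complex.exp (Complex.I * ((-2 * Real.pi * η * v x * τ ^ 2 : ℝ) : ℂ)) := by
          rw [← Complex.exp_add]; congr 1; push_cast; ring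
        rw [this]; ring

/-- The `L²` estimate with oscillatory gain for the single scale operator. -/
lemma exists_lintegral_scaleOp_sq_le {φ₀ : ℝ → ℝ} (h : IsLPBump φ₀) : ∃ C : ℝ≥0, ∀ {ρ ρ' : ℝ → ℝ} (_ : IsAmplitude ρ ρ')
    (k : ℤ) {r v : ℝ → ℝ} (_ : Measurable r) (_ : Measurable v) {E : Set ℝ} (_ : MeasurableSet E)
    (_ : ∀ x ∈ E, ∀ x' ∈ E, 0 < r x * r x') {Λ : ℝ} (_ : 0 < Λ) (_ : ∀ x ∈ E, Λ ≤ (2 : ℝ) ^ k * |v x|)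
    {f : ℝ × ℝ → ℂ} (_ : IsNice f),
    ∫⁻ z in E ×ˢ Set.univ, ‖scaleOp ρ r v (lpProj φ₀ k f) z‖ₑ ^ 2 ≤ C * ENNReal.ofReal (1 / √Λ) * ∫⁻ z, ‖f z‖ₑ ^ 2 := by
  obtain ⟨C, hC⟩ := exists_lintegral_chirp_sq_le
  obtain ⟨M, hM⟩ := h.hasCompactSupport.exists_bound_of_continuous h.smooth.continuous
  refine ⟨Real.toNNReal (M ^ 2) * C, fun {ρ ρ'} hρ k {r v} hr hv {E} hE hrr {Λ} hΛ hvΛ {f} hf => ?_⟩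
  have hfm := hf.measurable
  have hR0 : (0 : ℝ) < 2 ^ k := by positivity
  obtain ⟨B, hB0, hB⟩ := hf.exists_norm_fourier_slice_le
  have hφ := (h.isNice_dilate k)
  have hF := measurable_fourier_slice hfm
  have hFη : ∀ η, Measurable fun x => 𝓕 (fun s => f (x, s)) η := fun η => by
    exact hF.comp (f := fun x : ℝ => (x, η)) measurable_prodMk_right
  have hFs : Measurable fun q : ℝ × ℝ => ‖𝓕 (fun s => f (q.2, s)) q.1‖ₑ ^ 2 := by
    exact (hF.comp (f := fun q : ℝ × ℝ => (q.2, q.1)) measurable_swap).enorm.pow_const 2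
  have hSm := measurable_scaleSymbol hρ.measurable hr hv hfm
  have hSb : ∀ x η, ‖scaleSymbol ρ r v f x η‖ ≤ 2 * B := fun x η => by
    have := norm_setIntegral_le_of_norm_le_const (μ := volume) (s := Set.Ioc (1 / 2 : ℝ) 1) (C := 2 * B)
      (f := fun τ => (ρ τ : ℂ) * Complex.exp (Complex.I * ((-2 * Real.pi * η * v x * τ ^ 2 : ℝ) : ℂ)) *
        𝓕 (fun s => f (x - r x * τ, s)) η) (by simp) fun τ hτ => by
        rw [norm_mul, norm_mul, mul_comm Complex.I, Complex.norm_exp_ofReal_mul_I, mul_one]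
        exact mul_le_mul (hρ.norm_le hτ) (hB _ _) (norm_nonneg _) (by norm_num)
    refine this.trans ?_
    rw [Measure.real, Real.volume_Ioc, ENNReal.toReal_ofReal (by norm_num)]
    linarith
  have hSx : ∀ x, Measurable (scaleSymbol ρ r v f x) := fun x => hSm.of_uncurry_left
  have hmx : ∀ x, IsNice fun η => ((φ₀ (η / (2 : ℝ) ^ k) : ℝ) : ℂ) * scaleSymbol ρ r v f x η := by
    intro x
    exact hφ.mul_of_bounded (hSx x) (hSb x)
  have hAm : Measurable (scaleOp ρ r v (lpProj φ₀ k f)) := measurable_scaleOp hρ.measurable hr hv (h.measurable_lpProj k hfm)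
  set N : Set ℝ := {η | (2 : ℝ) ^ k / 2 ≤ |η|} with hN
  have hNm : MeasurableSet N := measurableSet_le measurable_const measurable_abs
  have hrest : (volume : Measure (ℝ × ℝ)).restrict (E ×ˢ Set.univ) = (volume.restrict E).prod volume := by
    rw [Measure.volume_eq_prod, ← Measure.prod_restrict, Measure.restrict_univ]
  calc ∫⁻ z in E ×ˢ Set.univ, ‖scaleOp ρ r v (lpProj φ₀ k f) z‖ₑ ^ 2
      = ∫⁻ x in E, ∫⁻ y, ‖scaleOp ρ r v (lpProj φ₀ k f) (x, y)‖ₑ ^ 2 := by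
        rw [hrest, lintegral_prod _ (by fun_prop)]
    -- Plancherel in `y` for fixed `x`. The bump is bounded by `M` and restricts the frequencies to
    -- `|η| ≥ 2^{k-1}`.
    _ ≤ ∫⁻ x in E, ∫⁻ η in N, ENNReal.ofReal (M ^ 2) * ‖scaleSymbol ρ r v f x η‖ₑ ^ 2 := by
        refine lintegral_mono fun x => ?_
        simp_rw [scaleOp_lpProj_eq_fourierInv h k hf hρ]
        rw [lintegral_enorm_fourierInv_sq (hmx x).integrable (hmx x).memLp_two, ← lintegral_indicator hNm]
        refine lintegral_mono fun η => ?_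
        by_cases h0 : φ₀ (η / (2 : ℝ) ^ k) = 0
        · simp [h0]
        rw [Set.indicator_of_mem (show η ∈ N from h.le_abs_of_ne_zero h0), enorm_mul, mul_pow]
        refine mul_le_mul_left ?_ _
        rw [← ofReal_norm, Complex.norm_real, ← ENNReal.ofReal_pow (norm_nonneg _)]
        exact ENNReal.ofReal_le_ofReal (pow_le_pow_left₀ (norm_nonneg _) (hM _) 2)
    _ = ∫⁻ η in N, ENNReal.ofReal (M ^ 2) * ∫⁻ x in E, ‖scaleSymbol ρ r v f x η‖ₑ ^ 2 := by
        rw [lintegral_lintegral_swap (by apply Measurable.aemeasurable; simp only [Function.uncurry_def]; fun_prop)]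
        refine lintegral_congr fun η => ?_
        rw [lintegral_const_mul' _ _ ENNReal.ofReal_ne_top]
    _ ≤ ∫⁻ η in N, ENNReal.ofReal (M ^ 2) * (C * ENNReal.ofReal (1 / √Λ) * ∫⁻ x, ‖𝓕 (fun s => f (x, s)) η‖ₑ ^ 2) := by
        refine setLIntegral_mono' hNm fun η hη => mul_le_mul_right ?_ _
        -- The chirp frequency satisfies `2π|η||v(x)| ≥ π 2^k |v(x)| ≥ Λ`.
        refine hC hρ (l := fun x => -2 * Real.pi * η * v x) hr (by fun_prop) hE hrr hΛ (fun x hx => ?_)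
          (g := fun x => 𝓕 (fun s => f (x, s)) η) (hFη η) (fun x => hB x η)
        rw [abs_mul, abs_mul, abs_mul, abs_neg, abs_two, abs_of_pos Real.pi_pos]
        refine (hvΛ x hx).trans (mul_le_mul_of_nonneg_right ?_ (abs_nonneg _))
        have hη : (2 : ℝ) ^ k / 2 ≤ |η| := hη
        nlinarith [Real.pi_gt_three, abs_nonneg η]
    _ ≤ ∫⁻ η, ENNReal.ofReal (M ^ 2) * (C * ENNReal.ofReal (1 / √Λ) * ∫⁻ x, ‖𝓕 (fun s => f (x, s)) η‖ₑ ^ 2) :=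
        setLIntegral_le_lintegral _ _
    _ = ENNReal.ofReal (M ^ 2) * (C * ENNReal.ofReal (1 / √Λ)) * ∫⁻ η, ∫⁻ x, ‖𝓕 (fun s => f (x, s)) η‖ₑ ^ 2 := by
        simp_rw [← mul_assoc]
        rw [lintegral_const_mul' _ _ (by finiteness)]
    _ = ENNReal.ofReal (M ^ 2) * (C * ENNReal.ofReal (1 / √Λ)) * ∫⁻ z, ‖f z‖ₑ ^ 2 := by
        rw [lintegral_lintegral_swap hFs.aemeasurable]
        rw [Measure.volume_eq_prod, lintegral_prod _ (by fun_prop)]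
        congr 1
        refine lintegral_congr fun x => ?_
        exact lintegral_enorm_fourier_sq (hf.slice x).integrable (hf.slice x).memLp_two
    _ = _ := by
        push_cast
        rw [ENNReal.ofReal, mul_assoc (_ : ℝ≥0∞) (C : ℝ≥0∞)]

end ScaleOperatorL2

end

noncomputable section

/-! ### Pointwise bounds for a single scale and splitting of functions. -/

section ScaleOperatorLp

lemma lintegral_comp_mul_left {r : ℝ} (hr : r ≠ 0) {g : ℝ → ℝ≥0∞} (hg : Measurable g) :
    ∫⁻ τ, g (r * τ) = ENNReal.ofReal |r|⁻¹ * ∫⁻ t, g t := by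
  rw [← lintegral_map hg (measurable_const_mul r), Real.map_volume_mul_left hr, lintegral_smul_measure, abs_inv,
    smul_eq_mul]

/-- Averages over a piece of a dyadic segment are controlled by the maximal function. -/
lemma setLIntegral_Ioc_mul_le_hlMax {g : ℝ → ℝ≥0∞} (hg : Measurable g) {r : ℝ} {i : ℤ} (hr : |r| = 2 ^ i) (x : ℝ) :
    ∫⁻ τ in Set.Ioc (1 / 2 : ℝ) 1, g (x - r * τ) ≤ hlMax g x := by
  have hi : (0 : ℝ) < 2 ^ i := by positivity
  have hr0 : r ≠ 0 := abs_pos.1 (hr ▸ hi)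
  calc _ ≤ ∫⁻ τ, (Set.Icc (-(2 : ℝ) ^ i) (2 ^ i)).indicator (fun t => g (x - t)) (r * τ) := by
        rw [← lintegral_indicator measurableSet_Ioc]
        refine lintegral_mono fun τ => ?_
        by_cases hτ : τ ∈ Set.Ioc (1 / 2 : ℝ) 1
        · have : r * τ ∈ Set.Icc (-(2 : ℝ) ^ i) (2 ^ i) := by
            rw [Set.mem_Icc, ← abs_le, abs_mul, hr, abs_of_pos (by linarith [hτ.1])]
            nlinarith [hτ.2]
          rw [Set.indicator_of_mem hτ, Set.indicator_of_mem this]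
        · rw [Set.indicator_of_notMem hτ]; exact zero_le
    _ = ENNReal.ofReal (2 ^ (-i)) * ∫⁻ t in Set.Icc (-(2 : ℝ) ^ i) (2 ^ i), g (x - t) := by
        rw [lintegral_comp_mul_left hr0 (Measurable.indicator (by fun_prop) measurableSet_Icc),
          lintegral_indicator measurableSet_Icc, hr, zpow_neg]
    _ ≤ _ := lintegral_Icc_le_hlMax g x i

/-- The scale data of the `l`-th dyadic piece of the parabolas away from the vertex. -/
structure IsScale (k : ℤ) (l : ℕ) (r v : ℝ → ℝ) (E : Set ℝ) : Prop where
  measurable_fst : Measurable r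
  measurable_snd : Measurable v
  measurableSet : MeasurableSet E
  mul_pos : ∀ x ∈ E, ∀ x' ∈ E, 0 < r x * r x'
  dyadic : ∀ x ∈ E, ∃ i : ℤ, |r x| = 2 ^ i
  le_mul : ∀ x ∈ E, (4 : ℝ) ^ l / 4 ≤ (2 : ℝ) ^ k * |v x|
  mul_le : ∀ x ∈ E, (2 : ℝ) ^ k * |v x| ≤ (4 : ℝ) ^ l

/-- The displacement `v(x) τ²` is at most `4^l` vertical wavelengths `2^{-k}`, and the shifted
kernel loses the square of this number, `16^l`. -/
lemma IsLPBump.exists_enorm_lpProj_parabola_le {φ₀ : ℝ → ℝ} (h : IsLPBump φ₀) : ∃ C : ℝ≥0, ∀ {k : ℤ} {l : ℕ} {r v : ℝ → ℝ}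
    {E : Set ℝ} (_ : IsScale k l r v E) {f : ℝ × ℝ → ℂ} (_ : Measurable f) {x : ℝ} (_ : x ∈ E) (y : ℝ) {τ : ℝ}
    (_ : τ ∈ Set.Ioc (1 / 2 : ℝ) 1),
    ‖lpProj φ₀ k f (x - r x * τ, y - v x * τ ^ 2)‖ₑ ≤ C * ENNReal.ofReal (16 ^ l) *
      hlMax₂ (fun w => ‖f w‖ₑ) (x - r x * τ, y) := by
  obtain ⟨C, hC⟩ := h.exists_enorm_lpProj_shift_le
  refine ⟨C * 2, ?_⟩
  intro k l r v E hs f hf x hx y τ hτ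
  refine (hC k hf _ y _).trans (mul_le_mul_left ?_ _)
  have h4 : (1 : ℝ) ≤ 4 ^ l := one_le_pow₀ (by norm_num)
  have h1 : |(2 : ℝ) ^ k * (v x * τ ^ 2)| ≤ 4 ^ l := by
    rw [abs_mul, abs_mul, abs_of_nonneg (sq_nonneg τ), abs_of_pos (by positivity), ← mul_assoc]
    have h2 : τ ^ 2 ≤ 1 := pow_le_one₀ (by linarith [hτ.1]) hτ.2
    calc _ ≤ (4 : ℝ) ^ l * 1 := mul_le_mul (hs.mul_le x hx) h2 (by positivity) (by positivity)
      _ = _ := mul_one _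
  have h3 : ENNReal.ofReal (1 + ((2 : ℝ) ^ k * (v x * τ ^ 2)) ^ 2) ≤ 2 * ENNReal.ofReal (16 ^ l) := by
    rw [← ENNReal.ofReal_ofNat 2, ← ENNReal.ofReal_mul (by norm_num)]
    refine ENNReal.ofReal_le_ofReal ?_
    have e : (16 : ℝ) ^ l = (4 ^ l) ^ 2 := by rw [← pow_mul, mul_comm, pow_mul]; norm_num
    rw [e, ← sq_abs ((2 : ℝ) ^ k * (v x * τ ^ 2))]
    nlinarith [abs_nonneg ((2 : ℝ) ^ k * (v x * τ ^ 2))]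
  push_cast
  rw [mul_assoc]
  exact mul_le_mul_right h3 _

lemma IsAmplitude.enorm_le {ρ ρ' : ℝ → ℝ} (hρ : IsAmplitude ρ ρ') {τ : ℝ} (hτ : τ ∈ Set.Ioc (1 / 2 : ℝ) 1) :
    ‖(ρ τ : ℂ)‖ₑ ≤ 2 := by
  rw [← ofReal_norm, ← ENNReal.ofReal_ofNat 2]
  exact ENNReal.ofReal_le_ofReal (hρ.norm_le hτ)

lemma enorm_scaleOp_le {ρ ρ' r v : ℝ → ℝ} (hρ : IsAmplitude ρ ρ') (F : ℝ × ℝ → ℂ) (z : ℝ × ℝ) :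
    ‖scaleOp ρ r v F z‖ₑ ≤ 2 * ∫⁻ τ in Set.Ioc (1 / 2 : ℝ) 1, ‖F (z.1 - r z.1 * τ, z.2 - v z.1 * τ ^ 2)‖ₑ := by
  refine (enorm_integral_le_lintegral_enorm _).trans ?_
  rw [← lintegral_const_mul' _ _ (by norm_num)]
  refine setLIntegral_mono' measurableSet_Ioc fun τ hτ => ?_
  rw [enorm_mul]
  exact mul_le_mul_left (hρ.enorm_le hτ) _

lemma IsLPBump.exists_lintegral_scale_le {φ₀ : ℝ → ℝ} (h : IsLPBump φ₀) : ∃ C : ℝ≥0, ∀ {k : ℤ} {l : ℕ} {r v : ℝ → ℝ}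
    {E : Set ℝ} (_ : IsScale k l r v E) {f : ℝ × ℝ → ℂ} (_ : Measurable f) {z : ℝ × ℝ} (_ : z.1 ∈ E),
    ∫⁻ τ in Set.Ioc (1 / 2 : ℝ) 1, ‖lpProj φ₀ k f (z.1 - r z.1 * τ, z.2 - v z.1 * τ ^ 2)‖ₑ ≤
      C * ENNReal.ofReal (16 ^ l) * hlMax₁ (hlMax₂ fun w => ‖f w‖ₑ) z := by
  obtain ⟨C, hC⟩ := h.exists_enorm_lpProj_parabola_le
  refine ⟨C, ?_⟩
  intro k l r v E hs f hf z hz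
  obtain ⟨i, hi⟩ := hs.dyadic _ hz
  have hm := measurable_hlMax₂ (g := fun w => ‖f w‖ₑ) hf.enorm
  refine (setLIntegral_mono' measurableSet_Ioc fun τ hτ => hC hs hf hz z.2 hτ).trans ?_
  rw [lintegral_const_mul' _ _ (by finiteness)]
  exact mul_le_mul_right (setLIntegral_Ioc_mul_le_hlMax
    (g := fun x => hlMax₂ (fun w => ‖f w‖ₑ) (x, z.2)) (by fun_prop) hi z.1) _

/-- At the endpoint `L^∞` there is no loss in `l`: the maximal function is evaluated at the
displaced point itself, so the kernel estimate is used with shift zero. -/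
lemma IsLPBump.exists_enorm_scaleOp_le_of_le {φ₀ : ℝ → ℝ} (h : IsLPBump φ₀) : ∃ C : ℝ≥0, ∀ {ρ ρ' r v : ℝ → ℝ}
    (_ : IsAmplitude ρ ρ') (k : ℤ) {f : ℝ × ℝ → ℂ} (_ : Measurable f) {B : ℝ≥0∞} (_ : ∀ z, ‖f z‖ₑ ≤ B) (z : ℝ × ℝ),
    ‖scaleOp ρ r v (lpProj φ₀ k f) z‖ₑ ≤ C * B := by
  obtain ⟨C, hC⟩ := h.exists_enorm_lpProj_shift_le
  refine ⟨4 * C, ?_⟩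
  intro ρ ρ' r v hρ k f hf B hB z
  refine (enorm_scaleOp_le hρ _ z).trans ?_
  have hb : ∀ w, ‖lpProj φ₀ k f w‖ₑ ≤ C * (2 * B) := fun w => by
    have := hC k hf w.1 w.2 0
    simp only [sub_zero, mul_zero, ne_eq, OfNat.ofNat_ne_zero, not_false_eq_true, zero_pow, add_zero,
      ENNReal.ofReal_one, mul_one] at this
    exact this.trans (mul_le_mul_right (hlMax_le_of_le (fun y => hB (w.1, y)) w.2) _)
  have h1 : ∫⁻ τ in Set.Ioc (1 / 2 : ℝ) 1, ‖lpProj φ₀ k f (z.1 - r z.1 * τ, z.2 - v z.1 * τ ^ 2)‖ₑ ≤ C * (2 * B) := by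
    refine (lintegral_mono fun τ => hb _).trans ?_
    rw [lintegral_const, Measure.restrict_apply_univ, Real.volume_Ioc]
    refine mul_le_of_le_one_right zero_le ?_
    rw [← ENNReal.ofReal_one]
    exact ENNReal.ofReal_le_ofReal (by norm_num)
  refine (mul_le_mul_right h1 _).trans (le_of_eq ?_)
  push_cast
  ring

lemma IsNice.exists_enorm_le {α : Type*} [MeasurableSpace α] [Norm α] {f : α → ℂ} (hf : IsNice f) :
    ∃ B : ℝ≥0, ∀ z, ‖f z‖ₑ ≤ B := by
  obtain ⟨B, hB⟩ := hf.bounded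
  refine ⟨B.toNNReal, fun z => ?_⟩
  rw [← ofReal_norm]
  exact ENNReal.ofReal_le_ofReal (hB z)

lemma IsNice.hlMax₂_ne_top {f : ℝ × ℝ → ℂ} (hf : IsNice f) (z : ℝ × ℝ) : hlMax₂ (fun w => ‖f w‖ₑ) z ≠ ⊤ := by
  obtain ⟨B, hB⟩ := hf.exists_enorm_le
  have : hlMax₂ (fun w => ‖f w‖ₑ) z ≤ 2 * B := hlMax_le_of_le (fun y => hB (z.1, y)) z.2
  exact (this.trans_lt (by finiteness)).ne

lemma IsNice.integrable_lpProj {φ₀ : ℝ → ℝ} (h : IsLPBump φ₀) (k : ℤ) {f : ℝ × ℝ → ℂ} (hf : IsNice f) (z : ℝ × ℝ) :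
    Integrable fun t => f (z.1, z.2 - t) * lpKernel φ₀ k t := by
  simpa using h.integrable_lpProj k hf.measurable (hf.hlMax₂_ne_top z) 0

lemma lpProj_add {φ₀ : ℝ → ℝ} (h : IsLPBump φ₀) (k : ℤ) {f g : ℝ × ℝ → ℂ} (hf : IsNice f) (hg : IsNice g) (z : ℝ × ℝ) :
    lpProj φ₀ k (fun w => f w + g w) z = lpProj φ₀ k f z + lpProj φ₀ k g z := by
  unfold lpProj
  rw [← integral_add (hf.integrable_lpProj h k z) (hg.integrable_lpProj h k z)]
  simp_rw [add_mul]

lemma IsNice.integrableOn_scaleOp {φ₀ : ℝ → ℝ} (h : IsLPBump φ₀) (k : ℤ) {f : ℝ × ℝ → ℂ} (hf : IsNice f) {ρ ρ' r v : ℝ → ℝ}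
    (hρ : IsAmplitude ρ ρ') (z : ℝ × ℝ) : IntegrableOn (fun τ => (ρ τ : ℂ) *
      lpProj φ₀ k f (z.1 - r z.1 * τ, z.2 - v z.1 * τ ^ 2)) (Set.Ioc (1 / 2 : ℝ) 1) := by
  obtain ⟨C, hC⟩ := h.exists_enorm_lpProj_shift_le
  obtain ⟨B, hB⟩ := hf.exists_enorm_le
  have hF := h.measurable_lpProj k hf.measurable
  have hρm := hρ.measurable
  refine ⟨by apply Measurable.aestronglyMeasurable; fun_prop, ?_⟩
  have hb : ∀ τ ∈ Set.Ioc (1 / 2 : ℝ) 1, ‖(ρ τ : ℂ) * lpProj φ₀ k f (z.1 - r z.1 * τ, z.2 - v z.1 * τ ^ 2)‖ₑ ≤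
      2 * (C * (2 * B)) := fun τ hτ => by
    rw [enorm_mul]
    refine mul_le_mul' (hρ.enorm_le hτ) ?_
    have := hC k hf.measurable (z.1 - r z.1 * τ) (z.2 - v z.1 * τ ^ 2) 0
    simp only [sub_zero, mul_zero, ne_eq, OfNat.ofNat_ne_zero, not_false_eq_true, zero_pow, add_zero,
      ENNReal.ofReal_one, mul_one] at this
    exact this.trans (mul_le_mul_right (hlMax_le_of_le (fun y => hB (_, y)) _) _)
  refine (setLIntegral_mono' measurableSet_Ioc hb).trans_lt ?_
  rw [lintegral_const, Measure.restrict_apply_univ, Real.volume_Ioc]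
  finiteness

lemma enorm_scaleOp_add_le {φ₀ : ℝ → ℝ} (h : IsLPBump φ₀) (k : ℤ) {f g : ℝ × ℝ → ℂ} (hf : IsNice f) (hg : IsNice g)
    {ρ ρ' r v : ℝ → ℝ} (hρ : IsAmplitude ρ ρ') (z : ℝ × ℝ) : ‖scaleOp ρ r v (lpProj φ₀ k fun w => f w + g w) z‖ₑ ≤
      ‖scaleOp ρ r v (lpProj φ₀ k f) z‖ₑ + ‖scaleOp ρ r v (lpProj φ₀ k g) z‖ₑ := by
  refine le_trans (le_of_eq ?_) (enorm_add_le _ _)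
  congr 1
  unfold scaleOp
  rw [← integral_add (hf.integrableOn_scaleOp h k hρ z) (hg.integrableOn_scaleOp h k hρ z)]
  simp_rw [lpProj_add h k hf hg, mul_add]

lemma setLIntegral_large_rpow_le {α : Type*} [MeasurableSpace α] {μ : Measure α} (f : α → ℂ) (hf : Measurable f) {s q q' : ℝ}
    (hs : 0 < s) (hqq : q ≤ q') :
    ∫⁻ x in {x | ENNReal.ofReal s < ‖f x‖ₑ}, ‖f x‖ₑ ^ q ∂μ ≤ ENNReal.ofReal (s ^ (q - q')) * ∫⁻ x, ‖f x‖ₑ ^ q' ∂μ := by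
  rw [← lintegral_const_mul' _ _ ENNReal.ofReal_ne_top]
  refine le_trans ?_ (setLIntegral_le_lintegral {x | ENNReal.ofReal s < ‖f x‖ₑ} _)
  refine setLIntegral_mono' (measurableSet_lt measurable_const hf.enorm) fun x hx => ?_
  have hx : ENNReal.ofReal s < ‖f x‖ₑ := hx
  rw [← ofReal_norm, ENNReal.ofReal_lt_ofReal_iff_of_nonneg hs.le] at hx
  have h0 : 0 < ‖f x‖ := hs.trans hx
  rw [← ofReal_norm, ENNReal.ofReal_rpow_of_pos h0, ENNReal.ofReal_rpow_of_pos h0, ← ENNReal.ofReal_mul (by positivity)]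
  refine ENNReal.ofReal_le_ofReal ?_
  calc ‖f x‖ ^ q = ‖f x‖ ^ (q - q') * ‖f x‖ ^ q' := by rw [← Real.rpow_add h0]; congr 1; ring
    _ ≤ _ := mul_le_mul_of_nonneg_right (Real.rpow_le_rpow_of_nonpos hs hx.le (by linarith)) (by positivity)

lemma setLIntegral_small_rpow_le {α : Type*} [MeasurableSpace α] {μ : Measure α} (f : α → ℂ) (hf : Measurable f) {s q q' : ℝ}
    (hs : 0 < s) (hq : 0 < q') (hqq : q' ≤ q) :
    ∫⁻ x in {x | ENNReal.ofReal s < ‖f x‖ₑ}ᶜ, ‖f x‖ₑ ^ q ∂μ ≤ ENNReal.ofReal (s ^ (q - q')) * ∫⁻ x, ‖f x‖ₑ ^ q' ∂μ := by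
  rw [← lintegral_const_mul' _ _ ENNReal.ofReal_ne_top]
  refine le_trans ?_ (setLIntegral_le_lintegral {x | ENNReal.ofReal s < ‖f x‖ₑ}ᶜ _)
  refine setLIntegral_mono' (measurableSet_lt measurable_const hf.enorm).compl fun x hx => ?_
  have hx : ‖f x‖ₑ ≤ ENNReal.ofReal s := not_lt.1 hx
  rw [← ofReal_norm, ENNReal.ofReal_le_ofReal_iff hs.le] at hx
  have hq0 := hq.trans_le hqq
  rw [← ofReal_norm, ENNReal.ofReal_rpow_of_nonneg (norm_nonneg _) hq0.le,
    ENNReal.ofReal_rpow_of_nonneg (norm_nonneg _) hq.le, ← ENNReal.ofReal_mul (by positivity)]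
  refine ENNReal.ofReal_le_ofReal ?_
  rcases (norm_nonneg (f x)).eq_or_lt with h0 | h0
  · rw [← h0, Real.zero_rpow hq0.ne', Real.zero_rpow hq.ne', mul_zero]
  calc ‖f x‖ ^ q = ‖f x‖ ^ (q - q') * ‖f x‖ ^ q' := by rw [← Real.rpow_add h0]; congr 1; ring
    _ ≤ _ := mul_le_mul_of_nonneg_right (Real.rpow_le_rpow h0.le hx (by linarith)) (by positivity)

end ScaleOperatorLp

end

noncomputable section

/-! ### Interpolation to geometric decay for a single scale. -/

section ScaleOperatorBound

/-- The crude endpoint, with no use of oscillation: the loss `16^l` against the iterated maximal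
function becomes `16^{3l/2} = 64^l`. Its growth is harmless since the other endpoint decays. -/
lemma IsLPBump.exists_lintegral_scaleOp_rpow_three_halves_le {φ₀ : ℝ → ℝ} (h : IsLPBump φ₀) : ∃ C : ℝ≥0,
    ∀ {ρ ρ' : ℝ → ℝ} (_ : IsAmplitude ρ ρ') {k : ℤ} {l : ℕ} {r v : ℝ → ℝ} {E : Set ℝ} (_ : IsScale k l r v E)
    {f : ℝ × ℝ → ℂ} (_ : Measurable f), ∫⁻ z in E ×ˢ Set.univ, ‖scaleOp ρ r v (lpProj φ₀ k f) z‖ₑ ^ (3 / 2 : ℝ) ≤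
      C * ENNReal.ofReal (64 ^ l) * ∫⁻ z, ‖f z‖ₑ ^ (3 / 2 : ℝ) := by
  obtain ⟨C₁, hC₁⟩ := h.exists_lintegral_scale_le
  obtain ⟨C₂, hC₂⟩ := exists_lintegral_strongMax_rpow_le (p := 3 / 2) (by norm_num)
  refine ⟨(2 * C₁) ^ (3 / 2 : ℝ) * C₂, ?_⟩
  intro ρ ρ' hρ k l r v E hs f hf
  have hfe : Measurable fun w => ‖f w‖ₑ := hf.enorm
  have e64 : ENNReal.ofReal (16 ^ l) ^ (3 / 2 : ℝ) = ENNReal.ofReal (64 ^ l) := by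
    rw [ENNReal.ofReal_rpow_of_pos (by positivity), ← Real.rpow_natCast, ← Real.rpow_natCast, ← Real.rpow_mul (by norm_num),
      mul_comm, Real.rpow_mul (by norm_num)]
    congr 2
    rw [show (16 : ℝ) = 4 ^ (2 : ℝ) by norm_num, ← Real.rpow_mul (by norm_num)]
    norm_num
  calc _ ≤ ∫⁻ z in E ×ˢ Set.univ, ((2 * C₁ : ℝ≥0) * ENNReal.ofReal (16 ^ l) *
        hlMax₁ (hlMax₂ fun w => ‖f w‖ₑ) z) ^ (3 / 2 : ℝ) := by
        refine setLIntegral_mono' (hs.measurableSet.prod MeasurableSet.univ) fun z hz =>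
          ENNReal.rpow_le_rpow ?_ (by norm_num)
        refine (enorm_scaleOp_le hρ _ z).trans ?_
        push_cast
        rw [mul_assoc, mul_assoc, ← mul_assoc (C₁ : ℝ≥0∞)]
        exact mul_le_mul_right (hC₁ hs hf hz.1) _
    _ ≤ ∫⁻ z, ((2 * C₁ : ℝ≥0) * ENNReal.ofReal (16 ^ l) *
        hlMax₁ (hlMax₂ fun w => ‖f w‖ₑ) z) ^ (3 / 2 : ℝ) := setLIntegral_le_lintegral _ _
    _ = ((2 * C₁ : ℝ≥0) : ℝ≥0∞) ^ (3 / 2 : ℝ) * ENNReal.ofReal (64 ^ l) *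
        ∫⁻ z, (hlMax₁ (hlMax₂ fun w => ‖f w‖ₑ) z) ^ (3 / 2 : ℝ) := by
        simp_rw [ENNReal.mul_rpow_of_nonneg _ _ (by norm_num : (0 : ℝ) ≤ 3 / 2), e64]
        rw [lintegral_const_mul' _ _ (by finiteness)]
    _ ≤ ((2 * C₁ : ℝ≥0) : ℝ≥0∞) ^ (3 / 2 : ℝ) * ENNReal.ofReal (64 ^ l) * (C₂ * ∫⁻ z, ‖f z‖ₑ ^ (3 / 2 : ℝ)) :=
        mul_le_mul_right (hC₂ _ hfe) _
    _ = _ := by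
        rw [ENNReal.coe_mul (_ ^ _) C₂, ENNReal.coe_rpow_of_nonneg _ (by norm_num)]
        ring

lemma IsLPBump.exists_lintegral_scaleOp_sq_le {φ₀ : ℝ → ℝ} (h : IsLPBump φ₀) : ∃ C : ℝ≥0,
    ∀ {ρ ρ' : ℝ → ℝ} (_ : IsAmplitude ρ ρ') {k : ℤ} {l : ℕ} {r v : ℝ → ℝ} {E : Set ℝ} (_ : IsScale k l r v E)
    {f : ℝ × ℝ → ℂ} (_ : IsNice f), ∫⁻ z in E ×ˢ Set.univ, ‖scaleOp ρ r v (lpProj φ₀ k f) z‖ₑ ^ (2 : ℝ) ≤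
      C * ENNReal.ofReal ((2 : ℝ)⁻¹ ^ l) * ∫⁻ z, ‖f z‖ₑ ^ (2 : ℝ) := by
  obtain ⟨C, hC⟩ := _root_.exists_lintegral_scaleOp_sq_le h
  refine ⟨C * 2, ?_⟩
  intro ρ ρ' hρ k l r v E hs f hf
  have := hC hρ k hs.measurable_fst hs.measurable_snd hs.measurableSet hs.mul_pos (Λ := 4 ^ l / 4) (by positivity)
    hs.le_mul hf
  have e : 1 / √((4 : ℝ) ^ l / 4) = 2 * 2⁻¹ ^ l := by
    rw [show (4 : ℝ) ^ l / 4 = (2 ^ l / 2) ^ 2 by rw [div_pow, ← pow_mul, mul_comm, pow_mul]; norm_num,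
      Real.sqrt_sq (by positivity), one_div_div, inv_pow, div_eq_mul_inv]
  rw [e, ENNReal.ofReal_mul (by norm_num), ENNReal.ofReal_ofNat, ← mul_assoc (C : ℝ≥0∞)] at this
  simpa only [ENNReal.rpow_ofNat, ENNReal.coe_mul, ENNReal.coe_ofNat] using this

/-- The geometric decay `2^{-3l/10}` of the `l`-th scale at the exponent `39/20`. -/
def scaleDecay (l : ℕ) : ℝ := 2 ^ (-(3 / 10) * (l : ℝ))

lemma scaleDecay_pos (l : ℕ) : 0 < scaleDecay l := Real.rpow_pos_of_pos (by norm_num) _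

/-- Interpolation between the growing `L^{3/2}` bound and the decaying `L²` bound at an exponent
close enough to `2` for the decay to win. In this interpolation the exponent of `2^l` at `q` is `-1
+ 14 (2 - q)`, negative for `q > 27/14`; it equals `-3/10` at `q = 39/20`. -/
lemma IsLPBump.exists_measure_lt_scaleOp_le {φ₀ : ℝ → ℝ} (h : IsLPBump φ₀) : ∃ C : ℝ≥0,
    ∀ {ρ ρ' : ℝ → ℝ} (_ : IsAmplitude ρ ρ') {k : ℤ} {l : ℕ} {r v : ℝ → ℝ} {E : Set ℝ} (_ : IsScale k l r v E)
    {f : ℝ × ℝ → ℂ} (_ : IsNice f) {t : ℝ} (_ : 0 < t), (volume.restrict (E ×ˢ Set.univ))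
      {z | ENNReal.ofReal t < ‖scaleOp ρ r v (lpProj φ₀ k f) z‖ₑ} ≤
      C * ENNReal.ofReal (scaleDecay l) * ENNReal.ofReal (t ^ (-(39 / 20 : ℝ))) * ∫⁻ z, ‖f z‖ₑ ^ (39 / 20 : ℝ) := by
  obtain ⟨C₀, hC₀⟩ := h.exists_lintegral_scaleOp_rpow_three_halves_le
  obtain ⟨C₁, hC₁⟩ := h.exists_lintegral_scaleOp_sq_le
  refine ⟨Real.toNNReal (2 ^ (3 / 2 : ℝ)) * C₀ + Real.toNNReal (2 ^ (2 : ℝ)) * C₁, ?_⟩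
  intro ρ ρ' hρ k l r v E hs f hf t ht
  have hfm := hf.measurable
  -- The cutting height balances the two contributions: `6 - 14 · 9/20 = -3/10` from the large part
  -- and `-1 + 14/20 = -3/10` from the small part.
  set κ : ℝ := 2 ^ (14 * (l : ℝ)) with hκ
  have hκ0 : 0 < κ := Real.rpow_pos_of_pos (by norm_num) _
  set S : Set (ℝ × ℝ) := {z | ENNReal.ofReal (κ * t) < ‖f z‖ₑ} with hS
  have hSm : MeasurableSet S := measurableSet_lt measurable_const hfm.enorm
  have n0 := hf.indicator hSm
  have n1 := hf.indicator hSm.compl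
  have hsum : f = fun w => S.indicator f w + Sᶜ.indicator f w := by
    ext w; exact (congrFun (Set.indicator_self_add_compl S f) w).symm
  have hAm : ∀ {g : ℝ × ℝ → ℂ}, Measurable g → Measurable (scaleOp ρ r v (lpProj φ₀ k g)) := fun hg =>
    measurable_scaleOp hρ.measurable hs.measurable_fst hs.measurable_snd (h.measurable_lpProj k hg)
  have hle : ∀ z, ‖scaleOp ρ r v (lpProj φ₀ k f) z‖ₑ ≤ ‖scaleOp ρ r v (lpProj φ₀ k (S.indicator f)) z‖ₑ +
      ‖scaleOp ρ r v (lpProj φ₀ k (Sᶜ.indicator f)) z‖ₑ := fun z => by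
    conv_lhs => rw [hsum]
    exact enorm_scaleOp_add_le h k n0 n1 hρ z
  refine (measure_lt_le_add_of_le_add (hAm n0.measurable).enorm (hAm n1.measurable).enorm hle ht
    (q₀ := 3 / 2) (q₁ := 2) (by norm_num) (by norm_num)).trans ?_
  have hκt : 0 < κ * t := by positivity
  have b0 := (hC₀ hρ hs n0.measurable).trans (mul_le_mul_right ((lintegral_enorm_indicator_rpow f hSm (by norm_num)).trans_le
    (setLIntegral_large_rpow_le f hfm hκt (q := 3 / 2) (q' := 39 / 20) (by norm_num))) _)
  have b1 := (hC₁ hρ hs n1).trans (mul_le_mul_right ((lintegral_enorm_indicator_rpow f hSm.compl (by norm_num)).trans_le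
    (setLIntegral_small_rpow_le f hfm hκt (q := 2) (q' := 39 / 20) (by norm_num) (by norm_num))) _)
  refine (add_le_add (mul_le_mul_right b0 _) (mul_le_mul_right b1 _)).trans (le_of_eq ?_)
  set I := ∫⁻ z, ‖f z‖ₑ ^ (39 / 20 : ℝ)
  have e0 : t ^ (-(3 / 2) : ℝ) * (64 ^ l * (κ * t) ^ (3 / 2 - 39 / 20 : ℝ)) = scaleDecay l * t ^ (-(39 / 20) : ℝ) := by
    rw [Real.mul_rpow hκ0.le ht.le, scaleDecay, hκ, ← Real.rpow_mul (by norm_num), ← Real.rpow_natCast,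
      show (64 : ℝ) = 2 ^ (6 : ℝ) by norm_num, ← Real.rpow_mul (by norm_num)]
    calc _ = (2 ^ (6 * (l : ℝ)) * 2 ^ (14 * (l : ℝ) * (3 / 2 - 39 / 20))) *
        (t ^ (-(3 / 2) : ℝ) * t ^ (3 / 2 - 39 / 20 : ℝ)) := by ring
      _ = _ := by
        rw [← Real.rpow_add (by norm_num), ← Real.rpow_add ht]
        congr 2 <;> ring
  have e1 : t ^ (-2 : ℝ) * (2⁻¹ ^ l * (κ * t) ^ (2 - 39 / 20 : ℝ)) = scaleDecay l * t ^ (-(39 / 20) : ℝ) := by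
    rw [Real.mul_rpow hκ0.le ht.le, scaleDecay, hκ, ← Real.rpow_mul (by norm_num), ← Real.rpow_natCast,
      Real.inv_rpow (by norm_num), ← Real.rpow_neg (by norm_num)]
    calc _ = (2 ^ (-(l : ℝ)) * 2 ^ (14 * (l : ℝ) * (2 - 39 / 20))) *
        (t ^ (-2 : ℝ) * t ^ (2 - 39 / 20 : ℝ)) := by ring
      _ = _ := by
        rw [← Real.rpow_add (by norm_num), ← Real.rpow_add ht]
        congr 2 <;> ring
  have f0 := congrArg ENNReal.ofReal e0
  have f1 := congrArg ENNReal.ofReal e1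
  rw [ENNReal.ofReal_mul (by positivity), ENNReal.ofReal_mul (by positivity), ENNReal.ofReal_mul (scaleDecay_pos l).le] at f0 f1
  calc _ = ENNReal.ofReal (2 ^ (3 / 2 : ℝ)) * C₀ * (ENNReal.ofReal (t ^ (-(3 / 2) : ℝ)) * (ENNReal.ofReal (64 ^ l) *
        ENNReal.ofReal ((κ * t) ^ (3 / 2 - 39 / 20 : ℝ)))) * I + ENNReal.ofReal (2 ^ (2 : ℝ)) * C₁ *
        (ENNReal.ofReal (t ^ (-2 : ℝ)) * (ENNReal.ofReal (2⁻¹ ^ l) * ENNReal.ofReal ((κ * t) ^ (2 - 39 / 20 : ℝ)))) * I := by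
        ring
    _ = _ := by
        rw [f0, f1]
        push_cast
        simp only [ENNReal.ofReal]
        ring

/-- Interpolation between the weak type bound at `39/20` and the `L^∞` bound. The decay sits
entirely in `A₀`, so it survives linearly for every larger `p`. -/
lemma IsLPBump.exists_lintegral_scaleOp_rpow_le_of_isNice {φ₀ : ℝ → ℝ} (h : IsLPBump φ₀) {p : ℝ} (hp : 39 / 20 < p) :
    ∃ C : ℝ≥0, ∀ {ρ ρ' : ℝ → ℝ} (_ : IsAmplitude ρ ρ') {k : ℤ} {l : ℕ} {r v : ℝ → ℝ} {E : Set ℝ} (_ : IsScale k l r v E)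
    {f : ℝ × ℝ → ℂ} (_ : IsNice f), ∫⁻ z in E ×ˢ Set.univ, ‖scaleOp ρ r v (lpProj φ₀ k f) z‖ₑ ^ p ≤
      C * ENNReal.ofReal (scaleDecay l) * ∫⁻ z, ‖f z‖ₑ ^ p := by
  obtain ⟨C₀, hC₀⟩ := h.exists_measure_lt_scaleOp_le
  obtain ⟨C₁, hC₁⟩ := h.exists_enorm_scaleOp_le_of_le
  set c : ℝ := 1 / (2 * (C₁ + 1)) with hc
  have hC₁0 : (0 : ℝ) ≤ C₁ := C₁.2
  have hc0 : 0 < c := by positivity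
  obtain ⟨C₂, hC₂⟩ := exists_lintegral_rpow_le_of_distribution (p₁ := p + 1) (by norm_num : (0 : ℝ) < 39 / 20) hp
    (by linarith) hc0
  refine ⟨C₂ * C₀ * Real.toNNReal (2 ^ (39 / 20 : ℝ)), ?_⟩
  intro ρ ρ' hρ k l r v E hs f hf
  have hfm := hf.measurable
  have hAm : ∀ {g : ℝ × ℝ → ℂ}, Measurable g → Measurable (scaleOp ρ r v (lpProj φ₀ k g)) := fun hg =>
    measurable_scaleOp hρ.measurable hs.measurable_fst hs.measurable_snd (h.measurable_lpProj k hg)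
  have key := hC₂ (μ := volume.restrict (E ×ˢ Set.univ)) (ν := (volume : Measure (ℝ × ℝ))) (hAm hfm).enorm hfm.enorm
    (A₀ := C₀ * Real.toNNReal (2 ^ (39 / 20 : ℝ)) * Real.toNNReal (scaleDecay l)) (A₁ := 0) fun t ht => by
      set S : Set (ℝ × ℝ) := {z | ENNReal.ofReal (c * t) < ‖f z‖ₑ} with hS
      have hSm : MeasurableSet S := measurableSet_lt measurable_const hfm.enorm
      have n0 := hf.indicator hSm
      have n1 := hf.indicator hSm.compl
      have hsum : f = fun w => S.indicator f w + Sᶜ.indicator f w := by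
        ext w; exact (congrFun (Set.indicator_self_add_compl S f) w).symm
      have hsmall : ∀ z, ‖scaleOp ρ r v (lpProj φ₀ k (Sᶜ.indicator f)) z‖ₑ ≤ ENNReal.ofReal (t / 2) := fun z => by
        refine (hC₁ hρ k n1.measurable (B := ENNReal.ofReal (c * t)) (fun w => ?_) z).trans ?_
        · by_cases hw : w ∈ Sᶜ
          · rw [Set.indicator_of_mem hw]; exact not_lt.1 hw
          · rw [Set.indicator_of_notMem hw]; simp
        · rw [← ENNReal.ofReal_coe_nnreal, ← ENNReal.ofReal_mul hC₁0]
          refine ENNReal.ofReal_le_ofReal ?_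
          rw [hc, ← mul_assoc, mul_one_div, div_mul_eq_mul_div, div_le_div_iff₀ (by positivity) (by norm_num)]
          nlinarith
      have hsub : {z | ENNReal.ofReal t < ‖scaleOp ρ r v (lpProj φ₀ k f) z‖ₑ} ⊆
          {z | ENNReal.ofReal (t / 2) < ‖scaleOp ρ r v (lpProj φ₀ k (S.indicator f)) z‖ₑ} := fun z hz => by
        have hz : ENNReal.ofReal t < ‖scaleOp ρ r v (lpProj φ₀ k f) z‖ₑ := hz
        show ENNReal.ofReal (t / 2) < _
        by_contra hcon
        have hle : ‖scaleOp ρ r v (lpProj φ₀ k f) z‖ₑ ≤ ‖scaleOp ρ r v (lpProj φ₀ k (S.indicator f)) z‖ₑ +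
            ‖scaleOp ρ r v (lpProj φ₀ k (Sᶜ.indicator f)) z‖ₑ := by
          conv_lhs => rw [hsum]
          exact enorm_scaleOp_add_le h k n0 n1 hρ z
        have := hz.trans_le (hle.trans (add_le_add (not_lt.1 hcon) (hsmall z)))
        rw [← ENNReal.ofReal_add (by positivity) (by positivity), add_halves] at this
        exact lt_irrefl _ this
      refine (measure_mono hsub).trans ((hC₀ hρ hs n0 (half_pos ht)).trans ?_)
      rw [lintegral_enorm_indicator_rpow f hSm (by norm_num), zero_mul, zero_mul, add_zero]
      refine le_of_eq ?_
      have e : (t / 2) ^ (-(39 / 20) : ℝ) = 2 ^ (39 / 20 : ℝ) * t ^ (-(39 / 20) : ℝ) := by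
        rw [Real.div_rpow ht.le (by norm_num), Real.rpow_neg (by norm_num : (0 : ℝ) ≤ 2)]
        field_simp
      rw [e, ENNReal.ofReal_mul (by positivity)]
      simp only [ENNReal.ofReal]
      ring
  refine key.trans (le_of_eq ?_)
  push_cast
  rw [ENNReal.ofReal]
  ring

lemma tendsto_lpProj {φ₀ : ℝ → ℝ} (h : IsLPBump φ₀) (k : ℤ) {f : ℝ × ℝ → ℂ} (hf : Measurable f) {g : ℕ → ℝ × ℝ → ℂ}
    (hg : ∀ n, Measurable (g n)) (hgf : ∀ n z, ‖g n z‖ ≤ ‖f z‖) (hlim : ∀ z, Tendsto (fun n => g n z) atTop (𝓝 (f z)))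
    {x y : ℝ} (hfin : hlMax₂ (fun w => ‖f w‖ₑ) (x, y) ≠ ⊤) (a : ℝ) :
    Tendsto (fun n => lpProj φ₀ k (g n) (x, y - a)) atTop (𝓝 (lpProj φ₀ k f (x, y - a))) := by
  have hi := h.integrable_lpProj k hf hfin a
  have hK := (h.continuous_lpKernel k).measurable
  refine tendsto_integral_of_dominated_convergence _ (fun n => ?_) hi.norm (fun n => Eventually.of_forall fun t => ?_)
    (Eventually.of_forall fun t => (hlim _).mul_const _)
  · have := hg n
    apply Measurable.aestronglyMeasurable; fun_prop
  · rw [norm_mul, norm_mul]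
    gcongr
    exact hgf n _

/-- The `L^p` estimate with geometric decay for the single scale operator. -/
lemma IsLPBump.exists_lintegral_scaleOp_rpow_le {φ₀ : ℝ → ℝ} (h : IsLPBump φ₀) {p : ℝ} (hp : 39 / 20 < p) :
    ∃ C : ℝ≥0, ∀ {ρ ρ' : ℝ → ℝ} (_ : IsAmplitude ρ ρ') {k : ℤ} {l : ℕ} {r v : ℝ → ℝ} {E : Set ℝ} (_ : IsScale k l r v E)
    {f : ℝ × ℝ → ℂ} (_ : Measurable f) (_ : ∫⁻ z, ‖f z‖ₑ ^ p ≠ ⊤),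
    ∫⁻ z in E ×ˢ Set.univ, ‖scaleOp ρ r v (lpProj φ₀ k f) z‖ₑ ^ p ≤
      C * ENNReal.ofReal (scaleDecay l) * ∫⁻ z, ‖f z‖ₑ ^ p := by
  obtain ⟨C, hC⟩ := h.exists_lintegral_scaleOp_rpow_le_of_isNice hp
  obtain ⟨C₁, hC₁⟩ := h.exists_enorm_lpProj_parabola_le
  obtain ⟨C₂, hC₂⟩ := exists_lintegral_strongMax_rpow_le (p := p) (by linarith)
  have hp0 : 0 < p := by linarith
  refine ⟨C, ?_⟩
  intro ρ ρ' hρ k l r v E hs f hf hfin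
  set S : ℕ → Set (ℝ × ℝ) := fun n => {z | ‖f z‖ ≤ n ∧ ‖z‖ ≤ n} with hS
  have hSm : ∀ n, MeasurableSet (S n) := fun n =>
    (measurableSet_le hf.norm measurable_const).inter (measurableSet_le measurable_norm measurable_const)
  set g : ℕ → ℝ × ℝ → ℂ := fun n => (S n).indicator f with hg
  have hgm : ∀ n, Measurable (g n) := fun n => hf.indicator (hSm n)
  have hgf : ∀ n z, ‖g n z‖ ≤ ‖f z‖ := fun n z => norm_indicator_le_norm_self _ _
  have hnice : ∀ n, IsNice (g n) := fun n =>
    ⟨hgm n, ⟨n, fun z => by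
      by_cases hz : z ∈ S n
      · simp only [hg, Set.indicator_of_mem hz]; exact hz.1
      · simp [hg, Set.indicator_of_notMem hz]⟩, ⟨n, fun z hz => (Set.mem_of_indicator_ne_zero hz).2⟩⟩
  have hlim : ∀ z, Tendsto (fun n => g n z) atTop (𝓝 (f z)) := fun z => by
    refine tendsto_const_nhds.congr' ?_
    filter_upwards [eventually_ge_atTop ⌈max ‖f z‖ ‖z‖⌉₊] with n hn
    have hn' := max_le_iff.1 (Nat.ceil_le.1 hn)
    simp only [hg, Set.indicator_of_mem (show z ∈ S n from hn')]
  have hAm : ∀ {g : ℝ × ℝ → ℂ}, Measurable g → Measurable (scaleOp ρ r v (lpProj φ₀ k g)) := fun hg =>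
    measurable_scaleOp hρ.measurable hs.measurable_fst hs.measurable_snd (h.measurable_lpProj k hg)
  have hfe : Measurable fun w => ‖f w‖ₑ := hf.enorm
  have hMm := measurable_hlMax₂ hfe
  have hMfin : ∀ᵐ z : ℝ × ℝ, hlMax₁ (hlMax₂ fun w => ‖f w‖ₑ) z < ⊤ := by
    have h1 : ∫⁻ z, hlMax₁ (hlMax₂ fun w => ‖f w‖ₑ) z ^ p ≠ ⊤ :=
      ((hC₂ _ hfe).trans_lt (ENNReal.mul_lt_top (by simp) hfin.lt_top)).ne
    filter_upwards [ae_lt_top ((measurable_hlMax₁ hMm).pow_const p) h1] with z hz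
    exact (ENNReal.rpow_lt_top_iff_of_pos hp0).1 hz
  have hrm := hs.measurable_fst
  have hvm := hs.measurable_snd
  have hρm := hρ.measurable
  -- Pointwise convergence of the truncated operators by dominated convergence. The majorant is a
  -- multiple of `hlMax₂ |f|` along the horizontal segment, integrable wherever the iterated maximal
  -- function is finite; Fatou's lemma then transfers the bound to `f`.
  have hconv : ∀ᵐ z ∂(volume.restrict (E ×ˢ Set.univ) : Measure (ℝ × ℝ)),
      Tendsto (fun n => scaleOp ρ r v (lpProj φ₀ k (g n)) z) atTop (𝓝 (scaleOp ρ r v (lpProj φ₀ k f) z)) := by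
    filter_upwards [ae_restrict_of_ae hMfin, ae_restrict_mem (hs.measurableSet.prod MeasurableSet.univ)] with z hz hzE
    have hzE : z.1 ∈ E := hzE.1
    obtain ⟨i, hi⟩ := hs.dyadic _ hzE
    have hM1 : ∫⁻ τ in Set.Ioc (1 / 2 : ℝ) 1, hlMax₂ (fun w => ‖f w‖ₑ) (z.1 - r z.1 * τ, z.2) < ⊤ :=
      (setLIntegral_Ioc_mul_le_hlMax (g := fun x => hlMax₂ (fun w => ‖f w‖ₑ) (x, z.2)) (by fun_prop) hi z.1).trans_lt hz
    set D : ℝ → ℝ≥0∞ := fun τ => 2 * (C₁ * ENNReal.ofReal (16 ^ l) * hlMax₂ (fun w => ‖f w‖ₑ) (z.1 - r z.1 * τ, z.2)) with hD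
    have hDm : Measurable D := by fun_prop
    have hDfin : ∫⁻ τ in Set.Ioc (1 / 2 : ℝ) 1, D τ ≠ ⊤ := by
      simp only [hD]
      rw [lintegral_const_mul' _ _ (by norm_num), lintegral_const_mul' _ _ (by finiteness)]
      finiteness
    have hae : ∀ᵐ τ ∂(volume.restrict (Set.Ioc (1 / 2 : ℝ) 1)), hlMax₂ (fun w => ‖f w‖ₑ) (z.1 - r z.1 * τ, z.2) < ⊤ :=
      ae_lt_top (by fun_prop) hM1.ne
    have haeD := ae_lt_top hDm hDfin
    refine tendsto_integral_of_dominated_convergence (fun τ => (D τ).toReal) (fun n => ?_)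
      (integrable_toReal_of_lintegral_ne_top hDm.aemeasurable hDfin) (fun n => ?_) ?_
    · have := h.measurable_lpProj k (hgm n)
      apply Measurable.aestronglyMeasurable; fun_prop
    · filter_upwards [haeD, ae_restrict_mem measurableSet_Ioc] with τ hτD hτ
      rw [← ENNReal.ofReal_le_iff_le_toReal hτD.ne, ofReal_norm, enorm_mul]
      refine mul_le_mul' (hρ.enorm_le hτ) ((hC₁ hs (hgm n) hzE z.2 hτ).trans (mul_le_mul_right ?_ _))
      exact hlMax_mono (fun y => by simpa [enorm_le_iff_norm_le] using hgf n (_, y)) _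
    · filter_upwards [hae] with τ hτ
      exact (tendsto_lpProj h k hf hgm hgf hlim hτ.ne _).const_mul _
  calc _ ≤ ∫⁻ z in E ×ˢ Set.univ, liminf (fun n => ‖scaleOp ρ r v (lpProj φ₀ k (g n)) z‖ₑ ^ p) atTop := by
        refine lintegral_mono_ae ?_
        filter_upwards [hconv] with z hz
        have := (ENNReal.continuous_rpow_const (y := p)).continuousAt.tendsto.comp hz.enorm
        exact this.liminf_eq.ge
    _ ≤ liminf (fun n => ∫⁻ z in E ×ˢ Set.univ, ‖scaleOp ρ r v (lpProj φ₀ k (g n)) z‖ₑ ^ p) atTop :=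
        lintegral_liminf_le fun n => (hAm (hgm n)).enorm.pow_const p
    _ ≤ _ := by
        refine liminf_le_of_le (by isBoundedDefault) fun b hb => ?_
        obtain ⟨n, hn⟩ := hb.exists
        refine hn.trans ((hC hρ hs (hnice n)).trans (mul_le_mul_right ?_ _))
        exact lintegral_mono fun z => ENNReal.rpow_le_rpow (by simpa [enorm_le_iff_norm_le] using hgf n z) hp0.le

end ScaleOperatorBound

end

noncomputable section

/-! ### Decomposition into dyadic shells and the critical radius. -/

section DyadicShells

lemma setIntegral_shell_eq {b : ℝ → ℂ} {σ : ℝ} (hσ : 0 < σ) (hb : IntegrableOn b {t : ℝ | σ / 2 < |t| ∧ |t| ≤ σ}) :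
    ∫ t in {t : ℝ | σ / 2 < |t| ∧ |t| ≤ σ}, b t =
      σ * ((∫ τ in Set.Ioc (1 / 2 : ℝ) 1, b (σ * τ)) + ∫ τ in Set.Ioc (1 / 2 : ℝ) 1, b (-(σ * τ))) := by
  have e : {t : ℝ | σ / 2 < |t| ∧ |t| ≤ σ} = Set.Ioc (σ / 2) σ ∪ Set.Ico (-σ) (-(σ / 2)) := by
    ext t
    simp only [Set.mem_ofPred_eq, Set.mem_union, Set.mem_Ioc, Set.mem_Ico]
    constructor
    · rintro ⟨h1, h2⟩
      rcases le_total 0 t with h | h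
      · rw [abs_of_nonneg h] at h1 h2; exact Or.inl ⟨h1, h2⟩
      · rw [abs_of_nonpos h] at h1 h2; exact Or.inr ⟨by linarith, by linarith⟩
    · rintro (⟨h1, h2⟩ | ⟨h1, h2⟩)
      · rw [abs_of_pos (by linarith)]; exact ⟨h1, h2⟩
      · rw [abs_of_neg (by linarith)]; exact ⟨by linarith, by linarith⟩
  have hd : Disjoint (Set.Ioc (σ / 2) σ) (Set.Ico (-σ) (-(σ / 2))) :=
    Set.disjoint_left.2 fun t h h' => by linarith [h.1, h'.2]
  rw [e] at hb ⊢
  rw [setIntegral_union hd measurableSet_Ico (hb.mono_set Set.subset_union_left) (hb.mono_set Set.subset_union_right)]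
  have h12 : (1 / 2 : ℝ) ≤ 1 := by norm_num
  have i1 := intervalIntegral.integral_comp_mul_left (a := 1 / 2) (b := 1) b hσ.ne'
  have i2 := intervalIntegral.integral_comp_mul_left (a := 1 / 2) (b := 1) b (neg_ne_zero.2 hσ.ne')
  rw [mul_one, intervalIntegral.integral_of_le h12, intervalIntegral.integral_of_le (by linarith), mul_one_div] at i1
  rw [mul_one, intervalIntegral.integral_of_le h12, intervalIntegral.integral_of_ge (by linarith), mul_one_div, neg_div] at i2
  simp only [neg_mul] at i2
  rw [i1, i2, integral_Ico_eq_integral_Ioc]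
  simp only [Complex.real_smul]
  push_cast
  have : (σ : ℂ) ≠ 0 := by exact_mod_cast hσ.ne'
  field_simp

/-- The size of the averages of `a` over the two halves of a dyadic shell of radius `σ`. -/
def shellNorm (ρ : ℝ → ℝ) (a : ℝ → ℂ) (σ : ℝ) : ℝ≥0∞ :=
  ‖∫ τ in Set.Ioc (1 / 2 : ℝ) 1, (ρ τ : ℂ) * a (σ * τ)‖ₑ + ‖∫ τ in Set.Ioc (1 / 2 : ℝ) 1, (ρ τ : ℂ) * a (-(σ * τ))‖ₑ

lemma setOf_abs_le (s : ℝ) : {t : ℝ | |t| ≤ s} = Set.Icc (-s) s := by ext t; exact abs_le (a := t)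

lemma volume_setOf_abs_le_ne_top (s : ℝ) : volume {t : ℝ | |t| ≤ s} ≠ ⊤ := by rw [setOf_abs_le]; simp

lemma enorm_setIntegral_shell_le {a : ℝ → ℂ} {σ : ℝ} (hσ : 0 < σ) (ha : ∀ s, IntegrableOn a {t : ℝ | |t| ≤ s}) :
    ‖∫ t in {t : ℝ | σ / 2 < |t| ∧ |t| ≤ σ}, a t‖ₑ ≤ ENNReal.ofReal σ * shellNorm (fun _ => 1) a σ := by
  rw [setIntegral_shell_eq hσ ((ha σ).mono_set fun t ht => ht.2), enorm_mul, ← ofReal_norm (σ : ℂ), Complex.norm_real,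
    Real.norm_of_nonneg hσ.le]
  refine mul_le_mul_right ((enorm_add_le _ _).trans (le_of_eq ?_)) _
  simp [shellNorm]

/-- The measure `dt/t` is scale invariant, so rescaling the shell to `(1/2, 1]` produces the
amplitude `τ⁻¹` and no power of `σ`; the sign on the negative half is irrelevant after taking norms.
-/
lemma enorm_setIntegral_div_shell_le {a : ℝ → ℂ} {σ : ℝ} (hσ : 0 < σ)
    (ha : IntegrableOn (fun t => a t / (t : ℂ)) {t : ℝ | σ / 2 < |t|}) :
    ‖∫ t in {t : ℝ | σ / 2 < |t| ∧ |t| ≤ σ}, a t / (t : ℂ)‖ₑ ≤ shellNorm (fun τ => τ⁻¹) a σ := by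
  rw [setIntegral_shell_eq hσ (ha.mono_set fun t ht => ht.1), mul_add, ← integral_const_mul, ← integral_const_mul]
  have h0 : (σ : ℂ) ≠ 0 := by exact_mod_cast hσ.ne'
  refine (enorm_add_le _ _).trans (add_le_add (le_of_eq ?_) (le_of_eq ?_))
  · congr 2 with τ
    push_cast
    field_simp
  · rw [← enorm_neg, ← integral_neg]
    congr 2 with τ
    push_cast
    field_simp

lemma setIntegral_abs_le_eq_add {a : ℝ → ℂ} {s σ : ℝ} (hs : s ≤ σ) (ha : IntegrableOn a {t : ℝ | |t| ≤ σ}) :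
    ∫ t in {t : ℝ | |t| ≤ σ}, a t = (∫ t in {t : ℝ | |t| ≤ s}, a t) + ∫ t in {t : ℝ | s < |t| ∧ |t| ≤ σ}, a t := by
  have hd : Disjoint {t : ℝ | |t| ≤ s} {t : ℝ | s < |t| ∧ |t| ≤ σ} :=
    Set.disjoint_left.2 fun t (h : |t| ≤ s) h' => absurd h (not_le.2 h'.1)
  rw [← setIntegral_union hd (measurableSet_annulus s σ)
    (ha.mono_set fun t (ht : |t| ≤ s) => ht.trans hs) (ha.mono_set fun t ht => ht.2)]
  congr 2
  ext t
  constructor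
  · intro h
    rcases le_or_gt |t| s with h' | h'
    · exact Or.inl h'
    · exact Or.inr ⟨h', h⟩
  · rintro (h | h)
    · exact le_trans h hs
    · exact h.2

/-- Averages over centred intervals are controlled by a central average and the averages over dyadic shells. -/
lemma enorm_setIntegral_abs_le_le {a : ℝ → ℂ} {σ : ℝ} (hσ : 0 < σ) (ha : ∀ s, IntegrableOn a {t : ℝ | |t| ≤ s}) {D : ℝ≥0∞}
    (hD : ‖∫ t in {t : ℝ | |t| ≤ σ}, a t‖ₑ ≤ ENNReal.ofReal σ * D) (l : ℕ) :
    ‖∫ t in {t : ℝ | |t| ≤ 2 ^ l * σ}, a t‖ₑ ≤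
      ENNReal.ofReal (2 ^ l * σ) * (D + ∑' m : ℕ, shellNorm (fun _ => 1) a (2 ^ (m + 1) * σ)) := by
  have h : ∀ l : ℕ, ‖∫ t in {t : ℝ | |t| ≤ 2 ^ l * σ}, a t‖ₑ ≤
      ENNReal.ofReal (2 ^ l * σ) * (D + ∑ m ∈ Finset.range l, shellNorm (fun _ => 1) a (2 ^ (m + 1) * σ)) := by
    intro l
    induction l with
    | zero => simpa using hD
    | succ n ih =>
      have e : (2 : ℝ) ^ (n + 1) * σ / 2 = 2 ^ n * σ := by rw [pow_succ]; ring
      have hle : (2 : ℝ) ^ n * σ ≤ 2 ^ (n + 1) * σ := by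
        rw [pow_succ]; nlinarith [mul_pos (pow_pos (two_pos : (0 : ℝ) < 2) n) hσ]
      rw [setIntegral_abs_le_eq_add hle (ha _)]
      have h2 := enorm_setIntegral_shell_le (by positivity : (0 : ℝ) < 2 ^ (n + 1) * σ) ha
      rw [e] at h2
      refine (enorm_add_le _ _).trans ((add_le_add ih h2).trans ?_)
      rw [Finset.sum_range_succ, ← add_assoc, mul_add _ (D + _)]
      exact add_le_add (mul_le_mul_left (ENNReal.ofReal_le_ofReal hle) _) le_rfl
  exact (h l).trans (mul_le_mul_right (add_le_add le_rfl (ENNReal.sum_le_tsum _)) _)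

lemma tendsto_truncIntegral_atTop {a : ℝ → ℂ} {σ : ℝ} (hσ : 0 < σ)
    (ha : IntegrableOn (fun t => a t / (t : ℂ)) {t : ℝ | σ < |t|}) :
    Tendsto (fun l : ℕ => truncIntegral a (2 ^ l * σ)) atTop (𝓝 0) := by
  have hanti : Antitone fun l : ℕ => {t : ℝ | 2 ^ l * σ < |t|} := fun m n hmn t (ht : 2 ^ n * σ < |t|) =>
    lt_of_le_of_lt (mul_le_mul_of_nonneg_right (pow_le_pow_right₀ one_le_two hmn) hσ.le) ht
  have h := tendsto_setIntegral_of_antitone (μ := volume) (f := fun t => a t / (t : ℂ)) (fun l => measurableSet_lt_abs _) hanti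
    ⟨0, by simpa using ha⟩
  have he : ⋂ l : ℕ, {t : ℝ | 2 ^ l * σ < |t|} = ∅ := by
    refine Set.eq_empty_of_forall_notMem fun t ht => ?_
    obtain ⟨n, hn⟩ := pow_unbounded_of_one_lt (|t| / σ) one_lt_two
    have h1 : 2 ^ n * σ < |t| := Set.mem_iInter.1 ht n
    rw [div_lt_iff₀ hσ] at hn
    linarith
  rw [he, setIntegral_empty] at h
  exact h

/-- Shells are peeled off successively, and the remaining tail tends to zero by absolute
convergence. -/
lemma enorm_truncIntegral_le_tsum {a : ℝ → ℂ} {σ : ℝ} (hσ : 0 < σ)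
    (ha : IntegrableOn (fun t => a t / (t : ℂ)) {t : ℝ | σ < |t|}) :
    ‖truncIntegral a σ‖ₑ ≤ ∑' m : ℕ, shellNorm (fun τ => τ⁻¹) a (2 ^ (m + 1) * σ) := by
  have h : ∀ l : ℕ, ‖truncIntegral a σ‖ₑ ≤
      (∑ m ∈ Finset.range l, shellNorm (fun τ => τ⁻¹) a (2 ^ (m + 1) * σ)) + ‖truncIntegral a (2 ^ l * σ)‖ₑ := by
    intro l
    induction l with
    | zero => simp
    | succ n ih =>
      have e : (2 : ℝ) ^ (n + 1) * σ / 2 = 2 ^ n * σ := by rw [pow_succ]; ring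
      have hle : (2 : ℝ) ^ n * σ ≤ 2 ^ (n + 1) * σ := by
        rw [pow_succ]; nlinarith [mul_pos (pow_pos (two_pos : (0 : ℝ) < 2) n) hσ]
      have hσn : σ ≤ 2 ^ n * σ := le_mul_of_one_le_left hσ.le (one_le_pow₀ one_le_two)
      have hi : IntegrableOn (fun t => a t / (t : ℂ)) {t : ℝ | 2 ^ n * σ < |t|} :=
        ha.mono_set fun t (ht : 2 ^ n * σ < |t|) => hσn.trans_lt ht
      have h2 := enorm_setIntegral_div_shell_le (a := a) (by positivity : (0 : ℝ) < 2 ^ (n + 1) * σ) (by rwa [e])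
      rw [e] at h2
      refine ih.trans ?_
      rw [truncIntegral_eq_add hle hi, Finset.sum_range_succ, add_assoc]
      exact add_le_add le_rfl ((enorm_add_le _ _).trans (add_le_add h2 le_rfl))
  have hlim := ((tendsto_truncIntegral_atTop hσ ha).enorm).const_add
    (∑' m : ℕ, shellNorm (fun τ => τ⁻¹) a (2 ^ (m + 1) * σ))
  rw [enorm_zero, add_zero] at hlim
  exact ge_of_tendsto' hlim fun l => (h l).trans (add_le_add (ENNReal.sum_le_tsum _) le_rfl)

/-- Minkowski's inequality for partial sums, then Fatou's lemma. -/
lemma lintegral_tsum_rpow_le {α : Type*} [MeasurableSpace α] {μ : Measure α} {p : ℝ} (hp : 1 ≤ p) {a : ℕ → α → ℝ≥0∞}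
    (ha : ∀ m, Measurable (a m)) {δ : ℕ → ℝ≥0∞} {I : ℝ≥0∞} (h : ∀ m, ∫⁻ x, a m x ^ p ∂μ ≤ δ m * I) :
    ∫⁻ x, (∑' m, a m x) ^ p ∂μ ≤ (∑' m, δ m ^ (1 / p)) ^ p * I := by
  have hp0 : 0 < p := by linarith
  have hpart : ∀ n, (∫⁻ x, (∑ m ∈ Finset.range n, a m x) ^ p ∂μ) ^ (1 / p) ≤
      (∑ m ∈ Finset.range n, δ m ^ (1 / p)) * I ^ (1 / p) := by
    intro n
    induction n with
    | zero => simp [hp0]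
    | succ n ih =>
      simp only [Finset.sum_range_succ]
      refine (ENNReal.lintegral_Lp_add_le (f := fun x => ∑ m ∈ Finset.range n, a m x) (g := a n)
        (Finset.measurable_sum _ fun m _ => ha m).aemeasurable (ha n).aemeasurable hp).trans ?_
      rw [add_mul, ← ENNReal.mul_rpow_of_nonneg (δ n) _ (by positivity)]
      exact add_le_add ih (ENNReal.rpow_le_rpow (h n) (by positivity))
  have hpart' : ∀ n, ∫⁻ x, (∑ m ∈ Finset.range n, a m x) ^ p ∂μ ≤ (∑' m, δ m ^ (1 / p)) ^ p * I := fun n => by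
    have h1 := (hpart n).trans (mul_le_mul_left (ENNReal.sum_le_tsum _) _)
    rw [← ENNReal.rpow_le_rpow_iff (z := 1 / p) (by positivity), ENNReal.mul_rpow_of_nonneg _ _ (by positivity),
      ← ENNReal.rpow_mul, mul_one_div_cancel hp0.ne', ENNReal.rpow_one]
    exact h1
  have hlim : ∀ x, ∑' m, a m x = liminf (fun n => ∑ m ∈ Finset.range n, a m x) atTop := fun x =>
    (ENNReal.tendsto_nat_tsum _).liminf_eq.symm
  simp_rw [hlim]
  exact lintegral_liminf_rpow_le (fun n => Finset.measurable_sum _ fun m _ => ha m) hp0 hpart'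

lemma tsum_scaleDecay_ne_top {p : ℝ} (hp : 0 < p) (C : ℝ≥0) :
    (∑' m : ℕ, (C * ENNReal.ofReal (scaleDecay (m + 1))) ^ (1 / p)) ≠ ⊤ := by
  set q : ℝ := 2 ^ (-(3 / 10) * (1 / p)) with hq
  have hq0 : 0 < q := Real.rpow_pos_of_pos (by norm_num) _
  have hq1 : q < 1 := by
    refine Real.rpow_lt_one_of_one_lt_of_neg (by norm_num) ?_
    have : 0 < 1 / p := by positivity
    linarith
  have e : ∀ m : ℕ, (C * ENNReal.ofReal (scaleDecay (m + 1))) ^ (1 / p) =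
      (C : ℝ≥0∞) ^ (1 / p) * ENNReal.ofReal (q ^ (m + 1)) := fun m => by
    rw [ENNReal.mul_rpow_of_nonneg _ _ (by positivity), ENNReal.ofReal_rpow_of_pos (scaleDecay_pos _), scaleDecay, hq,
      ← Real.rpow_mul (by norm_num), ← Real.rpow_natCast, ← Real.rpow_mul (by norm_num)]
    congr 3
    ring
  simp_rw [e]
  rw [ENNReal.tsum_mul_left, ← ENNReal.ofReal_tsum_of_nonneg (fun m => by positivity)
    ((summable_nat_add_iff 1).2 (summable_geometric_of_lt_one hq0.le hq1))]
  finiteness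

/-- The exponent of the largest dyadic radius at which the parabola is flat at frequency `2^k`. -/
def scaleExp (k : ℤ) (u : ℝ → ℝ) (x : ℝ) : ℤ := ⌊-Real.logb 2 ((2 : ℝ) ^ k * |u x|) / 2⌋

/-- The dyadic radii at which the parabolas are curved at frequency `2^k`. -/
def scaleRadius (k : ℤ) (u : ℝ → ℝ) (l : ℕ) (x : ℝ) : ℝ := 2 ^ l * 2 ^ scaleExp k u x

lemma scaleRadius_pos (k : ℤ) (u : ℝ → ℝ) (l : ℕ) (x : ℝ) : 0 < scaleRadius k u l x := by
  unfold scaleRadius; positivity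

lemma measurable_scaleRadius (k : ℤ) {u : ℝ → ℝ} (hu : Measurable u) (l : ℕ) : Measurable (scaleRadius k u l) := by
  have h1 : Measurable (scaleExp k u) := by
    refine Int.measurable_floor.comp (Measurable.div_const (Measurable.neg ?_) 2)
    unfold Real.logb
    fun_prop
  exact ((Measurable.of_discrete (f := fun i : ℤ => (2 : ℝ) ^ i)).comp h1).const_mul _

/-- Taking the integer part of half a logarithm loses at most a factor `2` in the radius, hence `4`
in its square. -/
lemma four_zpow_scaleExp_mul {k : ℤ} {u : ℝ → ℝ} {x : ℝ} (hx : u x ≠ 0) :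
    1 / 4 ≤ ((2 : ℝ) ^ scaleExp k u x) ^ 2 * ((2 : ℝ) ^ k * |u x|) ∧
      ((2 : ℝ) ^ scaleExp k u x) ^ 2 * ((2 : ℝ) ^ k * |u x|) ≤ 1 := by
  have hP : 0 < (2 : ℝ) ^ k * |u x| := by positivity
  set P := (2 : ℝ) ^ k * |u x| with hPdef
  set i := scaleExp k u x with hi
  have h1 : (i : ℝ) ≤ -Real.logb 2 P / 2 := Int.floor_le _
  have h2 : -Real.logb 2 P / 2 < i + 1 := Int.lt_floor_add_one _
  have e : ((2 : ℝ) ^ i) ^ 2 * P = 2 ^ (2 * (i : ℝ) + Real.logb 2 P) := by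
    rw [Real.rpow_add (by norm_num), Real.rpow_logb (by norm_num) (by norm_num) hP, mul_comm (2 : ℝ) (i : ℝ),
      Real.rpow_mul (by norm_num), Real.rpow_intCast]
    norm_num
  rw [e]
  constructor
  · rw [show (1 / 4 : ℝ) = 2 ^ (-2 : ℝ) by norm_num [Real.rpow_neg]]
    exact Real.rpow_le_rpow_of_exponent_le (by norm_num) (by linarith)
  · exact Real.rpow_le_one_of_one_le_of_nonpos (by norm_num) (by linarith)

/-- Stated through `|r x|` so that it applies to the halves `t > 0` and `t < 0` of a shell, with `r
= ± scaleRadius`. -/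
lemma isScale_of_abs_eq {k : ℤ} {u : ℝ → ℝ} (hu : Measurable u) (l : ℕ) {r : ℝ → ℝ} (hr : Measurable r)
    (hpos : ∀ x x', 0 < r x * r x') (habs : ∀ x, |r x| = scaleRadius k u l x) :
    IsScale k l r (fun x => u x * scaleRadius k u l x ^ 2) {x | u x ≠ 0} := by
  have e : ∀ x, (2 : ℝ) ^ k * |u x * scaleRadius k u l x ^ 2| =
      4 ^ l * (((2 : ℝ) ^ scaleExp k u x) ^ 2 * ((2 : ℝ) ^ k * |u x|)) := fun x => by
    rw [abs_mul, abs_of_nonneg (sq_nonneg (scaleRadius k u l x)), scaleRadius, mul_pow,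
      show ((2 : ℝ) ^ l) ^ 2 = 4 ^ l by rw [← pow_mul, mul_comm, pow_mul]; norm_num]
    ring
  exact
    { measurable_fst := hr
      measurable_snd := hu.mul ((measurable_scaleRadius k hu l).pow_const 2)
      measurableSet := (measurableSet_eq_fun hu measurable_const).compl
      mul_pos := fun x _ x' _ => hpos x x'
      dyadic := fun x _ => ⟨l + scaleExp k u x, by
        rw [habs, scaleRadius, zpow_add₀ (by norm_num), zpow_natCast]⟩
      le_mul := fun x hx => by
        rw [e x]
        have := (four_zpow_scaleExp_mul (k := k) hx).1
        nlinarith [pow_pos (by norm_num : (0 : ℝ) < 4) l]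
      mul_le := fun x hx => by
        rw [e x]
        exact mul_le_of_le_one_right (by positivity) (four_zpow_scaleExp_mul (k := k) hx).2 }

end DyadicShells

end

noncomputable section

/-! ### Pointwise control by flat and curved parts. -/

section PointwiseBounds

/-- The contribution of the curved parts of the parabolas. -/
def curvedPart (ρ : ℝ → ℝ) (k : ℤ) (u : ℝ → ℝ) (F : ℝ × ℝ → ℂ) (z : ℝ × ℝ) : ℝ≥0∞ :=
  ∑' m : ℕ, ({x | u x ≠ 0} ×ˢ Set.univ).indicator
    (fun z => shellNorm ρ (alongParabola u F z) (scaleRadius k u (m + 1) z.1)) z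

lemma shellNorm_alongParabola (ρ : ℝ → ℝ) (k : ℤ) (u : ℝ → ℝ) (F : ℝ × ℝ → ℂ) (l : ℕ) (z : ℝ × ℝ) :
    shellNorm ρ (alongParabola u F z) (scaleRadius k u l z.1) =
      ‖scaleOp ρ (scaleRadius k u l) (fun x => u x * scaleRadius k u l x ^ 2) F z‖ₑ +
      ‖scaleOp ρ (fun x => -scaleRadius k u l x) (fun x => u x * scaleRadius k u l x ^ 2) F z‖ₑ := by
  unfold shellNorm scaleOp alongParabola
  congr 3
  · ext τ; congr 3; ring
  · ext τ; congr 3 <;> ring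

lemma measurable_curvedPart_summand {ρ : ℝ → ℝ} (hρ : Measurable ρ) (k : ℤ) {u : ℝ → ℝ} (hu : Measurable u) {F : ℝ × ℝ → ℂ}
    (hF : Measurable F) (l : ℕ) : Measurable (({x | u x ≠ 0} ×ˢ Set.univ).indicator
    (fun z => shellNorm ρ (alongParabola u F z) (scaleRadius k u l z.1))) := by
  have hE : MeasurableSet {x | u x ≠ 0} := (measurableSet_eq_fun hu measurable_const).compl
  have hr := measurable_scaleRadius k hu l
  have hv := hu.mul (hr.pow_const 2)
  refine Measurable.indicator ?_ (hE.prod MeasurableSet.univ)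
  simp_rw [shellNorm_alongParabola]
  exact (measurable_scaleOp hρ hr hv hF).enorm.add (measurable_scaleOp hρ hr.neg hv hF).enorm

/-- On each shell the two halves are single-scale operators with decay `scaleDecay (m + 1)`; the
`p`-th roots of these constants form a convergent geometric series. -/
lemma IsLPBump.exists_lintegral_curvedPart_le {φ₀ : ℝ → ℝ} (h : IsLPBump φ₀) {p : ℝ} (hp : 39 / 20 < p) : ∃ C : ℝ≥0,
    ∀ {ρ ρ' : ℝ → ℝ} (_ : IsAmplitude ρ ρ') (k : ℤ) {u : ℝ → ℝ} (_ : Measurable u) {f : ℝ × ℝ → ℂ} (_ : Measurable f)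
    (_ : ∫⁻ z, ‖f z‖ₑ ^ p ≠ ⊤), ∫⁻ z, curvedPart ρ k u (lpProj φ₀ k f) z ^ p ≤ C * ∫⁻ z, ‖f z‖ₑ ^ p := by
  obtain ⟨C, hC⟩ := h.exists_lintegral_scaleOp_rpow_le hp
  have hp0 : 0 < p := by linarith
  have hp1 : 1 ≤ p := by linarith
  set C' : ℝ≥0 := 2 ^ (p - 1) * (2 * C) with hC'
  set T := (∑' m : ℕ, (C' * ENNReal.ofReal (scaleDecay (m + 1))) ^ (1 / p)) ^ p with hT
  have hTfin : T ≠ ⊤ := ENNReal.rpow_ne_top_of_nonneg hp0.le (tsum_scaleDecay_ne_top hp0 C')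
  refine ⟨T.toNNReal, ?_⟩
  intro ρ ρ' hρ k u hu f hf hfin
  rw [ENNReal.coe_toNNReal hTfin]
  have hF := h.measurable_lpProj k hf
  refine lintegral_tsum_rpow_le hp1 (fun m => measurable_curvedPart_summand hρ.measurable k hu hF (m + 1)) fun m => ?_
  set E := {x | u x ≠ 0} with hE
  have hEm : MeasurableSet (E ×ˢ (Set.univ : Set ℝ)) :=
    MeasurableSet.prod (measurableSet_eq_fun hu measurable_const).compl MeasurableSet.univ
  set r := scaleRadius k u (m + 1) with hr
  have hrm : Measurable r := measurable_scaleRadius k hu (m + 1)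
  have hr0 := scaleRadius_pos k u (m + 1)
  set v : ℝ → ℝ := fun x => u x * r x ^ 2 with hv
  have s1 : IsScale k (m + 1) r v E := isScale_of_abs_eq hu (m + 1) hrm
    (fun x x' => mul_pos (hr0 x) (hr0 x')) fun x => abs_of_pos (hr0 x)
  have s2 : IsScale k (m + 1) (fun x => -r x) v E := isScale_of_abs_eq hu (m + 1) hrm.neg
    (fun x x' => mul_pos_of_neg_of_neg (neg_lt_zero.2 (hr0 x)) (neg_lt_zero.2 (hr0 x'))) fun x => by
      rw [abs_neg]; exact abs_of_pos (hr0 x)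
  have b1 := hC hρ s1 hf hfin
  have b2 := hC hρ s2 hf hfin
  have hm1 : Measurable (scaleOp ρ r v (lpProj φ₀ k f)) := measurable_scaleOp hρ.measurable hrm s1.measurable_snd hF
  calc _ = ∫⁻ z in E ×ˢ Set.univ, (‖scaleOp ρ r v (lpProj φ₀ k f) z‖ₑ +
        ‖scaleOp ρ (fun x => -r x) v (lpProj φ₀ k f) z‖ₑ) ^ p := by
        rw [← lintegral_indicator hEm]
        refine lintegral_congr fun z => ?_
        by_cases hz : z ∈ E ×ˢ (Set.univ : Set ℝ)
        · rw [Set.indicator_of_mem hz, Set.indicator_of_mem hz, shellNorm_alongParabola]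
        · rw [Set.indicator_of_notMem hz, Set.indicator_of_notMem hz, ENNReal.zero_rpow_of_pos hp0]
    _ ≤ ∫⁻ z in E ×ˢ Set.univ, 2 ^ (p - 1) * (‖scaleOp ρ r v (lpProj φ₀ k f) z‖ₑ ^ p +
        ‖scaleOp ρ (fun x => -r x) v (lpProj φ₀ k f) z‖ₑ ^ p) := lintegral_mono fun z => add_rpow_le_two hp1 _ _
    _ = 2 ^ (p - 1) * ((∫⁻ z in E ×ˢ Set.univ, ‖scaleOp ρ r v (lpProj φ₀ k f) z‖ₑ ^ p) +
        ∫⁻ z in E ×ˢ Set.univ, ‖scaleOp ρ (fun x => -r x) v (lpProj φ₀ k f) z‖ₑ ^ p) := by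
        rw [lintegral_const_mul' _ _ (ENNReal.rpow_ne_top_of_nonneg (by linarith) (by norm_num)),
          lintegral_add_left (hm1.enorm.pow_const p)]
    _ ≤ 2 ^ (p - 1) * (C * ENNReal.ofReal (scaleDecay (m + 1)) * (∫⁻ z, ‖f z‖ₑ ^ p) +
        C * ENNReal.ofReal (scaleDecay (m + 1)) * ∫⁻ z, ‖f z‖ₑ ^ p) := mul_le_mul_right (add_le_add b1 b2) _
    _ = _ := by
        rw [hC', ENNReal.coe_mul, ENNReal.coe_rpow_of_nonneg _ (by linarith)]
        push_cast
        ring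

lemma mul_sq_le_one_of_abs_le {R w s t : ℝ} (hR : 0 ≤ R) (hs : s ^ 2 * (R * |w|) ≤ 1) (ht : |t| ≤ s) :
    R * |w * t ^ 2| ≤ 1 := by
  rw [abs_mul, abs_of_nonneg (sq_nonneg t), ← sq_abs t]
  have h1 : |t| ^ 2 ≤ s ^ 2 := pow_le_pow_left₀ (abs_nonneg t) ht 2
  nlinarith [mul_nonneg hR (abs_nonneg w)]

/-- Near the vertex the parabola is flat at frequency `2^k`. -/
lemma IsLPBump.exists_lintegral_flat_le {φ₀ : ℝ → ℝ} (h : IsLPBump φ₀) : ∃ C : ℝ≥0, ∀ (k : ℤ) (u : ℝ → ℝ) {f : ℝ × ℝ → ℂ},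
    Measurable f → ∀ (z : ℝ × ℝ) (j : ℤ), ((2 : ℝ) ^ j) ^ 2 * ((2 : ℝ) ^ k * |u z.1|) ≤ 1 →
    ∫⁻ t in {t : ℝ | |t| ≤ 2 ^ j}, ‖alongParabola u (lpProj φ₀ k f) z t‖ₑ ≤
      ENNReal.ofReal (2 ^ j) * (C * hlMax₁ (hlMax₂ fun w => ‖f w‖ₑ) z) := by
  obtain ⟨C, hC⟩ := h.exists_enorm_lpProj_shift_le
  refine ⟨C * 2, fun k u f hf z j hj => ?_⟩
  have hm := measurable_hlMax₂ (g := fun w => ‖f w‖ₑ) hf.enorm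
  have hmeas : MeasurableSet {t : ℝ | |t| ≤ 2 ^ j} := measurableSet_le measurable_abs measurable_const
  calc _ ≤ ∫⁻ t in {t : ℝ | |t| ≤ 2 ^ j}, (C * 2 : ℝ≥0) * hlMax₂ (fun w => ‖f w‖ₑ) (z.1 - t, z.2) := by
        refine setLIntegral_mono' hmeas fun t ht => (hC k hf _ _ _).trans (mul_le_mul_left ?_ _)
        push_cast
        refine mul_le_mul_right ?_ _
        rw [← ENNReal.ofReal_ofNat 2]
        refine ENNReal.ofReal_le_ofReal ?_
        have h1 := mul_sq_le_one_of_abs_le (by positivity) hj ht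
        have h2 : |(2 : ℝ) ^ k * (u z.1 * t ^ 2)| ≤ 1 := by
          rwa [abs_mul, abs_of_pos (by positivity : (0 : ℝ) < 2 ^ k)]
        have h3 := (sq_le_one_iff_abs_le_one _).2 h2
        linarith
    _ = (C * 2 : ℝ≥0) * ∫⁻ t in Set.Icc (-(2 : ℝ) ^ j) (2 ^ j), hlMax₂ (fun w => ‖f w‖ₑ) (z.1 - t, z.2) := by
        rw [lintegral_const_mul' _ _ ENNReal.coe_ne_top, setOf_abs_le]
    _ ≤ (C * 2 : ℝ≥0) * (ENNReal.ofReal (2 ^ j) * hlMax₁ (hlMax₂ fun w => ‖f w‖ₑ) z) :=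
        mul_le_mul_right (lintegral_Icc_le_mul_hlMax (fun s => hlMax₂ (fun w => ‖f w‖ₑ) (s, z.2)) z.1 j) _
    _ = _ := by ring

/-- Moving from the parabola to the horizontal line costs `2^k |u| t²` times a maximal function.
Division by `t` leaves a factor at most `2^j 2^k |u|`, and integration over `|t| ≤ 2^j` supplies the
second `2^j`, so the total factor is at most `1`. -/
lemma IsLPBump.exists_lintegral_flat_sub_le {φ₀ : ℝ → ℝ} (h : IsLPBump φ₀) : ∃ C : ℝ≥0, ∀ (k : ℤ) (u : ℝ → ℝ)
    {f : ℝ × ℝ → ℂ}, Measurable f → ∀ (z : ℝ × ℝ) (j : ℤ), ((2 : ℝ) ^ j) ^ 2 * ((2 : ℝ) ^ k * |u z.1|) ≤ 1 →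
    ∫⁻ t in {t : ℝ | |t| ≤ 2 ^ j},
      ‖(alongParabola u (lpProj φ₀ k f) z t - lpProj φ₀ k f (z.1 - t, z.2)) / (t : ℂ)‖ₑ ≤
      C * hlMax₁ (hlMax₂ fun w => ‖f w‖ₑ) z := by
  obtain ⟨C, hC⟩ := h.exists_enorm_lpProj_sub_le
  refine ⟨C, fun k u f hf z j hj => ?_⟩
  have hm := measurable_hlMax₂ (g := fun w => ‖f w‖ₑ) hf.enorm
  have hmeas : MeasurableSet {t : ℝ | |t| ≤ 2 ^ j} := measurableSet_le measurable_abs measurable_const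
  have hj0 : (0 : ℝ) < 2 ^ j := by positivity
  calc _ ≤ ∫⁻ t in {t : ℝ | |t| ≤ 2 ^ j}, C * ENNReal.ofReal (2 ^ j * (2 ^ k * |u z.1|)) *
        hlMax₂ (fun w => ‖f w‖ₑ) (z.1 - t, z.2) := by
        refine setLIntegral_mono' hmeas fun t ht => ?_
        have ht : |t| ≤ 2 ^ j := ht
        rcases eq_or_ne t 0 with rfl | ht0
        · simp
        have h1 := hC k hf (z.1 - t) z.2 (u z.1 * t ^ 2) (mul_sq_le_one_of_abs_le (by positivity) hj ht)
        rw [div_eq_mul_inv, enorm_mul]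
        refine (mul_le_mul_left h1 _).trans ?_
        rw [mul_right_comm, mul_assoc (C : ℝ≥0∞)]
        refine mul_le_mul_left (mul_le_mul_right ?_ _) _
        rw [← ofReal_norm, norm_inv, Complex.norm_real, Real.norm_eq_abs, ← ENNReal.ofReal_mul (by positivity)]
        refine ENNReal.ofReal_le_ofReal ?_
        have ht' : 0 < |t| := abs_pos.2 ht0
        rw [abs_mul, abs_of_nonneg (sq_nonneg t), ← sq_abs t]
        have e : (2 : ℝ) ^ k * (|u z.1| * |t| ^ 2) * |t|⁻¹ = |t| * (2 ^ k * |u z.1|) := by field_simp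
        rw [e]
        gcongr
    _ = C * ENNReal.ofReal (2 ^ j * (2 ^ k * |u z.1|)) *
        ∫⁻ t in Set.Icc (-(2 : ℝ) ^ j) (2 ^ j), hlMax₂ (fun w => ‖f w‖ₑ) (z.1 - t, z.2) := by
        rw [lintegral_const_mul' _ _ (by finiteness), setOf_abs_le]
    _ ≤ C * ENNReal.ofReal (2 ^ j * (2 ^ k * |u z.1|)) *
        (ENNReal.ofReal (2 ^ j) * hlMax₁ (hlMax₂ fun w => ‖f w‖ₑ) z) :=
        mul_le_mul_right (lintegral_Icc_le_mul_hlMax (fun s => hlMax₂ (fun w => ‖f w‖ₑ) (s, z.2)) z.1 j) _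
    _ = C * ENNReal.ofReal ((2 ^ j) ^ 2 * (2 ^ k * |u z.1|)) * hlMax₁ (hlMax₂ fun w => ‖f w‖ₑ) z := by
        rw [show ((2 : ℝ) ^ j) ^ 2 * (2 ^ k * |u z.1|) = 2 ^ j * (2 ^ k * |u z.1|) * 2 ^ j by ring,
          ENNReal.ofReal_mul (by positivity : (0 : ℝ) ≤ 2 ^ j * (2 ^ k * |u z.1|))]
        ring
    _ ≤ C * 1 * hlMax₁ (hlMax₂ fun w => ‖f w‖ₑ) z := by
        gcongr
        rw [← ENNReal.ofReal_one]
        exact ENNReal.ofReal_le_ofReal hj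
    _ = _ := by rw [mul_one]

lemma intervalIntegral_eq_setIntegral_abs_le (a : ℝ → ℂ) {s : ℝ} (hs : 0 ≤ s) :
    ∫ t in (-s)..s, a t = ∫ t in {t : ℝ | |t| ≤ s}, a t := by
  rw [intervalIntegral.integral_of_le (by linarith), setOf_abs_le, integral_Icc_eq_integral_Ioc]

/-- An average with flat radius is bounded by the iterated maximal function. A larger radius is
`2^l` times the critical one, and its integral is the critical flat integral plus `l` shell
integrals whose weights do not exceed the total radius. -/
lemma IsLPBump.exists_parabolaMaximal_le {φ₀ : ℝ → ℝ} (h : IsLPBump φ₀) : ∃ C : ℝ≥0, ∀ (k : ℤ) (u : ℝ → ℝ)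
    {f : ℝ × ℝ → ℂ}, Measurable f → ∀ (z : ℝ × ℝ),
    (∀ s, IntegrableOn (alongParabola u (lpProj φ₀ k f) z) {t : ℝ | |t| ≤ s}) →
    parabolaMaximal u (lpProj φ₀ k f) z ≤ C * hlMax₁ (hlMax₂ fun w => ‖f w‖ₑ) z +
      curvedPart (fun _ => 1) k u (lpProj φ₀ k f) z := by
  obtain ⟨C, hC⟩ := h.exists_lintegral_flat_le
  refine ⟨C, fun k u f hf z hz => iSup_le fun j => ?_⟩
  have hj0 : (0 : ℝ) < 2 ^ j := by positivity
  rw [intervalIntegral_eq_setIntegral_abs_le _ hj0.le]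
  set a := alongParabola u (lpProj φ₀ k f) z with ha
  set D := C * hlMax₁ (hlMax₂ fun w => ‖f w‖ₑ) z with hD
  have hlow : ∀ i : ℤ, ((2 : ℝ) ^ i) ^ 2 * ((2 : ℝ) ^ k * |u z.1|) ≤ 1 →
      ‖∫ t in {t : ℝ | |t| ≤ 2 ^ i}, a t‖ₑ ≤ ENNReal.ofReal (2 ^ i) * D := fun i hi =>
    (enorm_integral_le_lintegral_enorm _).trans (hC k u hf z i hi)
  have key : ‖∫ t in {t : ℝ | |t| ≤ 2 ^ j}, a t‖ₑ ≤
      ENNReal.ofReal (2 ^ j) * (D + curvedPart (fun _ => 1) k u (lpProj φ₀ k f) z) := by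
    by_cases hj : ((2 : ℝ) ^ j) ^ 2 * ((2 : ℝ) ^ k * |u z.1|) ≤ 1
    · exact (hlow j hj).trans (mul_le_mul_right le_self_add _)
    have hu0 : u z.1 ≠ 0 := fun h0 => hj (by rw [h0]; simp)
    have hi := (four_zpow_scaleExp_mul (k := k) hu0).2
    set i := scaleExp k u z.1 with hidef
    have hij : i < j := by
      by_contra hcon
      refine hj (le_trans ?_ hi)
      have : (2 : ℝ) ^ j ≤ 2 ^ i := zpow_le_zpow_right₀ one_le_two (not_lt.1 hcon)
      gcongr
    obtain ⟨l, hl⟩ := Int.eq_ofNat_of_zero_le (sub_nonneg.2 hij.le)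
    have hjl : (2 : ℝ) ^ j = 2 ^ l * 2 ^ i := by
      rw [← zpow_natCast, ← zpow_add₀ (by norm_num)]
      congr 1
      omega
    have := enorm_setIntegral_abs_le_le (by positivity : (0 : ℝ) < 2 ^ i) hz (hlow i hi) l
    rw [← hjl] at this
    refine this.trans (le_of_eq ?_)
    congr 2
    refine tsum_congr fun m => ?_
    rw [Set.indicator_of_mem (show z ∈ {x | u x ≠ 0} ×ˢ Set.univ from ⟨hu0, trivial⟩)]
    rfl
  rw [ENNReal.ofReal_mul (by positivity), ofReal_norm]
  refine (mul_le_mul_right key _).trans (le_of_eq ?_)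
  rw [← mul_assoc, ← ENNReal.ofReal_mul (by positivity), one_div_mul_cancel hj0.ne', ENNReal.ofReal_one, one_mul]

/-- Existence of the principal value along the parabola, with a pointwise bound. -/
lemma IsLPBump.exists_tendsto_parabolaHilbertTrunc {φ₀ : ℝ → ℝ} (h : IsLPBump φ₀) : ∃ C : ℝ≥0, ∀ (k : ℤ) (u : ℝ → ℝ)
    {f : ℝ × ℝ → ℂ}, Measurable u → Measurable f → ∀ (z : ℝ × ℝ) {W : ℝ≥0∞},
    (∀ ε > 0, IntegrableOn (fun t => alongParabola u (lpProj φ₀ k f) z t / (t : ℂ)) {t : ℝ | ε < |t|}) →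
    (∀ ε > 0, IntegrableOn (fun t => lpProj φ₀ k f (z.1 - t, z.2) / (t : ℂ)) {t : ℝ | ε < |t|}) →
    hlMax₁ (hlMax₂ fun w => ‖f w‖ₑ) z ≠ ⊤ →
    (∀ ε > 0, ‖truncIntegral (fun t => lpProj φ₀ k f (z.1 - t, z.2)) ε‖ₑ ≤ W) →
    (∃ l, Tendsto (truncIntegral fun t => lpProj φ₀ k f (z.1 - t, z.2)) (𝓝[>] 0) (𝓝 l)) →
    ∃ l, Tendsto (parabolaHilbertTrunc u (lpProj φ₀ k f) z) (𝓝[>] 0) (𝓝 l) ∧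
      ‖l‖ₑ ≤ 2 * W + C * hlMax₁ (hlMax₂ fun w => ‖f w‖ₑ) z + curvedPart (fun τ => τ⁻¹) k u (lpProj φ₀ k f) z := by
  obtain ⟨C, hC⟩ := h.exists_lintegral_flat_sub_le
  refine ⟨C, fun k u f hum hf z W ha hb hM hW ⟨l, hl⟩ => ?_⟩
  have hFm := h.measurable_lpProj k hf
  set F := lpProj φ₀ k f with hF
  set a := alongParabola u F z with hadef
  set b : ℝ → ℂ := fun t => F (z.1 - t, z.2) with hbdef
  have hb : ∀ ε > 0, IntegrableOn (fun t => b t / (t : ℂ)) {t : ℝ | ε < |t|} := hb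
  have hlW : ‖l‖ₑ ≤ W := by
    refine le_of_tendsto hl.enorm ?_
    filter_upwards [self_mem_nhdsWithin] with ε hε using hW ε hε
  -- Where `u` vanishes the parabola is a horizontal line, and the assertion is that for the Hilbert
  -- transform in the first variable.
  by_cases hu0 : u z.1 = 0
  · have hab : a = b := by
      ext t; simp [hadef, hbdef, alongParabola, hu0]
    refine ⟨l, ?_, ?_⟩
    · have : parabolaHilbertTrunc u F z = truncIntegral b := by rw [← hab]; rfl
      rw [this]; exact hl
    · rw [two_mul, add_assoc, add_assoc]
      exact hlW.trans le_self_add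
  have hi := (four_zpow_scaleExp_mul (k := k) hu0).2
  set i := scaleExp k u z.1 with hidef
  set s : ℝ := 2 ^ i with hs
  have hs0 : 0 < s := by positivity
  have hd := hC k u hf z i hi
  have hdint : IntegrableOn (fun t => (a t - b t) / (t : ℂ)) {t : ℝ | |t| ≤ s} := by
    refine ⟨?_, hd.trans_lt (ENNReal.mul_lt_top (by simp) hM.lt_top)⟩
    have : Measurable a := by
      rw [hadef]; unfold alongParabola; fun_prop
    apply Measurable.aestronglyMeasurable; fun_prop
  -- Beyond the critical radius `s` the parabola is kept (`a`); inside, it is compared with the line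
  -- (`b`). The line's principal value over `|t| ≤ s` is `l - truncIntegral b s`, which accounts for
  -- the two copies of `W`, and the difference integral converges absolutely.
  refine ⟨l - truncIntegral b s + truncIntegral a s + ∫ t in {t : ℝ | |t| ≤ s}, (a t - b t) / (t : ℂ), ?_, ?_⟩
  · refine (((hl.sub_const _).add_const _).add (tendsto_setIntegral_truncated hdint)).congr' ?_
    have h1 : ∀ᶠ ε in 𝓝[>] (0 : ℝ), ε < s := nhdsWithin_le_nhds (eventually_lt_nhds hs0)
    filter_upwards [h1, self_mem_nhdsWithin] with ε hε hε0
    have hε0 : 0 < ε := hε0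
    have e1 := truncIntegral_eq_add hε.le (ha ε hε0)
    have e2 := truncIntegral_eq_add hε.le (hb ε hε0)
    have e3 : ∫ t in {t : ℝ | ε < |t| ∧ |t| ≤ s}, (a t - b t) / (t : ℂ) =
        (∫ t in {t : ℝ | ε < |t| ∧ |t| ≤ s}, a t / (t : ℂ)) - ∫ t in {t : ℝ | ε < |t| ∧ |t| ≤ s}, b t / (t : ℂ) := by
      rw [← integral_sub ((ha ε hε0).mono_set fun t ht => ht.1) ((hb ε hε0).mono_set fun t ht => ht.1)]
      simp_rw [sub_div]
    have e4 : parabolaHilbertTrunc u F z ε = truncIntegral a ε := rfl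
    rw [e3, e4, e1, e2]
    ring
  · have b1 : ‖truncIntegral b s‖ₑ ≤ W := hW s hs0
    have b2 : ‖truncIntegral a s‖ₑ ≤ curvedPart (fun τ => τ⁻¹) k u F z := by
      refine (enorm_truncIntegral_le_tsum hs0 (ha s hs0)).trans (le_of_eq ?_)
      refine tsum_congr fun m => ?_
      rw [Set.indicator_of_mem (show z ∈ {x | u x ≠ 0} ×ˢ Set.univ from ⟨hu0, trivial⟩)]
      rfl
    have b3 : ‖∫ t in {t : ℝ | |t| ≤ s}, (a t - b t) / (t : ℂ)‖ₑ ≤ C * hlMax₁ (hlMax₂ fun w => ‖f w‖ₑ) z :=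
      (enorm_integral_le_lintegral_enorm _).trans hd
    calc _ ≤ ((‖l‖ₑ + ‖truncIntegral b s‖ₑ) + ‖truncIntegral a s‖ₑ) + ‖∫ t in {t : ℝ | |t| ≤ s}, (a t - b t) / (t : ℂ)‖ₑ := by
          refine (enorm_add_le _ _).trans (add_le_add ((enorm_add_le _ _).trans (add_le_add ?_ le_rfl)) le_rfl)
          exact enorm_sub_le
      _ ≤ ((W + W) + curvedPart (fun τ => τ⁻¹) k u F z) + C * hlMax₁ (hlMax₂ fun w => ‖f w‖ₑ) z := by gcongr
      _ = _ := by ring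

end PointwiseBounds

end

noncomputable section

/-! ### Measurability and the `L^p` bounds for measurable representatives. -/

section MainBounds

lemma measurable_setIntegral_alongParabola {u : ℝ → ℝ} (hu : Measurable u) {F : ℝ × ℝ → ℂ} (hF : Measurable F) {w : ℝ → ℂ}
    (hw : Measurable w) (s : Set ℝ) : Measurable fun z => ∫ t in s, alongParabola u F z t / w t := by
  have : StronglyMeasurable fun z : ℝ × ℝ => ∫ t in s, alongParabola u F z t / w t :=
    StronglyMeasurable.integral_prod_right (f := fun (z : ℝ × ℝ) (t : ℝ) => alongParabola u F z t / w t)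
      (Measurable.stronglyMeasurable (by simp only [Function.uncurry_def, alongParabola]; fun_prop))
  exact this.measurable

lemma measurable_parabolaMaximal {u : ℝ → ℝ} (hu : Measurable u) {F : ℝ × ℝ → ℂ} (hF : Measurable F) :
    Measurable (parabolaMaximal u F) := by
  refine Measurable.iSup fun j => ?_
  have h := measurable_setIntegral_alongParabola hu hF (w := fun _ => 1) measurable_const {t : ℝ | |t| ≤ 2 ^ j}
  simp only [div_one] at h
  simp_rw [intervalIntegral_eq_setIntegral_abs_le _ (by positivity : (0 : ℝ) ≤ 2 ^ j)]
  fun_prop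

lemma measurable_parabolaHilbertTrunc {u : ℝ → ℝ} (hu : Measurable u) {F : ℝ × ℝ → ℂ} (hF : Measurable F) (ε : ℝ) :
    Measurable fun z => parabolaHilbertTrunc u F z ε :=
  measurable_setIntegral_alongParabola hu hF Complex.measurable_ofReal _

lemma IsLPBump.exists_lintegral_lpProj_le {φ₀ : ℝ → ℝ} (h : IsLPBump φ₀) {p : ℝ} (hp : 1 < p) : ∃ C : ℝ≥0, ∀ (k : ℤ)
    {f : ℝ × ℝ → ℂ}, Measurable f → ∫⁻ z, ‖lpProj φ₀ k f z‖ₑ ^ p ≤ C * ∫⁻ z, ‖f z‖ₑ ^ p := by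
  obtain ⟨C₁, hC₁⟩ := h.exists_enorm_lpProj_shift_le
  obtain ⟨C₂, hC₂⟩ := exists_lintegral_hlMax₂_rpow_le hp
  have hp0 : 0 < p := by linarith
  refine ⟨C₁ ^ p * C₂, fun k f hf => ?_⟩
  have hfe : Measurable fun w => ‖f w‖ₑ := hf.enorm
  calc _ ≤ ∫⁻ z, (C₁ * hlMax₂ (fun w => ‖f w‖ₑ) z) ^ p := by
        refine lintegral_mono fun z => ENNReal.rpow_le_rpow ?_ hp0.le
        simpa using hC₁ k hf z.1 z.2 0
    _ = C₁ ^ p * ∫⁻ z, hlMax₂ (fun w => ‖f w‖ₑ) z ^ p := by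
        simp_rw [ENNReal.mul_rpow_of_nonneg _ _ hp0.le]
        rw [lintegral_const_mul' _ _ (by finiteness)]
    _ ≤ C₁ ^ p * (C₂ * ∫⁻ z, ‖f z‖ₑ ^ p) := mul_le_mul_right (hC₂ _ hfe) _
    _ = _ := by
        rw [ENNReal.coe_mul, ENNReal.coe_rpow_of_nonneg _ hp0.le, mul_assoc]

lemma ae_hlMax₁_hlMax₂_ne_top {p : ℝ} (hp : 1 < p) {f : ℝ × ℝ → ℂ} (hf : Measurable f)
    (hfin : ∫⁻ z, ‖f z‖ₑ ^ p ≠ ⊤) : ∀ᵐ z : ℝ × ℝ, hlMax₁ (hlMax₂ fun w => ‖f w‖ₑ) z ≠ ⊤ := by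
  obtain ⟨C, hC⟩ := exists_lintegral_strongMax_rpow_le hp
  have hfe : Measurable fun w => ‖f w‖ₑ := hf.enorm
  have h1 : ∫⁻ z, hlMax₁ (hlMax₂ fun w => ‖f w‖ₑ) z ^ p ≠ ⊤ :=
    ((hC _ hfe).trans_lt (ENNReal.mul_lt_top (by simp) hfin.lt_top)).ne
  filter_upwards [ae_lt_top ((measurable_hlMax₁ (measurable_hlMax₂ hfe)).pow_const p) h1] with z hz
  exact ((ENNReal.rpow_lt_top_iff_of_pos (by linarith)).1 hz).ne

lemma ae_hlMax₂_ne_top {p : ℝ} (hp : 1 < p) {f : ℝ × ℝ → ℂ} (hf : Measurable f)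
    (hfin : ∫⁻ z, ‖f z‖ₑ ^ p ≠ ⊤) : ∀ᵐ z : ℝ × ℝ, hlMax₂ (fun w => ‖f w‖ₑ) z ≠ ⊤ := by
  obtain ⟨C, hC⟩ := exists_lintegral_hlMax₂_rpow_le hp
  have hfe : Measurable fun w => ‖f w‖ₑ := hf.enorm
  have h1 : ∫⁻ z, hlMax₂ (fun w => ‖f w‖ₑ) z ^ p ≠ ⊤ :=
    ((hC _ hfe).trans_lt (ENNReal.mul_lt_top (by simp) hfin.lt_top)).ne
  filter_upwards [ae_lt_top ((measurable_hlMax₂ hfe).pow_const p) h1] with z hz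
  exact ((ENNReal.rpow_lt_top_iff_of_pos (by linarith)).1 hz).ne

lemma ae_lintegral_alongParabola_ne_top {p : ℝ} {u : ℝ → ℝ} (hu : Measurable u) {F : ℝ × ℝ → ℂ} (hF : Measurable F)
    (hfin : ∫⁻ z, ‖F z‖ₑ ^ p ≠ ⊤) : ∀ᵐ z : ℝ × ℝ, ∫⁻ t, ‖alongParabola u F z t‖ₑ ^ p ≠ ⊤ := by
  filter_upwards [ae_lintegral_parabola_lt_top hu (hF.enorm.pow_const p) hfin] with z hz using hz.ne

lemma measurable_alongParabola (u : ℝ → ℝ) {F : ℝ × ℝ → ℂ} (hF : Measurable F) (z : ℝ × ℝ) :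
    Measurable (alongParabola u F z) := by
  unfold alongParabola; fun_prop

lemma lintegral_add_rpow_le {α : Type*} [MeasurableSpace α] {μ : Measure α} {p : ℝ} (hp : 1 ≤ p) {a b : α → ℝ≥0∞}
    (ha : Measurable a) {A B : ℝ≥0} {I : ℝ≥0∞} (h1 : ∫⁻ x, a x ^ p ∂μ ≤ A * I) (h2 : ∫⁻ x, b x ^ p ∂μ ≤ B * I) :
    ∫⁻ x, (a x + b x) ^ p ∂μ ≤ (2 ^ (p - 1) * (A + B) : ℝ≥0) * I := by
  refine (lintegral_mono fun x => add_rpow_le_two hp _ _).trans ?_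
  rw [lintegral_const_mul' _ _ (ENNReal.rpow_ne_top_of_nonneg (by linarith) (by norm_num)),
    lintegral_add_left (ha.pow_const p), ENNReal.coe_mul, ENNReal.coe_rpow_of_nonneg _ (by linarith), mul_assoc]
  push_cast
  rw [add_mul]
  exact mul_le_mul_right (add_le_add h1 h2) _

lemma lintegral_const_mul_rpow_le {α : Type*} [MeasurableSpace α] {μ : Measure α} {p : ℝ} (hp : 0 ≤ p) {a : α → ℝ≥0∞}
    {A : ℝ≥0} {I : ℝ≥0∞} (h1 : ∫⁻ x, a x ^ p ∂μ ≤ A * I) (c : ℝ≥0) :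
    ∫⁻ x, (c * a x) ^ p ∂μ ≤ (c ^ p * A : ℝ≥0) * I := by
  simp_rw [ENNReal.mul_rpow_of_nonneg _ _ hp]
  rw [lintegral_const_mul' _ _ (ENNReal.rpow_ne_top_of_nonneg hp ENNReal.coe_ne_top), ENNReal.coe_mul,
    ENNReal.coe_rpow_of_nonneg _ hp, mul_assoc]
  exact mul_le_mul_right h1 _

lemma IsLPBump.exists_lintegral_parabolaMaximal_le {φ₀ : ℝ → ℝ} (h : IsLPBump φ₀) {p : ℝ} (hp : 39 / 20 < p) :
    ∃ C : ℝ≥0, ∀ (k : ℤ) {u : ℝ → ℝ} {f : ℝ × ℝ → ℂ}, Measurable u → Measurable f → ∫⁻ z, ‖f z‖ₑ ^ p ≠ ⊤ →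
    (∀ᵐ z : ℝ × ℝ, ∀ s, IntegrableOn (alongParabola u (lpProj φ₀ k f) z) {t : ℝ | |t| ≤ s}) ∧
    ∫⁻ z, parabolaMaximal u (lpProj φ₀ k f) z ^ p ≤ C * ∫⁻ z, ‖f z‖ₑ ^ p := by
  have hp1 : 1 < p := by linarith
  obtain ⟨C₀, hC₀⟩ := h.exists_lintegral_lpProj_le hp1
  obtain ⟨C₁, hC₁⟩ := h.exists_parabolaMaximal_le
  obtain ⟨C₂, hC₂⟩ := exists_lintegral_strongMax_rpow_le hp1
  obtain ⟨C₃, hC₃⟩ := h.exists_lintegral_curvedPart_le hp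
  -- The constant combines the iterated maximal function for the flat part and the amplitude `1` on
  -- the shells.
  refine ⟨2 ^ (p - 1) * (C₁ ^ p * C₂ + C₃), fun k u f hu hf hfin => ?_⟩
  have hF := h.measurable_lpProj k hf
  have hFfin : ∫⁻ z, ‖lpProj φ₀ k f z‖ₑ ^ p ≠ ⊤ := ((hC₀ k hf).trans_lt (ENNReal.mul_lt_top (by simp) hfin.lt_top)).ne
  have hfe : Measurable fun w => ‖f w‖ₑ := hf.enorm
  have hint : ∀ᵐ z : ℝ × ℝ, ∀ s, IntegrableOn (alongParabola u (lpProj φ₀ k f) z) {t : ℝ | |t| ≤ s} := by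
    filter_upwards [ae_lintegral_alongParabola_ne_top hu hF hFfin] with z hz s
    exact integrableOn_of_lintegral_rpow hp1.le (measurable_alongParabola u hF z) hz (volume_setOf_abs_le_ne_top s)
  refine ⟨hint, le_trans (lintegral_mono_ae ?_) (lintegral_add_rpow_le hp1.le
    ((measurable_hlMax₁ (measurable_hlMax₂ hfe)).const_mul C₁)
    (lintegral_const_mul_rpow_le (by linarith) (hC₂ _ hfe) C₁) (hC₃ isAmplitude_one k hu hf hfin))⟩
  filter_upwards [hint] with z hz
  exact ENNReal.rpow_le_rpow (hC₁ k u hf z hz) (by linarith)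

lemma IsLPBump.exists_lintegral_parabolaHilbert_le {φ₀ : ℝ → ℝ} (h : IsLPBump φ₀) {p : ℝ} (hp : 39 / 20 < p) :
    ∃ C : ℝ≥0, ∀ (k : ℤ) {u : ℝ → ℝ} {f : ℝ × ℝ → ℂ}, Measurable u → Measurable f → ∫⁻ z, ‖f z‖ₑ ^ p ≠ ⊤ →
    (∀ᵐ z : ℝ × ℝ, (∀ ε : ℝ, 0 < ε →
        IntegrableOn (fun t : ℝ => alongParabola u (lpProj φ₀ k f) z t / (t : ℂ)) {t : ℝ | ε < |t|}) ∧
      ∃ l : ℂ, Tendsto (parabolaHilbertTrunc u (lpProj φ₀ k f) z) (𝓝[>] (0 : ℝ)) (𝓝 l)) ∧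
    ∫⁻ z, ‖parabolaHilbert u (lpProj φ₀ k f) z‖ₑ ^ p ≤ C * ∫⁻ z, ‖f z‖ₑ ^ p := by
  have hp1 : 1 < p := by linarith
  obtain ⟨C₀, hC₀⟩ := h.exists_lintegral_lpProj_le hp1
  obtain ⟨C₁, hC₁⟩ := h.exists_tendsto_parabolaHilbertTrunc
  obtain ⟨C₂, hC₂⟩ := exists_lintegral_strongMax_rpow_le hp1
  obtain ⟨C₃, hC₃⟩ := h.exists_lintegral_curvedPart_le hp
  obtain ⟨C₄, hC₄⟩ := exists_maximal_truncIntegral hp1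
  -- Three contributions: twice the maximal Hilbert transform in the first variable applied to `P_k
  -- f`, the flat error, and the shells with amplitude `τ⁻¹`.
  refine ⟨2 ^ (p - 1) * (2 ^ (p - 1) * (2 ^ p * (C₄ * C₀) + C₁ ^ p * C₂) + C₃), fun k u f hu hf hfin => ?_⟩
  have hF := h.measurable_lpProj k hf
  have hFfin : ∫⁻ z, ‖lpProj φ₀ k f z‖ₑ ^ p ≠ ⊤ := ((hC₀ k hf).trans_lt (ENNReal.mul_lt_top (by simp) hfin.lt_top)).ne
  have hfe : Measurable fun w => ‖f w‖ₑ := hf.enorm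
  obtain ⟨W, hWm, hWb, hWp⟩ := hC₄ hF hFfin
  have hWp' : ∫⁻ z, W z ^ p ≤ (C₄ * C₀ : ℝ≥0) * ∫⁻ z, ‖f z‖ₑ ^ p := by
    refine hWp.trans ((mul_le_mul_right (hC₀ k hf) _).trans (le_of_eq ?_))
    rw [← mul_assoc]; push_cast; rfl
  have hall : ∀ᵐ z : ℝ × ℝ, (∀ ε : ℝ, 0 < ε →
        IntegrableOn (fun t : ℝ => alongParabola u (lpProj φ₀ k f) z t / (t : ℂ)) {t : ℝ | ε < |t|}) ∧
      ∃ l : ℂ, Tendsto (parabolaHilbertTrunc u (lpProj φ₀ k f) z) (𝓝[>] (0 : ℝ)) (𝓝 l) ∧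
        ‖l‖ₑ ≤ (2 : ℝ≥0) * W z + C₁ * hlMax₁ (hlMax₂ fun w => ‖f w‖ₑ) z + curvedPart (fun τ => τ⁻¹) k u (lpProj φ₀ k f) z := by
    filter_upwards [ae_lintegral_alongParabola_ne_top hu hF hFfin,
      ae_lintegral_alongParabola_ne_top (u := fun _ => 0) measurable_const hF hFfin,
      ae_hlMax₁_hlMax₂_ne_top hp1 hf hfin, hWb, ae_exists_tendsto_truncIntegral hp1 hF hFfin]
      with z hz hz0 hzM hzW hzl
    simp only [alongParabola, zero_mul, sub_zero] at hz0
    have i1 : ∀ ε : ℝ, 0 < ε →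
        IntegrableOn (fun t : ℝ => alongParabola u (lpProj φ₀ k f) z t / (t : ℂ)) {t : ℝ | ε < |t|} := fun ε hε =>
      integrableOn_div_of_lintegral_rpow hp1 (measurable_alongParabola u hF z) hz hε
    have i2 : ∀ ε : ℝ, 0 < ε →
        IntegrableOn (fun t : ℝ => lpProj φ₀ k f (z.1 - t, z.2) / (t : ℂ)) {t : ℝ | ε < |t|} := fun ε hε =>
      integrableOn_div_of_lintegral_rpow hp1 (by fun_prop) hz0 hε
    exact ⟨i1, hC₁ k u hu hf z i1 i2 hzM hzW hzl⟩
  refine ⟨hall.mono fun z hz => ⟨hz.1, hz.2.imp fun l hl => hl.1⟩, le_trans (lintegral_mono_ae ?_)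
    (lintegral_add_rpow_le hp1.le ?_ (lintegral_add_rpow_le hp1.le (hWm.const_mul _)
      (lintegral_const_mul_rpow_le (by linarith) hWp' 2) (lintegral_const_mul_rpow_le (by linarith) (hC₂ _ hfe) C₁))
      (hC₃ isAmplitude_inv k hu hf hfin))⟩
  · filter_upwards [hall] with z hz
    obtain ⟨l, hl, hb⟩ := hz.2
    have : parabolaHilbert u (lpProj φ₀ k f) z = l := hl.limUnder_eq
    rw [this]
    exact ENNReal.rpow_le_rpow hb (by linarith)
  · exact (hWm.const_mul _).add ((measurable_hlMax₁ (measurable_hlMax₂ hfe)).const_mul _)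

/-- Changing `f` on a null set changes it, for almost every `x`, on a null set of the vertical line,
which integration in `t` does not see. So the two projections agree on entire vertical lines; this
is what makes restrictions to parabolas, themselves null sets, independent of the representative. -/
lemma lpProj_eq_of_ae_eq (φ₀ : ℝ → ℝ) (k : ℤ) {f g : ℝ × ℝ → ℂ} (hfg : f =ᵐ[volume] g) :
    ∀ᵐ x : ℝ, ∀ y, lpProj φ₀ k f (x, y) = lpProj φ₀ k g (x, y) := by
  filter_upwards [Measure.ae_ae_of_ae_prod hfg] with x hx y
  refine integral_congr_ae ?_
  have := (quasiMeasurePreserving_sub_left_of_right_invariant volume y).ae hx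
  filter_upwards [this] with t ht
  rw [ht]

lemma ae_alongParabola_ae_eq {u v : ℝ → ℝ} (huv : u =ᵐ[volume] v) {F G : ℝ × ℝ → ℂ} (hFG : ∀ᵐ x : ℝ, ∀ y, F (x, y) = G (x, y)) :
    ∀ᵐ z : ℝ × ℝ, alongParabola u F z =ᵐ[volume] alongParabola v G z := by
  filter_upwards [Measure.quasiMeasurePreserving_fst.ae huv] with z hz
  filter_upwards [(quasiMeasurePreserving_sub_left_of_right_invariant volume z.1).ae hFG] with t ht
  simp only [alongParabola]
  rw [hz, ht]

end MainBounds

end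

/-! ### The main theorem, by reduction to measurable representatives of `u` and `f`. -/

theorem theorem1p1 :
    ∃ p₀ : ℝ, 1 < p₀ ∧ p₀ < 2 ∧
      ∀ φ₀ : ℝ → ℝ, IsLPBump φ₀ →
      ∀ p : ℝ, p₀ < p →
      ∃ C : ℝ≥0, 0 < C ∧
        ∀ u : ℝ → ℝ, AEMeasurable u volume →
        ∀ k : ℤ, ∀ f : ℝ × ℝ → ℂ, MemLp f (ENNReal.ofReal p) volume →
          -- the integral defining `P_k f` converges absolutely almost everywhere
          (∀ᵐ z : ℝ × ℝ, Integrable (fun t : ℝ => f (z.1, z.2 - t) * lpKernel φ₀ k t) volume) ∧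
          -- the maximal operator: its averages converge absolutely, and the bound holds
          (∀ᵐ z : ℝ × ℝ, ∀ j : ℤ,
            IntervalIntegrable (alongParabola u (lpProj φ₀ k f) z) volume
              (-(2 : ℝ) ^ j) ((2 : ℝ) ^ j)) ∧
          AEMeasurable (parabolaMaximal u (lpProj φ₀ k f)) volume ∧
          eLpNorm (parabolaMaximal u (lpProj φ₀ k f)) (ENNReal.ofReal p) volume
            ≤ C * eLpNorm f (ENNReal.ofReal p) volume ∧
          -- the Hilbert transform: the principal value exists a.e., and the bound holds
          (∀ᵐ z : ℝ × ℝ,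
            (∀ ε : ℝ, 0 < ε →
              IntegrableOn (fun t : ℝ => alongParabola u (lpProj φ₀ k f) z t / (t : ℂ))
                {t : ℝ | ε < |t|} volume) ∧
            ∃ l : ℂ, Tendsto (parabolaHilbertTrunc u (lpProj φ₀ k f) z) (𝓝[>] (0 : ℝ)) (𝓝 l)) ∧
          AEStronglyMeasurable (parabolaHilbert u (lpProj φ₀ k f)) volume ∧
          eLpNorm (parabolaHilbert u (lpProj φ₀ k f)) (ENNReal.ofReal p) volume
            ≤ C * eLpNorm f (ENNReal.ofReal p) volume := by
  refine ⟨39 / 20, by norm_num, by norm_num, fun φ₀ h p hp => ?_⟩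
  have hp1 : 1 < p := by linarith
  have hp0 : 0 < p := by linarith
  obtain ⟨C₁, hC₁⟩ := h.exists_lintegral_parabolaMaximal_le hp
  obtain ⟨C₂, hC₂⟩ := h.exists_lintegral_parabolaHilbert_le hp
  -- One constant serves both operators; the summand `1` guarantees positivity.
  refine ⟨(C₁ + C₂ + 1) ^ (1 / p), by positivity, fun u hu k f hf => ?_⟩
  set v := hu.mk u with hv
  have hvm : Measurable v := hu.measurable_mk
  have huv : u =ᵐ[volume] v := hu.ae_eq_mk
  have hfa := hf.1.aemeasurable
  set g := hfa.mk f with hg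
  have hgm : Measurable g := hfa.measurable_mk
  have hfg : f =ᵐ[volume] g := hfa.ae_eq_mk
  have hpr0 : ENNReal.ofReal p ≠ 0 := by simpa using hp0
  have hnorm : ∀ {E : Type} [TopologicalSpace E] [ContinuousENorm E] (a : ℝ × ℝ → E),
      eLpNorm a (ENNReal.ofReal p) volume = (∫⁻ z, ‖a z‖ₑ ^ p) ^ (1 / p) := fun a => by
    rw [eLpNorm_eq_lintegral_rpow_enorm_toReal hpr0 ENNReal.ofReal_ne_top, ENNReal.toReal_ofReal hp0.le]
  have hgfin : ∫⁻ z, ‖g z‖ₑ ^ p ≠ ⊤ := by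
    have := (eLpNorm_lt_top_iff_lintegral_rpow_enorm_lt_top hpr0 ENNReal.ofReal_ne_top).1 ((memLp_congr_ae hfg).1 hf).2
    rw [ENNReal.toReal_ofReal hp0.le] at this
    exact this.ne
  have hfgnorm : eLpNorm f (ENNReal.ofReal p) volume = (∫⁻ z, ‖g z‖ₑ ^ p) ^ (1 / p) := by
    rw [eLpNorm_congr_ae hfg, hnorm]
  have hbound : ∀ {E : Type} [TopologicalSpace E] [ContinuousENorm E] {a : ℝ × ℝ → E} {C : ℝ≥0}, C ≤ C₁ + C₂ + 1 →
      ∫⁻ z, ‖a z‖ₑ ^ p ≤ C * ∫⁻ z, ‖g z‖ₑ ^ p → eLpNorm a (ENNReal.ofReal p) volume ≤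
        ((C₁ + C₂ + 1) ^ (1 / p) : ℝ≥0) * eLpNorm f (ENNReal.ofReal p) volume := fun hC ha => by
    rw [hnorm, hfgnorm, ENNReal.coe_rpow_of_nonneg _ (by positivity), ← ENNReal.mul_rpow_of_nonneg _ _ (by positivity)]
    exact ENNReal.rpow_le_rpow (ha.trans (mul_le_mul_left (ENNReal.coe_le_coe.2 hC) _)) (by positivity)
  have hGm := h.measurable_lpProj k hgm
  have hproj := lpProj_eq_of_ae_eq φ₀ k hfg
  have halong := ae_alongParabola_ae_eq huv hproj
  obtain ⟨M1, M2⟩ := hC₁ k hvm hgm hgfin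
  obtain ⟨H1, H2⟩ := hC₂ k hvm hgm hgfin
  have hmax : parabolaMaximal u (lpProj φ₀ k f) =ᵐ[volume] parabolaMaximal v (lpProj φ₀ k g) := by
    filter_upwards [halong] with z hz
    refine iSup_congr fun j => ?_
    congr 3
    exact intervalIntegral.integral_congr_ae (hz.mono fun t ht _ => ht)
  have htrunc : ∀ᵐ z : ℝ × ℝ, parabolaHilbertTrunc u (lpProj φ₀ k f) z = parabolaHilbertTrunc v (lpProj φ₀ k g) z := by
    filter_upwards [halong] with z hz
    ext ε
    refine integral_congr_ae (ae_restrict_of_ae ?_)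
    filter_upwards [hz] with t ht
    rw [ht]
  have hhil : parabolaHilbert u (lpProj φ₀ k f) =ᵐ[volume] parabolaHilbert v (lpProj φ₀ k g) := by
    filter_upwards [htrunc] with z hz
    unfold parabolaHilbert
    rw [hz]
  refine ⟨?_, ?_, (measurable_parabolaMaximal hvm hGm).aemeasurable.congr hmax.symm, ?_, ?_, ?_, ?_⟩
  · filter_upwards [ae_hlMax₂_ne_top hp1 hgm hgfin, Measure.quasiMeasurePreserving_fst.ae (Measure.ae_ae_of_ae_prod hfg)]
      with z hz hzx
    have := h.integrable_lpProj k hgm hz 0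
    simp only [sub_zero] at this
    refine this.congr ?_
    filter_upwards [(quasiMeasurePreserving_sub_left_of_right_invariant volume z.2).ae hzx] with t ht
    rw [ht]
  · filter_upwards [M1, halong] with z hz hza j
    have hj : (0 : ℝ) < 2 ^ j := by positivity
    rw [intervalIntegrable_iff_integrableOn_Icc_of_le (by linarith), ← setOf_abs_le]
    exact (hz _).congr (ae_restrict_of_ae hza.symm)
  · rw [eLpNorm_congr_ae hmax]
    refine hbound (C := C₁) (by rw [add_assoc]; exact le_self_add) ?_
    simpa using M2
  · filter_upwards [H1, halong, htrunc] with z hz hza hzt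
    refine ⟨fun ε hε => (hz.1 ε hε).congr (ae_restrict_of_ae ?_), ?_⟩
    · filter_upwards [hza] with t ht
      rw [ht]
    · rw [hzt]; exact hz.2
  · refine AEStronglyMeasurable.congr ?_ hhil.symm
    -- The principal value is an almost everywhere limit of measurable truncations along the
    -- sequence `ε = 1/(n + 1)`.
    refine aestronglyMeasurable_of_tendsto_ae atTop (f := fun (n : ℕ) z =>
      parabolaHilbertTrunc v (lpProj φ₀ k g) z (1 / ((n : ℝ) + 1)))
      (fun n => (measurable_parabolaHilbertTrunc hvm hGm _).aestronglyMeasurable) ?_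
    filter_upwards [H1] with z hz
    obtain ⟨l, hl⟩ := hz.2
    have : parabolaHilbert v (lpProj φ₀ k g) z = l := hl.limUnder_eq
    rw [this]
    refine hl.comp (tendsto_nhdsWithin_iff.2 ⟨tendsto_one_div_add_atTop_nhds_zero_nat, Eventually.of_forall fun n => ?_⟩)
    show (0 : ℝ) < 1 / ((n : ℝ) + 1)
    positivity
  · rw [eLpNorm_congr_ae hhil]
    refine hbound (C := C₂) ?_ H2
    rw [add_comm C₁, add_assoc]
    exact le_self_add
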